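/- **Setting.** Let $d,n,k\in\mathbb N$ and $0<\lambda,\Lambda<\infty$. For a field $\omega$ on $\mathbf Z^d$ write $\tau_x\omega(z)=\omega(x+z)$. Let $\tilde P$ be a translation invariant probability measure on the space $\tilde\Omega$ of fields $\tilde\omega:\mathbf Z^d\to\mathbf R^k$ (with the product Borel $\sigma$-algebra) that satisfies the Poincaré inequality with constant $m>0$: $$\mathrm{Var}[G]\le \frac1{m^2}\Big\langle\sum_{y\in\mathbf Z^d}\Big|\frac{\partial G}{\partial\tilde\omega(y)}\Big|^2\Big\rangle$$ for all square integrable $G:\tilde\Omega\to\mathbf C$ that depend on finitely many of the variables $\tilde\omega(y)$ and are $C^1$ in them. Let $1\le p_0<2$ and let $h$ be a $p_0$-summable function from $\mathbf Z^d$ to the real $n\times k$ matrices such that for every $x$ the series $\omega(x)=(h*\tilde\omega)(x)=\sum_y h(x-y)\tilde\omega(y)$ converges unconditionally in $\tilde P$-probability. Let $P$ be the law of $\omega=h*\tilde\omega$ on the space $\Omega$ of fields $\omega:\mathbf Z^d\to\mathbf R^n$. Let $\tilde{\mathbf a}$ be a $C^1$ function from $\mathbf R^n$ to the real symmetric $d\times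 d$ matrices with $\lambda I_d\le\tilde{\mathbf a}\le\Lambda I_d$ and $\|D\tilde{\mathbf a}\|_\infty=\sup|D\tilde{\mathbf a}|<\infty$, and put $\mathbf a(\omega)=\tilde{\mathbf a}(\omega(0))$. For $\xi\in\mathbf R^d$ and $\psi:\Omega\to\mathbf C$ let $\partial_{i,\xi}\psi(\omega)=e^{-i\xi_i}\psi(\tau_{e_i}\omega)-\psi(\omega)$ and $\partial^*_{i,\xi}\psi(\omega)=e^{i\xi_i}\psi(\tau_{-e_i}\omega)-\psi(\omega)$ (in the exponents $i=\sqrt{-1}$); $\partial_\xi$ is the column of the $\partial_{i,\xi}$ and $\partial_\xi^*$ the row of the $\partial^*_{i,\xi}$. For $\eta>0$ let $\Phi(\xi,\eta,\cdot)\in L^2(\Omega)$, with values row vectors in $\mathbf C^d$, be the solution of $$\eta\Phi+\partial_\xi^*\,\mathbf a(\omega)\,\partial_\xi\Phi=-\partial_\xi^*\,\mathbf a(\omega)\qquad P\text{-a.s.},$$ so that $\partial_\xi\Phi$ is a $d\times d$ matrix. Let $\mathsf P X=X-\langle X\rangle$ be the projection orthogonal to the constants in $L^2(\Omega,\mathbf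 C^d)$, whose norm is $\|\cdot\|$. Matrices carry the operator norm between Euclidean spaces, and $\|f\|_q=(\sum_x|f(x)|^q)^{1/q}$ for functions $f$ on $\mathbf Z^d$. **Proposition.** There is $p_1\in(1,2)$ depending only on $d,\Lambda/\lambda,p_0$, and a constant $C$ depending only on $d,n,k,\Lambda/\lambda,p_0$, such that for all $\tilde{\mathbf a},\tilde P,m,h$ as above, all $\xi\in\mathbf R^d$, $\eta>0$, all $1\le p\le p_1$, all $p$-summable functions $g$ from $\mathbf Z^d$ to the complex $d\times d$ matrices and all $v\in\mathbf C^d$, the series $\sum_{x}\mathsf P\,[g(x)\,\partial_\xi\Phi(\xi,\eta,\tau_x\cdot)v]$ converges unconditionally in $L^2(\Omega,\mathbf C^d)$ and $$\Big\|\mathsf P\sum_{x\in\mathbf Z^d} g(x)\,\partial_\xi\Phi(\xi,\eta,\tau_x\cdot)v\Big\|\ \le\ \frac{C\,\|D\tilde{\mathbf a}\|_\infty\,|v|}{m\Lambda}\,\|h\|_{p_0}\,\|g\|_p ,$$ where the left side denotes the norm of the sum of that series. -/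

import Mathlib

open MeasureTheory Filter Topology
open scoped Matrix Matrix.Norms.L2Operator

noncomputable section

namespace RandomEnv

/-- The integer lattice of dimension `d`. -/
abbrev Lattice (d : ℕ) : Type := Fin d → ℤ

/-- Fields on the lattice with values in Euclidean space of dimension `n`. It carries the product
σ-algebra, the smallest one for which all evaluations `ω ↦ ω x` are Borel measurable. -/
abbrev FieldSpace (d n : ℕ) : Type := Lattice d → EuclideanSpace ℝ (Fin n)

/-- The translation operator `(τ_x ω)(z) = ω (x + z)`. -/
def shift {d n : ℕ} (x : Lattice d) (ω : FieldSpace d n) : FieldSpace d n := fun z => ω (x + z)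

/-- The law `P` of a random field is translation invariant. -/
def TranslationInvariant {d k : ℕ} (P : Measure (FieldSpace d k)) : Prop :=
  ∀ x : Lattice d, MeasurePreserving (shift x) P P

/-- The squared Euclidean length at the configuration `w` of the gradient of a function `G` of the
finitely many field variables in `F`: the sum over the sites `y ∈ F` and the components `j` of
`|∂G/∂w_j(y)|²`. -/
def gradSq {d k : ℕ} {F : Finset (Lattice d)}
    (G : (F → EuclideanSpace ℝ (Fin k)) → ℂ) (w : F → EuclideanSpace ℝ (Fin k)) : ℝ :=
  ∑ y : F, ∑ j : Fin k, ‖fderiv ℝ G w (Pi.single y (EuclideanSpace.single j 1))‖ ^ 2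

/-- The Poincaré inequality with constant `m`,
`Var[G] ≤ m⁻² ⟨‖dG‖²⟩`, for all square integrable complex valued functions `G` of the field that
depend on finitely many field variables and are continuously differentiable in them. The right
side may be infinite. -/
def Poincare {d k : ℕ} (P : Measure (FieldSpace d k)) (m : ℝ) : Prop :=
  ∀ (F : Finset (Lattice d)) (G : (F → EuclideanSpace ℝ (Fin k)) → ℂ),
    ContDiff ℝ 1 G →
    MemLp (fun w : FieldSpace d k => G (F.restrict w)) 2 P →
    ∫⁻ w, ENNReal.ofReal (‖G (F.restrict w) - ∫ w', G (F.restrict w') ∂P‖ ^ 2) ∂P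
      ≤ ENNReal.ofReal (1 / m ^ 2) * ∫⁻ w, ENNReal.ofReal (gradSq G (F.restrict w)) ∂P

/-- `W` is a version of the convolution `h * w`, where `w` has law `P`: for every site `x` the
series `∑_y h(x - y) w(y)` converges unconditionally in probability, with sum `W(w)(x)`. -/
def IsConvolution {d n k : ℕ} (P : Measure (FieldSpace d k))
    (h : Lattice d → Matrix (Fin n) (Fin k) ℝ) (W : FieldSpace d k → FieldSpace d n) : Prop :=
  AEMeasurable W P ∧
  ∀ x : Lattice d, TendstoInMeasure P
    (fun (F : Finset (Lattice d)) (w : FieldSpace d k) =>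
      ∑ y ∈ F, (WithLp.toLp 2 (h (x - y) *ᵥ (w y).ofLp) : EuclideanSpace ℝ (Fin n)))
    atTop (fun w => W w x)

/-- The norm `(∑_x ‖f x‖^p)^(1/p)`, for `p`-summable `f`. Matrices carry the operator norm between
Euclidean spaces. -/
def ellNorm {ι E : Type*} [Norm E] (p : ℝ) (f : ι → E) : ℝ := (∑' x, ‖f x‖ ^ p) ^ (1 / p)

/-- The supremum norm of the derivative of a matrix valued function, if it is bounded. -/
def derivSup {n d : ℕ} (a : EuclideanSpace ℝ (Fin n) → Matrix (Fin d) (Fin d) ℝ) : ℝ :=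
  ⨆ s, ‖fderiv ℝ a s‖

/-- Symmetric matrix valued functions `a` with `lam I ≤ a ≤ Lam I` as quadratic forms. -/
def Elliptic {n d : ℕ} (a : EuclideanSpace ℝ (Fin n) → Matrix (Fin d) (Fin d) ℝ)
    (lam Lam : ℝ) : Prop :=
  ∀ s, (a s).IsSymm ∧ ∀ u : Fin d → ℝ,
    lam * (u ⬝ᵥ u) ≤ u ⬝ᵥ (a s *ᵥ u) ∧ u ⬝ᵥ (a s *ᵥ u) ≤ Lam * (u ⬝ᵥ u)

/-- The operator `(∂_{i,ξ} ψ)(ω) = e^{-iξ_i} ψ(τ_{e_i} ω) - ψ(ω)` on functions on field space. -/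
def dXi {d n : ℕ} (ξ : Fin d → ℝ) (i : Fin d) (ψ : FieldSpace d n → ℂ) (ω : FieldSpace d n) : ℂ :=
  Complex.exp (-(Complex.I * ξ i)) * ψ (shift (Pi.single i 1) ω) - ψ ω

/-- The adjoint `(∂*_{i,ξ} ψ)(ω) = e^{iξ_i} ψ(τ_{-e_i} ω) - ψ(ω)`. -/
def dXiStar {d n : ℕ} (ξ : Fin d → ℝ) (i : Fin d) (ψ : FieldSpace d n → ℂ) (ω : FieldSpace d n) : ℂ :=
  Complex.exp (Complex.I * ξ i) * ψ (shift (-Pi.single i 1) ω) - ψ ω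

/-- The `d × d` matrix `∂_ξ Φ` with entries `∂_{i,ξ} Φ_j`, where `Φ` is a row vector. -/
def gradXi {d n : ℕ} (ξ : Fin d → ℝ) (Φ : FieldSpace d n → EuclideanSpace ℂ (Fin d))
    (ω : FieldSpace d n) : Matrix (Fin d) (Fin d) ℂ :=
  Matrix.of fun i j => dXi ξ i (fun ω' => Φ ω' j) ω

/-- The row vector valued function `Φ ∈ L²(Ω)` solves `η Φ + ∂*_ξ a(ω) ∂_ξ Φ = -∂*_ξ a(ω)`
on the probability space `(Ω, P)` of fields, with `a(ω) = a(ω(0))`. -/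
structure IsCorrector {d n : ℕ} (P : Measure (FieldSpace d n))
    (a : EuclideanSpace ℝ (Fin n) → Matrix (Fin d) (Fin d) ℝ) (ξ : Fin d → ℝ) (η : ℝ)
    (Φ : FieldSpace d n → EuclideanSpace ℂ (Fin d)) : Prop where
  memLp : MemLp Φ 2 P
  eqn : ∀ᵐ ω ∂P, ∀ j : Fin d,
    (η : ℂ) * Φ ω j
      + ∑ i, dXiStar ξ i (fun ω' => ∑ l, (a (ω' 0) i l : ℂ) * gradXi ξ Φ ω' l j) ω
      = -∑ i, dXiStar ξ i (fun ω' => (a (ω' 0) i j : ℂ)) ω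

/-- The summand `ω ↦ g(x) ∂_ξ Φ(τ_x ω) v`. -/
def summand {d n : ℕ} (ξ : Fin d → ℝ) (Φ : FieldSpace d n → EuclideanSpace ℂ (Fin d))
    (g : Lattice d → Matrix (Fin d) (Fin d) ℂ) (v : EuclideanSpace ℂ (Fin d)) (x : Lattice d)
    (ω : FieldSpace d n) : EuclideanSpace ℂ (Fin d) :=
  WithLp.toLp 2 (g x *ᵥ (gradXi ξ Φ (shift x ω) *ᵥ v.ofLp))

/-- The projection orthogonal to the constants, `X ↦ X - ⟨X⟩`. -/
def proj {Ω E : Type*} [MeasurableSpace Ω] [NormedAddCommGroup E] [NormedSpace ℝ E]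
    (P : Measure Ω) (X : Ω → E) (ω : Ω) : E := X ω - ∫ ω', X ω' ∂P

end RandomEnv

end

/-!
The corrector in a direction `v` is the limit in `L²` of the gradient descent for its equation,
whose steps are smooth functionals of finitely many values of the field. Their derivatives in the
direction of a variation `θ` of the field can be followed along the descent: lifted to functions
`u(x, ω) = e^{-i x·ξ} δφ(τ_x ω; τ_x θ)` of a site and a field, they perform themselves a gradient
descent (`lift_iterDeriv_succ`), and converge in `L²(ℤ^d × Ω)` to the solution of the linearized
equation `η u + ∇* a(ω(x)) ∇ u = -∇* s`, whose source `s(x, ω)`, the product of `e^{-i x·ξ}`,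
`Da(ω(x)) θ(x)` and `(∂_ξ φ + v)(τ_x ω)`, has at the site `x` a norm at most `‖D a‖_∞ |θ(x)|` times that of `∂_ξ φ + v`
(`tendsto_lift_iterDeriv`). Uniform ellipticity enters in the form `|ζ - a ζ / Λ| ≤ (1 - 1/ρ) |ζ|`
with `ρ = Λ / λ` (`NearScalar`).

The Poincaré inequality passes to the convolution `h * w` (`variance_smoothFunctional_le`), where a
variation at the site `y` in the `j`-th direction becomes the field `x ↦ h(x - y) e_j`. By
translation invariance, the variance of `∑ g(x) ∂_ξ φ(τ_x ω)` is thus bounded by the square sum of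
the convolution of `|g|` with the norms `‖∇ u(x, ·)‖` in `L²(Ω)`, for the variations `θ = h(·) e_j`
(`variance_comb_le`). Young's inequality `ℓ^p * ℓ^q ⊆ ℓ²` with `1/p + 1/q = 3/2` (`young_sq`)
reduces the claim to a bound for `∇ u` in `ℓ^q(L²)` for some `q < 2`, by the norm of the source in
`ℓ^{p₀}(L²)` (`exists_lq_bound`).

That bound needs nothing but the ellipticity of the coefficients: by superposition, it suffices to
interpolate between the energy estimate in `ℓ²` and a decay of `∇ u` away from a source at a single
site, in `ℓ²` with the weight `(1 + |x_i - z_i|)^{2t}` for a small exponent `t` that depends on `ρ`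
only (`exists_interpolation`). For the Laplacian, the weighted estimate holds with a constant
`1 + O(t)`, uniformly in the mass; then the operator with coefficients `a` is treated as a perturbation
of `Λ` times the Laplacian, with the contraction factor `1 - 1/ρ` (`weighted_lattice_coeff`). Since
the weight depends on one coordinate only, a Fourier transform in the other coordinates
(`weighted_lattice_fin`) reduces the estimate for the Laplacian to the integers (`weighted_int`).
There the Green's function is explicit, the weighted solution differs from the solution with
weighted sources by a commutator of order `t`, and the commutator is bounded by the Schur test
(`sum_kernel_ratio_sq_le`).
-/

namespace RandomEnv

/-! ### Power weights and geometric kernels on the integers -/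

/-- The weight `1 + |s|` on the integers. -/
noncomputable def bracket (s : ℤ) : ℝ := 1 + (s.natAbs : ℝ)

lemma one_le_bracket (s : ℤ) : 1 ≤ bracket s := by unfold bracket; simp

lemma bracket_pos (s : ℤ) : 0 < bracket s := lt_of_lt_of_le one_pos (one_le_bracket s)

lemma hasSum_pow_natAbs {q : ℝ} (hq0 : 0 ≤ q) (hq1 : q < 1) :
    HasSum (fun y : ℤ => q ^ y.natAbs) ((1 - q)⁻¹ + q * (1 - q)⁻¹) := by
  apply HasSum.of_nat_of_neg_add_one
  · simpa using hasSum_geometric_of_lt_one hq0 hq1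
  · have h := (hasSum_geometric_of_lt_one hq0 hq1).mul_left q
    refine h.congr_fun ?_ |> fun h => h
    intro n
    have : (-((n : ℤ) + 1)).natAbs = n + 1 := by omega
    rw [this, pow_succ]; ring

lemma sum_pow_natAbs_sub_le {q : ℝ} (hq0 : 0 ≤ q) (hq1 : q < 1) (x : ℤ) (S : Finset ℤ) :
    ∑ z ∈ S, (1 - q) * q ^ (x - z).natAbs ≤ 2 := by
  have h := (hasSum_pow_natAbs hq0 hq1).mul_left (1 - q)
  have h2 : HasSum (fun z : ℤ => (1 - q) * q ^ (x - z).natAbs)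
      ((1 - q) * ((1 - q)⁻¹ + q * (1 - q)⁻¹)) := by
    rw [← (Equiv.subLeft x).hasSum_iff] at h
    exact h
  have h3 := sum_le_hasSum S (fun z _ => mul_nonneg (by linarith) (pow_nonneg hq0 _)) h2
  have h4 : (1 - q) * ((1 - q)⁻¹ + q * (1 - q)⁻¹) = 1 + q := by
    have : (1 - q) ≠ 0 := by linarith
    field_simp
  linarith

lemma sum_range_inv_sqrt_le (m : ℕ) :
    ∑ n ∈ Finset.range m, (1 + (n : ℝ)) ^ (-(1 / 2) : ℝ) ≤ 2 * Real.sqrt m := by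
  induction m with
  | zero => simp
  | succ m ih =>
    rw [Finset.sum_range_succ]
    have hp : (0 : ℝ) < 1 + m := by positivity
    have h1 : (1 + (m : ℝ)) ^ (-(1 / 2) : ℝ) = 1 / Real.sqrt (m + 1) := by
      rw [Real.rpow_neg hp.le, ← Real.sqrt_eq_rpow, add_comm, one_div]
    rw [h1]
    push_cast
    have ha := Real.sq_sqrt (show (0 : ℝ) ≤ m by positivity)
    have hb := Real.sq_sqrt (show (0 : ℝ) ≤ (m : ℝ) + 1 by positivity)
    have hbp : 0 < Real.sqrt ((m : ℝ) + 1) := Real.sqrt_pos.mpr (by positivity)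
    have : 1 / Real.sqrt ((m : ℝ) + 1) ≤ 2 * (Real.sqrt (m + 1) - Real.sqrt m) := by
      rw [div_le_iff₀ hbp]
      nlinarith [sq_nonneg (Real.sqrt ((m : ℝ) + 1) - Real.sqrt m)]
    linarith

lemma sum_bracket_le (N : ℕ) (S : Finset ℤ) :
    ∑ z ∈ S with z.natAbs ≤ N, bracket z ^ (-(1 / 2) : ℝ) ≤ 4 * Real.sqrt (N + 1) := by
  have hsub : (S.filter fun z => z.natAbs ≤ N) ⊆
      (Finset.range (N + 1)).image (fun n : ℕ => (n : ℤ)) ∪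
        (Finset.range (N + 1)).image (fun n : ℕ => -(n : ℤ)) := by
    intro z hz
    simp only [Finset.mem_filter, Finset.mem_union, Finset.mem_image, Finset.mem_range] at hz ⊢
    rcases le_total 0 z with h | h
    · left; exact ⟨z.natAbs, by omega, by omega⟩
    · right; exact ⟨z.natAbs, by omega, by omega⟩
  have hnn : ∀ z : ℤ, 0 ≤ bracket z ^ (-(1 / 2) : ℝ) :=
    fun z => Real.rpow_nonneg (bracket_pos z).le _
  refine (Finset.sum_le_sum_of_subset_of_nonneg hsub fun z _ _ => hnn z).trans ?_
  refine (le_of_le_of_eq (le_add_of_nonneg_right (Finset.sum_nonneg fun z _ => hnn z))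
    (Finset.sum_union_inter (s₁ := (Finset.range (N + 1)).image (fun n : ℕ => (n : ℤ)))
      (s₂ := (Finset.range (N + 1)).image (fun n : ℕ => -(n : ℤ))))).trans ?_
  rw [Finset.sum_image (by intro a _ b _ h; simpa using h),
    Finset.sum_image (by intro a _ b _ h; simpa using h)]
  have h := sum_range_inv_sqrt_le (N + 1)
  simp only [bracket, Int.natAbs_neg, Int.natAbs_natCast]
  push_cast at h
  linarith

lemma one_sub_mul_pow_le {q : ℝ} (hq0 : 0 ≤ q) (hq1 : q < 1) (n : ℕ) :
    (1 - q) * q ^ n ≤ 1 / (1 + n) := by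
  have h1 : (1 - q) * ∑ i ∈ Finset.range (n + 1), q ^ i = 1 - q ^ (n + 1) := by
    have := geom_sum_mul q (n + 1)
    linarith
  have h2 : ((n : ℝ) + 1) * q ^ n ≤ ∑ i ∈ Finset.range (n + 1), q ^ i := by
    have := Finset.card_nsmul_le_sum (Finset.range (n + 1)) (fun i => q ^ i) (q ^ n)
      (fun i hi => pow_le_pow_of_le_one hq0 hq1.le (by simpa [Nat.lt_succ_iff] using hi))
    simpa using this
  rw [le_div_iff₀ (by positivity)]
  have h3 : 0 ≤ q ^ (n + 1) := pow_nonneg hq0 _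
  nlinarith [mul_le_mul_of_nonneg_left h2 (by linarith : (0:ℝ) ≤ 1 - q)]

/-- The weight `(1 + |s|)^(-1/2)` is reproduced, up to a constant, by all the geometric
convolution kernels `(1 - q) q^|s|`, uniformly in `q`. -/
lemma sum_kernel_bracket_le {q : ℝ} (hq0 : 0 ≤ q) (hq1 : q < 1) (x : ℤ) (S : Finset ℤ) :
    ∑ z ∈ S, (1 - q) * q ^ (x - z).natAbs * bracket z ^ (-(1 / 2) : ℝ)
      ≤ 12 * bracket x ^ (-(1 / 2) : ℝ) := by
  have hbx := bracket_pos x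
  have key : ∀ z ∈ S, (1 - q) * q ^ (x - z).natAbs * bracket z ^ (-(1 / 2) : ℝ) ≤
      (2 * bracket x ^ (-(1 / 2) : ℝ)) * ((1 - q) * q ^ (x - z).natAbs)
      + (if z.natAbs ≤ x.natAbs then 2 / bracket x * bracket z ^ (-(1 / 2) : ℝ) else 0) := by
    intro z _
    have hbz := bracket_pos z
    have hk : 0 ≤ (1 - q) * q ^ (x - z).natAbs := mul_nonneg (by linarith) (pow_nonneg hq0 _)
    have hz : 0 ≤ bracket z ^ (-(1 / 2) : ℝ) := Real.rpow_nonneg hbz.le _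
    by_cases h : x.natAbs ≤ 2 * z.natAbs
    · have h1 : bracket x / 4 ≤ bracket z := by
        have : (x.natAbs : ℝ) ≤ 2 * z.natAbs := by exact_mod_cast h
        unfold bracket; have : (0:ℝ) ≤ z.natAbs := by positivity
        linarith
      have h2 : bracket z ^ (-(1 / 2) : ℝ) ≤ 2 * bracket x ^ (-(1 / 2) : ℝ) := by
        have := Real.rpow_le_rpow_of_nonpos (by positivity) h1 (by norm_num : (-(1 / 2) : ℝ) ≤ 0)
        refine this.trans (le_of_eq ?_)
        rw [Real.div_rpow hbx.le (by norm_num), Real.rpow_neg (by norm_num : (0:ℝ) ≤ 4),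
          ← Real.sqrt_eq_rpow, show (4 : ℝ) = 2 ^ 2 by norm_num, Real.sqrt_sq (by norm_num)]
        field_simp
      have h3 : (0:ℝ) ≤ if z.natAbs ≤ x.natAbs then 2 / bracket x * bracket z ^ (-(1 / 2) : ℝ)
          else 0 := by split_ifs <;> positivity
      calc _ ≤ (1 - q) * q ^ (x - z).natAbs * (2 * bracket x ^ (-(1 / 2) : ℝ)) := by gcongr
        _ ≤ _ := by linarith
    · have h0 : z.natAbs ≤ x.natAbs := by omega
      rw [if_pos h0]
      have h1 : (1 - q) * q ^ (x - z).natAbs ≤ 2 / bracket x := by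
        refine (one_sub_mul_pow_le hq0 hq1 _).trans ?_
        have h2 : (x.natAbs : ℝ) ≤ 2 * ((x - z).natAbs : ℝ) := by
          have : x.natAbs ≤ 2 * (x - z).natAbs := by omega
          exact_mod_cast this
        rw [div_le_div_iff₀ (by positivity) hbx]
        unfold bracket; linarith
      have h4 : 0 ≤ (2 * bracket x ^ (-(1 / 2) : ℝ)) * ((1 - q) * q ^ (x - z).natAbs) := by
        have := Real.rpow_nonneg hbx.le (-(1 / 2) : ℝ)
        positivity
      calc _ ≤ 2 / bracket x * bracket z ^ (-(1 / 2) : ℝ) := by gcongr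
        _ ≤ _ := by linarith
  refine (Finset.sum_le_sum key).trans ?_
  rw [Finset.sum_add_distrib, ← Finset.sum_filter]
  have e1 := sum_pow_natAbs_sub_le hq0 hq1 x S
  have e2 := sum_bracket_le x.natAbs S
  have hpx : 0 ≤ bracket x ^ (-(1 / 2) : ℝ) := Real.rpow_nonneg hbx.le _
  have e3 : 2 / bracket x * (4 * Real.sqrt (x.natAbs + 1)) = 8 * bracket x ^ (-(1 / 2) : ℝ) := by
    rw [Real.rpow_neg hbx.le, ← Real.sqrt_eq_rpow, show ((x.natAbs : ℝ) + 1) = bracket x by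
      unfold bracket; ring]
    have h5 := Real.sqrt_pos.mpr hbx
    have h6 := Real.mul_self_sqrt hbx.le
    field_simp
    nlinarith
  calc _ ≤ (2 * bracket x ^ (-(1 / 2) : ℝ)) * 2 + 2 / bracket x * (4 * Real.sqrt (x.natAbs + 1)) := by
        refine add_le_add ?_ ?_
        · rw [← Finset.mul_sum]; gcongr
        · rw [← Finset.mul_sum]; gcongr
    _ = _ := by rw [e3]; ring

/-- The Schur test for symmetric nonnegative kernels. -/
lemma schur_test {ι : Type*} (M : ι → ι → ℝ) (hM : ∀ x z, 0 ≤ M x z) (hsymm : ∀ x z, M x z = M z x)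
    (φ : ι → ℝ) (hφ : ∀ x, 0 < φ x) (C : ℝ)
    (hC : ∀ (x : ι) (S : Finset ι), ∑ z ∈ S, M x z * φ z ≤ C * φ x) (F : ι → ℝ)
    (Y S : Finset ι) :
    ∑ x ∈ Y, (∑ z ∈ S, M x z * F z) ^ 2 ≤ C ^ 2 * ∑ z ∈ S, F z ^ 2 := by
  have step : ∀ x ∈ Y, (∑ z ∈ S, M x z * F z) ^ 2 ≤
      C * ∑ z ∈ S, M x z * φ x / φ z * F z ^ 2 := by
    intro x _
    have cs := Finset.sum_mul_sq_le_sq_mul_sq S (fun z => Real.sqrt (M x z * φ z))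
      (fun z => Real.sqrt (M x z / φ z) * F z)
    have e1 : ∀ z ∈ S, Real.sqrt (M x z * φ z) * (Real.sqrt (M x z / φ z) * F z) = M x z * F z := by
      intro z _
      have := (hφ z).ne'
      rw [← mul_assoc, ← Real.sqrt_mul (mul_nonneg (hM x z) (hφ z).le),
        show M x z * φ z * (M x z / φ z) = M x z * M x z by field_simp,
        Real.sqrt_mul_self (hM x z)]
    have e2 : ∀ z ∈ S, Real.sqrt (M x z * φ z) ^ 2 = M x z * φ z :=
      fun z _ => Real.sq_sqrt (mul_nonneg (hM x z) (hφ z).le)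
    have e3 : ∀ z ∈ S, (Real.sqrt (M x z / φ z) * F z) ^ 2 = M x z / φ z * F z ^ 2 := by
      intro z _
      rw [mul_pow, Real.sq_sqrt (div_nonneg (hM x z) (hφ z).le)]
    rw [Finset.sum_congr rfl e1, Finset.sum_congr rfl e2, Finset.sum_congr rfl e3] at cs
    refine cs.trans ?_
    have hnn : 0 ≤ ∑ z ∈ S, M x z / φ z * F z ^ 2 :=
      Finset.sum_nonneg fun z _ => mul_nonneg (div_nonneg (hM x z) (hφ z).le) (sq_nonneg _)
    refine (mul_le_mul_of_nonneg_right (hC x S) hnn).trans (le_of_eq ?_)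
    rw [mul_assoc, Finset.mul_sum]
    congr 1
    exact Finset.sum_congr rfl fun z _ => by ring
  refine (Finset.sum_le_sum step).trans ?_
  rw [← Finset.mul_sum, Finset.sum_comm, pow_two, mul_assoc]
  rcases Y.eq_empty_or_nonempty with rfl | ⟨x0, _⟩
  · simp
    have := Finset.sum_nonneg (s := S) fun z _ => sq_nonneg (F z)
    have h2 := mul_self_nonneg C
    nlinarith
  have hC0 : 0 ≤ C := by
    have := hC x0 ∅
    simp at this
    exact nonneg_of_mul_nonneg_left this (hφ x0)
  refine mul_le_mul_of_nonneg_left ?_ hC0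
  rw [Finset.mul_sum]
  refine Finset.sum_le_sum fun z _ => ?_
  have : ∑ x ∈ Y, M x z * φ x / φ z * F z ^ 2 = (∑ x ∈ Y, M z x * φ x) * (F z ^ 2 / φ z) := by
    rw [Finset.sum_mul]
    exact Finset.sum_congr rfl fun x _ => by rw [hsymm x z]; ring
  rw [this]
  refine (mul_le_mul_of_nonneg_right (hC z Y) (div_nonneg (sq_nonneg _) (hφ z).le)).trans
    (le_of_eq ?_)
  have := (hφ z).ne'
  field_simp

/-- A linear bound in the exponent for small powers, up to a fixed power of the base. -/
lemma abs_rpow_sub_one_le {A t : ℝ} (hA : 0 < A) (ht : 0 ≤ t) (ht' : t ≤ 1 / 8) :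
    |A ^ t - 1| ≤ 8 * t * (A ^ (1 / 4 : ℝ) + A ^ (-(1 / 4) : ℝ)) := by
  have main : ∀ B : ℝ, 1 ≤ B → B ^ t - 1 ≤ 8 * t * B ^ (1 / 4 : ℝ) := by
    intro B hB
    have hB0 : 0 < B := by linarith
    have h1 : Real.log B ≤ 8 * B ^ (1 / 8 : ℝ) := by
      have := Real.log_le_rpow_div hB0.le (show (0 : ℝ) < 1 / 8 by norm_num)
      linarith
    have h2 : B ^ t - 1 ≤ t * Real.log B * B ^ t := by
      have := Real.add_one_le_exp (-(t * Real.log B))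
      have h3 : B ^ t = Real.exp (t * Real.log B) := by rw [Real.rpow_def_of_pos hB0, mul_comm]
      have h4 : Real.exp (-(t * Real.log B)) * Real.exp (t * Real.log B) = 1 := by
        rw [← Real.exp_add]; simp
      rw [h3]
      nlinarith [Real.exp_pos (t * Real.log B)]
    have h5 : B ^ t ≤ B ^ (1 / 8 : ℝ) := Real.rpow_le_rpow_of_exponent_le hB ht'
    have h6 : B ^ (1 / 8 : ℝ) * B ^ (1 / 8 : ℝ) = B ^ (1 / 4 : ℝ) := by
      rw [← Real.rpow_add hB0]; norm_num
    have hl : 0 ≤ Real.log B := Real.log_nonneg hB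
    have h7 : 0 ≤ B ^ (1 / 8 : ℝ) := Real.rpow_nonneg hB0.le _
    calc _ ≤ t * Real.log B * B ^ t := h2
      _ ≤ t * (8 * B ^ (1 / 8 : ℝ)) * B ^ (1 / 8 : ℝ) := by gcongr
      _ = _ := by rw [← h6]; ring
  have p1 : 0 ≤ A ^ (1 / 4 : ℝ) := Real.rpow_nonneg hA.le _
  have p2 : 0 ≤ A ^ (-(1 / 4) : ℝ) := Real.rpow_nonneg hA.le _
  rcases le_total 1 A with h | h
  · rw [abs_of_nonneg (by linarith [Real.one_le_rpow h ht])]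
    have := main A h
    nlinarith [mul_nonneg ht p2]
  · rw [abs_of_nonpos (by linarith [Real.rpow_le_one hA.le h ht])]
    have h1 := main A⁻¹ ((one_le_inv₀ hA).mpr h)
    rw [Real.inv_rpow hA.le, Real.inv_rpow hA.le, ← Real.rpow_neg hA.le (1/4)] at h1
    have h2 : 0 < A ^ t := Real.rpow_pos_of_pos hA _
    have h3 : 1 - A ^ t ≤ (A ^ t)⁻¹ - 1 := by
      have := add_inv_le_inv_add h2
      linarith
    nlinarith [mul_nonneg ht p1]
  where
  add_inv_le_inv_add {a : ℝ} (ha : 0 < a) : 2 ≤ a + a⁻¹ := by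
    have : 0 ≤ (a - 1) ^ 2 * a⁻¹ := by positivity
    have h : (a - 1) ^ 2 * a⁻¹ = a + a⁻¹ - 2 := by field_simp; ring
    linarith

/-- The weight `min (1 + |s|) N`, bounded so that weighted sums of square summable sequences are
finite. -/
noncomputable def cutBracket (N : ℝ) (s : ℤ) : ℝ := min (bracket s) N

lemma one_le_cutBracket {N : ℝ} (hN : 1 ≤ N) (s : ℤ) : 1 ≤ cutBracket N s :=
  le_min (one_le_bracket s) hN

lemma cutBracket_pos {N : ℝ} (hN : 1 ≤ N) (s : ℤ) : 0 < cutBracket N s :=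
  lt_of_lt_of_le one_pos (one_le_cutBracket hN s)

/-- Ratios of the cut weights are controlled by those of the uncut ones, independently of the
cutoff. -/
lemma cutBracket_div_rpow_le {N : ℝ} (hN : 1 ≤ N) (x z : ℤ) :
    (cutBracket N x / cutBracket N z) ^ (1 / 4 : ℝ)
      ≤ (bracket x / bracket z) ^ (1 / 4 : ℝ) + (bracket z / bracket x) ^ (1 / 4 : ℝ) := by
  have hx := bracket_pos x
  have hz := bracket_pos z
  have hr : 0 < bracket x / bracket z := by positivity
  have hr' : 0 < bracket z / bracket x := by positivity
  have hc : cutBracket N x / cutBracket N z ≤ max (bracket x / bracket z) 1 := by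
    have h1 := cutBracket_pos hN x
    have h2 := cutBracket_pos hN z
    rw [div_le_iff₀ h2]
    unfold cutBracket
    rcases le_total (bracket z) N with h | h
    · rw [min_eq_left h]
      calc min (bracket x) N ≤ bracket x / bracket z * bracket z := by
            rw [div_mul_cancel₀ _ hz.ne']; exact min_le_left _ _
        _ ≤ _ := by gcongr; exact le_max_left _ _
    · rw [min_eq_right h]
      have : N ≤ max (bracket x / bracket z) 1 * N := by
        have := le_max_right (bracket x / bracket z) 1
        nlinarith
      exact (min_le_right _ _).trans this
  have hcp : 0 ≤ cutBracket N x / cutBracket N z :=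
    (div_pos (cutBracket_pos hN x) (cutBracket_pos hN z)).le
  have p1 : 0 ≤ (bracket x / bracket z) ^ (1 / 4 : ℝ) := Real.rpow_nonneg hr.le _
  have p2 : 0 ≤ (bracket z / bracket x) ^ (1 / 4 : ℝ) := Real.rpow_nonneg hr'.le _
  refine (Real.rpow_le_rpow hcp hc (by norm_num)).trans ?_
  rcases le_total (bracket x / bracket z) 1 with h | h
  · rw [max_eq_right h, Real.one_rpow]
    have : 1 ≤ (bracket z / bracket x) ^ (1 / 4 : ℝ) := by
      apply Real.one_le_rpow _ (by norm_num)
      rw [div_le_one hz] at h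
      rwa [le_div_iff₀ hx, one_mul]
    linarith
  · rw [max_eq_left h]; linarith

/-- The oscillation of a small power `t` of the weight is of order `t`, uniformly in the cutoff `N`.
-/
lemma abs_cutBracket_rpow_sub_le {N : ℝ} (hN : 1 ≤ N) {t : ℝ} (ht : 0 ≤ t) (ht' : t ≤ 1 / 8)
    (x z : ℤ) :
    |cutBracket N x ^ t - cutBracket N z ^ t| ≤ 16 * t *
      ((bracket x / bracket z) ^ (1 / 4 : ℝ) + (bracket z / bracket x) ^ (1 / 4 : ℝ))
        * cutBracket N z ^ t := by
  have h1 := cutBracket_pos hN x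
  have h2 := cutBracket_pos hN z
  have hzt : 0 < cutBracket N z ^ t := Real.rpow_pos_of_pos h2 _
  have e : cutBracket N x ^ t - cutBracket N z ^ t =
      ((cutBracket N x / cutBracket N z) ^ t - 1) * cutBracket N z ^ t := by
    rw [Real.div_rpow h1.le h2.le]; field_simp
  rw [e, abs_mul, abs_of_pos hzt]
  refine mul_le_mul_of_nonneg_right ?_ hzt.le
  refine (abs_rpow_sub_one_le (div_pos h1 h2) ht ht').trans ?_
  have a1 := cutBracket_div_rpow_le hN x z
  have a2 := cutBracket_div_rpow_le hN z x
  have e2 : (cutBracket N x / cutBracket N z) ^ (-(1 / 4) : ℝ) =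
      (cutBracket N z / cutBracket N x) ^ (1 / 4 : ℝ) := by
    rw [Real.rpow_neg (div_pos h1 h2).le, ← Real.inv_rpow (div_pos h1 h2).le, inv_div]
  rw [e2]
  have : 8 * t * ((cutBracket N x / cutBracket N z) ^ (1 / 4 : ℝ) +
      (cutBracket N z / cutBracket N x) ^ (1 / 4 : ℝ)) ≤ 8 * t * (2 *
      ((bracket x / bracket z) ^ (1 / 4 : ℝ) + (bracket z / bracket x) ^ (1 / 4 : ℝ))) := by
    gcongr; linarith
  linarith

/-- Commutators of power weights with geometric convolution kernels are bounded on `ℓ²`, uniformly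
in the kernel. -/
lemma sum_kernel_ratio_sq_le {q : ℝ} (hq0 : 0 ≤ q) (hq1 : q < 1) (s₀ : ℤ) (F : ℤ → ℝ)
    (Y S : Finset ℤ) :
    ∑ x ∈ Y, (∑ z ∈ S, (1 - q) * q ^ (x - z).natAbs *
      ((bracket (x - s₀) / bracket (z - s₀)) ^ (1 / 4 : ℝ) +
        (bracket (z - s₀) / bracket (x - s₀)) ^ (1 / 4 : ℝ)) * F z) ^ 2
      ≤ 14 ^ 2 * ∑ z ∈ S, F z ^ 2 := by
  refine schur_test (fun x z => (1 - q) * q ^ (x - z).natAbs *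
      ((bracket (x - s₀) / bracket (z - s₀)) ^ (1 / 4 : ℝ) +
        (bracket (z - s₀) / bracket (x - s₀)) ^ (1 / 4 : ℝ))) ?_ ?_
    (fun z => bracket (z - s₀) ^ (-(1 / 4) : ℝ)) ?_ 14 ?_ F Y S
  · intro x z
    have h1 := bracket_pos (x - s₀)
    have h2 := bracket_pos (z - s₀)
    have := pow_nonneg hq0 (x - z).natAbs
    have : 0 ≤ 1 - q := by linarith
    positivity
  · intro x z
    have : (x - z).natAbs = (z - x).natAbs := by omega
    simp only [this]; ring
  · intro x; exact Real.rpow_pos_of_pos (bracket_pos _) _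
  · intro x S
    have hx := bracket_pos (x - s₀)
    have e : ∀ z ∈ S, (1 - q) * q ^ (x - z).natAbs *
        ((bracket (x - s₀) / bracket (z - s₀)) ^ (1 / 4 : ℝ) +
        (bracket (z - s₀) / bracket (x - s₀)) ^ (1 / 4 : ℝ)) * bracket (z - s₀) ^ (-(1 / 4) : ℝ)
        = bracket (x - s₀) ^ (1 / 4 : ℝ) *
          ((1 - q) * q ^ ((x - s₀) - (z - s₀)).natAbs * bracket (z - s₀) ^ (-(1 / 2) : ℝ))
        + bracket (x - s₀) ^ (-(1 / 4) : ℝ) * ((1 - q) * q ^ (x - z).natAbs) := by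
      intro z _
      have hz := bracket_pos (z - s₀)
      rw [Real.div_rpow hx.le hz.le, Real.div_rpow hz.le hx.le, Real.rpow_neg hx.le,
        Real.rpow_neg hz.le, Real.rpow_neg hz.le, sub_sub_sub_cancel_right,
        show (1 / 2 : ℝ) = 1 / 4 + 1 / 4 by norm_num, Real.rpow_add hz]
      have := (Real.rpow_pos_of_pos hz (1 / 4)).ne'
      have := (Real.rpow_pos_of_pos hx (1 / 4)).ne'
      field_simp
    rw [Finset.sum_congr rfl e, Finset.sum_add_distrib, ← Finset.mul_sum, ← Finset.mul_sum]
    have k1 := sum_kernel_bracket_le hq0 hq1 (x - s₀) (S.map (Equiv.subRight s₀).toEmbedding)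
    rw [Finset.sum_map] at k1
    simp only [Equiv.coe_toEmbedding, Equiv.subRight_apply] at k1
    have k2 := sum_pow_natAbs_sub_le hq0 hq1 x S
    have px : 0 < bracket (x - s₀) ^ (1 / 4 : ℝ) := Real.rpow_pos_of_pos hx _
    have px' : 0 < bracket (x - s₀) ^ (-(1 / 4) : ℝ) := Real.rpow_pos_of_pos hx _
    have e4 : bracket (x - s₀) ^ (1 / 4 : ℝ) * (12 * bracket (x - s₀) ^ (-(1 / 2) : ℝ)) =
        12 * bracket (x - s₀) ^ (-(1 / 4) : ℝ) := by
      rw [show (-(1 / 4) : ℝ) = 1 / 4 + -(1 / 2) by norm_num, Real.rpow_add hx]; ring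
    calc _ ≤ bracket (x - s₀) ^ (1 / 4 : ℝ) * (12 * bracket (x - s₀) ^ (-(1 / 2) : ℝ)) +
          bracket (x - s₀) ^ (-(1 / 4) : ℝ) * 2 := by gcongr
      _ = _ := by rw [e4]; ring

end RandomEnv

namespace RandomEnv

/-! ### The massive Laplacian on the integers -/

lemma re_conj_mul_le (a b : ℂ) : (starRingEnd ℂ a * b).re ≤ (‖a‖ ^ 2 + ‖b‖ ^ 2) / 2 := by
  have h1 : (starRingEnd ℂ a * b).re ≤ ‖starRingEnd ℂ a * b‖ := Complex.re_le_norm _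
  rw [norm_mul, RCLike.norm_conj] at h1
  nlinarith [sq_nonneg (‖a‖ - ‖b‖)]

lemma summable_sq_norm_of_summable {ι : Type*} {v : ι → ℂ} (hv : Summable fun x => ‖v x‖) :
    Summable fun x => ‖v x‖ ^ 2 := by
  refine (hv.mul_left (∑' x, ‖v x‖)).of_nonneg_of_le (fun x => sq_nonneg _) fun x => ?_
  rw [pow_two]
  exact mul_le_mul_of_nonneg_right (hv.le_tsum x fun _ _ => norm_nonneg _) (norm_nonneg _)

lemma summable_comp_add {G : Type*} [AddGroup G] {f : G → ℝ} (hf : Summable f) (a : G) :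
    Summable fun x => f (x + a) := (Equiv.addRight a).summable_iff.mpr hf

lemma tsum_comp_add {G : Type*} [AddGroup G] (f : G → ℝ) (a : G) :
    ∑' x, f (x + a) = ∑' x, f x := (Equiv.addRight a).tsum_eq f

/-- The energy estimate for `μ u + ∂*∂ u = ∂* f + √μ g` on the integers, `c = √μ`. -/
lemma energy_int {c : ℝ} {v f g : ℤ → ℂ} (hv : Summable fun x => ‖v x‖)
    (hf : Summable fun x => ‖f x‖) (hg : Summable fun x => ‖g x‖)
    (h : ∀ x, (c : ℂ) ^ 2 * v x + (2 * v x - v (x + 1) - v (x - 1)) =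
      (f (x - 1) - f x) + c * g x) :
    Summable (fun x => c ^ 2 * ‖v x‖ ^ 2 + ‖v (x + 1) - v x‖ ^ 2) ∧
    ∑' x, (c ^ 2 * ‖v x‖ ^ 2 + ‖v (x + 1) - v x‖ ^ 2) ≤ ∑' x, (‖f x‖ ^ 2 + ‖g x‖ ^ 2) := by
  have hv1 : Summable fun x => ‖v (x + 1)‖ := summable_comp_add hv 1
  have hdv : Summable fun x => ‖v (x + 1) - v x‖ :=
    (hv1.add hv).of_nonneg_of_le (fun _ => norm_nonneg _) fun x => norm_sub_le _ _
  have hs1 := summable_sq_norm_of_summable hdv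
  have hs0 := (summable_sq_norm_of_summable hv).mul_left (c ^ 2)
  have hS := hs0.add hs1
  have hFG := (summable_sq_norm_of_summable hf).add (summable_sq_norm_of_summable hg)
  refine ⟨hS, ?_⟩
  -- the boundary term of the summation by parts
  let k : ℤ → ℝ := fun x => (starRingEnd ℂ (v x) * (f (x - 1) - (v x - v (x - 1)))).re
  have hk : Summable k := by
    have hb : ∀ x, ‖v x‖ ≤ ∑' x, ‖v x‖ := fun x => hv.le_tsum x fun _ _ => norm_nonneg _
    have hf1 : Summable fun x => ‖f (x - 1)‖ := summable_comp_add hf (-1)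
    have hv2 : Summable fun x => ‖v (x - 1)‖ := summable_comp_add hv (-1)
    refine Summable.of_norm_bounded ((hf1.add (hv.add hv2)).mul_left (∑' x, ‖v x‖)) fun x => ?_
    refine (Complex.abs_re_le_norm _).trans ?_
    rw [norm_mul, RCLike.norm_conj]
    refine mul_le_mul (hb x) ?_ (norm_nonneg _) (tsum_nonneg fun _ => norm_nonneg _)
    exact (norm_sub_le _ _).trans (add_le_add le_rfl (norm_sub_le _ _))
  have hk1 : Summable fun x => k (x + 1) := summable_comp_add hk 1
  have hk0 : ∑' x, (k (x + 1) - k x) = 0 := by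
    rw [hk1.tsum_sub hk, sub_eq_zero]
    exact tsum_comp_add k 1
  have pt : ∀ x, (c ^ 2 * ‖v x‖ ^ 2 + ‖v (x + 1) - v x‖ ^ 2) / 2 ≤
      (‖f x‖ ^ 2 + ‖g x‖ ^ 2) / 2 - (k (x + 1) - k x) := by
    intro x
    have e : c ^ 2 * ‖v x‖ ^ 2 + ‖v (x + 1) - v x‖ ^ 2 =
        (starRingEnd ℂ (v (x + 1) - v x) * f x).re + (starRingEnd ℂ (c * v x) * g x).re
          - (k (x + 1) - k x) := by
      have hh := congrArg (fun w => (starRingEnd ℂ (v x) * w).re) (h x)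
      simp only [k, ← Complex.normSq_eq_norm_sq, Complex.normSq_apply, add_sub_cancel_right]
      simp only [Complex.mul_re, Complex.add_re, Complex.sub_re, Complex.sub_im, Complex.add_im,
        Complex.mul_im, Complex.conj_re, Complex.conj_im, Complex.ofReal_re, Complex.ofReal_im,
        pow_two, map_sub, map_mul, Complex.re_ofNat, Complex.im_ofNat] at hh ⊢
      linarith
    have b1 := re_conj_mul_le (v (x + 1) - v x) (f x)
    have b2 := re_conj_mul_le (c * v x) (g x)
    have b3 : ‖(c : ℂ) * v x‖ ^ 2 = c ^ 2 * ‖v x‖ ^ 2 := by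
      rw [norm_mul, mul_pow, Complex.norm_real, Real.norm_eq_abs, sq_abs]
    rw [b3] at b2
    linarith
  have := (hS.div_const 2).tsum_le_tsum pt ((hFG.div_const 2).sub (hk1.sub hk))
  rw [(hFG.div_const 2).tsum_sub (hk1.sub hk), hk0, tsum_div_const, tsum_div_const] at this
  linarith

/-- The Green's function of `c² + ∂*∂` on the integers, where `c = q⁻¹ - q`. -/
noncomputable def greenInt (q : ℝ) (y : ℤ) : ℝ := q ^ 2 / (1 - q ^ 4) * q ^ (2 * y.natAbs)

section green

variable {q : ℝ} (hq0 : 0 < q) (hq1 : q < 1)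
include hq0 hq1

lemma one_sub_pow_four_pos : 0 < 1 - q ^ 4 := by
  have := pow_lt_one₀ hq0.le hq1 (show 4 ≠ 0 by norm_num); linarith

lemma greenInt_eqn (y : ℤ) :
    (q⁻¹ - q) ^ 2 * greenInt q y + (2 * greenInt q y - greenInt q (y + 1) - greenInt q (y - 1)) =
      if y = 0 then 1 else 0 := by
  have h4 := (one_sub_pow_four_pos hq0 hq1).ne'
  have hq := hq0.ne'
  unfold greenInt
  rcases lt_trichotomy y 0 with h | h | h
  · obtain ⟨n, hn⟩ : ∃ n : ℕ, y = -(n + 1 : ℤ) := ⟨(-y - 1).toNat, by omega⟩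
    have e1 : y.natAbs = n + 1 := by omega
    have e2 : (y + 1).natAbs = n := by omega
    have e3 : (y - 1).natAbs = n + 2 := by omega
    rw [if_neg h.ne, e1, e2, e3]
    field_simp
    ring
  · subst h
    have e2 : ((0 : ℤ) + 1).natAbs = 1 := by omega
    have e3 : ((0 : ℤ) - 1).natAbs = 1 := by omega
    rw [if_pos rfl, e2, e3]
    simp only [Int.natAbs_zero]
    field_simp
    ring
  · obtain ⟨n, hn⟩ : ∃ n : ℕ, y = (n + 1 : ℤ) := ⟨(y - 1).toNat, by omega⟩
    have e1 : y.natAbs = n + 1 := by omega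
    have e2 : (y + 1).natAbs = n + 2 := by omega
    have e3 : (y - 1).natAbs = n := by omega
    rw [if_neg h.ne', e1, e2, e3]
    field_simp
    ring

lemma summable_greenInt : Summable (greenInt q) := by
  have h := (hasSum_pow_natAbs (q := q ^ 2) (by positivity)
    (pow_lt_one₀ hq0.le hq1 (by norm_num))).summable.mul_left (q ^ 2 / (1 - q ^ 4))
  refine h.congr fun y => ?_
  unfold greenInt; rw [pow_mul]

lemma greenInt_nonneg (y : ℤ) : 0 ≤ greenInt q y := by
  have := one_sub_pow_four_pos hq0 hq1
  unfold greenInt; positivity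

/-- The Green's function scales like the mass: with the factor `c²` it is dominated by a geometric
kernel of mass of order one, uniformly in `q`. -/
lemma kernel_bound_mass (y : ℤ) :
    |(q⁻¹ - q) * ((q⁻¹ - q) * greenInt q y)| ≤ 2 * ((1 - q) * q ^ y.natAbs) := by
  have h4 := one_sub_pow_four_pos hq0 hq1
  have e : (q⁻¹ - q) * ((q⁻¹ - q) * greenInt q y) =
      (1 - q ^ 2) / (1 + q ^ 2) * q ^ (y.natAbs) * q ^ (y.natAbs) := by
    unfold greenInt
    rw [two_mul, pow_add]
    have : (1 - q ^ 4) = (1 - q ^ 2) * (1 + q ^ 2) := by ring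
    have h2 : (1 - q ^ 2) ≠ 0 := by
      have := pow_lt_one₀ hq0.le hq1 (show 2 ≠ 0 by norm_num); linarith
    have h3 : (1 + q ^ 2) ≠ 0 := by positivity
    rw [this]; field_simp
  have hA : 0 ≤ (1 - q ^ 2) / (1 + q ^ 2) :=
    div_nonneg (by nlinarith) (by positivity)
  have hB : (1 - q ^ 2) / (1 + q ^ 2) ≤ 2 * (1 - q) := by
    rw [div_le_iff₀ (by positivity)]
    nlinarith [sq_nonneg q, mul_nonneg (sub_nonneg.mpr hq1.le) (sq_nonneg q)]
  have hp : q ^ y.natAbs ≤ 1 := pow_le_one₀ hq0.le hq1.le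
  have hp0 : 0 ≤ q ^ y.natAbs := pow_nonneg hq0.le _
  rw [e, abs_of_nonneg (by positivity)]
  calc _ ≤ 2 * (1 - q) * q ^ y.natAbs * 1 := by
        have : 0 ≤ 1 - q := by linarith
        gcongr
    _ = _ := by ring

/-- With the factor `c`, the difference of the Green's function is dominated by a geometric kernel
of mass of order one, uniformly in `q`. -/
lemma kernel_bound_deriv (y : ℤ) :
    |(q⁻¹ - q) * (greenInt q (y + 1) - greenInt q y)| ≤ 2 * ((1 - q) * q ^ y.natAbs) := by
  have h4 := one_sub_pow_four_pos hq0 hq1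
  have h40 : (1 - q ^ 4) = (1 - q ^ 2) * (1 + q ^ 2) := by ring
  have h2 : (1 - q ^ 2) ≠ 0 := by
    have := pow_lt_one₀ hq0.le hq1 (show 2 ≠ 0 by norm_num); linarith
  have h3 : (1 + q ^ 2) ≠ 0 := by positivity
  have hC : q / (1 + q ^ 2) ≤ 1 := by
    rw [div_le_one (by positivity)]; nlinarith
  have hC0 : 0 ≤ q / (1 + q ^ 2) := by positivity
  have hD : 0 ≤ 1 - q ^ 2 := by nlinarith
  have hD' : 1 - q ^ 2 ≤ 2 * (1 - q) := by nlinarith [sq_nonneg (1 - q)]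
  have fin : ∀ n m : ℕ, m ≤ n → (1 - q ^ 2) * (q / (1 + q ^ 2)) * q ^ n ≤
      2 * ((1 - q) * q ^ m) := by
    intro n m hnm
    have hp : q ^ n ≤ q ^ m := pow_le_pow_of_le_one hq0.le hq1.le hnm
    have hp0 : 0 ≤ q ^ n := pow_nonneg hq0.le _
    have : 0 ≤ 1 - q := by linarith
    calc _ ≤ 2 * (1 - q) * 1 * q ^ m := by gcongr
      _ = _ := by ring
  rcases le_or_gt 0 y with h | h
  · have e1 : (y + 1).natAbs = y.natAbs + 1 := by omega
    have e2 : q ^ (2 * (y.natAbs + 1)) = q ^ (2 * y.natAbs) * q ^ 2 := by rw [mul_add, pow_add]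
    have e : (q⁻¹ - q) * (greenInt q (y + 1) - greenInt q y) =
        -((1 - q ^ 2) * (q / (1 + q ^ 2)) * q ^ (2 * y.natAbs)) := by
      unfold greenInt
      rw [e1, h40, e2]
      field_simp
      ring
    rw [e, abs_neg, abs_of_nonneg (by positivity)]
    exact fin _ _ (by omega)
  · have e1 : y.natAbs = (y + 1).natAbs + 1 := by omega
    have e2 : q ^ (2 * ((y + 1).natAbs + 1)) = q ^ (2 * (y + 1).natAbs) * q ^ 2 := by
      rw [mul_add, pow_add]
    have e : (q⁻¹ - q) * (greenInt q (y + 1) - greenInt q y) =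
        ((1 - q ^ 2) * (q / (1 + q ^ 2)) * q ^ (2 * (y + 1).natAbs)) := by
      unfold greenInt
      rw [e1, h40, e2]
      field_simp
    rw [e, abs_of_nonneg (by positivity)]
    -- the case `y = -1` has to be treated apart: there `|y| = 1` but the exponent is `0`
    rcases Nat.eq_zero_or_pos (y + 1).natAbs with h0 | h0
    · rw [e1, h0]
      have : q / (1 + q ^ 2) ≤ q := div_le_self hq0.le (by nlinarith)
      have hh : 0 ≤ 1 - q := by linarith
      calc _ ≤ 2 * (1 - q) * q * q ^ (2 * 0) := by gcongr
        _ = _ := by ring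
    · exact fin _ _ (by omega)

/-- The solution of `c² v + ∂*∂ v = ∂* a + c b` given by the Green's function. -/
lemma greenInt_solution {a b : ℤ → ℂ} {S : Finset ℤ} (ha : ∀ z, z ∉ S → a z = 0)
    (hb : ∀ z, z ∉ S → b z = 0) (v : ℤ → ℂ)
    (hv : ∀ x, v x = ∑ z ∈ S, (((greenInt q (x - z - 1) - greenInt q (x - z) : ℝ) : ℂ) * a z +
      (((q⁻¹ - q) * greenInt q (x - z) : ℝ) : ℂ) * b z)) :
    (Summable fun x => ‖v x‖) ∧
    ∀ x, (((q⁻¹ - q : ℝ)) : ℂ) ^ 2 * v x + (2 * v x - v (x + 1) - v (x - 1)) =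
      (a (x - 1) - a x) + ((q⁻¹ - q : ℝ) : ℂ) * b x := by
  constructor
  · have hG : Summable fun y => ‖((greenInt q y : ℝ) : ℂ)‖ := by
      refine (summable_greenInt hq0 hq1).congr fun y => ?_
      rw [Complex.norm_real, Real.norm_of_nonneg (greenInt_nonneg hq0 hq1 y)]
    have hs : ∀ z : ℤ, Summable fun x => ‖((greenInt q (x - z) : ℝ) : ℂ)‖ :=
      fun z => (Equiv.subRight z).summable_iff.mpr hG
    have hs1 : ∀ z : ℤ, Summable fun x => ‖((greenInt q (x - z - 1) : ℝ) : ℂ)‖ := by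
      intro z
      refine (hs (z + 1)).congr fun x => by rw [sub_sub]
    simp_rw [hv]
    have : Summable fun x => ∑ z ∈ S, ((‖((greenInt q (x - z - 1) : ℝ) : ℂ)‖ +
        ‖((greenInt q (x - z) : ℝ) : ℂ)‖) * ‖a z‖ +
        |q⁻¹ - q| * ‖((greenInt q (x - z) : ℝ) : ℂ)‖ * ‖b z‖) := by
      refine summable_sum fun z _ => ?_
      exact (((hs1 z).add (hs z)).mul_right _).add (((hs z).mul_left _).mul_right _)
    refine this.of_nonneg_of_le (fun _ => norm_nonneg _) fun x => ?_
    refine (norm_sum_le _ _).trans (Finset.sum_le_sum fun z _ => ?_)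
    refine (norm_add_le _ _).trans ?_
    rw [norm_mul, norm_mul]
    push_cast
    refine add_le_add (mul_le_mul_of_nonneg_right (norm_sub_le _ _) (norm_nonneg _)) ?_
    rw [norm_mul, show ((q : ℂ)⁻¹ - q) = ((q⁻¹ - q : ℝ) : ℂ) by push_cast; rfl, Complex.norm_real,
      Real.norm_eq_abs]
  · intro x
    have key : ∀ z ∈ S, (((q⁻¹ - q : ℝ)) : ℂ) ^ 2 *
        (((greenInt q (x - z - 1) - greenInt q (x - z) : ℝ) : ℂ) * a z +
        (((q⁻¹ - q) * greenInt q (x - z) : ℝ) : ℂ) * b z) +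
        (2 * (((greenInt q (x - z - 1) - greenInt q (x - z) : ℝ) : ℂ) * a z +
        (((q⁻¹ - q) * greenInt q (x - z) : ℝ) : ℂ) * b z)
        - (((greenInt q (x + 1 - z - 1) - greenInt q (x + 1 - z) : ℝ) : ℂ) * a z +
        (((q⁻¹ - q) * greenInt q (x + 1 - z) : ℝ) : ℂ) * b z)
        - (((greenInt q (x - 1 - z - 1) - greenInt q (x - 1 - z) : ℝ) : ℂ) * a z +
        (((q⁻¹ - q) * greenInt q (x - 1 - z) : ℝ) : ℂ) * b z)) =
        ((if x - 1 = z then a z else 0) - (if x = z then a z else 0)) +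
          ((q⁻¹ - q : ℝ) : ℂ) * (if x = z then b z else 0) := by
      intro z _
      have e1 := congrArg (fun t : ℝ => (t : ℂ)) (greenInt_eqn hq0 hq1 (x - z - 1))
      have e2 := congrArg (fun t : ℝ => (t : ℂ)) (greenInt_eqn hq0 hq1 (x - z))
      rw [show (x + 1 - z - 1) = x - z by ring, show x + 1 - z = x - z + 1 by ring,
        show x - 1 - z - 1 = x - z - 1 - 1 by ring, show x - 1 - z = x - z - 1 by ring]
      rw [show x - z - 1 + 1 = x - z by ring] at e1
      have c1 : (x - z - 1 = 0) ↔ (x - 1 = z) := by omega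
      have c2 : (x - z = 0) ↔ (x = z) := by omega
      simp only [c1] at e1
      simp only [c2] at e2
      have r1 : ((if x - 1 = z then (1:ℝ) else 0 : ℝ) : ℂ) * a z = if x - 1 = z then a z else 0 := by
        split_ifs <;> simp
      have r2 : ((if x = z then (1:ℝ) else 0 : ℝ) : ℂ) * a z = if x = z then a z else 0 := by
        split_ifs <;> simp
      have r3 : ((if x = z then (1:ℝ) else 0 : ℝ) : ℂ) * b z = if x = z then b z else 0 := by
        split_ifs <;> simp
      rw [← r1, ← r2, ← r3, ← e1, ← e2]
      push_cast
      ring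
    have hsum := Finset.sum_congr rfl key
    simp only [Finset.sum_add_distrib, Finset.sum_sub_distrib, ← Finset.mul_sum] at hsum
    rw [Finset.sum_ite_eq, Finset.sum_ite_eq, Finset.sum_ite_eq] at hsum
    have q1 : (if x - 1 ∈ S then a (x - 1) else 0) = a (x - 1) := by
      split_ifs with h
      · rfl
      · exact (ha _ h).symm
    have q2 : (if x ∈ S then a x else 0) = a x := by
      split_ifs with h
      · rfl
      · exact (ha _ h).symm
    have q3 : (if x ∈ S then b x else 0) = b x := by
      split_ifs with h
      · rfl
      · exact (hb _ h).symm
    rw [q1, q2, q3] at hsum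
    rw [← hsum, hv x, hv (x + 1), hv (x - 1)]
    simp only [Finset.sum_add_distrib]

/-- The commutator of the weight with convolution operators whose kernels `P`, `Q` have geometric
decay. Only the values off the diagonal matter, since the difference of the weights vanishes there.
-/
lemma norm_commutator_le {N : ℝ} (hN : 1 ≤ N) {t : ℝ} (ht : 0 ≤ t) (ht' : t ≤ 1 / 8) (s₀ : ℤ)
    (P Q : ℤ → ℝ) (hP : ∀ y, y ≠ 0 → |P y| ≤ 2 * ((1 - q) * q ^ y.natAbs))
    (hQ : ∀ y, y ≠ 0 → |Q y| ≤ 2 * ((1 - q) * q ^ y.natAbs))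
    (f g : ℤ → ℂ) (S : Finset ℤ) (x : ℤ) :
    ‖∑ z ∈ S, (((P (x - z) : ℝ) : ℂ) *
        (((cutBracket N (x - s₀) ^ t - cutBracket N (z - s₀) ^ t : ℝ) : ℂ) * f z) +
      ((Q (x - z) : ℝ) : ℂ) *
        (((cutBracket N (x - s₀) ^ t - cutBracket N (z - s₀) ^ t : ℝ) : ℂ) * g z))‖ ≤
    32 * t * ∑ z ∈ S, (1 - q) * q ^ (x - z).natAbs *
      ((bracket (x - s₀) / bracket (z - s₀)) ^ (1 / 4 : ℝ) +
        (bracket (z - s₀) / bracket (x - s₀)) ^ (1 / 4 : ℝ)) *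
        (cutBracket N (z - s₀) ^ t * (‖f z‖ + ‖g z‖)) := by
  refine (norm_sum_le _ _).trans ?_
  rw [Finset.mul_sum]
  refine Finset.sum_le_sum fun z _ => ?_
  have hk : 0 ≤ (1 - q) * q ^ (x - z).natAbs :=
    mul_nonneg (by linarith) (pow_nonneg hq0.le _)
  have hx := bracket_pos (x - s₀)
  have hz := bracket_pos (z - s₀)
  have hc : 0 ≤ cutBracket N (z - s₀) ^ t := Real.rpow_nonneg (cutBracket_pos hN _).le _
  refine (norm_add_le _ _).trans ?_
  simp only [norm_mul, Complex.norm_real, Real.norm_eq_abs]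
  by_cases h : x = z
  · subst h
    simp only [sub_self, abs_zero, zero_mul, mul_zero, add_zero]
    positivity
  · have hxz : x - z ≠ 0 := sub_ne_zero.mpr h
    have b1 := abs_cutBracket_rpow_sub_le hN ht ht' (x - s₀) (z - s₀)
    calc _ ≤ 2 * ((1 - q) * q ^ (x - z).natAbs) * (16 * t *
      ((bracket (x - s₀) / bracket (z - s₀)) ^ (1 / 4 : ℝ) +
        (bracket (z - s₀) / bracket (x - s₀)) ^ (1 / 4 : ℝ)) * cutBracket N (z - s₀) ^ t * ‖f z‖) +
        2 * ((1 - q) * q ^ (x - z).natAbs) * (16 * t *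
      ((bracket (x - s₀) / bracket (z - s₀)) ^ (1 / 4 : ℝ) +
        (bracket (z - s₀) / bracket (x - s₀)) ^ (1 / 4 : ℝ)) * cutBracket N (z - s₀) ^ t * ‖g z‖) := by
          gcongr
          · exact hP _ hxz
          · exact hQ _ hxz
      _ = _ := by ring

omit hq0 hq1 in
lemma norm_add_sq_le {E : Type*} [SeminormedAddCommGroup E] {t : ℝ} (ht : 0 < t) (a b : E) :
    ‖a + b‖ ^ 2 ≤ (1 + t) * ‖a‖ ^ 2 + (1 + 1 / t) * ‖b‖ ^ 2 := by
  have h := norm_add_le a b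
  have h0 := norm_nonneg (a + b)
  have h1 : ‖a + b‖ ^ 2 ≤ (‖a‖ + ‖b‖) ^ 2 := by gcongr
  have h2 : (1 + t) * ‖a‖ ^ 2 + (1 + 1 / t) * ‖b‖ ^ 2 - (‖a‖ + ‖b‖) ^ 2 =
      (t * ‖a‖ - ‖b‖) ^ 2 / t := by field_simp; ring
  have h3 : 0 ≤ (t * ‖a‖ - ‖b‖) ^ 2 / t := by positivity
  linarith

omit hq0 hq1 in
lemma greenInt_neg (y : ℤ) : greenInt q (-y) = greenInt q y := by
  unfold greenInt; rw [Int.natAbs_neg]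

lemma kernel_bound_deriv' (y : ℤ) :
    |(q⁻¹ - q) * (greenInt q (y - 1) - greenInt q y)| ≤ 2 * ((1 - q) * q ^ y.natAbs) := by
  have := kernel_bound_deriv hq0 hq1 (-y)
  rwa [show -y + 1 = -(y - 1) by ring, greenInt_neg, greenInt_neg, Int.natAbs_neg] at this

/-- Off the diagonal the second difference of the Green's function is `-c²` times the function
itself, by the equation. -/
lemma kernel_bound_second (y : ℤ) (hy : y ≠ 0) :
    |(greenInt q (y + 1 - 1) - greenInt q (y + 1)) - (greenInt q (y - 1) - greenInt q y)| ≤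
      2 * ((1 - q) * q ^ y.natAbs) := by
  have e := greenInt_eqn hq0 hq1 y
  rw [if_neg hy] at e
  have : (greenInt q (y + 1 - 1) - greenInt q (y + 1)) - (greenInt q (y - 1) - greenInt q y) =
      -((q⁻¹ - q) * ((q⁻¹ - q) * greenInt q y)) := by
    rw [add_sub_cancel_right]; linarith
  rw [this, abs_neg]
  exact kernel_bound_mass hq0 hq1 y

/-- A finitely supported solution of `c² u + ∂*∂ u = ∂* f + c g` is given by the Green's
function. -/
lemma eq_greenInt_solution {u f g : ℤ → ℂ} {S : Finset ℤ} (hu : ∀ z, z ∉ S → u z = 0)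
    (hf : ∀ z, z ∉ S → f z = 0) (hg : ∀ z, z ∉ S → g z = 0)
    (h : ∀ x, (((q⁻¹ - q : ℝ)) : ℂ) ^ 2 * u x + (2 * u x - u (x + 1) - u (x - 1)) =
      (f (x - 1) - f x) + ((q⁻¹ - q : ℝ) : ℂ) * g x) (x : ℤ) :
    u x = ∑ z ∈ S, (((greenInt q (x - z - 1) - greenInt q (x - z) : ℝ) : ℂ) * f z +
      (((q⁻¹ - q) * greenInt q (x - z) : ℝ) : ℂ) * g z) := by
  set v : ℤ → ℂ := fun x => ∑ z ∈ S,
    (((greenInt q (x - z - 1) - greenInt q (x - z) : ℝ) : ℂ) * f z +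
      (((q⁻¹ - q) * greenInt q (x - z) : ℝ) : ℂ) * g z) with hv
  obtain ⟨hs, he⟩ := greenInt_solution hq0 hq1 hf hg v (fun _ => rfl)
  have hus : Summable fun x => ‖u x‖ := summable_of_ne_finset_zero (s := S) fun z hz => by
    rw [hu z hz, norm_zero]
  have hd : Summable fun x => ‖u x - v x‖ :=
    (hus.add hs).of_nonneg_of_le (fun _ => norm_nonneg _) fun x => norm_sub_le _ _
  have h0 : Summable fun _ : ℤ => ‖(0 : ℂ)‖ := by simp
  obtain ⟨a1, a2⟩ := energy_int (c := q⁻¹ - q) (f := fun _ => 0) (g := fun _ => 0) hd h0 h0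
    (fun x => by linear_combination h x - he x)
  have hnn : ∀ x, 0 ≤ (q⁻¹ - q) ^ 2 * ‖u x - v x‖ ^ 2 +
      ‖(u (x + 1) - v (x + 1)) - (u x - v x)‖ ^ 2 := fun x => by positivity
  have h1 := a1.le_tsum x fun y _ => hnn y
  simp only [norm_zero] at a2
  have h2 : (q⁻¹ - q) ^ 2 * ‖u x - v x‖ ^ 2 ≤ 0 := by
    have h3 := sq_nonneg ‖(u (x + 1) - v (x + 1)) - (u x - v x)‖
    refine (le_add_of_nonneg_right h3).trans ((h1.trans a2).trans (le_of_eq ?_))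
    simp
  have h3 : 0 < (q⁻¹ - q) ^ 2 := by
    have : 1 < q⁻¹ := (one_lt_inv₀ hq0).mpr hq1
    have : 0 < q⁻¹ - q := by linarith
    positivity
  have h4 : ‖u x - v x‖ ^ 2 ≤ 0 := by
    by_contra hc
    push Not at hc
    have := mul_pos h3 hc
    linarith
  have h5 : ‖u x - v x‖ = 0 := by
    have := sq_nonneg ‖u x - v x‖
    exact pow_eq_zero_iff (two_ne_zero) |>.mp (le_antisymm h4 this)
  exact sub_eq_zero.mp (norm_eq_zero.mp h5)

/-- The weighted energy estimate in terms of the decay rate `q`. The weighted solution differs from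
the solution for the weighted sources, to which the plain energy estimate applies, by a commutator
of size `O(t)`. The numerical factor is not optimized. -/
lemma weighted_int_aux {N : ℝ} (hN : 1 ≤ N) {t : ℝ} (ht : 0 < t) (ht' : t ≤ 1 / 8) (s₀ : ℤ)
    {u f g : ℤ → ℂ} {S : Finset ℤ} (hu : ∀ z, z ∉ S → u z = 0)
    (hf : ∀ z, z ∉ S → f z = 0) (hg : ∀ z, z ∉ S → g z = 0)
    (h : ∀ x, (((q⁻¹ - q : ℝ)) : ℂ) ^ 2 * u x + (2 * u x - u (x + 1) - u (x - 1)) =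
      (f (x - 1) - f x) + ((q⁻¹ - q : ℝ) : ℂ) * g x) (Y : Finset ℤ) :
    ∑ x ∈ Y, (cutBracket N (x - s₀) ^ t) ^ 2 *
        ((q⁻¹ - q) ^ 2 * ‖u x‖ ^ 2 + ‖u (x + 1) - u x‖ ^ 2) ≤
      (1 + 2000000 * t) * ∑ z ∈ S, (cutBracket N (z - s₀) ^ t) ^ 2 * (‖f z‖ ^ 2 + ‖g z‖ ^ 2) := by
  set c : ℝ := q⁻¹ - q with hc
  set w : ℤ → ℝ := fun x => cutBracket N (x - s₀) ^ t with hw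
  have hw0 : ∀ x, 0 ≤ w x := fun x => Real.rpow_nonneg (cutBracket_pos hN _).le _
  -- `v` solves the equation with the weighted sources
  set v : ℤ → ℂ := fun x => ∑ z ∈ S,
    (((greenInt q (x - z - 1) - greenInt q (x - z) : ℝ) : ℂ) * ((w z : ℂ) * f z) +
      ((c * greenInt q (x - z) : ℝ) : ℂ) * ((w z : ℂ) * g z)) with hv
  have hwf : ∀ z, z ∉ S → (w z : ℂ) * f z = 0 := fun z hz => by rw [hf z hz, mul_zero]
  have hwg : ∀ z, z ∉ S → (w z : ℂ) * g z = 0 := fun z hz => by rw [hg z hz, mul_zero]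
  obtain ⟨hvs, hve⟩ := greenInt_solution hq0 hq1 hwf hwg v (fun _ => rfl)
  have hfs : Summable fun x => ‖(w x : ℂ) * f x‖ := summable_of_ne_finset_zero (s := S) fun z hz => by
    rw [hwf z hz, norm_zero]
  have hgs : Summable fun x => ‖(w x : ℂ) * g x‖ := summable_of_ne_finset_zero (s := S) fun z hz => by
    rw [hwg z hz, norm_zero]
  obtain ⟨en1, en2⟩ := energy_int (c := c) hvs hfs hgs hve
  set R : ℝ := ∑ z ∈ S, (w z) ^ 2 * (‖f z‖ ^ 2 + ‖g z‖ ^ 2) with hR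
  have enR : ∑' x, (‖(w x : ℂ) * f x‖ ^ 2 + ‖(w x : ℂ) * g x‖ ^ 2) = R := by
    rw [tsum_eq_sum (s := S) (fun z hz => by rw [hwf z hz, hwg z hz]; simp)]
    refine Finset.sum_congr rfl fun z _ => ?_
    simp only [norm_mul, Complex.norm_real, Real.norm_eq_abs, mul_pow, sq_abs]
    ring
  rw [enR] at en2
  have hY : ∑ x ∈ Y, (c ^ 2 * ‖v x‖ ^ 2 + ‖v (x + 1) - v x‖ ^ 2) ≤ R :=
    (en1.sum_le_tsum Y fun x _ => by positivity).trans en2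
  have hur := eq_greenInt_solution hq0 hq1 hu hf hg h
  -- the commutator
  set T : ℤ → ℝ := fun x => ∑ z ∈ S, (1 - q) * q ^ (x - z).natAbs *
      ((bracket (x - s₀) / bracket (z - s₀)) ^ (1 / 4 : ℝ) +
        (bracket (z - s₀) / bracket (x - s₀)) ^ (1 / 4 : ℝ)) * (w z * (‖f z‖ + ‖g z‖)) with hT
  have hTsum : ∑ x ∈ Y, T x ^ 2 ≤ 14 ^ 2 * (2 * R) := by
    refine (sum_kernel_ratio_sq_le hq0.le hq1 s₀ (fun z => w z * (‖f z‖ + ‖g z‖)) Y S).trans ?_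
    refine mul_le_mul_of_nonneg_left ?_ (by norm_num)
    rw [hR, Finset.mul_sum]
    refine Finset.sum_le_sum fun z _ => ?_
    have : (‖f z‖ + ‖g z‖) ^ 2 ≤ 2 * (‖f z‖ ^ 2 + ‖g z‖ ^ 2) := by
      nlinarith [sq_nonneg (‖f z‖ - ‖g z‖)]
    rw [mul_pow]
    nlinarith [sq_nonneg (w z)]
  have d0 : ∀ x, ‖(c : ℂ) * ((w x : ℂ) * u x) - c * v x‖ ≤ 32 * t * T x := by
    intro x
    refine le_trans (le_of_eq ?_) (norm_commutator_le hq0 hq1 hN ht.le ht' s₀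
      (fun y => (q⁻¹ - q) * (greenInt q (y - 1) - greenInt q y))
      (fun y => (q⁻¹ - q) * ((q⁻¹ - q) * greenInt q y))
      (fun y _ => kernel_bound_deriv' hq0 hq1 y) (fun y _ => kernel_bound_mass hq0 hq1 y) f g S x)
    congr 1
    rw [hur x, hv]
    simp only [Finset.mul_sum, ← Finset.sum_sub_distrib]
    refine Finset.sum_congr rfl fun z _ => ?_
    simp only [hw, hc]; push_cast; ring
  have d1 : ∀ x, ‖((w x : ℂ) * (u (x + 1) - u x)) - (v (x + 1) - v x)‖ ≤ 32 * t * T x := by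
    intro x
    refine le_trans (le_of_eq ?_) (norm_commutator_le hq0 hq1 hN ht.le ht' s₀
      (fun y => (greenInt q (y + 1 - 1) - greenInt q (y + 1)) - (greenInt q (y - 1) - greenInt q y))
      (fun y => (q⁻¹ - q) * (greenInt q (y + 1) - greenInt q y))
      (fun y hy => kernel_bound_second hq0 hq1 y hy) (fun y _ => kernel_bound_deriv hq0 hq1 y) f g S x)
    congr 1
    rw [hur x, hur (x + 1), hv]
    simp only [Finset.mul_sum, ← Finset.sum_sub_distrib]
    refine Finset.sum_congr rfl fun z _ => ?_
    rw [show x + 1 - z = x - z + 1 by ring]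
    simp only [hw, hc]; push_cast; ring
  have pt : ∀ x ∈ Y, (w x) ^ 2 * (c ^ 2 * ‖u x‖ ^ 2 + ‖u (x + 1) - u x‖ ^ 2) ≤
      (1 + t) * (c ^ 2 * ‖v x‖ ^ 2 + ‖v (x + 1) - v x‖ ^ 2) +
        (1 + 1 / t) * (2 * (32 * t) ^ 2) * T x ^ 2 := by
    intro x _
    have n0 : (w x) ^ 2 * (c ^ 2 * ‖u x‖ ^ 2) = ‖c * v x + ((c : ℂ) * ((w x : ℂ) * u x) - c * v x)‖ ^ 2 := by
      rw [add_sub_cancel]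
      simp only [norm_mul, Complex.norm_real, Real.norm_eq_abs, mul_pow, sq_abs]; ring
    have n1 : (w x) ^ 2 * ‖u (x + 1) - u x‖ ^ 2 =
        ‖(v (x + 1) - v x) + (((w x : ℂ) * (u (x + 1) - u x)) - (v (x + 1) - v x))‖ ^ 2 := by
      rw [add_sub_cancel]
      simp only [norm_mul, Complex.norm_real, Real.norm_eq_abs, mul_pow, sq_abs]
    have m0 := norm_add_sq_le ht (c * v x) ((c : ℂ) * ((w x : ℂ) * u x) - c * v x)
    have m1 := norm_add_sq_le ht (v (x + 1) - v x)
      (((w x : ℂ) * (u (x + 1) - u x)) - (v (x + 1) - v x))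
    rw [← n0] at m0
    rw [← n1] at m1
    have e0 : ‖(c : ℂ) * v x‖ ^ 2 = c ^ 2 * ‖v x‖ ^ 2 := by
      simp only [norm_mul, Complex.norm_real, Real.norm_eq_abs, mul_pow, sq_abs]
    rw [e0] at m0
    have k0 : ‖(c : ℂ) * ((w x : ℂ) * u x) - c * v x‖ ^ 2 ≤ (32 * t * T x) ^ 2 := by
      have := d0 x; gcongr
    have k1 : ‖((w x : ℂ) * (u (x + 1) - u x)) - (v (x + 1) - v x)‖ ^ 2 ≤ (32 * t * T x) ^ 2 := by
      have := d1 x; gcongr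
    have ht1 : 0 ≤ 1 + 1 / t := by positivity
    have := mul_le_mul_of_nonneg_left k0 ht1
    have := mul_le_mul_of_nonneg_left k1 ht1
    calc _ = (w x) ^ 2 * (c ^ 2 * ‖u x‖ ^ 2) + (w x) ^ 2 * ‖u (x + 1) - u x‖ ^ 2 := by ring
      _ ≤ (1 + t) * (c ^ 2 * ‖v x‖ ^ 2) + (1 + 1 / t) * (32 * t * T x) ^ 2 +
        ((1 + t) * ‖v (x + 1) - v x‖ ^ 2 + (1 + 1 / t) * (32 * t * T x) ^ 2) := by linarith
      _ = _ := by ring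
  refine (Finset.sum_le_sum pt).trans ?_
  rw [Finset.sum_add_distrib, ← Finset.mul_sum, ← Finset.mul_sum]
  have hR0 : 0 ≤ R := Finset.sum_nonneg fun z _ => by positivity
  have ht2 : (1 + 1 / t) * (2 * (32 * t) ^ 2) = 2048 * (t ^ 2 + t) := by field_simp; ring
  rw [ht2]
  have : 2048 * (t ^ 2 + t) ≤ 4096 * t := by nlinarith
  have h5 : 2048 * (t ^ 2 + t) * ∑ x ∈ Y, T x ^ 2 ≤ 4096 * t * (14 ^ 2 * (2 * R)) := by
    gcongr
  have h6 : (1 + t) * ∑ x ∈ Y, (c ^ 2 * ‖v x‖ ^ 2 + ‖v (x + 1) - v x‖ ^ 2) ≤ (1 + t) * R := by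
    gcongr
  nlinarith [mul_nonneg ht.le hR0]

end green

/-- Weighted energy estimate for the massive Laplacian on the integers. The constant tends to `1`
with the exponent of the weight, uniformly in the mass. -/
lemma weighted_int {c : ℝ} (hc : 0 < c) {N : ℝ} (hN : 1 ≤ N) {t : ℝ} (ht : 0 < t) (ht' : t ≤ 1 / 8)
    (s₀ : ℤ) {u f g : ℤ → ℂ} {S : Finset ℤ} (hu : ∀ z, z ∉ S → u z = 0)
    (hf : ∀ z, z ∉ S → f z = 0) (hg : ∀ z, z ∉ S → g z = 0)
    (h : ∀ x, (c : ℂ) ^ 2 * u x + (2 * u x - u (x + 1) - u (x - 1)) =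
      (f (x - 1) - f x) + (c : ℂ) * g x) (Y : Finset ℤ) :
    ∑ x ∈ Y, (cutBracket N (x - s₀) ^ t) ^ 2 *
        (c ^ 2 * ‖u x‖ ^ 2 + ‖u (x + 1) - u x‖ ^ 2) ≤
      (1 + 2000000 * t) * ∑ z ∈ S, (cutBracket N (z - s₀) ^ t) ^ 2 * (‖f z‖ ^ 2 + ‖g z‖ ^ 2) := by
  -- `q` is the root in `(0, 1)` of `q⁻¹ - q = c`
  have h1 : Real.sqrt (c ^ 2 + 4) ^ 2 = c ^ 2 + 4 := Real.sq_sqrt (by positivity)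
  have h0 := Real.sqrt_nonneg (c ^ 2 + 4)
  set r := Real.sqrt (c ^ 2 + 4)
  have hq0 : 0 < (r - c) / 2 := by nlinarith
  have hq1 : (r - c) / 2 < 1 := by nlinarith
  have hqc : ((r - c) / 2)⁻¹ - (r - c) / 2 = c := by
    have : ((r - c) / 2)⁻¹ = (r + c) / 2 := by
      refine inv_eq_of_mul_eq_one_right ?_; nlinarith
    rw [this]; ring
  have := weighted_int_aux hq0 hq1 hN ht ht' s₀ hu hf hg (by rw [hqc]; exact h) Y
  rwa [hqc] at this

end RandomEnv

namespace RandomEnv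

/-! ### The weighted Helmholtz estimate on the lattice -/

/-- The normalized Haar measure on the torus of dimension `d`. -/
noncomputable def torusMeasure (d : ℕ) : Measure (UnitAddTorus (Fin d)) :=
  Measure.pi fun _ => AddCircle.haarAddCircle

instance (d : ℕ) : IsProbabilityMeasure (torusMeasure d) := by
  unfold torusMeasure; infer_instance

open UnitAddTorus in
/-- Orthogonality of the characters to the constants. -/
lemma integral_mFourier {d : ℕ} (n : Fin d → ℤ) :
    ∫ θ, mFourier n θ ∂(torusMeasure d) = if n = 0 then 1 else 0 := by
  unfold torusMeasure
  simp only [mFourier, ContinuousMap.coe_mk]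
  rw [MeasureTheory.integral_fintype_prod_eq_prod]
  have h1 : ∀ m : ℤ, ∫ x, fourier m x ∂(AddCircle.haarAddCircle (T := 1)) = if m = 0 then 1 else 0 := by
    intro m
    have h := (orthonormal_iff_ite.mp (orthonormal_fourier (T := 1))) 0 m
    rw [ContinuousMap.inner_toLp] at h
    simp only [fourier_zero, map_one, mul_one, eq_comm (a := (0 : ℤ))] at h
    exact h
  simp only [h1]
  split_ifs with h
  · subst h; simp
  · obtain ⟨i, hi⟩ := Function.ne_iff.mp h
    exact Finset.prod_eq_zero (Finset.mem_univ i) (if_neg hi)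

open UnitAddTorus in
lemma norm_mFourier_apply {d : ℕ} (n : Fin d → ℤ) (θ : UnitAddTorus (Fin d)) :
    ‖mFourier n θ‖ = 1 := by
  simp only [mFourier, fourier_apply, ContinuousMap.coe_mk, norm_prod, Circle.norm_coe,
      Finset.prod_const_one]

open UnitAddTorus in
/-- Parseval's identity for trigonometric polynomials with distinct frequencies. -/
lemma integral_norm_sq_sum_mFourier {d : ℕ} {ι : Type*} (S : Finset ι) (m : ι → Fin d → ℤ)
    (hm : Set.InjOn m S) (f : ι → ℂ) :
    ∫ θ, ‖∑ x ∈ S, f x * mFourier (m x) θ‖ ^ 2 ∂(torusMeasure d) = ∑ x ∈ S, ‖f x‖ ^ 2 := by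
  classical
  have hint : ∀ n : Fin d → ℤ, Integrable (fun θ => mFourier n θ) (torusMeasure d) := fun n =>
    (mFourier n).continuous.integrable_of_hasCompactSupport (HasCompactSupport.of_compactSpace _)
  have e : ∀ θ, ((‖∑ x ∈ S, f x * mFourier (m x) θ‖ ^ 2 : ℝ) : ℂ) =
      ∑ x ∈ S, ∑ y ∈ S, f x * starRingEnd ℂ (f y) * mFourier (m x - m y) θ := by
    intro θ
    rw [← Complex.normSq_eq_norm_sq, ← Complex.mul_conj, map_sum, Finset.sum_mul_sum]
    refine Finset.sum_congr rfl fun x _ => Finset.sum_congr rfl fun y _ => ?_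
    rw [map_mul, ← mFourier_neg, sub_eq_add_neg, mFourier_add]; ring
  have h : ((∫ θ, ‖∑ x ∈ S, f x * mFourier (m x) θ‖ ^ 2 ∂(torusMeasure d) : ℝ) : ℂ) =
      ((∑ x ∈ S, ‖f x‖ ^ 2 : ℝ) : ℂ) := by
    rw [← integral_complex_ofReal]
    simp_rw [e]
    rw [integral_finsetSum _ fun x _ => integrable_finsetSum _ fun y _ => (hint _).const_mul _]
    push_cast
    refine Finset.sum_congr rfl fun x hx => ?_
    rw [integral_finsetSum _ fun y _ => (hint _).const_mul _]
    simp only [integral_const_mul, integral_mFourier, sub_eq_zero]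
    rw [Finset.sum_eq_single x]
    · rw [if_pos rfl, mul_one, Complex.mul_conj, Complex.normSq_eq_norm_sq]; push_cast; rfl
    · intro y hy hyx
      rw [if_neg (fun h => hyx (hm hx hy h).symm), mul_zero]
    · intro h; exact absurd hx h
  exact_mod_cast h

section partialFourier

open UnitAddTorus

variable {d : ℕ} (i : Fin d)

/-- The Fourier transform of a finitely supported function on the lattice in all coordinates
but the `i`-th one, which has the value `s`. -/
noncomputable def partialFourier (φ : Lattice d → ℂ) (s : ℤ) (θ : UnitAddTorus (Fin d)) : ℂ :=
  ∑' x : Lattice d, if x i = s then φ x * mFourier (Function.update x i 0) θ else 0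

variable {i}

lemma partialFourier_eq_sum {φ : Lattice d → ℂ} {S : Finset (Lattice d)}
    (hS : ∀ x, x ∉ S → φ x = 0) (s : ℤ) (θ : UnitAddTorus (Fin d)) :
    partialFourier i φ s θ =
      ∑ x ∈ S, if x i = s then φ x * mFourier (Function.update x i 0) θ else 0 := by
  unfold partialFourier
  refine tsum_eq_sum fun x hx => ?_
  rw [hS x hx, zero_mul, ite_self]

lemma partialFourier_eq_zero {φ : Lattice d → ℂ} {S : Finset (Lattice d)}
    (hS : ∀ x, x ∉ S → φ x = 0) {s : ℤ} (hs : s ∉ S.image (fun x => x i))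
    (θ : UnitAddTorus (Fin d)) : partialFourier i φ s θ = 0 := by
  rw [partialFourier_eq_sum hS]
  refine Finset.sum_eq_zero fun x hx => if_neg fun h => hs ?_
  exact Finset.mem_image.mpr ⟨x, hx, h⟩

lemma continuous_partialFourier {φ : Lattice d → ℂ} {S : Finset (Lattice d)}
    (hS : ∀ x, x ∉ S → φ x = 0) (s : ℤ) : Continuous (partialFourier i φ s) := by
  have : partialFourier i φ s = fun θ => ∑ x ∈ S, if x i = s then
      φ x * mFourier (Function.update x i 0) θ else 0 :=
    funext fun θ => partialFourier_eq_sum hS s θ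
  rw [this]
  refine continuous_finsetSum _ fun x _ => ?_
  split_ifs
  · exact continuous_const.mul (mFourier _).continuous
  · exact continuous_const

lemma integral_norm_sq_partialFourier {φ : Lattice d → ℂ} {S : Finset (Lattice d)}
    (hS : ∀ x, x ∉ S → φ x = 0) (s : ℤ) :
    ∫ θ, ‖partialFourier i φ s θ‖ ^ 2 ∂(torusMeasure d) =
      ∑ x ∈ S with x i = s, ‖φ x‖ ^ 2 := by
  simp_rw [partialFourier_eq_sum hS, ← Finset.sum_filter]
  refine integral_norm_sq_sum_mFourier _ (fun x => Function.update x i 0) ?_ φ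
  intro x hx y hy h
  simp only [Finset.coe_filter, Set.mem_ofPred_eq] at hx hy
  ext j
  by_cases hj : j = i
  · subst hj; rw [hx.2, hy.2]
  · have := congrFun h j
    simpa [hj] using this

lemma partialFourier_comp_add (φ : Lattice d → ℂ) (a : Lattice d) (s : ℤ)
    (θ : UnitAddTorus (Fin d)) :
    partialFourier i (fun x => φ (x + a)) s θ =
      mFourier (-Function.update a i 0) θ * partialFourier i φ (s + a i) θ := by
  unfold partialFourier
  rw [← tsum_mul_left, ← (Equiv.addRight a).tsum_eq
    (fun x => mFourier (-Function.update a i 0) θ * _)]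
  refine tsum_congr fun x => ?_
  simp only [Equiv.coe_addRight, Pi.add_apply, add_left_inj]
  split_ifs
  · have : Function.update x i 0 = -Function.update a i 0 + Function.update (x + a) i 0 := by
      ext j
      by_cases hj : j = i
      · subst hj; simp
      · simp [hj]
    rw [this, mFourier_add]; ring
  · simp

end partialFourier

/-- The weight `min (1 + |x_i - s₀|) N ^ t` on the lattice. -/
noncomputable def slabWeight {d : ℕ} (N t : ℝ) (i : Fin d) (s₀ : ℤ) (x : Lattice d) : ℝ :=
  cutBracket N (x i - s₀) ^ t

/-- The unit vectors of the lattice. -/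
abbrev unitVec {d : ℕ} (j : Fin d) : Lattice d := Pi.single j 1

open UnitAddTorus in
/-- For the plain Laplacian, and finitely supported functions, the weighted norm of the gradient
is controlled with a constant that tends to `1` with the exponent of the weight. Partial Fourier
transform in the coordinates on which the weight does not depend reduces this to the integers, where
the squared frequency is the mass. -/
lemma weighted_lattice_fin {d : ℕ} {η : ℝ} (hη : 0 < η) {N : ℝ} (hN : 1 ≤ N) {t : ℝ} (ht : 0 < t)
    (ht' : t ≤ 1 / 8) (i : Fin d) (s₀ : ℤ) {u e : Lattice d → ℂ} {F : Fin d → Lattice d → ℂ}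
    {S : Finset (Lattice d)} (hu : ∀ x, x ∉ S → u x = 0) (he : ∀ x, x ∉ S → e x = 0)
    (hF : ∀ j x, x ∉ S → F j x = 0)
    (hup : ∀ j x, x ∉ S → u (x + unitVec j) = 0) (hum : ∀ j x, x ∉ S → u (x + -unitVec j) = 0)
    (hFm : ∀ j x, x ∉ S → F j (x + -unitVec j) = 0)
    (h : ∀ x, (η : ℂ) * u x + ∑ j, (2 * u x - u (x + unitVec j) - u (x + -unitVec j)) =
      ∑ j, (F j (x + -unitVec j) - F j x) + Real.sqrt η * e x) :
    ∑ x ∈ S, slabWeight N t i s₀ x ^ 2 * ∑ j, ‖u (x + unitVec j) - u x‖ ^ 2 ≤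
      (1 + 2000000 * t) * ∑ x ∈ S, slabWeight N t i s₀ x ^ 2 * (∑ j, ‖F j x‖ ^ 2 + ‖e x‖ ^ 2) := by
  classical
  set I : Finset ℤ := S.image (fun x => x i) with hI
  let T : (Lattice d → ℂ) → ℤ → UnitAddTorus (Fin d) → ℂ := partialFourier i
  let E : Fin d → UnitAddTorus (Fin d) → ℂ := fun j θ => mFourier (-unitVec j) θ
  have hE1 : ∀ j θ, E j θ * starRingEnd ℂ (E j θ) = 1 := by
    intro j θ
    rw [Complex.mul_conj, Complex.normSq_eq_norm_sq, norm_mFourier_apply]; simp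
  -- the transform of the shifts
  have tp : ∀ (φ : Lattice d → ℂ) j s θ, j ≠ i →
      T (fun x => φ (x + unitVec j)) s θ = E j θ * T φ s θ := by
    intro φ j s θ hj
    have h1 : Function.update (unitVec j) i 0 = unitVec j := by
      rw [Function.update_eq_iff]; simp [hj.symm]
    have h2 : unitVec j i = 0 := by simp [hj.symm]
    simp only [T, partialFourier_comp_add, h1, h2, add_zero, E]
  have tm : ∀ (φ : Lattice d → ℂ) j s θ, j ≠ i →
      T (fun x => φ (x + -unitVec j)) s θ = starRingEnd ℂ (E j θ) * T φ s θ := by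
    intro φ j s θ hj
    have h1 : Function.update (-unitVec j) i 0 = -unitVec j := by
      rw [Function.update_eq_iff]; simp [hj.symm]
    have h2 : (-unitVec j) i = 0 := by simp [hj.symm]
    simp only [T, partialFourier_comp_add, h1, h2, add_zero, E, mFourier_neg, Complex.conj_conj]
  have tip : ∀ (φ : Lattice d → ℂ) s θ, T (fun x => φ (x + unitVec i)) s θ = T φ (s + 1) θ := by
    intro φ s θ
    have h1 : Function.update (unitVec i) i 0 = 0 := by
      ext j; by_cases hj : j = i
      · subst hj; simp
      · simp [hj]
    simp only [T, partialFourier_comp_add, h1]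
    simp [mFourier_zero]
  have tim : ∀ (φ : Lattice d → ℂ) s θ, T (fun x => φ (x + -unitVec i)) s θ = T φ (s - 1) θ := by
    intro φ s θ
    have h1 : Function.update (-unitVec i) i 0 = 0 := by
      ext j; by_cases hj : j = i
      · subst hj; simp
      · simp [hj]
    simp only [T, partialFourier_comp_add, h1]
    simp [mFourier_zero, sub_eq_add_neg]
  have tsub : ∀ (φ ψ : Lattice d → ℂ), (∀ x, x ∉ S → φ x = 0) → (∀ x, x ∉ S → ψ x = 0) → ∀ s θ,
      T (fun x => φ x - ψ x) s θ = T φ s θ - T ψ s θ := by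
    intro φ ψ hφ hψ s θ
    simp only [T]
    rw [partialFourier_eq_sum hφ, partialFourier_eq_sum hψ,
      partialFourier_eq_sum (S := S) (fun x hx => by rw [hφ x hx, hψ x hx, sub_zero]),
      ← Finset.sum_sub_distrib]
    refine Finset.sum_congr rfl fun x _ => ?_
    split_ifs <;> ring
  -- the transformed equation
  have teq : ∀ s θ, (η : ℂ) * T u s θ + ∑ j, (2 * T u s θ - T (fun x => u (x + unitVec j)) s θ -
      T (fun x => u (x + -unitVec j)) s θ) =
      ∑ j, (T (fun x => F j (x + -unitVec j)) s θ - T (F j) s θ) + Real.sqrt η * T e s θ := by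
    intro s θ
    simp only [T]
    rw [partialFourier_eq_sum hu, partialFourier_eq_sum he]
    simp_rw [fun j => partialFourier_eq_sum (i := i) (hup j) s θ,
      fun j => partialFourier_eq_sum (i := i) (hum j) s θ,
      fun j => partialFourier_eq_sum (i := i) (hFm j) s θ,
      fun j => partialFourier_eq_sum (i := i) (hF j) s θ]
    simp only [Finset.mul_sum, ← Finset.sum_sub_distrib]
    rw [Finset.sum_comm, ← Finset.sum_add_distrib, Finset.sum_comm (s := Finset.univ),
      ← Finset.sum_add_distrib]
    refine Finset.sum_congr rfl fun x _ => ?_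
    split_ifs
    · have hx := congrArg (fun w => w * mFourier (Function.update x i 0) θ) (h x)
      simp only [add_mul, Finset.sum_mul] at hx
      refine Eq.trans ?_ (hx.trans ?_)
      · congr 1
        · ring
        · exact Finset.sum_congr rfl fun j _ => by ring
      · congr 1
        · exact Finset.sum_congr rfl fun j _ => by ring
        · ring
    · simp
  -- the estimate at a fixed frequency
  have pt : ∀ θ, ∑ s ∈ I, (cutBracket N (s - s₀) ^ t) ^ 2 *
        ∑ j, ‖T (fun x => u (x + unitVec j) - u x) s θ‖ ^ 2 ≤
      (1 + 2000000 * t) * ∑ s ∈ I, (cutBracket N (s - s₀) ^ t) ^ 2 *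
        (∑ j, ‖T (F j) s θ‖ ^ 2 + ‖T e s θ‖ ^ 2) := by
    intro θ
    set μ : ℝ := η + ∑ j ∈ Finset.univ.erase i, ‖E j θ - 1‖ ^ 2 with hμ
    have hμ0 : 0 < μ := add_pos_of_pos_of_nonneg hη (Finset.sum_nonneg fun _ _ => sq_nonneg _)
    set c : ℝ := Real.sqrt μ with hc
    have hc0 : 0 < c := Real.sqrt_pos.mpr hμ0
    have hc2 : c ^ 2 = μ := Real.sq_sqrt hμ0.le
    have hcC : (c : ℂ) ≠ 0 := by exact_mod_cast hc0.ne'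
    let g : ℤ → ℂ := fun s => (∑ j ∈ Finset.univ.erase i, starRingEnd ℂ (E j θ - 1) * T (F j) s θ +
      Real.sqrt η * T e s θ) / c
    have hg : ∀ s, ‖g s‖ ^ 2 ≤ ∑ j ∈ Finset.univ.erase i, ‖T (F j) s θ‖ ^ 2 + ‖T e s θ‖ ^ 2 := by
      intro s
      simp only [g]
      rw [norm_div, div_pow, Complex.norm_real, Real.norm_eq_abs, sq_abs, hc2, div_le_iff₀ hμ0]
      have b1 : ‖∑ j ∈ Finset.univ.erase i, starRingEnd ℂ (E j θ - 1) * T (F j) s θ +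
          Real.sqrt η * T e s θ‖ ≤ ∑ j ∈ Finset.univ.erase i, ‖E j θ - 1‖ * ‖T (F j) s θ‖ +
          Real.sqrt η * ‖T e s θ‖ := by
        refine (norm_add_le _ _).trans (add_le_add ((norm_sum_le _ _).trans (le_of_eq ?_)) ?_)
        · exact Finset.sum_congr rfl fun j _ => by rw [norm_mul, RCLike.norm_conj]
        · rw [norm_mul, Complex.norm_real, Real.norm_of_nonneg (Real.sqrt_nonneg _)]
      have b2 := Finset.sum_mul_sq_le_sq_mul_sq (Finset.univ.erase i) (fun j => ‖E j θ - 1‖)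
        (fun j => ‖T (F j) s θ‖)
      have b3 : (Real.sqrt η) ^ 2 = η := Real.sq_sqrt hη.le
      set A := ∑ j ∈ Finset.univ.erase i, ‖E j θ - 1‖ * ‖T (F j) s θ‖
      set B := ∑ j ∈ Finset.univ.erase i, ‖E j θ - 1‖ ^ 2
      set D := ∑ j ∈ Finset.univ.erase i, ‖T (F j) s θ‖ ^ 2
      have hB : 0 ≤ B := Finset.sum_nonneg fun _ _ => sq_nonneg _
      have hD : 0 ≤ D := Finset.sum_nonneg fun _ _ => sq_nonneg _
      have hA : A ≤ Real.sqrt B * Real.sqrt D := by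
        rw [← Real.sqrt_mul hB]; exact Real.le_sqrt_of_sq_le b2
      have s1 := Real.sq_sqrt hB
      have s2 := Real.sq_sqrt hD
      have hA0 : 0 ≤ A := Finset.sum_nonneg fun _ _ => by positivity
      calc _ ≤ (A + Real.sqrt η * ‖T e s θ‖) ^ 2 := by gcongr
        _ ≤ (Real.sqrt B * Real.sqrt D + Real.sqrt η * ‖T e s θ‖) ^ 2 := by gcongr
        _ ≤ _ := by
          rw [hμ]
          nlinarith [sq_nonneg (Real.sqrt B * ‖T e s θ‖ - Real.sqrt η * Real.sqrt D)]
    have hz : ∀ {φ : Lattice d → ℂ}, (∀ x, x ∉ S → φ x = 0) → ∀ s, s ∉ I → T φ s θ = 0 :=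
      fun hφ s hs => partialFourier_eq_zero hφ hs θ
    have eqn : ∀ s, (c : ℂ) ^ 2 * T u s θ + (2 * T u s θ - T u (s + 1) θ - T u (s - 1) θ) =
        (T (F i) (s - 1) θ - T (F i) s θ) + (c : ℂ) * g s := by
      intro s
      have hs := teq s θ
      rw [← Finset.add_sum_erase _ _ (Finset.mem_univ i),
        ← Finset.add_sum_erase _ _ (Finset.mem_univ i), tip, tim, tim] at hs
      have e1 : ∑ j ∈ Finset.univ.erase i, (2 * T u s θ - T (fun x => u (x + unitVec j)) s θ -
          T (fun x => u (x + -unitVec j)) s θ) =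
          ((∑ j ∈ Finset.univ.erase i, ‖E j θ - 1‖ ^ 2 : ℝ) : ℂ) * T u s θ := by
        push_cast
        rw [Finset.sum_mul]
        refine Finset.sum_congr rfl fun j hj => ?_
        rw [tp _ _ _ _ (Finset.ne_of_mem_erase hj), tm _ _ _ _ (Finset.ne_of_mem_erase hj)]
        have : ((‖E j θ - 1‖ : ℂ)) ^ 2 = (E j θ - 1) * starRingEnd ℂ (E j θ - 1) := by
          rw [Complex.mul_conj, Complex.normSq_eq_norm_sq]; push_cast; rfl
        rw [this, map_sub, map_one]
        linear_combination (-T u s θ) * hE1 j θ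
      have e2 : ∑ j ∈ Finset.univ.erase i, (T (fun x => F j (x + -unitVec j)) s θ - T (F j) s θ) =
          ∑ j ∈ Finset.univ.erase i, starRingEnd ℂ (E j θ - 1) * T (F j) s θ := by
        refine Finset.sum_congr rfl fun j hj => ?_
        rw [tm _ _ _ _ (Finset.ne_of_mem_erase hj), map_sub, map_one]; ring
      rw [e1, e2] at hs
      have hcg : (c : ℂ) * g s = ∑ j ∈ Finset.univ.erase i, starRingEnd ℂ (E j θ - 1) * T (F j) s θ +
          Real.sqrt η * T e s θ := mul_div_cancel₀ _ hcC
      have hc2' : (c : ℂ) ^ 2 = η + ((∑ j ∈ Finset.univ.erase i, ‖E j θ - 1‖ ^ 2 : ℝ) : ℂ) := by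
        rw [← Complex.ofReal_pow, hc2, hμ, Complex.ofReal_add]
      rw [hcg, hc2']
      linear_combination hs
    have hgz : ∀ s, s ∉ I → g s = 0 := by
      intro s hs
      simp only [g]
      rw [hz he s hs, Finset.sum_eq_zero fun j _ => by rw [hz (hF j) s hs, mul_zero]]
      simp
    have main := weighted_int hc0 hN ht ht' s₀ (hz hu) (hz (hF i)) hgz eqn I
    refine le_trans (Finset.sum_le_sum fun s _ => ?_) (main.trans ?_)
    · refine mul_le_mul_of_nonneg_left (le_of_le_of_eq ?_ (add_comm _ _)) (sq_nonneg _)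
      rw [← Finset.add_sum_erase _ _ (Finset.mem_univ i), tsub _ _ (hup i) hu, tip]
      refine add_le_add le_rfl ?_
      have : ∑ j ∈ Finset.univ.erase i, ‖T (fun x => u (x + unitVec j) - u x) s θ‖ ^ 2 =
          (∑ j ∈ Finset.univ.erase i, ‖E j θ - 1‖ ^ 2) * ‖T u s θ‖ ^ 2 := by
        rw [Finset.sum_mul]
        refine Finset.sum_congr rfl fun j hj => ?_
        rw [tsub _ _ (hup j) hu, tp _ _ _ _ (Finset.ne_of_mem_erase hj), ← sub_one_mul, norm_mul,
          mul_pow]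
      rw [this, hc2, hμ]
      gcongr
      linarith
    · refine mul_le_mul_of_nonneg_left (Finset.sum_le_sum fun s _ => ?_) (by positivity)
      refine mul_le_mul_of_nonneg_left ?_ (sq_nonneg _)
      rw [← Finset.add_sum_erase _ _ (Finset.mem_univ i), add_assoc]
      exact add_le_add le_rfl (hg s)
  -- integration over the frequencies
  have hint : ∀ {φ : Lattice d → ℂ}, (∀ x, x ∉ S → φ x = 0) → ∀ s,
      Integrable (fun θ => ‖T φ s θ‖ ^ 2) (torusMeasure d) := fun hφ s =>
    ((continuous_partialFourier hφ s).norm.pow 2).integrable_of_hasCompactSupport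
      (HasCompactSupport.of_compactSpace _)
  have hdu : ∀ j x, x ∉ S → u (x + unitVec j) - u x = 0 := fun j x hx => by
    rw [hup j x hx, hu x hx, sub_zero]
  have hFe : ∀ s, Integrable (fun θ => ∑ j, ‖T (F j) s θ‖ ^ 2 + ‖T e s θ‖ ^ 2) (torusMeasure d) :=
    fun s => (integrable_finsetSum _ fun j _ => hint (hF j) s).add (hint he s)
  have i1 : Integrable (fun θ => ∑ s ∈ I, (cutBracket N (s - s₀) ^ t) ^ 2 *
        ∑ j, ‖T (fun x => u (x + unitVec j) - u x) s θ‖ ^ 2) (torusMeasure d) :=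
    integrable_finsetSum _ fun s _ => (integrable_finsetSum _ fun j _ => hint (hdu j) s).const_mul _
  have i2 : Integrable (fun θ => (1 + 2000000 * t) * ∑ s ∈ I, (cutBracket N (s - s₀) ^ t) ^ 2 *
        (∑ j, ‖T (F j) s θ‖ ^ 2 + ‖T e s θ‖ ^ 2)) (torusMeasure d) :=
    (integrable_finsetSum _ fun s _ => (hFe s).const_mul _).const_mul _
  have fib : ∀ (G : Lattice d → ℝ), ∑ s ∈ I, (cutBracket N (s - s₀) ^ t) ^ 2 *
      ∑ x ∈ S with x i = s, G x = ∑ x ∈ S, slabWeight N t i s₀ x ^ 2 * G x := by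
    intro G
    rw [← Finset.sum_fiberwise_of_maps_to (s := S) (t := I) (g := fun x => x i)
      (fun x hx => Finset.mem_image_of_mem _ hx)]
    refine Finset.sum_congr rfl fun s _ => ?_
    rw [Finset.mul_sum]
    refine Finset.sum_congr rfl fun x hx => ?_
    rw [slabWeight, (Finset.mem_filter.mp hx).2]
  have key := integral_mono i1 i2 pt
  rw [integral_const_mul, integral_finsetSum _ fun s _ => (integrable_finsetSum _ fun j _ =>
      hint (hdu j) s).const_mul _, integral_finsetSum _ fun s _ => (hFe s).const_mul _] at key
  simp only [integral_const_mul] at key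
  have l1 : ∀ s, ∫ θ, ∑ j, ‖T (fun x => u (x + unitVec j) - u x) s θ‖ ^ 2 ∂(torusMeasure d) =
      ∑ x ∈ S with x i = s, ∑ j, ‖u (x + unitVec j) - u x‖ ^ 2 := by
    intro s
    rw [integral_finsetSum _ fun j _ => hint (hdu j) s, Finset.sum_comm]
    exact Finset.sum_congr rfl fun j _ => integral_norm_sq_partialFourier (hdu j) s
  have l2 : ∀ s, ∫ θ, (∑ j, ‖T (F j) s θ‖ ^ 2 + ‖T e s θ‖ ^ 2) ∂(torusMeasure d) =
      ∑ x ∈ S with x i = s, (∑ j, ‖F j x‖ ^ 2 + ‖e x‖ ^ 2) := by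
    intro s
    rw [integral_add (integrable_finsetSum _ fun j _ => hint (hF j) s) (hint he s),
      integral_finsetSum _ fun j _ => hint (hF j) s, Finset.sum_add_distrib, Finset.sum_comm]
    congr 1
    · exact Finset.sum_congr rfl fun j _ => integral_norm_sq_partialFourier (hF j) s
    · exact integral_norm_sq_partialFourier he s
  simp only [l1, l2, fib] at key
  exact key

end RandomEnv

namespace RandomEnv

/-! ### Weighted estimates for variable coefficients -/

/-- Square summable functions. -/
def SqSummable {ι E : Type*} [NormedAddCommGroup E] (f : ι → E) : Prop :=
  Summable fun x => ‖f x‖ ^ 2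

namespace SqSummable

variable {ι E : Type*} [NormedAddCommGroup E] {f g : ι → E}

lemma add (hf : SqSummable f) (hg : SqSummable g) : SqSummable fun x => f x + g x := by
  refine Summable.of_nonneg_of_le (fun _ => sq_nonneg _) (fun x => ?_)
    ((Summable.add hf hg).mul_left 2)
  have h := norm_add_le (f x) (g x)
  have h0 := norm_nonneg (f x + g x)
  nlinarith [sq_nonneg (‖f x‖ - ‖g x‖)]

lemma of_norm_le {F : Type*} [NormedAddCommGroup F] {h : ι → F} (hf : SqSummable f)
    (hh : ∀ x, ‖h x‖ ≤ ‖f x‖) : SqSummable h :=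
  Summable.of_nonneg_of_le (fun _ => sq_nonneg _)
    (fun x => by have := hh x; gcongr) hf

lemma norm (hf : SqSummable f) : SqSummable fun x => ‖f x‖ := hf.of_norm_le fun x => by simp

lemma neg (hf : SqSummable f) : SqSummable fun x => -f x := hf.of_norm_le fun x => by simp

lemma sub (hf : SqSummable f) (hg : SqSummable g) : SqSummable fun x => f x - g x := by
  simpa only [sub_eq_add_neg] using hf.add hg.neg

lemma const_mul {R : Type*} [NormedRing R] [NormMulClass R] {f : ι → R} (hf : SqSummable f)
    (c : R) : SqSummable fun x => c * f x := by
  have := Summable.mul_left (‖c‖ ^ 2) hf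
  refine this.congr fun x => ?_
  rw [norm_mul, mul_pow]

lemma sum {κ : Type*} (s : Finset κ) {f : κ → ι → E} (hf : ∀ k ∈ s, SqSummable (f k)) :
    SqSummable fun x => ∑ k ∈ s, f k x := by
  classical
  induction s using Finset.induction_on with
  | empty => simp [SqSummable]
  | insert a s ha ih =>
    simp only [Finset.sum_insert ha]
    exact (hf a (Finset.mem_insert_self a s)).add
      (ih fun k hk => hf k (Finset.mem_insert_of_mem hk))

lemma comp_add {G : Type*} [AddGroup G] {f : G → E} (hf : SqSummable f) (a : G) :
    SqSummable fun x => f (x + a) :=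
  summable_comp_add (f := fun x => ‖f x‖ ^ 2) hf a

end SqSummable

lemma slabWeight_sq_le {d : ℕ} {N t : ℝ} (hN : 1 ≤ N) (ht : 0 < t) (i : Fin d) (s₀ : ℤ)
    (x : Lattice d) : slabWeight N t i s₀ x ^ 2 ≤ (N ^ t) ^ 2 := by
  have h0 := cutBracket_pos hN (x i - s₀)
  have : slabWeight N t i s₀ x ≤ N ^ t := Real.rpow_le_rpow h0.le (min_le_right _ _) ht.le
  have h1 : 0 ≤ slabWeight N t i s₀ x := Real.rpow_nonneg h0.le _
  gcongr

/-- The estimate `weighted_lattice_fin` for square summable functions, without residual. -/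
lemma weighted_lattice_sqSummable {d : ℕ} {η : ℝ} (hη : 0 < η) {N : ℝ} (hN : 1 ≤ N) {t : ℝ}
    (ht : 0 < t) (ht' : t ≤ 1 / 8) (i : Fin d) (s₀ : ℤ) {u : Lattice d → ℂ}
    {F : Fin d → Lattice d → ℂ} (hu : SqSummable u) (hF : ∀ j, SqSummable (F j))
    (h : ∀ x, (η : ℂ) * u x + ∑ j, (2 * u x - u (x + unitVec j) - u (x + -unitVec j)) =
      ∑ j, (F j (x + -unitVec j) - F j x)) (Y : Finset (Lattice d)) :
    ∑ x ∈ Y, slabWeight N t i s₀ x ^ 2 * ∑ j, ‖u (x + unitVec j) - u x‖ ^ 2 ≤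
      (1 + 2000000 * t) * ∑' x, slabWeight N t i s₀ x ^ 2 * ∑ j, ‖F j x‖ ^ 2 := by
  classical
  have hsη : 0 < Real.sqrt η := Real.sqrt_pos.mpr hη
  let cut : Finset (Lattice d) → (Lattice d → ℂ) → Lattice d → ℂ :=
    fun B φ x => if x ∈ B then φ x else 0
  -- the residual of the truncated functions
  let e : Finset (Lattice d) → Lattice d → ℂ := fun B x => ((Real.sqrt η)⁻¹ : ℂ) *
    (((η : ℂ) * cut B u x + ∑ j, (2 * cut B u x - cut B u (x + unitVec j) -
      cut B u (x + -unitVec j))) - ∑ j, (cut B (F j) (x + -unitVec j) - cut B (F j) x))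
  let bd : Lattice d → ℝ := fun x => (Real.sqrt η)⁻¹ *
    ((η * ‖u x‖ + ∑ j, (2 * ‖u x‖ + ‖u (x + unitVec j)‖ + ‖u (x + -unitVec j)‖)) +
      ∑ j, (‖F j (x + -unitVec j)‖ + ‖F j x‖))
  have hbd : Summable fun x => bd x ^ 2 := by
    have : SqSummable bd := by
      refine SqSummable.const_mul (SqSummable.add (SqSummable.add (hu.norm.const_mul _)
        (SqSummable.sum _ fun j _ => ?_)) (SqSummable.sum _ fun j _ => ?_)) _
      · exact ((hu.norm.const_mul _).add (hu.comp_add _).norm).add (hu.comp_add _).norm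
      · exact ((hF j).comp_add _).norm.add (hF j).norm
    refine Summable.congr this fun x => ?_
    rw [Real.norm_eq_abs, sq_abs]
  have hcut : ∀ B φ x, ‖cut B φ x‖ ≤ ‖φ x‖ := by
    intro B φ x
    simp only [cut]; split_ifs <;> simp
  have hebd : ∀ B x, ‖e B x‖ ≤ bd x := by
    intro B x
    simp only [e, bd]
    rw [norm_mul, norm_inv, Complex.norm_real, Real.norm_of_nonneg hsη.le]
    refine mul_le_mul_of_nonneg_left ?_ (inv_nonneg.mpr hsη.le)
    refine (norm_sub_le _ _).trans (add_le_add ((norm_add_le _ _).trans (add_le_add ?_ ?_)) ?_)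
    · rw [norm_mul, Complex.norm_real, Real.norm_of_nonneg hη.le]
      have := hcut B u x; gcongr
    · refine (norm_sum_le _ _).trans (Finset.sum_le_sum fun j _ => ?_)
      refine (norm_sub_le _ _).trans (add_le_add ((norm_sub_le _ _).trans
        (add_le_add ?_ (hcut _ _ _))) (hcut _ _ _))
      rw [norm_mul, Complex.norm_ofNat]
      have := hcut B u x; gcongr
    · refine (norm_sum_le _ _).trans (Finset.sum_le_sum fun j _ => ?_)
      exact (norm_sub_le _ _).trans (add_le_add (hcut _ _ _) (hcut _ _ _))
  have hcutev : ∀ φ x, ∀ᶠ B in atTop, cut B φ x = φ x := by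
    intro φ x
    filter_upwards [eventually_ge_atTop ({x} : Finset (Lattice d))] with B hB
    exact if_pos (hB (Finset.mem_singleton_self x))
  have hev : ∀ x, ∀ᶠ B in atTop, e B x = 0 := by
    intro x
    have a1 := hcutev u x
    have a2 : ∀ᶠ B in atTop, ∀ j, cut B u (x + unitVec j) = u (x + unitVec j) :=
      eventually_all.mpr fun j => hcutev u _
    have a3 : ∀ᶠ B in atTop, ∀ j, cut B u (x + -unitVec j) = u (x + -unitVec j) :=
      eventually_all.mpr fun j => hcutev u _
    have a4 : ∀ᶠ B in atTop, ∀ j, cut B (F j) (x + -unitVec j) = F j (x + -unitVec j) :=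
      eventually_all.mpr fun j => hcutev _ _
    have a5 : ∀ᶠ B in atTop, ∀ j, cut B (F j) x = F j x :=
      eventually_all.mpr fun j => hcutev _ _
    filter_upwards [a1, a2, a3, a4, a5] with B b1 b2 b3 b4 b5
    simp only [e, b1, b2, b3, b4, b5, h x, sub_self, mul_zero]
  have hlim : Tendsto (fun B => ∑' x, ‖e B x‖ ^ 2) atTop (𝓝 0) := by
    have : Tendsto (fun B => ∑' x, ‖e B x‖ ^ 2) atTop (𝓝 (∑' _ : Lattice d, (0 : ℝ))) := by
      refine tendsto_tsum_of_dominated_convergence hbd (fun x => ?_) (Eventually.of_forall fun B x => ?_)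
      · refine tendsto_const_nhds.congr' ?_
        filter_upwards [hev x] with B hB
        rw [hB]; simp
      · rw [Real.norm_of_nonneg (sq_nonneg _)]
        have := hebd B x; gcongr
    simpa using this
  have hw0 : ∀ x, 0 ≤ slabWeight N t i s₀ x ^ 2 := fun x => sq_nonneg _
  have hsumF : Summable fun x => slabWeight N t i s₀ x ^ 2 * ∑ j, ‖F j x‖ ^ 2 := by
    have h1 : Summable fun x => (N ^ t) ^ 2 * ∑ j, ‖F j x‖ ^ 2 :=
      (summable_sum fun j _ => hF j).mul_left _
    refine h1.of_nonneg_of_le (fun x => mul_nonneg (hw0 x)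
      (Finset.sum_nonneg fun _ _ => sq_nonneg _)) fun x => ?_
    exact mul_le_mul_of_nonneg_right (slabWeight_sq_le hN ht i s₀ x)
      (Finset.sum_nonneg fun _ _ => sq_nonneg _)
  have hK : 0 ≤ 1 + 2000000 * t := by positivity
  have main : ∀ᶠ B in atTop, ∑ x ∈ Y, slabWeight N t i s₀ x ^ 2 *
      ∑ j, ‖u (x + unitVec j) - u x‖ ^ 2 ≤ (1 + 2000000 * t) *
        (∑' x, slabWeight N t i s₀ x ^ 2 * ∑ j, ‖F j x‖ ^ 2 +
          (N ^ t) ^ 2 * ∑' x, ‖e B x‖ ^ 2) := by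
    have c1 : ∀ᶠ B in atTop, ∀ x ∈ Y, cut B u x = u x :=
      (Finset.eventually_all Y).mpr fun x _ => hcutev u x
    have c2 : ∀ᶠ B in atTop, ∀ x ∈ Y, ∀ j, cut B u (x + unitVec j) = u (x + unitVec j) :=
      (Finset.eventually_all Y).mpr fun x _ => eventually_all.mpr fun j => hcutev u _
    filter_upwards [c1, c2] with B b1 b2
    set S : Finset (Lattice d) := (Y ∪ B) ∪ (Finset.univ.biUnion fun j =>
      B.image (fun x => x + unitVec j) ∪ B.image (fun x => x + -unitVec j)) with hS
    have s0 : ∀ x, x ∉ S → x ∉ B := fun x hx hB => hx (by simp [hS, hB])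
    have sp : ∀ (j : Fin d) x, x ∉ S → x + unitVec j ∉ B := fun j x hx hB => hx (by
      simp only [hS, Finset.mem_union, Finset.mem_biUnion, Finset.mem_image, Finset.mem_univ,
        true_and]
      exact Or.inr ⟨j, Or.inr ⟨_, hB, by rw [add_neg_cancel_right]⟩⟩)
    have sm : ∀ (j : Fin d) x, x ∉ S → x + -unitVec j ∉ B := fun j x hx hB => hx (by
      simp only [hS, Finset.mem_union, Finset.mem_biUnion, Finset.mem_image, Finset.mem_univ,
        true_and]
      exact Or.inr ⟨j, Or.inl ⟨_, hB, by rw [neg_add_cancel_right]⟩⟩)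
    have z : ∀ φ x, x ∉ B → cut B φ x = 0 := fun φ x hx => if_neg hx
    have := weighted_lattice_fin hη hN ht ht' i s₀ (u := cut B u) (e := e B)
      (F := fun j => cut B (F j)) (S := S) (fun x hx => z _ _ (s0 x hx)) ?_
      (fun j x hx => z _ _ (s0 x hx)) (fun j x hx => z _ _ (sp j x hx))
      (fun j x hx => z _ _ (sm j x hx)) (fun j x hx => z _ _ (sm j x hx)) ?_
    · have hYS : Y ⊆ S := fun x hx => by simp [hS, hx]
      calc _ = ∑ x ∈ Y, slabWeight N t i s₀ x ^ 2 *
          ∑ j, ‖cut B u (x + unitVec j) - cut B u x‖ ^ 2 := by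
            refine Finset.sum_congr rfl fun x hx => ?_
            rw [b1 x hx]; simp only [b2 x hx]
        _ ≤ _ := Finset.sum_le_sum_of_subset_of_nonneg hYS fun x _ _ =>
            mul_nonneg (hw0 x) (Finset.sum_nonneg fun _ _ => sq_nonneg _)
        _ ≤ _ := this
        _ ≤ _ := by
          refine mul_le_mul_of_nonneg_left ?_ hK
          simp only [mul_add, Finset.sum_add_distrib]
          refine add_le_add ?_ ?_
          · refine (Finset.sum_le_sum fun x _ => ?_).trans (hsumF.sum_le_tsum S fun x _ =>
              mul_nonneg (hw0 x) (Finset.sum_nonneg fun _ _ => sq_nonneg _))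
            refine mul_le_mul_of_nonneg_left (Finset.sum_le_sum fun j _ => ?_) (hw0 x)
            have := hcut B (F j) x; gcongr
          · rw [← tsum_mul_left]
            have hse : Summable fun x => ‖e B x‖ ^ 2 :=
              hbd.of_nonneg_of_le (fun _ => sq_nonneg _) fun x => by have := hebd B x; gcongr
            refine (Finset.sum_le_sum fun x _ => ?_).trans ((hse.mul_left ((N ^ t) ^ 2)).sum_le_tsum S
              fun x _ => by positivity)
            exact mul_le_mul_of_nonneg_right (slabWeight_sq_le hN ht i s₀ x) (sq_nonneg _)
    · intro x hx
      simp only [e, z _ _ (s0 x hx), z _ _ (sp _ x hx), z _ _ (sm _ x hx)]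
      simp
    · intro x
      have : (Real.sqrt η : ℂ) ≠ 0 := by exact_mod_cast hsη.ne'
      simp only [e]
      rw [mul_inv_cancel_left₀ this]; ring
  refine ge_of_tendsto ?_ main
  have := ((hlim.const_mul ((N ^ t) ^ 2)).const_add
    (∑' x, slabWeight N t i s₀ x ^ 2 * ∑ j, ‖F j x‖ ^ 2)).const_mul (1 + 2000000 * t)
  simpa using this

/-- The weighted estimate for variable coefficients: the operator is treated as a perturbation of
`lam` times the Laplacian, with the contraction factor `1 - 1 / ρ`, which for a small exponent of
the weight absorbs the constant in `weighted_lattice_sqSummable`. -/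
lemma weighted_lattice_coeff {d : ℕ} {η lam ρ : ℝ} (hη : 0 < η) (hlam : 0 < lam) (hρ : 1 ≤ ρ)
    {N : ℝ} (hN : 1 ≤ N) {t : ℝ} (ht : 0 < t) (ht' : t * (2000000 * ρ) ≤ 1)
    (i : Fin d) (s₀ : ℤ) {u : Lattice d → ℂ} {s : Fin d → Lattice d → ℂ}
    {A : Lattice d → Matrix (Fin d) (Fin d) ℂ} (hA : ∀ x (ζ : Fin d → ℂ),
      ∑ j, ‖ζ j - (lam : ℂ)⁻¹ * ∑ l, A x j l * ζ l‖ ^ 2 ≤ (1 - ρ⁻¹) ^ 2 * ∑ j, ‖ζ j‖ ^ 2)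
    (hu : SqSummable u) (hs : ∀ j, SqSummable (s j))
    (h : ∀ x, (η : ℂ) * u x + ∑ j, ((∑ l, A (x + -unitVec j) j l *
        (u (x + -unitVec j + unitVec l) - u (x + -unitVec j))) -
        ∑ l, A x j l * (u (x + unitVec l) - u x)) =
      ∑ j, (s j (x + -unitVec j) - s j x)) (Y : Finset (Lattice d)) :
    ∑ x ∈ Y, slabWeight N t i s₀ x ^ 2 * ∑ j, ‖u (x + unitVec j) - u x‖ ^ 2 ≤
      4 * ρ ^ 3 / lam ^ 2 * ∑' x, slabWeight N t i s₀ x ^ 2 * ∑ j, ‖s j x‖ ^ 2 := by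
  have hρ0 : 0 < ρ := by linarith
  have hlC : (lam : ℂ) ≠ 0 := by exact_mod_cast hlam.ne'
  let D : Fin d → Lattice d → ℂ := fun l x => u (x + unitVec l) - u x
  have hD : ∀ l, SqSummable (D l) := fun l => (hu.comp_add _).sub hu
  let G : Fin d → Lattice d → ℂ := fun j x => D j x - (lam : ℂ)⁻¹ * ∑ l, A x j l * D l x
  let F : Fin d → Lattice d → ℂ := fun j x => G j x + (lam : ℂ)⁻¹ * s j x
  have hκ0 : 0 ≤ ρ⁻¹ := by positivity
  have hκ1 : ρ⁻¹ ≤ 1 := inv_le_one_of_one_le₀ hρ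
  have hκp : 0 < ρ⁻¹ := by positivity
  have hGsum : Summable fun x => ∑ j, ‖G j x‖ ^ 2 := by
    refine Summable.of_nonneg_of_le (fun x => Finset.sum_nonneg fun _ _ => sq_nonneg _)
      (fun x => hA x fun l => D l x) ((summable_sum fun j _ => hD j).mul_left _)
  have hG : ∀ j, SqSummable (G j) := fun j => hGsum.of_nonneg_of_le (fun _ => sq_nonneg _)
    fun x => Finset.single_le_sum (f := fun j => ‖G j x‖ ^ 2) (fun _ _ => sq_nonneg _)
      (Finset.mem_univ j)
  have hF : ∀ j, SqSummable (F j) := fun j => (hG j).add ((hs j).const_mul _)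
  have hη' : 0 < η / lam := by positivity
  have ht8 : t ≤ 1 / 8 := by nlinarith
  have eqn : ∀ x, ((η / lam : ℝ) : ℂ) * u x +
      ∑ j, (2 * u x - u (x + unitVec j) - u (x + -unitVec j)) =
      ∑ j, (F j (x + -unitVec j) - F j x) := by
    intro x
    have hx := congrArg (fun w => (lam : ℂ)⁻¹ * w) (h x)
    simp only [mul_add, Finset.mul_sum] at hx
    have e1 : ∑ j, (F j (x + -unitVec j) - F j x) = ∑ j, (lam : ℂ)⁻¹ * (s j (x + -unitVec j) - s j x) -
        ∑ j, (lam : ℂ)⁻¹ * ((∑ l, A (x + -unitVec j) j l *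
        (u (x + -unitVec j + unitVec l) - u (x + -unitVec j))) -
        ∑ l, A x j l * (u (x + unitVec l) - u x)) + ∑ j, (D j (x + -unitVec j) - D j x) := by
      rw [← Finset.sum_sub_distrib, ← Finset.sum_add_distrib]
      refine Finset.sum_congr rfl fun j _ => ?_
      simp only [F, G, D]; ring
    rw [e1, ← hx]
    have e2 : ∑ j, (D j (x + -unitVec j) - D j x) =
        ∑ j, (2 * u x - u (x + unitVec j) - u (x + -unitVec j)) := by
      refine Finset.sum_congr rfl fun j _ => ?_
      simp only [D]; rw [neg_add_cancel_right]; ring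
    rw [e2]
    push_cast
    ring
  have hw0 : ∀ x, 0 ≤ slabWeight N t i s₀ x ^ 2 := fun x => sq_nonneg _
  have sumw : ∀ {f : Fin d → Lattice d → ℂ}, (∀ j, SqSummable (f j)) →
      Summable fun x => slabWeight N t i s₀ x ^ 2 * ∑ j, ‖f j x‖ ^ 2 := by
    intro f hf
    have h1 : Summable fun x => (N ^ t) ^ 2 * ∑ j, ‖f j x‖ ^ 2 :=
      (summable_sum fun j _ => hf j).mul_left _
    refine h1.of_nonneg_of_le (fun x => mul_nonneg (hw0 x)
      (Finset.sum_nonneg fun _ _ => sq_nonneg _)) fun x => ?_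
    exact mul_le_mul_of_nonneg_right (slabWeight_sq_le hN ht i s₀ x)
      (Finset.sum_nonneg fun _ _ => sq_nonneg _)
  have main := weighted_lattice_sqSummable hη' hN ht ht8 i s₀ hu hF eqn
  set Q := ∑' x, slabWeight N t i s₀ x ^ 2 * ∑ j, ‖D j x‖ ^ 2 with hQ
  set R := ∑' x, slabWeight N t i s₀ x ^ 2 * ∑ j, ‖s j x‖ ^ 2 with hR
  have hQ0 : 0 ≤ Q := tsum_nonneg fun x => mul_nonneg (hw0 x)
    (Finset.sum_nonneg fun _ _ => sq_nonneg _)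
  have hR0 : 0 ≤ R := tsum_nonneg fun x => mul_nonneg (hw0 x)
    (Finset.sum_nonneg fun _ _ => sq_nonneg _)
  have hFle : ∑' x, slabWeight N t i s₀ x ^ 2 * ∑ j, ‖F j x‖ ^ 2 ≤
      (1 + ρ⁻¹) * (1 - ρ⁻¹) ^ 2 * Q + (1 + 1 / ρ⁻¹) * (lam⁻¹) ^ 2 * R := by
    rw [hQ, hR, ← tsum_mul_left, ← tsum_mul_left,
      ← ((sumw hD).mul_left _).tsum_add ((sumw hs).mul_left _)]
    refine (sumw hF).tsum_le_tsum (fun x => ?_)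
      (((sumw hD).mul_left _).add ((sumw hs).mul_left _))
    have p1 : ∑ j, ‖F j x‖ ^ 2 ≤ (1 + ρ⁻¹) * ∑ j, ‖G j x‖ ^ 2 +
        (1 + 1 / ρ⁻¹) * ((lam⁻¹) ^ 2 * ∑ j, ‖s j x‖ ^ 2) := by
      rw [Finset.mul_sum, Finset.mul_sum, Finset.mul_sum, ← Finset.sum_add_distrib]
      refine Finset.sum_le_sum fun j _ => ?_
      refine (norm_add_sq_le hκp _ _).trans (le_of_eq ?_)
      rw [norm_mul, norm_inv, Complex.norm_real, Real.norm_of_nonneg hlam.le, mul_pow]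
    have p2 := hA x fun l => D l x
    have p3 : (1 + ρ⁻¹) * ∑ j, ‖G j x‖ ^ 2 ≤ (1 + ρ⁻¹) * ((1 - ρ⁻¹) ^ 2 * ∑ j, ‖D j x‖ ^ 2) :=
      mul_le_mul_of_nonneg_left p2 (by positivity)
    have := mul_le_mul_of_nonneg_left (p1.trans (add_le_add p3 le_rfl)) (hw0 x)
    refine this.trans (le_of_eq ?_)
    ring
  have hQle : Q ≤ (1 + 2000000 * t) * ((1 + ρ⁻¹) * (1 - ρ⁻¹) ^ 2 * Q +
      (1 + 1 / ρ⁻¹) * (lam⁻¹) ^ 2 * R) :=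
    (sumw hD).tsum_le_of_sum_le fun Z => (main Z).trans
      (mul_le_mul_of_nonneg_left hFle (by positivity))
  have hYQ : ∑ x ∈ Y, slabWeight N t i s₀ x ^ 2 * ∑ j, ‖u (x + unitVec j) - u x‖ ^ 2 ≤ Q :=
    (sumw hD).sum_le_tsum Y fun x _ => mul_nonneg (hw0 x)
      (Finset.sum_nonneg fun _ _ => sq_nonneg _)
  refine hYQ.trans ?_
  have hKt : 2000000 * t ≤ ρ⁻¹ := by
    rw [le_inv_comm₀ (by positivity) hρ0, ← one_div, le_div_iff₀ (by positivity)]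
    linarith
  set κ := ρ⁻¹ with hκ
  have hρκ : ρ = 1 / κ := by rw [hκ]; field_simp
  have b1 : (1 + 2000000 * t) * ((1 + κ) * (1 - κ) ^ 2) ≤ 1 - κ ^ 2 := by
    have c1 : (1 + 2000000 * t) * ((1 + κ) * (1 - κ) ^ 2) ≤ (1 + κ) * ((1 + κ) * (1 - κ) ^ 2) := by
      gcongr
    have c2 : (1 + κ) * ((1 + κ) * (1 - κ) ^ 2) = (1 - κ ^ 2) * (1 - κ ^ 2) := by ring
    have c3 : 0 ≤ κ ^ 2 := sq_nonneg _
    have c4 : κ ^ 2 ≤ 1 := by nlinarith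
    nlinarith
  have b2 : (1 + 2000000 * t) * ((1 + 1 / κ) * (lam⁻¹) ^ 2 * R) ≤
      4 * (1 / κ) * (lam⁻¹) ^ 2 * R := by
    have : 1 ≤ 1 / κ := by rw [← hρκ]; exact hρ
    have hl : 0 ≤ (lam⁻¹) ^ 2 * R := by positivity
    have d1 : (1 + 2000000 * t) * (1 + 1 / κ) ≤ 2 * (2 * (1 / κ)) := by
      have : 1 + 2000000 * t ≤ 2 := by linarith
      gcongr
      linarith
    nlinarith [mul_le_mul_of_nonneg_right d1 hl]
  have b3 := mul_le_mul_of_nonneg_right b1 hQ0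
  have b4 : κ ^ 2 * Q ≤ 4 * (1 / κ) * (lam⁻¹) ^ 2 * R := by nlinarith
  rw [hρκ]
  have b5 : Q ≤ (4 * (1 / κ) * (lam⁻¹) ^ 2 * R) / κ ^ 2 := by
    rw [le_div_iff₀ (by positivity)]; linarith
  refine b5.trans (le_of_eq ?_)
  field_simp

/-- The weight `∑_i (1 + |x_i|)^(2t)` on the lattice. -/
noncomputable def latticeWeight {d : ℕ} (t : ℝ) (x : Lattice d) : ℝ :=
  ∑ i, (bracket (x i) ^ t) ^ 2

/-- The gradient of the response to a source at a single site `z` decays away from `z`, in a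
weighted square summable sense. -/
lemma weighted_lattice_source {d : ℕ} {η lam ρ : ℝ} (hη : 0 < η) (hlam : 0 < lam) (hρ : 1 ≤ ρ)
    {t : ℝ} (ht : 0 < t) (ht' : t * (2000000 * ρ) ≤ 1)
    {u : Lattice d → ℂ} {s : Fin d → Lattice d → ℂ}
    {A : Lattice d → Matrix (Fin d) (Fin d) ℂ} (hA : ∀ x (ζ : Fin d → ℂ),
      ∑ j, ‖ζ j - (lam : ℂ)⁻¹ * ∑ l, A x j l * ζ l‖ ^ 2 ≤ (1 - ρ⁻¹) ^ 2 * ∑ j, ‖ζ j‖ ^ 2)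
    (hu : SqSummable u) (z : Lattice d) (hs : ∀ j x, x ≠ z → s j x = 0)
    (h : ∀ x, (η : ℂ) * u x + ∑ j, ((∑ l, A (x + -unitVec j) j l *
        (u (x + -unitVec j + unitVec l) - u (x + -unitVec j))) -
        ∑ l, A x j l * (u (x + unitVec l) - u x)) =
      ∑ j, (s j (x + -unitVec j) - s j x)) (Y : Finset (Lattice d)) :
    ∑ x ∈ Y, latticeWeight t (x - z) * ∑ j, ‖u (x + unitVec j) - u x‖ ^ 2 ≤
      4 * d * ρ ^ 3 / lam ^ 2 * ∑ j, ‖s j z‖ ^ 2 := by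
  have hsS : ∀ j, SqSummable (s j) := fun j =>
    summable_of_ne_finset_zero (s := {z}) fun x hx => by
      rw [hs j x (by simpa using hx), norm_zero, zero_pow two_ne_zero]
  have each : ∀ i : Fin d, ∑ x ∈ Y, (bracket (x i - z i) ^ t) ^ 2 *
      ∑ j, ‖u (x + unitVec j) - u x‖ ^ 2 ≤ 4 * ρ ^ 3 / lam ^ 2 * ∑ j, ‖s j z‖ ^ 2 := by
    intro i
    -- a cutoff level above all the weights that occur
    set N : ℝ := 1 + ∑ x ∈ Y, bracket (x i - z i) with hN
    have hN1 : 1 ≤ N := le_add_of_nonneg_right (Finset.sum_nonneg fun x _ => (bracket_pos _).le)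
    have := weighted_lattice_coeff hη hlam hρ hN1 ht ht' i (z i) hA hu hsS h Y
    have e1 : ∀ x ∈ Y, slabWeight N t i (z i) x = bracket (x i - z i) ^ t := by
      intro x hx
      unfold slabWeight cutBracket
      rw [min_eq_left]
      have := Finset.single_le_sum (f := fun x : Lattice d => bracket (x i - z i))
        (fun x _ => (bracket_pos _).le) hx
      linarith
    have e2 : ∑' x, slabWeight N t i (z i) x ^ 2 * ∑ j, ‖s j x‖ ^ 2 = ∑ j, ‖s j z‖ ^ 2 := by
      rw [tsum_eq_single z]
      · have : slabWeight N t i (z i) z = 1 := by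
          unfold slabWeight cutBracket
          rw [sub_self]
          have : bracket 0 = 1 := by simp [bracket]
          rw [this, min_eq_left hN1, Real.one_rpow]
        rw [this]; ring
      · intro x hx
        rw [Finset.sum_eq_zero fun j _ => by rw [hs j x hx, norm_zero, zero_pow two_ne_zero], mul_zero]
    rw [e2] at this
    refine le_of_eq_of_le (Finset.sum_congr rfl fun x hx => ?_) this
    rw [e1 x hx]
  have : ∑ x ∈ Y, latticeWeight t (x - z) * ∑ j, ‖u (x + unitVec j) - u x‖ ^ 2 =
      ∑ i, ∑ x ∈ Y, (bracket (x i - z i) ^ t) ^ 2 * ∑ j, ‖u (x + unitVec j) - u x‖ ^ 2 := by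
    rw [Finset.sum_comm]
    refine Finset.sum_congr rfl fun x _ => ?_
    rw [latticeWeight, Finset.sum_mul]
    rfl
  rw [this]
  refine (Finset.sum_le_sum fun i _ => each i).trans (le_of_eq ?_)
  rw [Finset.sum_const, Finset.card_univ, Fintype.card_fin, nsmul_eq_mul]; ring

end RandomEnv

namespace RandomEnv

/-! ### Interpolation and Young's inequality -/

/-- Hölder's inequality for three functions. -/
lemma sum_rpow_mul_le {ι : Type*} (Y : Finset ι) {α β γ : ℝ} (hα : 0 < α) (hβ : 0 < β)
    (hγ : 0 < γ) (hs : α + β + γ = 1) {f₁ f₂ f₃ : ι → ℝ} (h₁ : ∀ x, 0 ≤ f₁ x)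
    (h₂ : ∀ x, 0 ≤ f₂ x) (h₃ : ∀ x, 0 ≤ f₃ x) {S₁ S₂ S₃ : ℝ} (b₁ : ∑ x ∈ Y, f₁ x ≤ S₁)
    (b₂ : ∑ x ∈ Y, f₂ x ≤ S₂) (b₃ : ∑ x ∈ Y, f₃ x ≤ S₃) :
    ∑ x ∈ Y, f₁ x ^ α * f₂ x ^ β * f₃ x ^ γ ≤ S₁ ^ α * S₂ ^ β * S₃ ^ γ := by
  have p₁ : 0 ≤ S₁ := (Finset.sum_nonneg fun x _ => h₁ x).trans b₁
  have p₂ : 0 ≤ S₂ := (Finset.sum_nonneg fun x _ => h₂ x).trans b₂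
  have p₃ : 0 ≤ S₃ := (Finset.sum_nonneg fun x _ => h₃ x).trans b₃
  have hR : 0 ≤ S₁ ^ α * S₂ ^ β * S₃ ^ γ := by positivity
  have zero : ∀ {f : ι → ℝ} {S : ℝ}, (∀ x, 0 ≤ f x) → ∑ x ∈ Y, f x ≤ S → S = 0 →
      ∀ x ∈ Y, f x = 0 := by
    intro f S hf hb hS x hx
    have := Finset.single_le_sum (f := f) (fun x _ => hf x) hx
    exact le_antisymm (by linarith) (hf x)
  rcases p₁.eq_or_lt' with e | q₁
  · refine (le_of_eq (Finset.sum_eq_zero fun x hx => ?_)).trans hR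
    rw [zero h₁ b₁ e x hx, Real.zero_rpow hα.ne']; simp
  rcases p₂.eq_or_lt' with e | q₂
  · refine (le_of_eq (Finset.sum_eq_zero fun x hx => ?_)).trans hR
    rw [zero h₂ b₂ e x hx, Real.zero_rpow hβ.ne']; simp
  rcases p₃.eq_or_lt' with e | q₃
  · refine (le_of_eq (Finset.sum_eq_zero fun x hx => ?_)).trans hR
    rw [zero h₃ b₃ e x hx, Real.zero_rpow hγ.ne']; simp
  have pt : ∀ x ∈ Y, f₁ x ^ α * f₂ x ^ β * f₃ x ^ γ ≤ (S₁ ^ α * S₂ ^ β * S₃ ^ γ) *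
      (α * (f₁ x / S₁) + β * (f₂ x / S₂) + γ * (f₃ x / S₃)) := by
    intro x _
    have := Real.geom_mean_le_arith_mean3_weighted hα.le hβ.le hγ.le
      (div_nonneg (h₁ x) p₁) (div_nonneg (h₂ x) p₂) (div_nonneg (h₃ x) p₃) hs
    rw [Real.div_rpow (h₁ x) p₁, Real.div_rpow (h₂ x) p₂, Real.div_rpow (h₃ x) p₃] at this
    have hp : 0 < S₁ ^ α * S₂ ^ β * S₃ ^ γ := by positivity
    refine le_trans (le_of_eq ?_) (mul_le_mul_of_nonneg_left this hp.le)
    have := (Real.rpow_pos_of_pos q₁ α).ne'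
    have := (Real.rpow_pos_of_pos q₂ β).ne'
    have := (Real.rpow_pos_of_pos q₃ γ).ne'
    field_simp
  refine (Finset.sum_le_sum pt).trans ?_
  rw [← Finset.mul_sum]
  refine mul_le_of_le_one_right hR ?_
  simp only [Finset.sum_add_distrib, ← Finset.mul_sum, ← Finset.sum_div]
  have c₁ : (∑ x ∈ Y, f₁ x) / S₁ ≤ 1 := (div_le_one q₁).mpr b₁
  have c₂ : (∑ x ∈ Y, f₂ x) / S₂ ≤ 1 := (div_le_one q₂).mpr b₂
  have c₃ : (∑ x ∈ Y, f₃ x) / S₃ ≤ 1 := (div_le_one q₃).mpr b₃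
  nlinarith

/-- Minkowski's inequality for finitely many summands. -/
lemma Lp_sum_le {ι κ : Type*} (Y : Finset ι) (J : Finset κ) {q : ℝ} (hq : 1 ≤ q)
    {f : κ → ι → ℝ} (hf : ∀ j x, 0 ≤ f j x) :
    (∑ x ∈ Y, (∑ j ∈ J, f j x) ^ q) ^ (1 / q) ≤ ∑ j ∈ J, (∑ x ∈ Y, f j x ^ q) ^ (1 / q) := by
  classical
  have hq0 : q ≠ 0 := by positivity
  induction J using Finset.induction_on with
  | empty => simp [Real.zero_rpow hq0, Real.zero_rpow (inv_ne_zero hq0)]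
  | insert a J ha ih =>
    simp only [Finset.sum_insert ha]
    refine (Real.Lp_add_le_of_nonneg Y hq (fun x _ => hf a x)
      (fun x _ => Finset.sum_nonneg fun j _ => hf j x)).trans ?_
    linarith

/-- Young's inequality for the convolution of `ℓ^p` and `ℓ^q` with values in `ℓ²`. -/
lemma young_sq {G : Type*} [AddCommGroup G] {p q : ℝ} (hp : 1 < p) (hp2 : p < 2) (hq : 1 < q)
    (hq2 : q < 2) (hpq : 1 / p + 1 / q = 3 / 2) {g k : G → ℝ} (hg : ∀ x, 0 ≤ g x)
    (hk : ∀ x, 0 ≤ k x) (X : Finset G) {A B : ℝ} (hA : ∑ x ∈ X, g x ^ p ≤ A)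
    (hB : ∀ Z : Finset G, ∑ x ∈ Z, k x ^ q ≤ B) (Y : Finset G) :
    ∑ y ∈ Y, (∑ x ∈ X, g x * k (x - y)) ^ 2 ≤ (A ^ (1 / p) * B ^ (1 / q)) ^ 2 := by
  have hA0 : 0 ≤ A := (Finset.sum_nonneg fun x _ => Real.rpow_nonneg (hg x) _).trans hA
  have hB0 : 0 ≤ B := by simpa using hB ∅
  have hp1 : 1 / 2 < 1 / p := one_div_lt_one_div_of_lt (by linarith) hp2
  have hq1 : 1 / 2 < 1 / q := one_div_lt_one_div_of_lt (by linarith) hq2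
  have hgp : ∀ x, 0 ≤ g x ^ p := fun x => Real.rpow_nonneg (hg x) _
  have hkq : ∀ x, 0 ≤ k x ^ q := fun x => Real.rpow_nonneg (hk x) _
  have step : ∀ y ∈ Y, (∑ x ∈ X, g x * k (x - y)) ^ 2 ≤
      (∑ x ∈ X, g x ^ p * k (x - y) ^ q) * (A ^ (1 / p - 1 / 2) * B ^ (1 / q - 1 / 2)) ^ 2 := by
    intro y _
    have hB' : ∑ x ∈ X, k (x - y) ^ q ≤ B := by
      have := hB (X.map (Equiv.subRight y).toEmbedding)
      simpa [Finset.sum_map] using this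
    have := sum_rpow_mul_le X (α := 1 / 2) (β := 1 / p - 1 / 2) (γ := 1 / q - 1 / 2) (by norm_num)
      (by linarith) (by linarith) (by linarith) (f₁ := fun x => g x ^ p * k (x - y) ^ q)
      (f₂ := fun x => g x ^ p) (f₃ := fun x => k (x - y) ^ q)
      (fun x => mul_nonneg (hgp x) (hkq _)) hgp (fun x => hkq _) le_rfl hA hB'
    have e : ∀ x ∈ X, (g x ^ p * k (x - y) ^ q) ^ (1 / 2 : ℝ) * (g x ^ p) ^ (1 / p - 1 / 2) *
        (k (x - y) ^ q) ^ (1 / q - 1 / 2) = g x * k (x - y) := by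
      intro x _
      rw [Real.mul_rpow (hgp x) (hkq _)]
      have r : ∀ {a s : ℝ}, 0 ≤ a → 1 < s → s < 2 →
          (a ^ s) ^ (1 / 2 : ℝ) * (a ^ s) ^ (1 / s - 1 / 2) = a := by
        intro a s ha hs hs2
        have hh : 1 / 2 < 1 / s := one_div_lt_one_div_of_lt (by linarith) hs2
        rw [← Real.rpow_add_of_nonneg (Real.rpow_nonneg ha _) (by norm_num) (by linarith),
          add_sub_cancel, ← Real.rpow_mul ha, mul_one_div_cancel (by linarith), Real.rpow_one]
      calc _ = ((g x ^ p) ^ (1 / 2 : ℝ) * (g x ^ p) ^ (1 / p - 1 / 2)) *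
            ((k (x - y) ^ q) ^ (1 / 2 : ℝ) * (k (x - y) ^ q) ^ (1 / q - 1 / 2)) := by ring
        _ = _ := by rw [r (hg x) hp hp2, r (hk _) hq hq2]
    rw [Finset.sum_congr rfl e] at this
    have h0 : 0 ≤ ∑ x ∈ X, g x * k (x - y) :=
      Finset.sum_nonneg fun x _ => mul_nonneg (hg x) (hk _)
    have hS : 0 ≤ ∑ x ∈ X, g x ^ p * k (x - y) ^ q :=
      Finset.sum_nonneg fun x _ => mul_nonneg (hgp x) (hkq _)
    calc _ ≤ ((∑ x ∈ X, g x ^ p * k (x - y) ^ q) ^ (1 / 2 : ℝ) * A ^ (1 / p - 1 / 2) *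
          B ^ (1 / q - 1 / 2)) ^ 2 := by gcongr
      _ = _ := by
        rw [mul_assoc, mul_pow, ← Real.rpow_natCast (_ ^ (1 / 2 : ℝ)), ← Real.rpow_mul hS]
        norm_num
  refine (Finset.sum_le_sum step).trans ?_
  rw [← Finset.sum_mul]
  have tot : ∑ y ∈ Y, ∑ x ∈ X, g x ^ p * k (x - y) ^ q ≤ A * B := by
    rw [Finset.sum_comm]
    simp only [← Finset.mul_sum]
    have : ∀ x ∈ X, g x ^ p * ∑ y ∈ Y, k (x - y) ^ q ≤ g x ^ p * B := by
      intro x _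
      refine mul_le_mul_of_nonneg_left ?_ (hgp x)
      have := hB (Y.map (Equiv.subLeft x).toEmbedding)
      simpa [Finset.sum_map] using this
    refine (Finset.sum_le_sum this).trans ?_
    rw [← Finset.sum_mul]
    gcongr
  refine (mul_le_mul_of_nonneg_right tot (sq_nonneg _)).trans (le_of_eq ?_)
  have r : ∀ {a s : ℝ}, 0 ≤ a → 1 / 2 < s → a * (a ^ (s - 1 / 2)) ^ 2 = (a ^ s) ^ 2 := by
    intro a s ha hs
    have e1 : a = (a ^ (1 / 2 : ℝ)) ^ 2 := by
      rw [← Real.rpow_natCast, ← Real.rpow_mul ha]; norm_num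
    have e2 : a ^ s = a ^ (1 / 2 : ℝ) * a ^ (s - 1 / 2) := by
      rw [← Real.rpow_add_of_nonneg ha (by norm_num) (by linarith), add_sub_cancel]
    rw [e2, mul_pow, ← e1]
  rw [mul_pow, mul_pow, ← r hA0 hp1, ← r hB0 hq1]
  ring

lemma summable_bracket_rpow : Summable fun s : ℤ => bracket s ^ (-2 : ℝ) := by
  have h : Summable fun n : ℕ => (1 + (n : ℝ)) ^ (-2 : ℝ) := by
    have := (summable_nat_add_iff 1).mpr (Real.summable_nat_rpow.mpr (by norm_num : (-2 : ℝ) < -1))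
    refine this.congr fun n => ?_
    push_cast; rw [add_comm]
  refine Summable.of_nat_of_neg (h.congr fun n => ?_) (h.congr fun n => ?_)
  · simp [bracket]
  · simp [bracket]

lemma latticeWeight_pos {d : ℕ} (hd : 0 < d) (t : ℝ) (x : Lattice d) : 0 < latticeWeight t x := by
  have : Nonempty (Fin d) := ⟨⟨0, hd⟩⟩
  exact Finset.sum_pos (fun i _ => by have := Real.rpow_pos_of_pos (bracket_pos (x i)) t; positivity)
    Finset.univ_nonempty

/-- Large negative powers of the weight are summable. -/
lemma sum_latticeWeight_le {d : ℕ} (hd : 0 < d) {t : ℝ} (ht : 0 < t) (A : Finset (Lattice d)) :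
    ∑ x ∈ A, latticeWeight t x ^ (-(d / t) : ℝ) ≤ (∑' s : ℤ, bracket s ^ (-2 : ℝ)) ^ d := by
  classical
  have hd' : (0 : ℝ) < d := by exact_mod_cast hd
  have hb : ∀ s : ℤ, 0 ≤ bracket s ^ (-2 : ℝ) := fun s => Real.rpow_nonneg (bracket_pos s).le _
  have pt : ∀ x : Lattice d, latticeWeight t x ^ (-(d / t) : ℝ) ≤ ∏ i, bracket (x i) ^ (-2 : ℝ) := by
    intro x
    have hw := latticeWeight_pos hd t x
    have e : latticeWeight t x ^ (-(d / t) : ℝ) = ∏ _i : Fin d, latticeWeight t x ^ (-(1 / t) : ℝ) := by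
      rw [Finset.prod_const, Finset.card_univ, Fintype.card_fin, ← Real.rpow_natCast,
        ← Real.rpow_mul hw.le]
      congr 1; ring
    rw [e]
    refine Finset.prod_le_prod (fun i _ => Real.rpow_nonneg hw.le _) fun i _ => ?_
    have hbi := bracket_pos (x i)
    have h1 : (bracket (x i) ^ t) ^ 2 ≤ latticeWeight t x :=
      Finset.single_le_sum (f := fun i => (bracket (x i) ^ t) ^ 2) (fun i _ => sq_nonneg _)
        (Finset.mem_univ i)
    have h2 : 0 < (bracket (x i) ^ t) ^ 2 := by
      have := Real.rpow_pos_of_pos hbi t; positivity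
    have h4 : (-(1 / t) : ℝ) ≤ 0 := by
      have : 0 < 1 / t := by positivity
      linarith
    have h3 := Real.rpow_le_rpow_of_nonpos h2 h1 h4
    refine h3.trans (le_of_eq ?_)
    rw [← Real.rpow_natCast, ← Real.rpow_mul hbi.le, ← Real.rpow_mul hbi.le]
    congr 1
    push_cast
    field_simp
  let I : Finset ℤ := A.biUnion fun x => Finset.univ.image x
  have hAI : A ⊆ Fintype.piFinset fun _ : Fin d => I := by
    intro x hx
    rw [Fintype.mem_piFinset]
    intro i
    exact Finset.mem_biUnion.mpr ⟨x, hx, Finset.mem_image_of_mem _ (Finset.mem_univ i)⟩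
  calc _ ≤ ∑ x ∈ A, ∏ i, bracket (x i) ^ (-2 : ℝ) := Finset.sum_le_sum fun x _ => pt x
    _ ≤ ∑ x ∈ Fintype.piFinset fun _ : Fin d => I, ∏ i, bracket (x i) ^ (-2 : ℝ) :=
      Finset.sum_le_sum_of_subset_of_nonneg hAI fun x _ _ => Finset.prod_nonneg fun i _ => hb _
    _ = ∏ _i : Fin d, ∑ s ∈ I, bracket s ^ (-2 : ℝ) :=
      (Finset.prod_univ_sum (fun _ => I) (fun _ s => bracket s ^ (-2 : ℝ))).symm
    _ = (∑ s ∈ I, bracket s ^ (-2 : ℝ)) ^ d := by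
      rw [Finset.prod_const, Finset.card_univ, Fintype.card_fin]
    _ ≤ _ := by
      refine pow_le_pow_left₀ (Finset.sum_nonneg fun s _ => hb s) ?_ d
      exact summable_bracket_rpow.sum_le_tsum I fun s _ => hb s

/-- The response to sources of size at most `b` on a finite set `A`, in `ℓ^q`: the
decay of the responses to single sources gives a bound by a power of the size of `A` that is
close to the power `1 / 2` of the `ℓ²` bound. -/
lemma interpolation_block {d : ℕ} (hd : 0 < d) {t q τ : ℝ} (ht : 0 < t) (hq : 1 < q) (hq2 : q < 2)
    (hτ : τ = d / t * (2 - q) / q) (hτ1 : τ < 1) {H : Type*} [NormedAddCommGroup H]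
    (K : Lattice d → Lattice d → H) {c b Z : ℝ} (hc : 0 < c) (hb : 0 ≤ b)
    (hZ : ∀ A : Finset (Lattice d), ∑ x ∈ A, latticeWeight t x ^ (-(d / t) : ℝ) ≤ Z)
    (A : Finset (Lattice d))
    (h₁ : ∀ z ∈ A, ∀ Y : Finset (Lattice d),
      ∑ x ∈ Y, latticeWeight t (x - z) * ‖K z x‖ ^ 2 ≤ c ^ 2 * b ^ 2)
    (h₂ : ∀ Y : Finset (Lattice d), ∑ x ∈ Y, ‖∑ z ∈ A, K z x‖ ^ 2 ≤ c ^ 2 * (A.card * b ^ 2))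
    (Y : Finset (Lattice d)) :
    (∑ x ∈ Y, ‖∑ z ∈ A, K z x‖ ^ q) ^ (1 / q) ≤
      Z ^ ((1 - q / 2) / q) * (c * b * (A.card : ℝ) ^ (1 / q + τ / 2)) := by
  have hq0 : 0 < q := by linarith
  have hd' : (0 : ℝ) < d := by exact_mod_cast hd
  set r : ℝ := d / t with hr
  have hr0 : 0 < r := by positivity
  have hτ0 : 0 < τ := by rw [hτ]; have : 0 < 2 - q := by linarith
                         positivity
  have hZ0 : 0 ≤ Z := by simpa using hZ ∅
  rcases A.eq_empty_or_nonempty with rfl | hA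
  · simp only [Finset.sum_empty, norm_zero, Real.zero_rpow hq0.ne', Finset.sum_const_zero,
      Real.zero_rpow (one_div_ne_zero hq0.ne')]
    positivity
  have hn : (0 : ℝ) < A.card := by exact_mod_cast hA.card_pos
  have hlw : ∀ x : Lattice d, 0 < latticeWeight t x := latticeWeight_pos hd t
  -- a weight below the weights centred at the points of `A`
  let V : Lattice d → ℝ := fun x => ∑ z ∈ A, latticeWeight t (x - z) ^ (-r)
  have hV : ∀ x, 0 < V x := fun x =>
    Finset.sum_pos (fun z _ => Real.rpow_pos_of_pos (hlw _) _) hA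
  let W : Lattice d → ℝ := fun x => V x ^ (-(1 / r))
  have hW : ∀ x, 0 < W x := fun x => Real.rpow_pos_of_pos (hV x) _
  have hWle : ∀ x, ∀ z ∈ A, W x ≤ latticeWeight t (x - z) := by
    intro x z hz
    have h1 : latticeWeight t (x - z) ^ (-r) ≤ V x :=
      Finset.single_le_sum (f := fun z => latticeWeight t (x - z) ^ (-r))
        (fun z _ => Real.rpow_nonneg (hlw _).le _) hz
    have h2 := Real.rpow_le_rpow_of_nonpos (Real.rpow_pos_of_pos (hlw (x - z)) _) h1
      (show -(1 / r) ≤ 0 by have : 0 < 1 / r := by positivity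
                            linarith)
    refine h2.trans (le_of_eq ?_)
    rw [← Real.rpow_mul (hlw _).le, show -r * -(1 / r) = 1 by field_simp, Real.rpow_one]
  set a : Lattice d → ℝ := fun x => ‖∑ z ∈ A, K z x‖ with ha
  have ha0 : ∀ x, 0 ≤ a x := fun x => norm_nonneg _
  have B₂ : ∑ x ∈ Y, W x * a x ^ 2 ≤ c ^ 2 * (A.card ^ 2 * b ^ 2) := by
    have pt : ∀ x ∈ Y, W x * a x ^ 2 ≤
        A.card * ∑ z ∈ A, latticeWeight t (x - z) * ‖K z x‖ ^ 2 := by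
      intro x _
      have h1 : a x ^ 2 ≤ A.card * ∑ z ∈ A, ‖K z x‖ ^ 2 := by
        have h2 : a x ≤ ∑ z ∈ A, ‖K z x‖ := norm_sum_le _ _
        have h3 := sq_sum_le_card_mul_sum_sq (s := A) (f := fun z => ‖K z x‖)
        have := ha0 x
        calc a x ^ 2 ≤ (∑ z ∈ A, ‖K z x‖) ^ 2 := by gcongr
          _ ≤ _ := h3
      calc _ ≤ W x * (A.card * ∑ z ∈ A, ‖K z x‖ ^ 2) :=
            mul_le_mul_of_nonneg_left h1 (hW x).le
        _ = A.card * ∑ z ∈ A, W x * ‖K z x‖ ^ 2 := by rw [← Finset.mul_sum]; ring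
        _ ≤ _ := by
          refine mul_le_mul_of_nonneg_left (Finset.sum_le_sum fun z hz => ?_) hn.le
          exact mul_le_mul_of_nonneg_right (hWle x z hz) (sq_nonneg _)
    refine (Finset.sum_le_sum pt).trans ?_
    rw [← Finset.mul_sum, Finset.sum_comm]
    calc _ ≤ (A.card : ℝ) * ∑ z ∈ A, c ^ 2 * b ^ 2 :=
          mul_le_mul_of_nonneg_left (Finset.sum_le_sum fun z hz => h₁ z hz Y) hn.le
      _ = _ := by rw [Finset.sum_const, nsmul_eq_mul]; ring
  have B₃ : ∑ x ∈ Y, W x ^ (-r) ≤ A.card * Z := by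
    have e : ∀ x ∈ Y, W x ^ (-r) = V x := by
      intro x _
      simp only [W]
      rw [← Real.rpow_mul (hV x).le, show -(1 / r) * -r = 1 by field_simp, Real.rpow_one]
    rw [Finset.sum_congr rfl e, Finset.sum_comm]
    have : ∀ z ∈ A, ∑ x ∈ Y, latticeWeight t (x - z) ^ (-r) ≤ Z := by
      intro z _
      have := hZ (Y.map (Equiv.subRight z).toEmbedding)
      simpa [Finset.sum_map] using this
    refine (Finset.sum_le_sum this).trans (le_of_eq ?_)
    rw [Finset.sum_const, nsmul_eq_mul]
  have hol := sum_rpow_mul_le Y (α := q / 2 * (1 - τ)) (β := q / 2 * τ) (γ := 1 - q / 2)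
    (by have : 0 < 1 - τ := by linarith
        positivity) (by positivity) (by linarith) (by ring)
    (f₁ := fun x => a x ^ 2) (f₂ := fun x => W x * a x ^ 2) (f₃ := fun x => W x ^ (-r))
    (fun x => sq_nonneg _) (fun x => mul_nonneg (hW x).le (sq_nonneg _))
    (fun x => Real.rpow_nonneg (hW x).le _) (h₂ Y) B₂ B₃
  have e : ∀ x ∈ Y, (a x ^ 2) ^ (q / 2 * (1 - τ)) * (W x * a x ^ 2) ^ (q / 2 * τ) *
      (W x ^ (-r)) ^ (1 - q / 2) = a x ^ q := by
    intro x _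
    have hrq : -r * (1 - q / 2) = -(q / 2 * τ) := by rw [hτ]; field_simp
    have hτ1' : 0 ≤ 1 - τ := by linarith
    rw [← Real.rpow_mul (hW x).le, hrq, Real.mul_rpow (hW x).le (sq_nonneg _),
      Real.rpow_neg (hW x).le]
    have := (Real.rpow_pos_of_pos (hW x) (q / 2 * τ)).ne'
    calc _ = (a x ^ 2) ^ (q / 2 * (1 - τ)) * (a x ^ 2) ^ (q / 2 * τ) := by
          linear_combination ((a x ^ 2) ^ (q / 2 * (1 - τ)) * (a x ^ 2) ^ (q / 2 * τ)) *
            mul_inv_cancel₀ this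
      _ = a x ^ q := by
        rw [← Real.rpow_add_of_nonneg (sq_nonneg _) (by positivity) (by positivity),
          ← Real.rpow_natCast, ← Real.rpow_mul (ha0 x)]
        congr 1; push_cast; ring
  rw [Finset.sum_congr rfl e] at hol
  have hl0 : 0 ≤ ∑ x ∈ Y, a x ^ q := Finset.sum_nonneg fun x _ => Real.rpow_nonneg (ha0 x) _
  refine (Real.rpow_le_rpow hl0 hol (by positivity)).trans (le_of_eq ?_)
  set n : ℝ := (A.card : ℝ)
  have hcb : 0 ≤ c * b := by positivity
  rw [show c ^ 2 * (n * b ^ 2) = (c * b) ^ 2 * n by ring,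
    show c ^ 2 * (n ^ 2 * b ^ 2) = (c * b) ^ 2 * n ^ 2 by ring]
  rw [Real.mul_rpow (sq_nonneg _) hn.le, Real.mul_rpow (sq_nonneg _) (sq_nonneg _),
    Real.mul_rpow hn.le hZ0]
  have e1 : ((c * b) ^ 2) ^ (q / 2 * (1 - τ)) * n ^ (q / 2 * (1 - τ)) *
      (((c * b) ^ 2) ^ (q / 2 * τ) * (n ^ 2) ^ (q / 2 * τ)) * (n ^ (1 - q / 2) * Z ^ (1 - q / 2)) =
      (c * b) ^ q * n ^ (1 + q / 2 * τ) * Z ^ (1 - q / 2) := by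
    have hτ1' : 0 ≤ 1 - τ := by linarith
    have e2 : ((c * b) ^ 2) ^ (q / 2 * (1 - τ)) * ((c * b) ^ 2) ^ (q / 2 * τ) = (c * b) ^ q := by
      rw [← Real.rpow_add_of_nonneg (sq_nonneg _) (by positivity) (by positivity),
        ← Real.rpow_natCast, ← Real.rpow_mul hcb]
      congr 1; push_cast; ring
    have e3 : n ^ (q / 2 * (1 - τ)) * (n ^ 2) ^ (q / 2 * τ) * n ^ (1 - q / 2) =
        n ^ (1 + q / 2 * τ) := by
      rw [← Real.rpow_natCast n 2, ← Real.rpow_mul hn.le, ← Real.rpow_add hn, ← Real.rpow_add hn]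
      congr 1; push_cast; ring
    rw [← e2, ← e3]; ring
  rw [e1, Real.mul_rpow (by positivity) (by positivity), Real.mul_rpow (by positivity)
    (by positivity), ← Real.rpow_mul hcb, ← Real.rpow_mul hn.le, ← Real.rpow_mul hZ0,
    mul_one_div_cancel hq0.ne', Real.rpow_one, show (1 + q / 2 * τ) * (1 / q) = 1 / q + τ / 2 by
      field_simp, show (1 - q / 2) * (1 / q) = (1 - q / 2) / q by ring]
  ring

/-- The interpolation between the `ℓ²` bound and the decay of the responses to single
sources: sources in `ℓ^p₀`, `p₀ < 2`, have responses in `ℓ^q` for some `q < 2`. The sources are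
split into the dyadic level sets of their size. -/
theorem exists_interpolation (d : ℕ) (hd : 0 < d) {t p₀ : ℝ} (ht : 0 < t) (hp₀ : 1 ≤ p₀)
    (hp₀' : p₀ < 2) : ∃ q C : ℝ, 1 < q ∧ q < 2 ∧ 0 ≤ C ∧
    ∀ (H : Type) [NormedAddCommGroup H] (K : Lattice d → Lattice d → H) (σ : Lattice d → ℝ) (c : ℝ)
      (B : Finset (Lattice d)), 0 < c → (∀ z, 0 ≤ σ z) →
      (∀ z ∈ B, ∀ Y : Finset (Lattice d),
        ∑ x ∈ Y, latticeWeight t (x - z) * ‖K z x‖ ^ 2 ≤ c ^ 2 * σ z ^ 2) →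
      (∀ A ⊆ B, ∀ Y : Finset (Lattice d),
        ∑ x ∈ Y, ‖∑ z ∈ A, K z x‖ ^ 2 ≤ c ^ 2 * ∑ z ∈ A, σ z ^ 2) →
      ∀ Y : Finset (Lattice d), (∑ x ∈ Y, ‖∑ z ∈ B, K z x‖ ^ q) ^ (1 / q) ≤
        C * c * (∑ z ∈ B, σ z ^ p₀) ^ (1 / p₀) := by
  classical
  have hd' : (0 : ℝ) < d := by exact_mod_cast hd
  have hp0 : 0 < p₀ := by linarith
  set r : ℝ := d / t with hr
  have hr0 : 0 < r := by positivity
  have hinv : 1 / 2 < 1 / p₀ := one_div_lt_one_div_of_lt hp0 hp₀'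
  have hinv1 : 1 / p₀ ≤ 1 := by rw [div_le_one hp0]; exact hp₀
  -- `1 / q = 1 / 2 + m`, with `m` so small that `p₀ * (1 / q + r * m) < 1`
  set m : ℝ := (1 / p₀ - 1 / 2) / (2 * (1 + r)) with hm
  have hm0 : 0 < m := div_pos (by linarith) (by positivity)
  have hm1 : m * (1 + r) = (1 / p₀ - 1 / 2) / 2 := by rw [hm]; field_simp
  set q : ℝ := 1 / (1 / 2 + m) with hq
  have hqi : 1 / q = 1 / 2 + m := by rw [hq, one_div_one_div]
  have hq1 : 1 < q := by rw [hq, lt_div_iff₀ (by positivity)]; nlinarith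
  have hq2 : q < 2 := by rw [hq, div_lt_iff₀ (by positivity)]; linarith
  have hq0 : 0 < q := by linarith
  set τ : ℝ := d / t * (2 - q) / q with hτ
  have hτm : τ = 2 * (r * m) := by
    have : (2 - q) / q = 2 * (1 / q) - 1 := by field_simp
    rw [hτ, mul_div_assoc, this, hqi]; ring
  have hτ1 : τ < 1 := by rw [hτm]; nlinarith
  set e : ℝ := 1 / q + τ / 2 with he
  have hep : p₀ * e < 1 := by
    have : e = 1 / 2 + (1 / p₀ - 1 / 2) / 2 := by rw [he, hqi, hτm, ← hm1]; ring
    have h2 : e < 1 / p₀ := by rw [this]; linarith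
    calc p₀ * e < p₀ * (1 / p₀) := by gcongr
      _ = 1 := mul_one_div_cancel hp0.ne'
  have he0 : 0 < e := by rw [he, hqi, hτm]; positivity
  set Z : ℝ := (∑' s : ℤ, bracket s ^ (-2 : ℝ)) ^ d with hZ
  have hZ' : ∀ A : Finset (Lattice d), ∑ x ∈ A, latticeWeight t x ^ (-(d / t) : ℝ) ≤ Z :=
    sum_latticeWeight_le hd ht
  have hZ0 : 0 ≤ Z := by simpa using hZ' ∅
  set θ : ℝ := 2 ^ (p₀ * e - 1) with hθ
  have hθ0 : 0 < θ := Real.rpow_pos_of_pos two_pos _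
  have hθ1 : θ < 1 := Real.rpow_lt_one_of_one_lt_of_neg (by norm_num) (by linarith)
  refine ⟨q, Z ^ ((1 - q / 2) / q) * (2 ^ (p₀ * e) * (1 - θ)⁻¹), hq1, hq2, by
    have : 0 < 1 - θ := by linarith
    positivity, ?_⟩
  intro H _ K σ c B hc hσ h₁ h₂ Y
  have hσp : ∀ z, 0 ≤ σ z ^ p₀ := fun z => Real.rpow_nonneg (hσ z) _
  have hK0 : ∀ z ∈ B, σ z = 0 → ∀ x, K z x = 0 := by
    intro z hz h0 x
    have := h₁ z hz {x}
    rw [Finset.sum_singleton, h0] at this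
    have h3 := latticeWeight_pos hd t (x - z)
    have h4 : ‖K z x‖ ^ 2 ≤ 0 := by
      by_contra hcon
      push Not at hcon
      have := mul_pos h3 hcon
      simp at *
      linarith
    have h5 : ‖K z x‖ = 0 := pow_eq_zero_iff two_ne_zero |>.mp (le_antisymm h4 (sq_nonneg _))
    exact norm_eq_zero.mp h5
  set M : ℝ := (∑ z ∈ B, σ z ^ p₀) ^ (1 / p₀) with hM
  have hsum0 : 0 ≤ ∑ z ∈ B, σ z ^ p₀ := Finset.sum_nonneg fun z _ => hσp z
  have hMp : M ^ p₀ = ∑ z ∈ B, σ z ^ p₀ := by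
    rw [hM, ← Real.rpow_mul hsum0, one_div_mul_cancel hp0.ne', Real.rpow_one]
  have hM0 : 0 ≤ M := Real.rpow_nonneg hsum0 _
  have hσM : ∀ z ∈ B, σ z ≤ M := by
    intro z hz
    have : σ z ^ p₀ ≤ M ^ p₀ := by
      rw [hMp]; exact Finset.single_le_sum (f := fun z => σ z ^ p₀) (fun z _ => hσp z) hz
    exact (Real.rpow_le_rpow_iff (hσ z) hM0 hp0).mp this
  -- the dyadic level of a source
  have lev : ∀ z, ∃ j : ℕ, z ∈ B → 0 < σ z → M * (1 / 2) ^ (j + 1) < σ z ∧ σ z ≤ M * (1 / 2) ^ j := by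
    intro z
    by_cases hz : z ∈ B ∧ 0 < σ z
    · have hMpos : 0 < M := lt_of_lt_of_le hz.2 (hσM z hz.1)
      obtain ⟨j, hj1, hj2⟩ := exists_nat_pow_near_of_lt_one (x := σ z / M) (y := (1 / 2 : ℝ))
        (div_pos hz.2 hMpos) ((div_le_one hMpos).mpr (hσM z hz.1)) (by norm_num) (by norm_num)
      refine ⟨j, fun _ _ => ⟨?_, ?_⟩⟩
      · rw [lt_div_iff₀ hMpos] at hj1; linarith
      · rw [div_le_iff₀ hMpos] at hj2; linarith
    · exact ⟨0, fun h1 h2 => absurd ⟨h1, h2⟩ hz⟩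
  choose lv hlv using lev
  set B' : Finset (Lattice d) := B.filter fun z => 0 < σ z with hB'
  set J : Finset ℕ := B'.image lv with hJ
  let A : ℕ → Finset (Lattice d) := fun j => B'.filter fun z => lv z = j
  have hAB : ∀ j, A j ⊆ B := fun j => (Finset.filter_subset _ _).trans (Finset.filter_subset _ _)
  have hAm : ∀ j, ∀ z ∈ A j, M * (1 / 2) ^ (j + 1) < σ z ∧ σ z ≤ M * (1 / 2) ^ j := by
    intro j z hz
    simp only [A, hB', Finset.mem_filter] at hz
    have := hlv z hz.1.1 hz.1.2
    rwa [hz.2] at this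
  have hdec : ∀ x, ∑ z ∈ B, K z x = ∑ j ∈ J, ∑ z ∈ A j, K z x := by
    intro x
    rw [Finset.sum_fiberwise_of_maps_to (fun z hz => Finset.mem_image_of_mem _ hz), hB',
      Finset.sum_filter_of_ne]
    intro z hz hne
    by_contra hcon
    exact hne (hK0 z hz (le_antisymm (not_lt.mp hcon) (hσ z)) x)
  have hcard : ∀ j, 0 < M → ((A j).card : ℝ) ≤ 2 ^ (p₀ * (j + 1)) := by
    intro j hMpos
    have h3 : ∑ z ∈ A j, (M * (1 / 2) ^ (j + 1)) ^ p₀ ≤ M ^ p₀ := by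
      rw [hMp]
      refine (Finset.sum_le_sum fun z hz => ?_).trans
        (Finset.sum_le_sum_of_subset_of_nonneg (hAB j) fun z _ _ => hσp z)
      exact Real.rpow_le_rpow (by positivity) (hAm j z hz).1.le hp0.le
    rw [Finset.sum_const, nsmul_eq_mul, Real.mul_rpow hM0 (by positivity)] at h3
    have hMp0 : 0 < M ^ p₀ := Real.rpow_pos_of_pos hMpos _
    have e1 : ((1 / 2 : ℝ) ^ (j + 1)) ^ p₀ = (2 ^ (p₀ * (j + 1)))⁻¹ := by
      rw [one_div, inv_pow, Real.inv_rpow (by positivity), ← Real.rpow_natCast,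
        ← Real.rpow_mul (by norm_num)]
      congr 2; push_cast; ring
    rw [e1] at h3
    have h4 : (0 : ℝ) < 2 ^ (p₀ * ((j : ℝ) + 1)) := Real.rpow_pos_of_pos two_pos _
    have h5 : ((A j).card : ℝ) * (2 ^ (p₀ * ((j : ℝ) + 1)))⁻¹ * M ^ p₀ ≤ 1 * M ^ p₀ := by linarith
    have h6 := le_of_mul_le_mul_right h5 hMp0
    rwa [← div_eq_mul_inv, div_le_one h4] at h6
  have hblock : ∀ j ∈ J, (∑ x ∈ Y, ‖∑ z ∈ A j, K z x‖ ^ q) ^ (1 / q) ≤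
      Z ^ ((1 - q / 2) / q) * (c * M * 2 ^ (p₀ * e)) * θ ^ j := by
    intro j hj
    obtain ⟨z, hz, -⟩ := Finset.mem_image.mp hj
    have hMpos : 0 < M := by
      simp only [hB', Finset.mem_filter] at hz
      exact lt_of_lt_of_le hz.2 (hσM z hz.1)
    have := interpolation_block hd ht hq1 hq2 hτ hτ1 K (b := M * (1 / 2) ^ j) hc (by positivity)
      hZ' (A j) ?_ ?_ Y
    · refine this.trans ?_
      rw [mul_assoc (Z ^ _)]
      refine mul_le_mul_of_nonneg_left ?_ (Real.rpow_nonneg hZ0 _)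
      have h5 : ((A j).card : ℝ) ^ e ≤ (2 ^ (p₀ * ((j : ℝ) + 1))) ^ e :=
        Real.rpow_le_rpow (by positivity) (hcard j hMpos) he0.le
      calc c * (M * (1 / 2) ^ j) * ((A j).card : ℝ) ^ e
          ≤ c * (M * (1 / 2) ^ j) * (2 ^ (p₀ * ((j : ℝ) + 1))) ^ e := by gcongr
        _ = _ := by
          have e5 : (2 : ℝ) ^ (p₀ * e * (j : ℝ)) = (2 ^ (p₀ * e)) ^ j := by
            rw [Real.rpow_mul two_pos.le, Real.rpow_natCast]
          rw [← Real.rpow_mul two_pos.le, show p₀ * ((j : ℝ) + 1) * e = p₀ * e + p₀ * e * j by ring,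
            Real.rpow_add two_pos, e5, hθ,
            Real.rpow_sub two_pos, Real.rpow_one, div_pow, div_pow, one_pow]
          ring
    · intro z hz Y'
      refine (h₁ z (hAB j hz) Y').trans ?_
      have := (hAm j z hz).2
      have := hσ z
      gcongr
    · intro Y'
      refine (h₂ (A j) (hAB j) Y').trans ?_
      refine mul_le_mul_of_nonneg_left ?_ (sq_nonneg _)
      rw [← nsmul_eq_mul]
      refine Finset.sum_le_card_nsmul _ _ _ fun z hz => ?_
      have := (hAm j z hz).2
      have := hσ z
      gcongr
  calc _ ≤ (∑ x ∈ Y, (∑ j ∈ J, ‖∑ z ∈ A j, K z x‖) ^ q) ^ (1 / q) := by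
        refine Real.rpow_le_rpow (Finset.sum_nonneg fun x _ => Real.rpow_nonneg (norm_nonneg _) _)
          (Finset.sum_le_sum fun x _ => ?_) (by positivity)
        refine Real.rpow_le_rpow (norm_nonneg _) ?_ hq0.le
        rw [hdec x]; exact norm_sum_le _ _
    _ ≤ ∑ j ∈ J, (∑ x ∈ Y, ‖∑ z ∈ A j, K z x‖ ^ q) ^ (1 / q) :=
        Lp_sum_le Y J hq1.le fun j x => norm_nonneg _
    _ ≤ ∑ j ∈ J, Z ^ ((1 - q / 2) / q) * (c * M * 2 ^ (p₀ * e)) * θ ^ j :=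
        Finset.sum_le_sum hblock
    _ ≤ Z ^ ((1 - q / 2) / q) * (c * M * 2 ^ (p₀ * e)) * (1 - θ)⁻¹ := by
        rw [← Finset.mul_sum]
        refine mul_le_mul_of_nonneg_left ?_ (by positivity)
        rw [← tsum_geometric_of_lt_one hθ0.le hθ1]
        exact (summable_geometric_of_lt_one hθ0.le hθ1).sum_le_tsum J fun j _ => by positivity
    _ = _ := by ring

end RandomEnv

namespace RandomEnv

/-! ### Divergence form equations in Hilbert space and in `L²` -/

section Hilbert

variable {E H : Type*} [NormedAddCommGroup E] [InnerProductSpace ℂ E]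
  [NormedAddCommGroup H] [InnerProductSpace ℂ H]

variable {η Lam ρ : ℝ} {D : E →L[ℂ] H} {A : H →L[ℂ] H}

/-- An operator `A` at distance less than one from a scalar, in units of that scalar, is coercive.
-/
lemma re_inner_ge_of_contraction (hLam : 0 < Lam)
    (hA : ∀ ζ, ‖ζ - (Lam : ℂ)⁻¹ • A ζ‖ ≤ (1 - ρ⁻¹) * ‖ζ‖) (ζ : H) :
    Lam / ρ * ‖ζ‖ ^ 2 ≤ RCLike.re (inner ℂ ζ (A ζ)) := by
  have h1 : RCLike.re (inner ℂ ζ (ζ - (Lam : ℂ)⁻¹ • A ζ)) ≤ ‖ζ‖ * ((1 - ρ⁻¹) * ‖ζ‖) :=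
    (re_inner_le_norm _ _).trans (mul_le_mul_of_nonneg_left (hA ζ) (norm_nonneg _))
  rw [inner_sub_right, map_sub, inner_smul_right, inner_self_eq_norm_sq] at h1
  have h2 : RCLike.re ((Lam : ℂ)⁻¹ * inner ℂ ζ (A ζ)) = Lam⁻¹ * RCLike.re (inner ℂ ζ (A ζ)) := by
    rw [← Complex.ofReal_inv]; simp
  rw [h2] at h1
  have h3 : ρ⁻¹ * ‖ζ‖ ^ 2 ≤ Lam⁻¹ * RCLike.re (inner ℂ ζ (A ζ)) := by nlinarith
  have h4 := mul_le_mul_of_nonneg_left h3 hLam.le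
  rw [← mul_assoc, ← mul_assoc, mul_inv_cancel₀ hLam.ne', one_mul] at h4
  rwa [div_eq_mul_inv]

lemma norm_le_of_contraction (hLam : 0 < Lam) (hρ : 1 ≤ ρ)
    (hA : ∀ ζ, ‖ζ - (Lam : ℂ)⁻¹ • A ζ‖ ≤ (1 - ρ⁻¹) * ‖ζ‖) (ζ : H) : ‖A ζ‖ ≤ 2 * Lam * ‖ζ‖ := by
  have h0 : 0 ≤ ρ⁻¹ := by positivity
  have h1 : ‖(Lam : ℂ)⁻¹ • A ζ‖ ≤ 2 * ‖ζ‖ := by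
    have := norm_sub_norm_le ((Lam : ℂ)⁻¹ • A ζ) ζ
    rw [norm_sub_rev] at this
    nlinarith [hA ζ, norm_nonneg ζ]
  rw [norm_smul, norm_inv, Complex.norm_real, Real.norm_of_nonneg hLam.le, inv_mul_le_iff₀ hLam] at h1
  linarith

variable [CompleteSpace E] [CompleteSpace H]

/-- The operator `η + D† A D` on a Hilbert space. -/
noncomputable def divForm (η : ℝ) (D : E →L[ℂ] H) (A : H →L[ℂ] H) : E →L[ℂ] E :=
  (η : ℂ) • ContinuousLinearMap.id ℂ E + (ContinuousLinearMap.adjoint D).comp (A.comp D)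

lemma divForm_apply (u : E) :
    divForm η D A u = (η : ℂ) • u + ContinuousLinearMap.adjoint D (A (D u)) := by
  simp [divForm]

lemma re_inner_divForm (u : E) : RCLike.re (inner ℂ u (divForm η D A u)) =
    η * ‖u‖ ^ 2 + RCLike.re (inner ℂ (D u) (A (D u))) := by
  rw [divForm_apply, inner_add_right, map_add, inner_smul_right,
    ContinuousLinearMap.adjoint_inner_right]
  congr 1
  rw [inner_self_eq_norm_sq_to_K]
  simp [← Complex.ofReal_pow]

/-- One step `u ↦ u - κ (η + D† A D) u` of the gradient descent is a strict contraction if `κ` is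
small. -/
lemma norm_sub_smul_divForm_le (hη : 0 < η) (hLam : 0 < Lam) (hρ : 1 ≤ ρ)
    (hA : ∀ ζ, ‖ζ - (Lam : ℂ)⁻¹ • A ζ‖ ≤ (1 - ρ⁻¹) * ‖ζ‖) {b : ℝ} (hb : ‖D‖ ^ 2 ≤ b)
    {κ : ℝ} (hκ : 0 < κ) (hκ' : κ * (η + 2 * Lam * b) ^ 2 ≤ η) (u : E) :
    ‖u - (κ : ℂ) • divForm η D A u‖ ≤ √(1 - κ * η) * ‖u‖ := by
  have hb0 : 0 ≤ b := (sq_nonneg _).trans hb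
  have hρ0 : 0 < ρ := by linarith
  have hM : ‖divForm η D A u‖ ≤ (η + 2 * Lam * b) * ‖u‖ := by
    rw [divForm_apply]
    refine (norm_add_le _ _).trans ?_
    rw [norm_smul, Complex.norm_real, Real.norm_of_nonneg hη.le, add_mul]
    gcongr
    calc ‖ContinuousLinearMap.adjoint D (A (D u))‖
        ≤ ‖ContinuousLinearMap.adjoint D‖ * ‖A (D u)‖ := ContinuousLinearMap.le_opNorm _ _
      _ ≤ ‖D‖ * (2 * Lam * (‖D‖ * ‖u‖)) := by
        rw [LinearIsometryEquiv.norm_map]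
        gcongr
        refine (norm_le_of_contraction hLam hρ hA _).trans ?_
        gcongr
        exact D.le_opNorm u
      _ = 2 * Lam * ‖D‖ ^ 2 * ‖u‖ := by ring
      _ ≤ _ := by gcongr
  have hre : η * ‖u‖ ^ 2 ≤ RCLike.re (inner ℂ u (divForm η D A u)) := by
    rw [re_inner_divForm]
    have := re_inner_ge_of_contraction hLam hA (D u)
    have h2 : 0 ≤ Lam / ρ * ‖D u‖ ^ 2 := by positivity
    linarith
  have hsq : ‖u - (κ : ℂ) • divForm η D A u‖ ^ 2 ≤ (1 - κ * η) * ‖u‖ ^ 2 := by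
    rw [norm_sub_sq (𝕜 := ℂ), inner_smul_right, norm_smul, Complex.norm_real,
      Real.norm_of_nonneg hκ.le]
    have h2 : RCLike.re ((κ : ℂ) * inner ℂ u (divForm η D A u)) =
        κ * RCLike.re (inner ℂ u (divForm η D A u)) := by simp
    rw [h2]
    have h3 : (κ * ‖divForm η D A u‖) ^ 2 ≤ κ * η * ‖u‖ ^ 2 := by
      calc (κ * ‖divForm η D A u‖) ^ 2 ≤ (κ * ((η + 2 * Lam * b) * ‖u‖)) ^ 2 := by gcongr
        _ = κ * (κ * (η + 2 * Lam * b) ^ 2) * ‖u‖ ^ 2 := by ring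
        _ ≤ _ := by gcongr
    have h4 := mul_le_mul_of_nonneg_left hre hκ.le
    linarith
  rcases le_or_gt (1 - κ * η) 0 with h0 | h0
  · have h5 : ‖u - (κ : ℂ) • divForm η D A u‖ ^ 2 ≤ 0 :=
      hsq.trans (mul_nonpos_of_nonpos_of_nonneg h0 (sq_nonneg _))
    have h6 : ‖u - (κ : ℂ) • divForm η D A u‖ = 0 :=
      pow_eq_zero_iff two_ne_zero |>.mp (le_antisymm h5 (sq_nonneg _))
    rw [h6]; positivity
  · refine (sq_le_sq₀ (norm_nonneg _) (by positivity)).mp ?_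
    rw [mul_pow, Real.sq_sqrt h0.le]; exact hsq

/-- The equation is solvable, because `1 - κ (η + D† A D)` is a contraction for small `κ`. -/
lemma exists_divForm_eq (hη : 0 < η) (hLam : 0 < Lam) (hρ : 1 ≤ ρ)
    (hA : ∀ ζ, ‖ζ - (Lam : ℂ)⁻¹ • A ζ‖ ≤ (1 - ρ⁻¹) * ‖ζ‖) (f : E) : ∃ u, divForm η D A u = f := by
  set b := ‖D‖ ^ 2 with hb
  set M := η + 2 * Lam * b with hM
  have hM0 : 0 < M := by positivity
  set κ := η / M ^ 2 with hκ
  have hκ0 : 0 < κ := by positivity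
  have hle := norm_sub_smul_divForm_le hη hLam hρ hA hb.ge hκ0
    (by rw [hκ, div_mul_cancel₀ _ (by positivity)])
  have hlt : ‖(1 : E →L[ℂ] E) - (κ : ℂ) • divForm η D A‖ < 1 := by
    refine lt_of_le_of_lt (ContinuousLinearMap.opNorm_le_bound _ (Real.sqrt_nonneg _) fun u => ?_)
      (?_ : √(1 - κ * η) < 1)
    · simpa using hle u
    · rw [Real.sqrt_lt' one_pos]; nlinarith [mul_pos hκ0 hη]
  have hu : IsUnit ((κ : ℂ) • divForm η D A) := by
    have := isUnit_one_sub_of_norm_lt_one hlt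
    rwa [sub_sub_cancel] at this
  obtain ⟨U, hU⟩ := hu
  refine ⟨(κ : ℂ) • (↑U⁻¹ : E →L[ℂ] E) f, ?_⟩
  have h1 : (((U : E →L[ℂ] E) * ↑U⁻¹ : E →L[ℂ] E)) f = f := by simp
  rw [hU] at h1
  simpa using h1

/-- The energy estimate: the solution of `η u + D† A D u = D† s` has `‖D u‖ ≤ (ρ / Λ) ‖s‖`. -/
lemma norm_grad_le_of_divForm_eq (hη : 0 < η) (hLam : 0 < Lam) (hρ : 1 ≤ ρ)
    (hA : ∀ ζ, ‖ζ - (Lam : ℂ)⁻¹ • A ζ‖ ≤ (1 - ρ⁻¹) * ‖ζ‖) {u : E} {s : H}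
    (h : divForm η D A u = ContinuousLinearMap.adjoint D s) : ‖D u‖ ≤ ρ / Lam * ‖s‖ := by
  have h1 := re_inner_divForm (η := η) (D := D) (A := A) u
  rw [h, ContinuousLinearMap.adjoint_inner_right] at h1
  have h2 := re_inner_ge_of_contraction hLam hA (D u)
  have h3 : RCLike.re (inner ℂ (D u) s) ≤ ‖D u‖ * ‖s‖ := re_inner_le_norm _ _
  have h4 : 0 ≤ η * ‖u‖ ^ 2 := by positivity
  have h5 : Lam / ρ * ‖D u‖ ^ 2 ≤ ‖D u‖ * ‖s‖ := by linarith
  have hρ0 : 0 < ρ := by linarith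
  by_cases h0 : ‖D u‖ = 0
  · rw [h0]; positivity
  · have h6 : 0 < ‖D u‖ := lt_of_le_of_ne (norm_nonneg _) (Ne.symm h0)
    have h7 : Lam / ρ * ‖D u‖ ≤ ‖s‖ := by
      refine le_of_mul_le_mul_left ?_ h6
      linarith
    calc ‖D u‖ = ρ / Lam * (Lam / ρ * ‖D u‖) := by field_simp
      _ ≤ _ := by gcongr

end Hilbert

section Shift

variable {X : Type*} [MeasurableSpace X] {d : ℕ}

/-- The twisted difference `(D_i u)(x) = c_i u(σ_i x) - u(x)` along a transformation `σ_i`. -/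
def twD (σ : Fin d → X ≃ᵐ X) (c : Fin d → ℂ) (i : Fin d) (u : X → ℂ) (x : X) : ℂ :=
  c i * u (σ i x) - u x

/-- The twisted difference `c'_i f(σ_i⁻¹ x) - f(x)` along the inverse transformation. For
`c'_i = c_i⁻¹` of modulus one this is the adjoint of `twD`. -/
def twDstar (σ : Fin d → X ≃ᵐ X) (c' : Fin d → ℂ) (i : Fin d) (f : X → ℂ) (x : X) : ℂ :=
  c' i * f ((σ i).symm x) - f x

/-- The divergence form operator `η + ∑ D_i* A_il D_l` on functions. -/
def twOp (σ : Fin d → X ≃ᵐ X) (c c' : Fin d → ℂ) (η : ℝ) (A : X → Matrix (Fin d) (Fin d) ℂ)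
    (u : X → ℂ) (x : X) : ℂ :=
  (η : ℂ) * u x + ∑ i, twDstar σ c' i (fun y => ∑ l, A y i l * twD σ c l u y) x

lemma twDstar_sub (σ : Fin d → X ≃ᵐ X) (c' : Fin d → ℂ) (i : Fin d) (f g : X → ℂ) (x : X) :
    twDstar σ c' i (fun y => f y - g y) x = twDstar σ c' i f x - twDstar σ c' i g x := by
  simp only [twDstar]; ring

lemma twOp_sub (σ : Fin d → X ≃ᵐ X) (c c' : Fin d → ℂ) (η : ℝ) (A : X → Matrix (Fin d) (Fin d) ℂ)
    (f g : X → ℂ) (x : X) :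
    twOp σ c c' η A (fun y => f y - g y) x = twOp σ c c' η A f x - twOp σ c c' η A g x := by
  have h : ∀ i y, ∑ l, A y i l * twD σ c l (fun y => f y - g y) y =
      ∑ l, A y i l * twD σ c l f y - ∑ l, A y i l * twD σ c l g y := by
    intro i y
    rw [← Finset.sum_sub_distrib]
    exact Finset.sum_congr rfl fun l _ => by simp only [twD]; ring
  simp only [twOp, h, twDstar_sub, Finset.sum_sub_distrib]
  ring

variable {ν : Measure X} {σ : Fin d → X ≃ᵐ X} {c c' : Fin d → ℂ}
  {A : X → Matrix (Fin d) (Fin d) ℂ}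

/-- The operator `u ↦ c_i u(σ_i ·)` on `L²`. -/
noncomputable def twShift (hσ : ∀ i, MeasurePreserving (σ i) ν ν) (c : Fin d → ℂ) (i : Fin d) :
    Lp ℂ 2 ν →L[ℂ] Lp ℂ 2 ν :=
  c i • (Lp.compMeasurePreservingₗᵢ ℂ (σ i) (hσ i)).toContinuousLinearMap

lemma coeFn_twShift (hσ : ∀ i, MeasurePreserving (σ i) ν ν) (c : Fin d → ℂ) (i : Fin d)
    (f : Lp ℂ 2 ν) : twShift hσ c i f =ᵐ[ν] fun x => c i * f (σ i x) := by
  have h1 := Lp.coeFn_smul (c i) (Lp.compMeasurePreserving (σ i) (hσ i) f)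
  have h2 := Lp.coeFn_compMeasurePreserving f (hσ i)
  filter_upwards [h1, h2] with x h1 h2
  have : (twShift hσ c i f) = c i • Lp.compMeasurePreserving (σ i) (hσ i) f := rfl
  rw [this, h1, Pi.smul_apply, h2, smul_eq_mul, Function.comp_apply]

/-- The operator `u ↦ (D_i u)_i` on `L²`. -/
noncomputable def twGrad (hσ : ∀ i, MeasurePreserving (σ i) ν ν) (c : Fin d → ℂ) :
    Lp ℂ 2 ν →L[ℂ] PiLp 2 (fun _ : Fin d => Lp ℂ 2 ν) :=
  (PiLp.continuousLinearEquiv 2 ℂ (fun _ : Fin d => Lp ℂ 2 ν)).symm.toContinuousLinearMap.comp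
    (ContinuousLinearMap.pi fun i => twShift hσ c i - ContinuousLinearMap.id ℂ _)

lemma twGrad_apply (hσ : ∀ i, MeasurePreserving (σ i) ν ν) (c : Fin d → ℂ) (u : Lp ℂ 2 ν)
    (i : Fin d) : twGrad hσ c u i = twShift hσ c i u - u := rfl

lemma twShift_inner (hσ : ∀ i, MeasurePreserving (σ i) ν ν) (hc : ∀ i, ‖c i‖ = 1)
    (hcc : ∀ i, c i * c' i = 1) (i : Fin d) (f u : Lp ℂ 2 ν) :
    inner ℂ f (twShift hσ c i u) =
      inner ℂ (twShift (σ := fun i => (σ i).symm) (fun i => (hσ i).symm) c' i f) u := by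
  have h1 : twShift hσ c i (twShift (σ := fun i => (σ i).symm) (fun i => (hσ i).symm) c' i f) = f := by
    refine Lp.ext ?_
    have h2 := coeFn_twShift (σ := fun i => (σ i).symm) (fun i => (hσ i).symm) c' i f
    filter_upwards [coeFn_twShift hσ c i (twShift (σ := fun i => (σ i).symm) (fun i => (hσ i).symm) c' i f),
      (hσ i).quasiMeasurePreserving.ae h2] with x h3 h4
    rw [h3, h4, (σ i).symm_apply_apply, ← mul_assoc, hcc, one_mul]
  conv_lhs => rw [← h1]
  have h5 : ∀ a b : Lp ℂ 2 ν, inner ℂ (twShift hσ c i a) (twShift hσ c i b) = inner ℂ a b := by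
    intro a b
    have : ∀ a, twShift hσ c i a = c i • Lp.compMeasurePreservingₗᵢ ℂ (σ i) (hσ i) a := fun _ => rfl
    rw [this, this, inner_smul_left, inner_smul_right, LinearIsometry.inner_map_map, ← mul_assoc,
      Complex.conj_mul', hc]
    simp
  rw [h5]

lemma adjoint_twGrad (hσ : ∀ i, MeasurePreserving (σ i) ν ν) (hc : ∀ i, ‖c i‖ = 1)
    (hcc : ∀ i, c i * c' i = 1) (f : PiLp 2 (fun _ : Fin d => Lp ℂ 2 ν)) :
    ContinuousLinearMap.adjoint (twGrad hσ c) f =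
      ∑ i, (twShift (σ := fun i => (σ i).symm) (fun i => (hσ i).symm) c' i (f i) - f i) := by
  refine ext_inner_right ℂ fun u => ?_
  rw [ContinuousLinearMap.adjoint_inner_left, PiLp.inner_apply, sum_inner]
  refine Finset.sum_congr rfl fun i _ => ?_
  rw [twGrad_apply, inner_sub_right, inner_sub_left, twShift_inner hσ hc hcc]

/-- Each of the `d` differences has norm at most `2`. -/
lemma norm_twGrad_sq_le (hσ : ∀ i, MeasurePreserving (σ i) ν ν) (hc : ∀ i, ‖c i‖ = 1) :
    ‖twGrad hσ c‖ ^ 2 ≤ 4 * d := by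
  have h1 : ‖twGrad hσ c‖ ≤ √(4 * d) := by
    refine ContinuousLinearMap.opNorm_le_bound _ (Real.sqrt_nonneg _) fun u => ?_
    refine (sq_le_sq₀ (norm_nonneg _) (by positivity)).mp ?_
    rw [PiLp.norm_sq_eq_of_L2, mul_pow, Real.sq_sqrt (by positivity)]
    calc ∑ i, ‖twGrad hσ c u i‖ ^ 2 ≤ ∑ i : Fin d, 4 * ‖u‖ ^ 2 := by
          refine Finset.sum_le_sum fun i _ => ?_
          have h3 : ‖twShift hσ c i u‖ = ‖u‖ := by
            have : twShift hσ c i u = c i • Lp.compMeasurePreservingₗᵢ ℂ (σ i) (hσ i) u := rfl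
            rw [this, norm_smul, hc, one_mul, LinearIsometry.norm_map]
          have h2 : ‖twGrad hσ c u i‖ ≤ 2 * ‖u‖ := by
            rw [twGrad_apply]; refine (norm_sub_le _ _).trans ?_
            rw [h3]; linarith
          calc _ ≤ (2 * ‖u‖) ^ 2 := by gcongr
            _ = _ := by ring
      _ = _ := by simp; ring
  calc ‖twGrad hσ c‖ ^ 2 ≤ (√(4 * d)) ^ 2 := by gcongr
    _ = _ := Real.sq_sqrt (by positivity)

/-- A bounded measurable matrix field acts on `L²` by multiplication. -/
noncomputable def twCoef (hA : ∀ i l, MemLp (fun x => A x i l) ⊤ ν) :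
    PiLp 2 (fun _ : Fin d => Lp ℂ 2 ν) →L[ℂ] PiLp 2 (fun _ : Fin d => Lp ℂ 2 ν) :=
  (PiLp.continuousLinearEquiv 2 ℂ (fun _ : Fin d => Lp ℂ 2 ν)).symm.toContinuousLinearMap.comp
    (ContinuousLinearMap.pi fun i => ∑ l,
      ((ContinuousLinearMap.mul ℂ ℂ).holderL ν ⊤ 2 2 ((hA i l).toLp _)).comp
        ((ContinuousLinearMap.proj l).comp
        (PiLp.continuousLinearEquiv 2 ℂ (fun _ : Fin d => Lp ℂ 2 ν)).toContinuousLinearMap))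

lemma coeFn_twCoef (hA : ∀ i l, MemLp (fun x => A x i l) ⊤ ν)
    (f : PiLp 2 (fun _ : Fin d => Lp ℂ 2 ν)) (i : Fin d) :
    twCoef hA f i =ᵐ[ν] fun x => ∑ l, A x i l * f l x := by
  have h1 : twCoef hA f i =
      ∑ l, (ContinuousLinearMap.mul ℂ ℂ).holder 2 ((hA i l).toLp _) (f l) := by
    simp [twCoef]
  rw [h1]
  have h2 : ∀ᵐ x ∂ν, ∀ l, ((ContinuousLinearMap.mul ℂ ℂ).holder 2 ((hA i l).toLp _) (f l) : Lp ℂ 2 ν) x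
      = A x i l * f l x := by
    rw [ae_all_iff]; intro l
    filter_upwards [(ContinuousLinearMap.mul ℂ ℂ).coeFn_holder (r := 2) ((hA i l).toLp _) (f l),
      (hA i l).coeFn_toLp] with x h3 h4
    rw [h3, h4]; simp
  have h3 := Lp.coeFn_finsetSum Finset.univ fun l =>
    (ContinuousLinearMap.mul ℂ ℂ).holder (μ := ν) 2 ((hA i l).toLp _) (f l)
  filter_upwards [h2, h3] with x h2 h3
  rw [h3, Finset.sum_apply]
  exact Finset.sum_congr rfl fun l _ => h2 l

lemma norm_Lp_sq {E : Type*} [NormedAddCommGroup E] [InnerProductSpace ℂ E]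
    (f : Lp E 2 ν) : ‖f‖ ^ 2 = ∫ x, ‖f x‖ ^ 2 ∂ν := by
  have h := L2.inner_def (𝕜 := ℂ) f f
  rw [inner_self_eq_norm_sq_to_K] at h
  have h2 : ∫ x, inner ℂ (f x) (f x) ∂ν = ((∫ x, ‖f x‖ ^ 2 ∂ν : ℝ) : ℂ) := by
    rw [← integral_complex_ofReal]
    refine integral_congr_ae (ae_of_all _ fun x => ?_)
    simp only [inner_self_eq_norm_sq_to_K]
    simp
  rw [h2] at h
  have h3 : ((‖f‖ ^ 2 : ℝ) : ℂ) = ((∫ x, ‖f x‖ ^ 2 ∂ν : ℝ) : ℂ) := by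
    rw [← h]; simp
  exact Complex.ofReal_injective h3

lemma norm_toLp_sq {E : Type*} [NormedAddCommGroup E] [InnerProductSpace ℂ E] {f : X → E}
    (hf : MemLp f 2 ν) : ‖hf.toLp f‖ ^ 2 = ∫ x, ‖f x‖ ^ 2 ∂ν := by
  rw [norm_Lp_sq]
  refine integral_congr_ae ?_
  filter_upwards [hf.coeFn_toLp] with x hx
  rw [hx]

/-- The uniform ellipticity of a complex matrix field in the form of a contraction property:
`|ζ - A ζ / Λ| ≤ (1 - 1/ρ) |ζ|`. -/
def NearScalar (A : X → Matrix (Fin d) (Fin d) ℂ) (Lam ρ : ℝ) : Prop :=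
  ∀ (x : X) (ζ : Fin d → ℂ), ∑ j, ‖ζ j - (Lam : ℂ)⁻¹ * ∑ l, A x j l * ζ l‖ ^ 2 ≤
    (1 - ρ⁻¹) ^ 2 * ∑ j, ‖ζ j‖ ^ 2

omit [MeasurableSpace X] in
lemma NearScalar.norm_entry_le {Lam ρ : ℝ} (hLam : 0 < Lam) (hρ : 1 ≤ ρ)
    (hA : NearScalar A Lam ρ) (x : X) (i l : Fin d) : ‖A x i l‖ ≤ 2 * Lam := by
  have h1 := hA x (Pi.single l 1)
  have h2 : ∑ j, ‖(Pi.single l (1 : ℂ) : Fin d → ℂ) j‖ ^ 2 = 1 := by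
    rw [Finset.sum_eq_single l]
    · simp
    · intro b _ hb; simp [Pi.single_eq_of_ne hb]
    · simp
  rw [h2, mul_one] at h1
  have h3 := (Finset.single_le_sum (f := fun j => ‖(Pi.single l (1 : ℂ) : Fin d → ℂ) j -
    (Lam : ℂ)⁻¹ * ∑ l', A x j l' * (Pi.single l (1 : ℂ) : Fin d → ℂ) l'‖ ^ 2)
    (fun j _ => sq_nonneg _) (Finset.mem_univ i)).trans h1
  have hρ1 : ρ⁻¹ ≤ 1 := inv_le_one_of_one_le₀ hρ
  have hρ2 : 0 ≤ ρ⁻¹ := by positivity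
  have h4 := (sq_le_sq₀ (norm_nonneg _) (by linarith)).mp h3
  have h5 : ∑ l', A x i l' * (Pi.single l (1 : ℂ) : Fin d → ℂ) l' = A x i l := by
    rw [Finset.sum_eq_single l]
    · simp
    · intro b _ hb; simp [Pi.single_eq_of_ne hb]
    · simp
  simp only [h5] at h4
  have h6 : ‖(Pi.single l (1 : ℂ) : Fin d → ℂ) i‖ ≤ 1 := by
    by_cases h : i = l
    · subst h; simp
    · simp [Pi.single_eq_of_ne h]
  have h7 : ‖(Lam : ℂ)⁻¹ * A x i l‖ ≤ 2 := by
    have := norm_sub_norm_le ((Lam : ℂ)⁻¹ * A x i l) ((Pi.single l (1 : ℂ) : Fin d → ℂ) i)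
    rw [norm_sub_rev] at this
    linarith
  rw [norm_mul, norm_inv, Complex.norm_real, Real.norm_of_nonneg hLam.le, inv_mul_le_iff₀ hLam] at h7
  linarith

lemma NearScalar.memLp {Lam ρ : ℝ} (hLam : 0 < Lam) (hρ : 1 ≤ ρ)
    (hA : NearScalar A Lam ρ) (hAm : ∀ i l, Measurable fun x => A x i l) (i l : Fin d) :
    MemLp (fun x => A x i l) ⊤ ν :=
  memLp_top_of_bound (hAm i l).aestronglyMeasurable (2 * Lam)
    (ae_of_all _ fun x => hA.norm_entry_le hLam hρ x i l)

/-- The pointwise contraction property passes to the multiplication operator on `L²`. -/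
lemma NearScalar.twCoef_contraction {Lam ρ : ℝ} (hρ : 1 ≤ ρ)
    (hA : NearScalar A Lam ρ) (hA' : ∀ i l, MemLp (fun x => A x i l) ⊤ ν)
    (ζ : PiLp 2 (fun _ : Fin d => Lp ℂ 2 ν)) :
    ‖ζ - (Lam : ℂ)⁻¹ • twCoef hA' ζ‖ ≤ (1 - ρ⁻¹) * ‖ζ‖ := by
  have hρ1 : ρ⁻¹ ≤ 1 := inv_le_one_of_one_le₀ hρ
  have hint : ∀ f : Lp ℂ 2 ν, Integrable (fun x => ‖f x‖ ^ 2) ν := fun f =>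
    (memLp_two_iff_integrable_sq_norm (Lp.memLp f).1).mp (Lp.memLp f)
  refine (sq_le_sq₀ (norm_nonneg _) (mul_nonneg (by linarith) (norm_nonneg _))).mp ?_
  rw [mul_pow, PiLp.norm_sq_eq_of_L2, PiLp.norm_sq_eq_of_L2]
  simp only [norm_Lp_sq]
  rw [← integral_finsetSum _ fun i _ => hint _, ← integral_finsetSum _ fun i _ => hint _,
    ← integral_const_mul]
  refine integral_mono_ae (integrable_finsetSum _ fun i _ => hint _)
    ((integrable_finsetSum _ fun i _ => hint _).const_mul _) ?_
  have h1 : ∀ᵐ x ∂ν, ∀ i, (ζ - (Lam : ℂ)⁻¹ • twCoef hA' ζ) i x =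
      ζ i x - (Lam : ℂ)⁻¹ * ∑ l, A x i l * ζ l x := by
    rw [ae_all_iff]; intro i
    filter_upwards [Lp.coeFn_sub (ζ i) ((Lam : ℂ)⁻¹ • twCoef hA' ζ i),
      Lp.coeFn_smul (Lam : ℂ)⁻¹ (twCoef hA' ζ i), coeFn_twCoef hA' ζ i] with x h2 h3 h4
    have : (ζ - (Lam : ℂ)⁻¹ • twCoef hA' ζ) i = ζ i - (Lam : ℂ)⁻¹ • twCoef hA' ζ i := rfl
    rw [this, h2, Pi.sub_apply, h3, Pi.smul_apply, h4, smul_eq_mul]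
  filter_upwards [h1] with x h1
  simp only [h1]
  exact hA x fun i => ζ i x

lemma memLp_twD (hσ : ∀ i, MeasurePreserving (σ i) ν ν) {u : X → ℂ} (hu : MemLp u 2 ν) (i : Fin d) :
    MemLp (twD σ c i u) 2 ν :=
  ((hu.comp_measurePreserving (hσ i)).const_mul (c i)).sub hu

lemma memLp_twDstar (hσ : ∀ i, MeasurePreserving (σ i) ν ν) {u : X → ℂ} (hu : MemLp u 2 ν)
    (i : Fin d) : MemLp (twDstar σ c' i u) 2 ν :=
  ((hu.comp_measurePreserving (hσ i).symm).const_mul (c' i)).sub hu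

lemma twGrad_toLp (hσ : ∀ i, MeasurePreserving (σ i) ν ν) (c : Fin d → ℂ) {u : X → ℂ}
    (hu : MemLp u 2 ν) (i : Fin d) :
    twGrad hσ c (hu.toLp u) i = (memLp_twD hσ (c := c) hu i).toLp _ := by
  refine Lp.ext ?_
  rw [twGrad_apply]
  filter_upwards [Lp.coeFn_sub (twShift hσ c i (hu.toLp u)) (hu.toLp u), hu.coeFn_toLp,
    (hσ i).quasiMeasurePreserving.ae hu.coeFn_toLp, coeFn_twShift hσ c i (hu.toLp u),
    (memLp_twD hσ (c := c) hu i).coeFn_toLp] with x h1 h2 h3 h4 h5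
  rw [h1, h5, Pi.sub_apply, h4, h3, h2, twD]

lemma sum_integral_twD_sq_le (hσ : ∀ i, MeasurePreserving (σ i) ν ν) (hc : ∀ i, ‖c i‖ = 1)
    {u : X → ℂ} (hu : MemLp u 2 ν) :
    ∑ i, ∫ x, ‖twD σ c i u x‖ ^ 2 ∂ν ≤ 4 * d * ∫ x, ‖u x‖ ^ 2 ∂ν := by
  have h1 : ‖twGrad hσ c (hu.toLp u)‖ ^ 2 ≤ (‖twGrad hσ c‖ * ‖hu.toLp u‖) ^ 2 := by
    gcongr; exact ContinuousLinearMap.le_opNorm _ _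
  rw [mul_pow, PiLp.norm_sq_eq_of_L2] at h1
  simp only [twGrad_toLp, norm_toLp_sq] at h1
  exact h1.trans (mul_le_mul_of_nonneg_right (norm_twGrad_sq_le hσ hc)
    (integral_nonneg fun _ => sq_nonneg _))

lemma eLpNorm_two_eq {E : Type*} [NormedAddCommGroup E] [InnerProductSpace ℂ E] {f : X → E}
    (hf : MemLp f 2 ν) : eLpNorm f 2 ν = ENNReal.ofReal (√(∫ x, ‖f x‖ ^ 2 ∂ν)) := by
  rw [← norm_toLp_sq hf, Real.sqrt_sq (norm_nonneg _), Lp.norm_toLp, ENNReal.ofReal_toReal hf.2.ne]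

lemma adjoint_twGrad_coeFn (hσ : ∀ i, MeasurePreserving (σ i) ν ν) (hc : ∀ i, ‖c i‖ = 1)
    (hcc : ∀ i, c i * c' i = 1) {s : Fin d → X → ℂ}
    (f : PiLp 2 (fun _ : Fin d => Lp ℂ 2 ν)) (hf : ∀ i, f i =ᵐ[ν] s i) :
    ContinuousLinearMap.adjoint (twGrad hσ c) f =ᵐ[ν] fun x => ∑ i, twDstar σ c' i (s i) x := by
  rw [adjoint_twGrad hσ hc hcc]
  have h1 : ∀ᵐ x ∂ν, ∀ i, (twShift (σ := fun i => (σ i).symm) (fun i => (hσ i).symm) c' i (f i) - f i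
      : Lp ℂ 2 ν) x = twDstar σ c' i (s i) x := by
    rw [ae_all_iff]; intro i
    filter_upwards [Lp.coeFn_sub (twShift (σ := fun i => (σ i).symm) (fun i => (hσ i).symm) c' i (f i))
      (f i), coeFn_twShift (σ := fun i => (σ i).symm) (fun i => (hσ i).symm) c' i (f i),
      (hσ i).symm.quasiMeasurePreserving.ae (hf i), hf i] with x h1 h2 h3 h4
    rw [h1, Pi.sub_apply, h2, h3, h4, twDstar]
  filter_upwards [h1, Lp.coeFn_finsetSum Finset.univ fun i =>
    (twShift (σ := fun i => (σ i).symm) (fun i => (hσ i).symm) c' i (f i) - f i : Lp ℂ 2 ν)]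
    with x h1 h2
  rw [h2, Finset.sum_apply]
  exact Finset.sum_congr rfl fun i _ => h1 i

lemma twCoef_twGrad_coeFn (hσ : ∀ i, MeasurePreserving (σ i) ν ν)
    (hA' : ∀ i l, MemLp (fun x => A x i l) ⊤ ν) {u : X → ℂ} (hu : MemLp u 2 ν) (i : Fin d) :
    twCoef hA' (twGrad hσ c (hu.toLp u)) i =ᵐ[ν] fun y => ∑ l, A y i l * twD σ c l u y := by
  have h1 : ∀ᵐ x ∂ν, ∀ l, twGrad hσ c (hu.toLp u) l x = twD σ c l u x := by
    rw [ae_all_iff]; intro l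
    rw [twGrad_toLp]; exact (memLp_twD hσ hu l).coeFn_toLp
  filter_upwards [h1, coeFn_twCoef hA' (twGrad hσ c (hu.toLp u)) i] with x h1 h2
  rw [h2]; simp only [h1]

/-- On `L²`, the Hilbert space operator `divForm` is the operator `twOp` on functions. -/
lemma divForm_coeFn (hσ : ∀ i, MeasurePreserving (σ i) ν ν) (hc : ∀ i, ‖c i‖ = 1)
    (hcc : ∀ i, c i * c' i = 1) (hA' : ∀ i l, MemLp (fun x => A x i l) ⊤ ν) (η : ℝ) {u : X → ℂ}
    (hu : MemLp u 2 ν) :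
    divForm η (twGrad hσ c) (twCoef hA') (hu.toLp u) =ᵐ[ν] twOp σ c c' η A u := by
  rw [divForm_apply]
  filter_upwards [Lp.coeFn_add ((η : ℂ) • hu.toLp u)
    (ContinuousLinearMap.adjoint (twGrad hσ c) (twCoef hA' (twGrad hσ c (hu.toLp u)))),
    Lp.coeFn_smul (η : ℂ) (hu.toLp u), hu.coeFn_toLp,
    adjoint_twGrad_coeFn hσ hc hcc (twCoef hA' (twGrad hσ c (hu.toLp u)))
      (twCoef_twGrad_coeFn hσ hA' hu)] with x h1 h2 h3 h4
  rw [h1, Pi.add_apply, h2, Pi.smul_apply, h3, h4, smul_eq_mul, twOp]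

section Consequences

variable {η Lam ρ : ℝ} (hη : 0 < η) (hLam : 0 < Lam) (hρ : 1 ≤ ρ) (hA : NearScalar A Lam ρ)
  (hAm : ∀ i l, Measurable fun x => A x i l) (hσ : ∀ i, MeasurePreserving (σ i) ν ν)
  (hc : ∀ i, ‖c i‖ = 1) (hcc : ∀ i, c i * c' i = 1)

include hLam hρ hA hAm hσ hc hcc

lemma memLp_twOp {u : X → ℂ} (hu : MemLp u 2 ν) : MemLp (twOp σ c c' η A u) 2 ν :=
  (memLp_congr_ae (divForm_coeFn hσ hc hcc (hA.memLp hLam hρ hAm) η hu)).mp (Lp.memLp _)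

include hη

/-- One step of the gradient descent for `twOp` is a strict contraction in `L²`. -/
lemma eLpNorm_sub_twOp_le {κ : ℝ} (hκ : 0 < κ) (hκ' : κ * (η + 2 * Lam * (4 * d)) ^ 2 ≤ η)
    {u : X → ℂ} (hu : MemLp u 2 ν) :
    eLpNorm (fun x => u x - κ * twOp σ c c' η A u x) 2 ν ≤
      ENNReal.ofReal (√(1 - κ * η)) * eLpNorm u 2 ν := by
  have hA' := hA.memLp (ν := ν) hLam hρ hAm
  have h1 := norm_sub_smul_divForm_le hη hLam hρ (hA.twCoef_contraction hρ hA')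
    (norm_twGrad_sq_le hσ hc) hκ hκ' (hu.toLp u)
  have h2 : (hu.toLp u - (κ : ℂ) • divForm η (twGrad hσ c) (twCoef hA') (hu.toLp u) : Lp ℂ 2 ν) =ᵐ[ν]
      fun x => u x - κ * twOp σ c c' η A u x := by
    filter_upwards [Lp.coeFn_sub (hu.toLp u) ((κ : ℂ) • divForm η (twGrad hσ c) (twCoef hA') (hu.toLp u)),
      Lp.coeFn_smul (κ : ℂ) (divForm η (twGrad hσ c) (twCoef hA') (hu.toLp u)), hu.coeFn_toLp,
      divForm_coeFn hσ hc hcc hA' η hu] with x h1 h2 h3 h4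
    rw [h1, Pi.sub_apply, h2, Pi.smul_apply, h3, h4, smul_eq_mul]
  rw [← eLpNorm_congr_ae h2, ← eLpNorm_congr_ae hu.coeFn_toLp]
  have h3 := ENNReal.ofReal_le_ofReal h1
  rw [ENNReal.ofReal_mul (Real.sqrt_nonneg _)] at h3
  rwa [← Lp.enorm_def, ← Lp.enorm_def, ← ofReal_norm, ← ofReal_norm]

/-- Solvability in `L²` of divergence form equations with square integrable sources. -/
lemma exists_twOp_eq {s : Fin d → X → ℂ} (hs : ∀ i, MemLp (s i) 2 ν) :
    ∃ u, MemLp u 2 ν ∧ twOp σ c c' η A u =ᵐ[ν] fun x => ∑ i, twDstar σ c' i (s i) x := by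
  have hA' := hA.memLp (ν := ν) hLam hρ hAm
  let S : PiLp 2 (fun _ : Fin d => Lp ℂ 2 ν) := WithLp.toLp 2 fun i => (hs i).toLp (s i)
  obtain ⟨u, hu⟩ := exists_divForm_eq hη hLam hρ (hA.twCoef_contraction hρ hA')
    (ContinuousLinearMap.adjoint (twGrad hσ c) S)
  refine ⟨u, Lp.memLp u, ?_⟩
  have h1 := divForm_coeFn hσ hc hcc hA' η (Lp.memLp u)
  rw [Lp.toLp_coeFn, hu] at h1
  exact h1.symm.trans (adjoint_twGrad_coeFn hσ hc hcc S fun i => (hs i).coeFn_toLp)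

/-- The energy estimate in `L²` for divergence form equations. -/
lemma integral_twD_sq_le {s : Fin d → X → ℂ} (hs : ∀ i, MemLp (s i) 2 ν) {u : X → ℂ}
    (hu : MemLp u 2 ν)
    (h : twOp σ c c' η A u =ᵐ[ν] fun x => ∑ i, twDstar σ c' i (s i) x) :
    ∑ i, ∫ x, ‖twD σ c i u x‖ ^ 2 ∂ν ≤ (ρ / Lam) ^ 2 * ∑ i, ∫ x, ‖s i x‖ ^ 2 ∂ν := by
  have hA' := hA.memLp (ν := ν) hLam hρ hAm
  let S : PiLp 2 (fun _ : Fin d => Lp ℂ 2 ν) := WithLp.toLp 2 fun i => (hs i).toLp (s i)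
  have h1 : divForm η (twGrad hσ c) (twCoef hA') (hu.toLp u) =
      ContinuousLinearMap.adjoint (twGrad hσ c) S :=
    Lp.ext ((divForm_coeFn hσ hc hcc hA' η hu).trans (h.trans
      (adjoint_twGrad_coeFn hσ hc hcc S fun i => (hs i).coeFn_toLp).symm))
  have h2 := norm_grad_le_of_divForm_eq hη hLam hρ (hA.twCoef_contraction hρ hA') h1
  have h3 : ‖twGrad hσ c (hu.toLp u)‖ ^ 2 ≤ (ρ / Lam * ‖S‖) ^ 2 := by gcongr
  rw [mul_pow, PiLp.norm_sq_eq_of_L2, PiLp.norm_sq_eq_of_L2] at h3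
  simp only [twGrad_toLp, norm_toLp_sq] at h3
  have h4 : ∀ i, ‖S i‖ ^ 2 = ∫ x, ‖s i x‖ ^ 2 ∂ν := fun i => norm_toLp_sq (hs i)
  simpa only [h4] using h3

end Consequences

end Shift

end RandomEnv

namespace RandomEnv

/-! ### Smooth local functionals of the field and elliptic matrices -/

section Fields

variable {d n : ℕ}

lemma shift_zero (ω : FieldSpace d n) : shift 0 ω = ω := by
  funext z; simp [shift]

lemma shift_shift (x y : Lattice d) (ω : FieldSpace d n) : shift x (shift y ω) = shift (x + y) ω := by
  funext z; simp only [shift]; congr 1; abel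

lemma continuous_shift (x : Lattice d) : Continuous (shift x : FieldSpace d n → FieldSpace d n) :=
  continuous_pi fun z => continuous_apply (x + z)

/-- Translation by `x` as a measurable automorphism of field space. -/
def shiftEquiv (x : Lattice d) : FieldSpace d n ≃ᵐ FieldSpace d n where
  toFun := shift x
  invFun := shift (-x)
  left_inv ω := by rw [shift_shift, neg_add_cancel, shift_zero]
  right_inv ω := by rw [shift_shift, add_neg_cancel, shift_zero]
  measurable_toFun := (continuous_shift x).measurable
  measurable_invFun := (continuous_shift (-x)).measurable

/-- Simultaneous translation of a field and a variation of it. -/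
def shiftEquiv₂ (x : Lattice d) :
    FieldSpace d n × FieldSpace d n ≃ᵐ FieldSpace d n × FieldSpace d n :=
  (shiftEquiv x).prodCongr (shiftEquiv x)

/-- `δ(ω, θ)` is the derivative of the functional `φ` of the field `ω` in the direction `θ`. Here
`φ` is bounded and continuous, it is continuously differentiable along every continuously
differentiable family of fields, and the derivative is controlled by finitely many values of the
variation. -/
structure SmoothFunctional (φ : FieldSpace d n → ℂ) (δ : FieldSpace d n × FieldSpace d n → ℂ) :
    Prop where
  continuous : Continuous φ
  bounded : ∃ C, ∀ ω, ‖φ ω‖ ≤ C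
  contDiff : ∀ (V : Type) [NormedAddCommGroup V] [NormedSpace ℝ V] (γ : V → FieldSpace d n),
    (∀ x, ContDiff ℝ 1 fun w => γ w x) → ContDiff ℝ 1 fun w => φ (γ w)
  hasDerivAt : ∀ ω θ, HasDerivAt (fun t : ℝ => φ (ω + t • θ)) (δ (ω, θ)) 0
  continuous_deriv : Continuous δ
  deriv_bound : ∃ (B : Finset (Lattice d)) (C : ℝ), 0 ≤ C ∧
    ∀ ω θ, ‖δ (ω, θ)‖ ≤ C * ∑ x ∈ B, ‖θ x‖

namespace SmoothFunctional

variable {φ φ' : FieldSpace d n → ℂ} {δ δ' : FieldSpace d n × FieldSpace d n → ℂ}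

lemma const (b : ℂ) : SmoothFunctional (d := d) (n := n) (fun _ => b) (fun _ => 0) where
  continuous := continuous_const
  bounded := ⟨‖b‖, fun _ => le_rfl⟩
  contDiff _ _ _ _ _ := contDiff_const
  hasDerivAt _ _ := hasDerivAt_const _ _
  continuous_deriv := continuous_const
  deriv_bound := ⟨∅, 0, le_rfl, by simp⟩

lemma add (h : SmoothFunctional φ δ) (h' : SmoothFunctional φ' δ') :
    SmoothFunctional (fun ω => φ ω + φ' ω) (fun p => δ p + δ' p) where
  continuous := h.continuous.add h'.continuous
  bounded := by
    obtain ⟨C, hC⟩ := h.bounded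
    obtain ⟨C', hC'⟩ := h'.bounded
    exact ⟨C + C', fun ω => (norm_add_le _ _).trans (add_le_add (hC ω) (hC' ω))⟩
  contDiff V _ _ γ hγ := (h.contDiff V γ hγ).add (h'.contDiff V γ hγ)
  hasDerivAt ω θ := (h.hasDerivAt ω θ).add (h'.hasDerivAt ω θ)
  continuous_deriv := h.continuous_deriv.add h'.continuous_deriv
  deriv_bound := by
    classical
    obtain ⟨B, C, hC0, hC⟩ := h.deriv_bound
    obtain ⟨B', C', hC0', hC'⟩ := h'.deriv_bound
    refine ⟨B ∪ B', C + C', by positivity, fun ω θ => (norm_add_le _ _).trans ?_⟩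
    rw [add_mul]
    refine add_le_add ((hC ω θ).trans ?_) ((hC' ω θ).trans ?_)
    · exact mul_le_mul_of_nonneg_left (Finset.sum_le_sum_of_subset_of_nonneg
        Finset.subset_union_left fun _ _ _ => norm_nonneg _) hC0
    · exact mul_le_mul_of_nonneg_left (Finset.sum_le_sum_of_subset_of_nonneg
        Finset.subset_union_right fun _ _ _ => norm_nonneg _) hC0'

/-- Multiplication by a bounded continuously differentiable function of the field at the origin. -/
lemma mul_local (h : SmoothFunctional φ δ) {b : EuclideanSpace ℝ (Fin n) → ℂ}
    (hb : ContDiff ℝ 1 b) (hbb : ∃ C, ∀ s, ‖b s‖ ≤ C) (hb' : ∃ C, ∀ s, ‖fderiv ℝ b s‖ ≤ C) :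
    SmoothFunctional (fun ω => b (ω 0) * φ ω)
      (fun p => b (p.1 0) * δ p + fderiv ℝ b (p.1 0) (p.2 0) * φ p.1) where
  continuous := (hb.continuous.comp (continuous_apply 0)).mul h.continuous
  bounded := by
    obtain ⟨C, hC⟩ := h.bounded
    obtain ⟨C', hC'⟩ := hbb
    refine ⟨C' * C, fun ω => ?_⟩
    rw [norm_mul]
    exact mul_le_mul (hC' _) (hC _) (norm_nonneg _) ((norm_nonneg _).trans (hC' 0))
  contDiff V _ _ γ hγ := (hb.comp (hγ 0)).mul (h.contDiff V γ hγ)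
  hasDerivAt ω θ := by
    have h1 : HasDerivAt (fun t : ℝ => ω 0 + t • θ 0) (θ 0) 0 := by
      simpa using ((hasDerivAt_id (0 : ℝ)).smul_const (θ 0)).const_add (ω 0)
    have h2 : HasFDerivAt b (fderiv ℝ b (ω 0)) (ω 0 + (0 : ℝ) • θ 0) := by
      simpa using (hb.differentiable one_ne_zero (ω 0)).hasFDerivAt
    have h3 := (h2.comp_hasDerivAt (0 : ℝ) h1).mul (h.hasDerivAt ω θ)
    refine h3.congr_deriv ?_
    simp
    ring
  continuous_deriv := by
    have h1 : Continuous fun p : FieldSpace d n × FieldSpace d n => p.1 0 :=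
      (continuous_apply 0).comp continuous_fst
    have h2 : Continuous fun p : FieldSpace d n × FieldSpace d n => p.2 0 :=
      (continuous_apply 0).comp continuous_snd
    exact ((hb.continuous.comp h1).mul h.continuous_deriv).add
      ((((hb.continuous_fderiv one_ne_zero).comp h1).clm_apply h2).mul
        (h.continuous.comp continuous_fst))
  deriv_bound := by
    classical
    obtain ⟨B, C, hC0, hC⟩ := h.deriv_bound
    obtain ⟨C₁, hC₁⟩ := h.bounded
    obtain ⟨C₂, hC₂⟩ := hbb
    obtain ⟨C₃, hC₃⟩ := hb'
    have p1 : 0 ≤ C₁ := (norm_nonneg _).trans (hC₁ 0)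
    have p2 : 0 ≤ C₂ := (norm_nonneg _).trans (hC₂ 0)
    have p3 : 0 ≤ C₃ := (norm_nonneg _).trans (hC₃ 0)
    refine ⟨insert 0 B, C₂ * C + C₃ * C₁, by positivity, fun ω θ => (norm_add_le _ _).trans ?_⟩
    have q1 : ∑ x ∈ B, ‖θ x‖ ≤ ∑ x ∈ insert 0 B, ‖θ x‖ :=
      Finset.sum_le_sum_of_subset_of_nonneg (Finset.subset_insert _ _) fun _ _ _ => norm_nonneg _
    have q2 : ‖θ 0‖ ≤ ∑ x ∈ insert 0 B, ‖θ x‖ :=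
      Finset.single_le_sum (f := fun x => ‖θ x‖) (fun _ _ => norm_nonneg _)
        (Finset.mem_insert_self _ _)
    have r1 : ‖δ (ω, θ)‖ ≤ C * ∑ x ∈ insert 0 B, ‖θ x‖ :=
      (hC ω θ).trans (mul_le_mul_of_nonneg_left q1 hC0)
    have r2 : ‖fderiv ℝ b (ω 0) (θ 0)‖ ≤ C₃ * ∑ x ∈ insert 0 B, ‖θ x‖ :=
      (ContinuousLinearMap.le_opNorm _ _).trans
        (mul_le_mul (hC₃ _) q2 (norm_nonneg _) p3)
    have r3 := mul_le_mul (hC₂ (ω 0)) r1 (norm_nonneg _) p2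
    have r4 := mul_le_mul r2 (hC₁ ω) (norm_nonneg _) (by positivity)
    rw [norm_mul, norm_mul]
    linarith

lemma const_mul (h : SmoothFunctional φ δ) (b : ℂ) :
    SmoothFunctional (fun ω => b * φ ω) (fun p => b * δ p) := by
  have := h.mul_local (b := fun _ => b) contDiff_const ⟨‖b‖, fun _ => le_rfl⟩ ⟨0, by simp⟩
  simpa using this

lemma sub (h : SmoothFunctional φ δ) (h' : SmoothFunctional φ' δ') :
    SmoothFunctional (fun ω => φ ω - φ' ω) (fun p => δ p - δ' p) := by
  simpa [sub_eq_add_neg] using h.add (h'.const_mul (-1))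

lemma sum {ι : Type*} (s : Finset ι) {φ : ι → FieldSpace d n → ℂ}
    {δ : ι → FieldSpace d n × FieldSpace d n → ℂ} (h : ∀ i ∈ s, SmoothFunctional (φ i) (δ i)) :
    SmoothFunctional (fun ω => ∑ i ∈ s, φ i ω) (fun p => ∑ i ∈ s, δ i p) := by
  classical
  induction s using Finset.induction_on with
  | empty => simpa using const 0
  | insert i s hi ih =>
    simp only [Finset.sum_insert hi]
    exact (h i (Finset.mem_insert_self _ _)).add
      (ih fun j hj => h j (Finset.mem_insert_of_mem hj))

lemma comp_shift (h : SmoothFunctional φ δ) (x : Lattice d) :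
    SmoothFunctional (fun ω => φ (shift x ω)) (fun p => δ (shiftEquiv₂ x p)) where
  continuous := h.continuous.comp (continuous_shift x)
  bounded := by
    obtain ⟨C, hC⟩ := h.bounded
    exact ⟨C, fun ω => hC _⟩
  contDiff V _ _ γ hγ := h.contDiff V (fun w => shift x (γ w)) fun z => hγ (x + z)
  hasDerivAt ω θ := h.hasDerivAt (shift x ω) (shift x θ)
  continuous_deriv := h.continuous_deriv.comp
    (((continuous_shift x).comp continuous_fst).prodMk ((continuous_shift x).comp continuous_snd))
  deriv_bound := by
    classical
    obtain ⟨B, C, hC0, hC⟩ := h.deriv_bound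
    refine ⟨B.map (addLeftEmbedding x), C, hC0, fun ω θ => ?_⟩
    rw [Finset.sum_map]
    exact hC (shift x ω) (shift x θ)

lemma twD (h : SmoothFunctional φ δ) (σ : Fin d → Lattice d) (c : Fin d → ℂ) (i : Fin d) :
    SmoothFunctional (RandomEnv.twD (fun i => shiftEquiv (σ i)) c i φ)
      (RandomEnv.twD (fun i => shiftEquiv₂ (σ i)) c i δ) :=
  ((h.comp_shift (σ i)).const_mul (c i)).sub h

lemma twDstar (h : SmoothFunctional φ δ) (σ : Fin d → Lattice d) (c : Fin d → ℂ) (i : Fin d) :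
    SmoothFunctional (RandomEnv.twDstar (fun i => shiftEquiv (σ i)) c i φ)
      (RandomEnv.twDstar (fun i => shiftEquiv₂ (σ i)) c i δ) :=
  ((h.comp_shift (-σ i)).const_mul (c i)).sub h

lemma memLp (h : SmoothFunctional φ δ) (P : Measure (FieldSpace d n)) [IsFiniteMeasure P]
    (q : ENNReal) : MemLp φ q P := by
  obtain ⟨C, hC⟩ := h.bounded
  exact MemLp.of_bound h.continuous.aestronglyMeasurable C (ae_of_all _ hC)

end SmoothFunctional

/-- The entry of a real matrix, as a complex number. -/
noncomputable def entryCLM (i l : Fin d) : Matrix (Fin d) (Fin d) ℝ →L[ℝ] ℂ :=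
  LinearMap.toContinuousLinearMap (Complex.ofRealLI.toLinearMap ∘ₗ Matrix.entryLinearMap ℝ ℝ i l)

/-- A real matrix acts on complex vectors with the same operator norm. -/
lemma sum_norm_mulVec_sq_le (M : Matrix (Fin d) (Fin d) ℝ) (ψ : Fin d → ℂ) :
    ∑ i, ‖∑ l, (M i l : ℂ) * ψ l‖ ^ 2 ≤ ‖M‖ ^ 2 * ∑ l, ‖ψ l‖ ^ 2 := by
  have hreal : ∀ w : Fin d → ℝ, ∑ i, (∑ l, M i l * w l) ^ 2 ≤ ‖M‖ ^ 2 * ∑ l, w l ^ 2 := by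
    intro w
    have h1 := Matrix.l2_opNorm_mulVec M (WithLp.toLp 2 w)
    have h2 := pow_le_pow_left₀ (norm_nonneg _) h1 2
    rw [mul_pow, EuclideanSpace.norm_sq_eq, EuclideanSpace.norm_sq_eq] at h2
    simpa [Matrix.mulVec, dotProduct] using h2
  have hre : ∀ i, ‖∑ l, (M i l : ℂ) * ψ l‖ ^ 2 =
      (∑ l, M i l * (ψ l).re) ^ 2 + (∑ l, M i l * (ψ l).im) ^ 2 := by
    intro i
    rw [← Complex.normSq_eq_norm_sq, Complex.normSq_apply]
    simp [sq]
  have hre' : ∀ l, ‖ψ l‖ ^ 2 = (ψ l).re ^ 2 + (ψ l).im ^ 2 := by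
    intro l
    rw [← Complex.normSq_eq_norm_sq, Complex.normSq_apply]; ring
  simp only [hre, hre', Finset.sum_add_distrib, mul_add]
  exact add_le_add (hreal _) (hreal _)

/-- A positive semidefinite form bounded by `β` has `|b ζ| ≤ β |ζ|`, by the Cauchy-Schwarz
inequality for the form. -/
lemma sum_mulVec_sq_le_of_form {b : Matrix (Fin d) (Fin d) ℝ} {β : ℝ} (hβ : 0 ≤ β) (hb : b.IsSymm)
    (h : ∀ u : Fin d → ℝ, 0 ≤ u ⬝ᵥ (b *ᵥ u) ∧ u ⬝ᵥ (b *ᵥ u) ≤ β * (u ⬝ᵥ u)) (u : Fin d → ℝ) :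
    (b *ᵥ u) ⬝ᵥ (b *ᵥ u) ≤ β ^ 2 * (u ⬝ᵥ u) := by
  set w := b *ᵥ u with hw
  have hsymm : ∀ x y : Fin d → ℝ, x ⬝ᵥ (b *ᵥ y) = y ⬝ᵥ (b *ᵥ x) := by
    intro x y
    rw [Matrix.dotProduct_mulVec, ← Matrix.mulVec_transpose, hb.eq, dotProduct_comm]
  -- nonnegativity of the form on `β u - w` and on `w`
  have h1 := (h (β • u - w)).1
  have h2 := (h w).2
  have h3 := (h u).2
  have h5 : u ⬝ᵥ (b *ᵥ w) = w ⬝ᵥ w := by rw [hsymm]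
  have h6 : w ⬝ᵥ (b *ᵥ u) = w ⬝ᵥ w := rfl
  rw [Matrix.mulVec_sub, Matrix.mulVec_smul, sub_dotProduct, dotProduct_sub, dotProduct_sub,
    smul_dotProduct, smul_dotProduct, dotProduct_smul, dotProduct_smul, h5, h6] at h1
  simp only [smul_eq_mul] at h1
  have h7 : β * (β * (u ⬝ᵥ (b *ᵥ u))) ≤ β * (β * (β * (u ⬝ᵥ u))) := by gcongr
  rcases hβ.eq_or_lt with h0 | h0
  · subst h0
    -- for `β = 0` the form vanishes
    have hz : ∀ x : Fin d → ℝ, x ⬝ᵥ (b *ᵥ x) = 0 := fun x =>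
      le_antisymm (by simpa using (h x).2) (h x).1
    have h8 := hz (u + w)
    rw [Matrix.mulVec_add, add_dotProduct, dotProduct_add, dotProduct_add, hz, hz, h5, h6] at h8
    linarith
  · have h9 : β * (w ⬝ᵥ w) ≤ β * (β ^ 2 * (u ⬝ᵥ u)) := by nlinarith
    exact le_of_mul_le_mul_left h9 h0

/-- The assumption `0 < d` excludes the empty matrix, for which ellipticity says nothing. -/
lemma Elliptic.one_le_ratio {a : EuclideanSpace ℝ (Fin n) → Matrix (Fin d) (Fin d) ℝ} {lam Lam : ℝ}
    (hd : 0 < d) (hlam : 0 < lam) (ha : Elliptic a lam Lam) : 1 ≤ Lam / lam := by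
  have h1 := (ha 0).2 (Pi.single ⟨0, hd⟩ 1)
  have h2 := h1.1.trans h1.2
  simp at h2
  rwa [one_le_div hlam]

/-- Uniform ellipticity as a contraction property: the symmetric matrix `1 - a / Λ` has its spectrum
in `[0, 1 - λ / Λ]`. -/
lemma Elliptic.contraction {a : EuclideanSpace ℝ (Fin n) → Matrix (Fin d) (Fin d) ℝ} {lam Lam : ℝ}
    (hLam : 0 < Lam) (hle : lam ≤ Lam) (ha : Elliptic a lam Lam)
    (s : EuclideanSpace ℝ (Fin n)) (ζ : Fin d → ℂ) :
    ∑ j, ‖ζ j - (Lam : ℂ)⁻¹ * ∑ l, (a s j l : ℂ) * ζ l‖ ^ 2 ≤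
      (1 - (Lam / lam)⁻¹) ^ 2 * ∑ j, ‖ζ j‖ ^ 2 := by
  set b : Matrix (Fin d) (Fin d) ℝ := 1 - Lam⁻¹ • a s with hb
  have hmv : ∀ u : Fin d → ℝ, b *ᵥ u = u - Lam⁻¹ • (a s *ᵥ u) := by
    intro u; rw [hb, Matrix.sub_mulVec, Matrix.one_mulVec, Matrix.smul_mulVec]
  have hform : ∀ u : Fin d → ℝ, 0 ≤ u ⬝ᵥ (b *ᵥ u) ∧
      u ⬝ᵥ (b *ᵥ u) ≤ (1 - (Lam / lam)⁻¹) * (u ⬝ᵥ u) := by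
    intro u
    rw [hmv, dotProduct_sub, dotProduct_smul, smul_eq_mul, inv_div]
    obtain ⟨h1, h2⟩ := (ha s).2 u
    have h3 := mul_le_mul_of_nonneg_left h1 (inv_nonneg.mpr hLam.le)
    have h4 := mul_le_mul_of_nonneg_left h2 (inv_nonneg.mpr hLam.le)
    rw [← mul_assoc, inv_mul_cancel₀ hLam.ne', one_mul] at h4
    refine ⟨by linarith, ?_⟩
    rw [sub_mul, one_mul, div_mul_eq_mul_div, div_eq_inv_mul]
    linarith
  have hsym : b.IsSymm := by
    rw [hb]; unfold Matrix.IsSymm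
    rw [Matrix.transpose_sub, Matrix.transpose_one, Matrix.transpose_smul, (ha s).1.eq]
  have hβ : 0 ≤ 1 - (Lam / lam)⁻¹ := by
    rw [inv_div, sub_nonneg, div_le_one hLam]; exact hle
  have hreal : ∀ w : Fin d → ℝ, ∑ j, (w j - Lam⁻¹ * ∑ l, a s j l * w l) ^ 2 ≤
      (1 - (Lam / lam)⁻¹) ^ 2 * ∑ j, w j ^ 2 := by
    intro w
    have := sum_mulVec_sq_le_of_form hβ hsym hform w
    rw [hmv] at this
    simpa [dotProduct, Matrix.mulVec, sq] using this
  have hre' : ∀ z : ℂ, ‖z‖ ^ 2 = z.re ^ 2 + z.im ^ 2 := by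
    intro z
    rw [← Complex.normSq_eq_norm_sq, Complex.normSq_apply]; ring
  have e1 : ∀ j, (ζ j - (Lam : ℂ)⁻¹ * ∑ l, (a s j l : ℂ) * ζ l).re =
      (ζ j).re - Lam⁻¹ * ∑ l, a s j l * (ζ l).re := by
    intro j; rw [← Complex.ofReal_inv]; simp
  have e2 : ∀ j, (ζ j - (Lam : ℂ)⁻¹ * ∑ l, (a s j l : ℂ) * ζ l).im =
      (ζ j).im - Lam⁻¹ * ∑ l, a s j l * (ζ l).im := by
    intro j; rw [← Complex.ofReal_inv]; simp
  simp only [hre', e1, e2, Finset.sum_add_distrib, mul_add]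
  exact add_le_add (hreal _) (hreal _)

end Fields

end RandomEnv

namespace RandomEnv

/-! ### Gradient descent for the corrector -/

/-- A contractive recursion with vanishing perturbation tends to zero. -/
lemma tendsto_zero_of_le_mul_add {x ε : ℕ → ℝ} {θ : ℝ} (hx : ∀ N, 0 ≤ x N) (hθ0 : 0 ≤ θ)
    (hθ : θ < 1) (h : ∀ N, x (N + 1) ≤ θ * x N + ε N) (hε : Tendsto ε atTop (𝓝 0)) :
    Tendsto x atTop (𝓝 0) := by
  rw [Metric.tendsto_atTop]
  intro e he
  have h1 : 0 < (1 - θ) * (e / 2) := mul_pos (by linarith) (by linarith)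
  obtain ⟨N, hN⟩ := eventually_atTop.mp (hε.eventually (gt_mem_nhds h1))
  have h2 : ∀ k, x (N + k) ≤ θ ^ k * x N + e / 2 := by
    intro k
    induction k with
    | zero => simp; linarith
    | succ k ih =>
      have h3 := h (N + k)
      have h4 := hN (N + k) (by omega)
      have h5 := mul_le_mul_of_nonneg_left ih hθ0
      rw [← add_assoc, pow_succ]
      nlinarith
  have h3 : Tendsto (fun k : ℕ => θ ^ k * x N) atTop (𝓝 0) := by
    simpa using (tendsto_pow_atTop_nhds_zero_of_lt_one hθ0 hθ).mul_const (x N)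
  obtain ⟨K, hK⟩ := eventually_atTop.mp (h3.eventually (gt_mem_nhds (half_pos he)))
  refine ⟨N + K, fun M hM => ?_⟩
  rw [Real.dist_eq, sub_zero, abs_of_nonneg (hx M)]
  obtain ⟨k, rfl⟩ := Nat.exists_eq_add_of_le (show N ≤ M by omega)
  have := h2 k
  have := hK k (by omega)
  linarith

section Iteration

variable {X : Type*} [MeasurableSpace X] {d : ℕ} {ν : Measure X} {σ : Fin d → X ≃ᵐ X}
  {c c' : Fin d → ℂ} {A : X → Matrix (Fin d) (Fin d) ℂ}

/-- A perturbed gradient descent for the equation `L w = 0` converges to zero if the perturbations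
do. -/
lemma tendsto_eLpNorm_iteration {η Lam ρ : ℝ} (hη : 0 < η) (hLam : 0 < Lam) (hρ : 1 ≤ ρ)
    (hA : NearScalar A Lam ρ)
    (hAm : ∀ i l, Measurable fun x => A x i l) (hσ : ∀ i, MeasurePreserving (σ i) ν ν)
    (hc : ∀ i, ‖c i‖ = 1) (hcc : ∀ i, c i * c' i = 1) {κ : ℝ} (hκ : 0 < κ)
    (hκ' : κ * (η + 2 * Lam * (4 * d)) ^ 2 ≤ η) {w r : ℕ → X → ℂ} (hw : ∀ N, MemLp (w N) 2 ν)
    (hr : ∀ N, MemLp (r N) 2 ν)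
    (h : ∀ N, w (N + 1) =ᵐ[ν] fun x => w N x - κ * twOp σ c c' η A (w N) x + r N x)
    (hr0 : Tendsto (fun N => eLpNorm (r N) 2 ν) atTop (𝓝 0)) :
    Tendsto (fun N => eLpNorm (w N) 2 ν) atTop (𝓝 0) := by
  have hle : ∀ N, eLpNorm (w (N + 1)) 2 ν ≤
      ENNReal.ofReal (√(1 - κ * η)) * eLpNorm (w N) 2 ν + eLpNorm (r N) 2 ν := by
    intro N
    rw [eLpNorm_congr_ae (h N)]
    refine (eLpNorm_add_le ((hw N).sub
      ((memLp_twOp hLam hρ hA hAm hσ hc hcc (hw N)).const_mul (κ : ℂ))).1 (hr N).1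
      one_le_two).trans ?_
    gcongr
    exact eLpNorm_sub_twOp_le hη hLam hρ hA hAm hσ hc hcc hκ hκ' (hw N)
  have hfin : ∀ N, eLpNorm (w N) 2 ν ≠ ⊤ := fun N => (hw N).2.ne
  have hfin' : ∀ N, eLpNorm (r N) 2 ν ≠ ⊤ := fun N => (hr N).2.ne
  rw [← ENNReal.tendsto_toReal_iff hfin ENNReal.zero_ne_top]
  refine tendsto_zero_of_le_mul_add (θ := √(1 - κ * η)) (ε := fun N => (eLpNorm (r N) 2 ν).toReal)
    (fun _ => ENNReal.toReal_nonneg) (Real.sqrt_nonneg _) ?_ ?_ ?_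
  · rw [Real.sqrt_lt' one_pos]; nlinarith [mul_pos hκ hη]
  · intro N
    have := ENNReal.toReal_mono (by finiteness [hfin N, hfin' N]) (hle N)
    rwa [ENNReal.toReal_add (by finiteness [hfin N]) (hfin' N), ENNReal.toReal_mul,
      ENNReal.toReal_ofReal (Real.sqrt_nonneg _)] at this
  · simpa [Function.comp_def] using (ENNReal.tendsto_toReal ENNReal.zero_ne_top).comp hr0

end Iteration

section Corrector

variable {d n : ℕ}

/-- The phases `e^{-iξ_i}`. -/
noncomputable def phase (ξ : Fin d → ℝ) (i : Fin d) : ℂ := Complex.exp (-(Complex.I * ξ i))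

/-- The conjugate phases `e^{iξ_i}`. -/
noncomputable def phaseInv (ξ : Fin d → ℝ) (i : Fin d) : ℂ := Complex.exp (Complex.I * ξ i)

lemma norm_phase (ξ : Fin d → ℝ) (i : Fin d) : ‖phase ξ i‖ = 1 := by
  have : -(Complex.I * ξ i) = ((-ξ i : ℝ) : ℂ) * Complex.I := by push_cast; ring
  rw [phase, this, Complex.norm_exp_ofReal_mul_I]

lemma phase_mul_phaseInv (ξ : Fin d → ℝ) (i : Fin d) : phase ξ i * phaseInv ξ i = 1 := by
  rw [phase, phaseInv, ← Complex.exp_add, neg_add_cancel, Complex.exp_zero]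

/-- The translations by the unit vectors. -/
def unitShift (i : Fin d) : FieldSpace d n ≃ᵐ FieldSpace d n := shiftEquiv (unitVec i)

/-- The simultaneous translations of a field and a variation of it by the unit vectors. -/
def unitShift₂ (i : Fin d) :
    FieldSpace d n × FieldSpace d n ≃ᵐ FieldSpace d n × FieldSpace d n := shiftEquiv₂ (unitVec i)

/-- The coefficient field `a(ω(0))`, as a complex matrix. -/
def fieldCoef (a : EuclideanSpace ℝ (Fin n) → Matrix (Fin d) (Fin d) ℝ) (ω : FieldSpace d n) :
    Matrix (Fin d) (Fin d) ℂ := (a (ω 0)).map Complex.ofReal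

variable (a : EuclideanSpace ℝ (Fin n) → Matrix (Fin d) (Fin d) ℝ) (ξ : Fin d → ℝ) (v : Fin d → ℂ)

/-- The flux `a(ω(0)) (∂_ξ φ + v)`. -/
noncomputable def flux (φ : FieldSpace d n → ℂ) (i : Fin d) (ω : FieldSpace d n) : ℂ :=
  ∑ l, (a (ω 0) i l : ℂ) * (twD unitShift (phase ξ) l φ ω + v l)

/-- The part of the derivative of the flux that comes from the derivative of the coefficients. -/
noncomputable def coefDeriv (φ : FieldSpace d n → ℂ) (i : Fin d)
    (p : FieldSpace d n × FieldSpace d n) : ℂ :=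
  ∑ l, (fderiv ℝ a (p.1 0) (p.2 0) i l : ℂ) * (twD unitShift (phase ξ) l φ p.1 + v l)

/-- The derivative of the flux in the direction of the variation. -/
noncomputable def fluxDeriv (φ : FieldSpace d n → ℂ) (δ : FieldSpace d n × FieldSpace d n → ℂ)
    (i : Fin d) (p : FieldSpace d n × FieldSpace d n) : ℂ :=
  ∑ l, (a (p.1 0) i l : ℂ) * twD unitShift₂ (phase ξ) l δ p + coefDeriv a ξ v φ i p

variable (η κ : ℝ)

/-- The gradient descent for the corrector `φ`, starting from zero, in the direction `v`. -/
noncomputable def iter : ℕ → FieldSpace d n → ℂ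
  | 0 => fun _ => 0
  | N + 1 => fun ω => iter N ω - κ * ((η : ℂ) * iter N ω +
      ∑ i, twDstar unitShift (phaseInv ξ) i (flux a ξ v (iter N) i) ω)

/-- The derivative of the gradient descent in the direction of a variation of the field. -/
noncomputable def iterDeriv : ℕ → FieldSpace d n × FieldSpace d n → ℂ
  | 0 => fun _ => 0
  | N + 1 => fun p => iterDeriv N p - κ * ((η : ℂ) * iterDeriv N p +
      ∑ i, twDstar unitShift₂ (phaseInv ξ) i
        (fluxDeriv a ξ v (iter a ξ v η κ N) (iterDeriv N) i) p)

variable {a}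

/-- Each step of the gradient descent is a smooth local functional of the field, with the derivative
`iterDeriv`. This makes the Poincaré inequality applicable, which it is not, as stated, for the
corrector. -/
lemma smoothFunctional_iter (ha : ContDiff ℝ 1 a) {C : ℝ} (hC : ∀ s i l, |a s i l| ≤ C)
    (hD : BddAbove (Set.range fun s => ‖fderiv ℝ a s‖)) (N : ℕ) :
    SmoothFunctional (iter a ξ v η κ N) (iterDeriv a ξ v η κ N) := by
  have hent : ∀ (i l : Fin d) s, HasFDerivAt (fun s => (a s i l : ℂ))
      ((entryCLM i l).comp (fderiv ℝ a s)) s := fun i l s =>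
    (entryCLM i l).hasFDerivAt.comp s (ha.differentiable one_ne_zero s).hasFDerivAt
  have hflux : ∀ {φ δ}, SmoothFunctional φ δ → ∀ i,
      SmoothFunctional (flux a ξ v φ i) (fluxDeriv a ξ v φ δ i) := by
    intro φ δ h i
    have h1 := SmoothFunctional.sum Finset.univ fun l _ =>
      (((h.twD unitVec (phase ξ) l).add (SmoothFunctional.const (v l))).mul_local
        (b := fun s => (a s i l : ℂ)) ((entryCLM i l).contDiff.comp ha)
        ⟨C, fun s => by rw [Complex.norm_real]; exact hC s i l⟩ (by
          obtain ⟨C', hC'⟩ := hD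
          refine ⟨‖entryCLM i l‖ * C', fun s => ?_⟩
          rw [(hent i l s).fderiv]
          refine (ContinuousLinearMap.opNorm_comp_le _ _).trans ?_
          gcongr
          exact hC' ⟨s, rfl⟩))
    have hf : ∀ l s, fderiv ℝ (fun s => (a s i l : ℂ)) s = (entryCLM i l).comp (fderiv ℝ a s) :=
      fun l s => (hent i l s).fderiv
    have h2 : fluxDeriv a ξ v φ δ i = fun p => ∑ l, ((a (p.1 0) i l : ℂ) *
        (RandomEnv.twD unitShift₂ (phase ξ) l δ p + 0) +
        fderiv ℝ (fun s => (a s i l : ℂ)) (p.1 0) (p.2 0) *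
          (RandomEnv.twD unitShift (phase ξ) l φ p.1 + v l)) := by
      funext p
      simp only [fluxDeriv, coefDeriv, hf, add_zero, Finset.sum_add_distrib]
      rfl
    rw [h2]
    exact h1
  induction N with
  | zero => exact SmoothFunctional.const 0
  | succ N ih =>
    exact ih.sub (((ih.const_mul (η : ℂ)).add (SmoothFunctional.sum Finset.univ fun i _ =>
      (hflux ih i).twDstar unitVec (phaseInv ξ) i)).const_mul (κ : ℂ))

lemma measurePreserving_unitShift {P : Measure (FieldSpace d n)}
    (hP : TranslationInvariant P) (i : Fin d) :
    MeasurePreserving (unitShift (n := n) i) P P := hP (unitVec i)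

lemma measurable_fieldCoef (ha : Continuous a) (i l : Fin d) :
    Measurable fun ω : FieldSpace d n => fieldCoef a ω i l :=
  ((entryCLM i l).continuous.comp (ha.comp (continuous_apply 0))).measurable

/-- The recursion of the gradient descent in terms of the corrector operator `twOp`. -/
lemma iter_succ (N : ℕ) (ω : FieldSpace d n) : iter a ξ v η κ (N + 1) ω =
    iter a ξ v η κ N ω - κ * (twOp unitShift (phase ξ) (phaseInv ξ) η (fieldCoef a)
      (iter a ξ v η κ N) ω +
      ∑ i, twDstar unitShift (phaseInv ξ) i (fun ω => ∑ l, (a (ω 0) i l : ℂ) * v l) ω) := by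
  have h : ∀ i, twDstar unitShift (phaseInv ξ) i (flux a ξ v (iter a ξ v η κ N) i) ω =
      twDstar unitShift (phaseInv ξ) i (fun y => ∑ l, fieldCoef a y i l *
        twD unitShift (phase ξ) l (iter a ξ v η κ N) y) ω +
      twDstar unitShift (phaseInv ξ) i (fun ω => ∑ l, (a (ω 0) i l : ℂ) * v l) ω := by
    intro i
    simp only [twDstar, flux, fieldCoef, Matrix.map_apply, mul_add, Finset.sum_add_distrib]
    ring
  simp only [iter, twOp, h, Finset.sum_add_distrib, add_assoc]

/-- The gradient descent converges in `L²` to the solution of the corrector equation. -/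
lemma tendsto_iter {P : Measure (FieldSpace d n)} [IsProbabilityMeasure P]
    (hP : TranslationInvariant P) {Lam ρ : ℝ} (hη : 0 < η) (hLam : 0 < Lam) (hρ : 1 ≤ ρ)
    (ha : Continuous a) (hA : NearScalar (fieldCoef a) Lam ρ) (hκ : 0 < κ)
    (hκ' : κ * (η + 2 * Lam * (4 * d)) ^ 2 ≤ η) (hiter : ∀ N, MemLp (iter a ξ v η κ N) 2 P)
    {φ : FieldSpace d n → ℂ} (hφ : MemLp φ 2 P)
    (h : twOp unitShift (phase ξ) (phaseInv ξ) η (fieldCoef a) φ =ᵐ[P] fun ω =>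
      -∑ i, twDstar unitShift (phaseInv ξ) i (fun ω => ∑ l, (a (ω 0) i l : ℂ) * v l) ω) :
    Tendsto (fun N => eLpNorm (fun ω => iter a ξ v η κ N ω - φ ω) 2 P) atTop (𝓝 0) := by
  refine tendsto_eLpNorm_iteration hη hLam hρ hA (measurable_fieldCoef ha)
    (measurePreserving_unitShift hP) (norm_phase ξ) (phase_mul_phaseInv ξ) hκ hκ'
    (r := fun _ _ => 0) (fun N => (hiter N).sub hφ) (fun _ => MemLp.zero) ?_ (by simp)
  intro N
  filter_upwards [h] with ω hω
  rw [iter_succ, twOp_sub, hω]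
  ring

end Corrector

end RandomEnv

namespace RandomEnv

/-! ### Divergence form equations on the lattice with random coefficients -/

section Slices

variable {d : ℕ} {Ω : Type*} [MeasurableSpace Ω] {P : Measure Ω} [IsProbabilityMeasure P]
  {f : Lattice d × Ω → ℂ}

lemma integrable_sq_of_memLp {X : Type*} [MeasurableSpace X] {ν : Measure X} {f : X → ℂ}
    (hf : MemLp f 2 ν) : Integrable (fun x => ‖f x‖ ^ 2) ν :=
  (memLp_two_iff_integrable_sq_norm hf.1).mp hf

lemma memLp_slice (hf : MemLp f 2 (Measure.count.prod P)) (x : Lattice d) :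
    MemLp (fun ω => f (x, ω)) 2 P := by
  have h1 := Measure.ae_count_iff.mp hf.1.prodMk_left x
  have h2 := Measure.ae_count_iff.mp (integrable_sq_of_memLp hf).prod_right_ae x
  exact (memLp_two_iff_integrable_sq_norm h1).mpr h2

lemma hasSum_slice (hf : MemLp f 2 (Measure.count.prod P)) :
    HasSum (fun x => ∫ ω, ‖f (x, ω)‖ ^ 2 ∂P) (∫ p, ‖f p‖ ^ 2 ∂(Measure.count.prod P)) := by
  have h1 := integrable_sq_of_memLp hf
  have h2 := h1.integral_prod_left
  rw [integral_prod _ h1, integral_countable h2]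
  have h3 := (integrable_count_iff.mp h2).of_norm
  simpa using h3.hasSum

lemma ae_sqSummable_slice (hf : MemLp f 2 (Measure.count.prod P)) :
    ∀ᵐ ω ∂P, SqSummable fun x => f (x, ω) := by
  filter_upwards [(integrable_sq_of_memLp hf).prod_left_ae] with ω hω
  exact (integrable_count_iff.mp hω).of_norm

lemma ae_forall_of_ae_prod {p : Lattice d × Ω → Prop} (h : ∀ᵐ q ∂(Measure.count.prod P), p q) :
    ∀ᵐ ω ∂P, ∀ x, p (x, ω) := by
  rw [ae_all_iff]
  exact Measure.ae_count_iff.mp (Measure.ae_ae_of_ae_prod h)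

end Slices

section LatticeProduct

variable {d : ℕ} {Ω : Type*} [MeasurableSpace Ω]

/-- Translation of the lattice site by the unit vectors, on pairs of a site and a configuration. -/
def latShift (i : Fin d) : Lattice d × Ω ≃ᵐ Lattice d × Ω :=
  (MeasurableEquiv.addRight (unitVec i)).prodCongr (MeasurableEquiv.refl Ω)

lemma latShift_apply (i : Fin d) (x : Lattice d) (ω : Ω) :
    latShift i (x, ω) = (x + unitVec i, ω) := rfl

lemma latShift_symm_apply (i : Fin d) (x : Lattice d) (ω : Ω) :
    (latShift i).symm (x, ω) = (x + -unitVec i, ω) := rfl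

lemma measurePreserving_latShift {P : Measure Ω} [IsProbabilityMeasure P] (i : Fin d) :
    MeasurePreserving (latShift (Ω := Ω) i) (Measure.count.prod P) (Measure.count.prod P) :=
  (measurePreserving_add_right Measure.count (unitVec i)).prod (MeasurePreserving.id P)

/-- The lattice gradient of a function of a site and a configuration. -/
noncomputable def latGrad (u : Lattice d × Ω → ℂ) (p : Lattice d × Ω) : EuclideanSpace ℂ (Fin d) :=
  WithLp.toLp 2 fun i => twD latShift (fun _ => 1) i u p

lemma norm_latGrad_sq (u : Lattice d × Ω → ℂ) (p : Lattice d × Ω) :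
    ‖latGrad u p‖ ^ 2 = ∑ i, ‖twD latShift (fun _ => 1) i u p‖ ^ 2 := by
  rw [EuclideanSpace.norm_sq_eq]; rfl

variable {P : Measure Ω} [IsProbabilityMeasure P] {A : Lattice d × Ω → Matrix (Fin d) (Fin d) ℂ}
  {η Lam ρ : ℝ}

lemma memLp_latGrad_slice {u : Lattice d × Ω → ℂ} (hu : MemLp u 2 (Measure.count.prod P))
    (x : Lattice d) : MemLp (fun ω => latGrad u (x, ω)) 2 P := by
  refine MemLp.of_eval_piLp fun i => ?_
  exact memLp_slice (f := twD latShift (fun _ => 1) i u)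
    (memLp_twD measurePreserving_latShift hu i) x

lemma integral_latGrad_sq {u : Lattice d × Ω → ℂ} (hu : MemLp u 2 (Measure.count.prod P))
    (x : Lattice d) : ∫ ω, ‖latGrad u (x, ω)‖ ^ 2 ∂P =
      ∑ i, ∫ ω, ‖twD latShift (fun _ => 1) i u (x, ω)‖ ^ 2 ∂P := by
  simp only [norm_latGrad_sq]
  exact integral_finsetSum _ fun i _ =>
    integrable_sq_of_memLp (memLp_slice (memLp_twD measurePreserving_latShift hu i) x)

/-- The equation `η u + ∇* A ∇ u = ∇* s` on the lattice, for almost every configuration. -/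
def SolvesLat (P : Measure Ω) (η : ℝ) (A : Lattice d × Ω → Matrix (Fin d) (Fin d) ℂ)
    (s : Fin d → Lattice d × Ω → ℂ) (u : Lattice d × Ω → ℂ) : Prop :=
  twOp latShift (fun _ => 1) (fun _ => 1) η A u =ᵐ[Measure.count.prod P]
    fun p => ∑ i, twDstar latShift (fun _ => 1) i (s i) p

lemma exists_solvesLat (hη : 0 < η) (hLam : 0 < Lam) (hρ : 1 ≤ ρ) (hA : NearScalar A Lam ρ)
    (hAm : ∀ i l, Measurable fun x => A x i l) {s : Fin d → Lattice d × Ω → ℂ}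
    (hs : ∀ i, MemLp (s i) 2 (Measure.count.prod P)) :
    ∃ u, MemLp u 2 (Measure.count.prod P) ∧ SolvesLat P η A s u :=
  exists_twOp_eq hη hLam hρ hA hAm measurePreserving_latShift (by simp) (by simp) hs

omit [IsProbabilityMeasure P] in
lemma SolvesLat.add {s s' : Fin d → Lattice d × Ω → ℂ} {u u' : Lattice d × Ω → ℂ}
    (h : SolvesLat P η A s u) (h' : SolvesLat P η A s' u') :
    SolvesLat P η A (fun i p => s i p + s' i p) (fun p => u p + u' p) := by
  filter_upwards [h, h'] with p h h'
  have h2 : ∀ i y, ∑ l, A y i l * twD latShift (fun _ => 1) l (fun p => u p + u' p) y =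
      ∑ l, A y i l * twD latShift (fun _ => 1) l u y +
      ∑ l, A y i l * twD latShift (fun _ => 1) l u' y := by
    intro i y
    rw [← Finset.sum_add_distrib]
    exact Finset.sum_congr rfl fun l _ => by simp only [twD]; ring
  have e1 : twOp latShift (fun _ => 1) (fun _ => 1) η A (fun p => u p + u' p) p =
      twOp latShift (fun _ => 1) (fun _ => 1) η A u p +
      twOp latShift (fun _ => 1) (fun _ => 1) η A u' p := by
    simp only [twOp, twDstar, h2]
    rw [mul_add, add_add_add_comm, ← Finset.sum_add_distrib]
    congr 1
    exact Finset.sum_congr rfl fun i _ => by ring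
  rw [e1, h, h', ← Finset.sum_add_distrib]
  exact Finset.sum_congr rfl fun i _ => by simp only [twDstar]; ring

omit [IsProbabilityMeasure P] in
lemma SolvesLat.neg {s : Fin d → Lattice d × Ω → ℂ} {u : Lattice d × Ω → ℂ}
    (h : SolvesLat P η A s u) :
    SolvesLat P η A (fun i p => -s i p) (fun p => -u p) := by
  filter_upwards [h] with p h
  have h2 : ∀ i y, ∑ l, A y i l * twD latShift (fun _ => 1) l (fun p => -u p) y =
      -∑ l, A y i l * twD latShift (fun _ => 1) l u y := by
    intro i y
    rw [← Finset.sum_neg_distrib]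
    exact Finset.sum_congr rfl fun l _ => by simp only [twD]; ring
  have e1 : twOp latShift (fun _ => 1) (fun _ => 1) η A (fun p => -u p) p =
      -twOp latShift (fun _ => 1) (fun _ => 1) η A u p := by
    simp only [twOp, twDstar, h2]
    rw [neg_add, ← Finset.sum_neg_distrib]
    congr 1
    · ring
    · exact Finset.sum_congr rfl fun i _ => by ring
  rw [e1, h, ← Finset.sum_neg_distrib]
  exact Finset.sum_congr rfl fun i _ => by simp only [twDstar]; ring

omit [IsProbabilityMeasure P] in
lemma SolvesLat.sum {ι : Type*} (B : Finset ι) {s : ι → Fin d → Lattice d × Ω → ℂ}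
    {u : ι → Lattice d × Ω → ℂ} (h : ∀ z ∈ B, SolvesLat P η A (s z) (u z)) :
    SolvesLat P η A (fun i p => ∑ z ∈ B, s z i p) (fun p => ∑ z ∈ B, u z p) := by
  classical
  induction B using Finset.induction_on with
  | empty => refine ae_of_all _ fun p => ?_; simp [twOp, twDstar, twD]
  | insert z B hz ih =>
    simp only [Finset.sum_insert hz]
    exact (h z (Finset.mem_insert_self _ _)).add
      (ih fun y hy => h y (Finset.mem_insert_of_mem hy))

lemma latGrad_sum {ι : Type*} (B : Finset ι) (u : ι → Lattice d × Ω → ℂ) (p : Lattice d × Ω) :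
    latGrad (fun p => ∑ z ∈ B, u z p) p = ∑ z ∈ B, latGrad (u z) p := by
  ext i
  simp [latGrad, twD, Finset.sum_sub_distrib]

lemma latGrad_sub (u u' : Lattice d × Ω → ℂ) (p : Lattice d × Ω) :
    latGrad (fun p => u p - u' p) p = latGrad u p - latGrad u' p := by
  ext i
  simp only [latGrad, twD, PiLp.sub_apply]
  ring

/-- The energy estimate on the lattice. -/
lemma SolvesLat.sum_integral_latGrad_le (hη : 0 < η) (hLam : 0 < Lam) (hρ : 1 ≤ ρ)
    (hA : NearScalar A Lam ρ) (hAm : ∀ i l, Measurable fun x => A x i l)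
    {s : Fin d → Lattice d × Ω → ℂ} (hs : ∀ i, MemLp (s i) 2 (Measure.count.prod P))
    {u : Lattice d × Ω → ℂ} (hu : MemLp u 2 (Measure.count.prod P)) (h : SolvesLat P η A s u)
    (Y : Finset (Lattice d)) :
    ∑ x ∈ Y, ∫ ω, ‖latGrad u (x, ω)‖ ^ 2 ∂P ≤
      (ρ / Lam) ^ 2 * ∑ i, ∫ p, ‖s i p‖ ^ 2 ∂(Measure.count.prod P) := by
  refine le_trans ?_ (integral_twD_sq_le hη hLam hρ hA hAm measurePreserving_latShift (by simp)
    (by simp) hs hu h)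
  simp only [integral_latGrad_sq hu]
  rw [Finset.sum_comm]
  refine Finset.sum_le_sum fun i _ => ?_
  exact sum_le_hasSum _ (fun x _ => integral_nonneg fun ω => sq_nonneg _)
    (hasSum_slice (memLp_twD measurePreserving_latShift hu i))

/-- The weighted estimate on the lattice: the gradient decays away from the support of the
source. -/
lemma SolvesLat.sum_weight_integral_latGrad_le (hη : 0 < η) (hLam : 0 < Lam) (hρ : 1 ≤ ρ)
    {t : ℝ} (ht : 0 < t) (ht' : t * (2000000 * ρ) ≤ 1)
    (hA : NearScalar A Lam ρ)
    {s : Fin d → Lattice d × Ω → ℂ} (hs : ∀ i, MemLp (s i) 2 (Measure.count.prod P))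
    {z : Lattice d} (hz : ∀ i x ω, x ≠ z → s i (x, ω) = 0)
    {u : Lattice d × Ω → ℂ} (hu : MemLp u 2 (Measure.count.prod P)) (h : SolvesLat P η A s u)
    (Y : Finset (Lattice d)) :
    ∑ x ∈ Y, latticeWeight t (x - z) * ∫ ω, ‖latGrad u (x, ω)‖ ^ 2 ∂P ≤
      4 * d * ρ ^ 3 / Lam ^ 2 * ∑ i, ∫ ω, ‖s i (z, ω)‖ ^ 2 ∂P := by
  have hint : ∀ x, Integrable (fun ω => ‖latGrad u (x, ω)‖ ^ 2) P := fun x => by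
    simp only [norm_latGrad_sq]
    exact integrable_finsetSum _ fun i _ =>
      integrable_sq_of_memLp (memLp_slice (memLp_twD measurePreserving_latShift hu i) x)
  have hints : ∀ i, Integrable (fun ω => ‖s i (z, ω)‖ ^ 2) P := fun i =>
    integrable_sq_of_memLp (memLp_slice (hs i) z)
  simp only [← integral_const_mul]
  rw [← integral_finsetSum _ fun x _ => (hint x).const_mul _,
    ← integral_finsetSum _ fun i _ => hints i, ← integral_const_mul]
  refine integral_mono_ae (integrable_finsetSum _ fun x _ => (hint x).const_mul _)
    ((integrable_finsetSum _ fun i _ => hints i).const_mul _) ?_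
  filter_upwards [ae_sqSummable_slice hu, ae_forall_of_ae_prod h] with ω h1 h2
  simp only [norm_latGrad_sq, twD, one_mul, latShift_apply]
  refine weighted_lattice_source hη hLam hρ ht ht' (A := fun x => A (x, ω)) (fun x => hA (x, ω)) h1 z
    (s := fun i x => s i (x, ω)) (fun j x hx => hz j x ω hx) (fun x => ?_) Y
  have := h2 x
  simpa only [twOp, twDstar, twD, one_mul, latShift_apply, latShift_symm_apply] using this

omit [IsProbabilityMeasure P] in
lemma memLp_restrict_sites {f : Lattice d × Ω → ℂ} (hf : MemLp f 2 (Measure.count.prod P))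
    (S : Set (Lattice d)) : MemLp ((Prod.fst ⁻¹' S).indicator f) 2 (Measure.count.prod P) :=
  hf.indicator (measurable_fst (Set.to_countable S).measurableSet)

lemma hasSum_restrict_sites {f : Lattice d × Ω → ℂ} (hf : MemLp f 2 (Measure.count.prod P))
    (S : Set (Lattice d)) : HasSum (S.indicator fun x => ∫ ω, ‖f (x, ω)‖ ^ 2 ∂P)
      (∫ p, ‖(Prod.fst ⁻¹' S).indicator f p‖ ^ 2 ∂(Measure.count.prod P)) := by
  convert hasSum_slice (memLp_restrict_sites hf S) using 2 with x
  by_cases hx : x ∈ S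
  · simp [hx]
  · simp [hx]

lemma hasSum_indicator_finset {ι : Type*} (B : Finset ι) (f : ι → ℝ) :
    HasSum ((B : Set ι).indicator f) (∑ z ∈ B, f z) := by
  have h := hasSum_sum_of_ne_finset_zero (f := (B : Set ι).indicator f) (s := B)
    (L := SummationFilter.unconditional ι) fun x hx => by simp [Set.indicator, hx]
  rwa [Finset.sum_congr rfl fun x hx => Set.indicator_of_mem (Finset.mem_coe.mpr hx) f] at h

end LatticeProduct

/-- The gradient of the solution of `η u + ∇* A ∇ u = ∇* s` is bounded in `ℓ^q(L²)`, for some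
`q < 2`, by the `ℓ^{p₀}(L²)` norm of the source: by superposition of the solutions for the sources
at single sites, which decay in a weighted norm. -/
theorem exists_lq_bound (d : ℕ) (hd : 0 < d) {ρ p₀ : ℝ} (hρ : 1 ≤ ρ) (hp₀ : 1 ≤ p₀)
    (hp₀' : p₀ < 2) : ∃ q C : ℝ, 1 < q ∧ q < 2 ∧ 0 ≤ C ∧
    ∀ (Ω : Type) [MeasurableSpace Ω] (P : Measure Ω) [IsProbabilityMeasure P]
      (A : Lattice d × Ω → Matrix (Fin d) (Fin d) ℂ) (η Lam : ℝ)
      (s : Fin d → Lattice d × Ω → ℂ) (u : Lattice d × Ω → ℂ) (σ : Lattice d → ℝ),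
      0 < η → 0 < Lam → NearScalar A Lam ρ → (∀ i l, Measurable fun x => A x i l) →
      (∀ i, MemLp (s i) 2 (Measure.count.prod P)) → (hu : MemLp u 2 (Measure.count.prod P)) →
      SolvesLat P η A s u → (∀ z, 0 ≤ σ z) → (∀ z, ∑ i, ∫ ω, ‖s i (z, ω)‖ ^ 2 ∂P ≤ σ z ^ 2) →
      (Summable fun z => σ z ^ p₀) → ∀ Y : Finset (Lattice d),
      (∑ x ∈ Y, ‖(memLp_latGrad_slice hu x).toLp _‖ ^ q) ^ (1 / q) ≤
        C / Lam * (∑' z, σ z ^ p₀) ^ (1 / p₀) := by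
  have hρ0 : 0 < ρ := by linarith
  have ht : 0 < 1 / (2000000 * ρ) := by positivity
  obtain ⟨q, C, hq1, hq2, hC, hI⟩ := exists_interpolation d hd ht hp₀ hp₀'
  refine ⟨q, C * (2 * d * ρ ^ 2), hq1, hq2, by positivity, ?_⟩
  intro Ω _ P _ A η Lam s u σ hη hLam hA hAm hs hu hsol hσ hsσ hsum Y
  set c := 2 * d * ρ ^ 2 / Lam with hc
  have hd1 : (1 : ℝ) ≤ d := by exact_mod_cast hd
  have hc0 : 0 < c := by positivity
  have hp0 : 0 < p₀ := by linarith
  have hq0 : 0 < q := by linarith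
  have hc1 : 4 * d * ρ ^ 3 / Lam ^ 2 ≤ c ^ 2 := by
    rw [hc, div_pow]
    gcongr
    calc 4 * d * ρ ^ 3 = 4 * (d * 1) * (ρ ^ 3 * 1) := by ring
      _ ≤ 4 * (d * d) * (ρ ^ 3 * ρ) := by gcongr
      _ = _ := by ring
  have hc2 : (ρ / Lam) ^ 2 ≤ c ^ 2 := by
    rw [hc]; gcongr
    calc ρ = 1 * ρ * 1 := by ring
      _ ≤ (2 * d) * ρ * ρ := by gcongr; linarith
      _ = _ := by ring
  -- the solutions for the sources at single sites
  have hex : ∀ z : Lattice d, ∃ w, MemLp w 2 (Measure.count.prod P) ∧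
      SolvesLat P η A (fun i => (Prod.fst ⁻¹' {z}).indicator (s i)) w := fun z =>
    exists_solvesLat hη hLam hρ hA hAm fun i => memLp_restrict_sites (hs i) _
  choose w hw hwsol using hex
  have hint : ∀ i x, 0 ≤ ∫ ω, ‖s i (x, ω)‖ ^ 2 ∂P := fun i x =>
    integral_nonneg fun ω => sq_nonneg _
  have hwsum : ∀ B : Finset (Lattice d), MemLp (fun p => ∑ z ∈ B, w z p) 2 (Measure.count.prod P) :=
    fun B => memLp_finsetSum _ fun z _ => hw z
  have hsrc : ∀ (B : Finset (Lattice d)) i p,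
      ∑ z ∈ B, (Prod.fst ⁻¹' {z}).indicator (s i) p =
        (Prod.fst ⁻¹' (B : Set (Lattice d))).indicator (s i) p := by
    rintro B i ⟨x, ω⟩
    simp only [Set.indicator, Set.mem_preimage, Set.mem_singleton_iff, Finset.mem_coe]
    rw [Finset.sum_ite_eq]
  have hsolB : ∀ B : Finset (Lattice d), SolvesLat P η A
      (fun i => (Prod.fst ⁻¹' (B : Set (Lattice d))).indicator (s i)) (fun p => ∑ z ∈ B, w z p) := by
    intro B
    have := SolvesLat.sum B fun z _ => hwsol z
    simpa only [hsrc] using this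
  let K : Lattice d → Lattice d → Lp (EuclideanSpace ℂ (Fin d)) 2 P :=
    fun z x => (memLp_latGrad_slice (hw z) x).toLp _
  have hKsum : ∀ (B : Finset (Lattice d)) x, ∑ z ∈ B, K z x =
      (memLp_latGrad_slice (hwsum B) x).toLp _ := by
    intro B x
    refine Lp.ext ?_
    have h1 : ∀ᵐ ω ∂P, ∀ z, K z x ω = latGrad (w z) (x, ω) := by
      rw [ae_all_iff]; exact fun z => (memLp_latGrad_slice (hw z) x).coeFn_toLp
    filter_upwards [Lp.coeFn_finsetSum B fun z => K z x, h1,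
      (memLp_latGrad_slice (hwsum B) x).coeFn_toLp] with ω h2 h1 h3
    rw [h2, h3, latGrad_sum, Finset.sum_apply]
    exact Finset.sum_congr rfl fun z _ => h1 z
  have hB : ∀ B : Finset (Lattice d), (∑ x ∈ Y, ‖∑ z ∈ B, K z x‖ ^ q) ^ (1 / q) ≤
      C * c * (∑ z ∈ B, σ z ^ p₀) ^ (1 / p₀) := by
    intro B
    refine hI _ K σ c B hc0 hσ ?_ ?_ Y
    · intro z _ Y'
      have h1 := (hwsol z).sum_weight_integral_latGrad_le hη hLam hρ ht
        (by rw [one_div_mul_cancel (by positivity)]) hA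
        (fun i => memLp_restrict_sites (hs i) _) (z := z)
        (fun i x ω hx => by simp [Set.indicator, hx]) (hw z) Y'
      simp only [K, norm_toLp_sq]
      refine h1.trans ?_
      simp only [Set.mem_preimage, Set.mem_singleton_iff, Set.indicator_of_mem]
      exact mul_le_mul hc1 (hsσ z) (Finset.sum_nonneg fun i _ => hint i z) (sq_nonneg _)
    · intro B' _ Y'
      have h1 := (hsolB B').sum_integral_latGrad_le hη hLam hρ hA hAm
        (fun i => memLp_restrict_sites (hs i) _) (hwsum B') Y'
      simp only [hKsum, norm_toLp_sq]
      refine h1.trans (mul_le_mul hc2 ?_ (Finset.sum_nonneg fun i _ =>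
        integral_nonneg fun _ => sq_nonneg _) (sq_nonneg _))
      have h2 : ∀ i, ∫ p, ‖(Prod.fst ⁻¹' (B' : Set (Lattice d))).indicator (s i) p‖ ^ 2
          ∂(Measure.count.prod P) = ∑ z ∈ B', ∫ ω, ‖s i (z, ω)‖ ^ 2 ∂P := fun i =>
        (hasSum_restrict_sites (hs i) (B' : Set (Lattice d))).unique (hasSum_indicator_finset _ _)
      simp only [h2]
      rw [Finset.sum_comm]
      exact Finset.sum_le_sum fun z _ => hsσ z
  -- exhaustion of the lattice by finite sets
  have hlim : ∀ x, Tendsto (fun B : Finset (Lattice d) => ‖∑ z ∈ B, K z x‖) atTop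
      (𝓝 ‖(memLp_latGrad_slice hu x).toLp _‖) := by
    intro x
    refine Tendsto.norm ?_
    rw [tendsto_iff_norm_sub_tendsto_zero]
    have hbd : ∀ B : Finset (Lattice d),
        ‖∑ z ∈ B, K z x - (memLp_latGrad_slice hu x).toLp _‖ ^ 2 ≤
        (ρ / Lam) ^ 2 * ∑ i, (∫ p, ‖s i p‖ ^ 2 ∂(Measure.count.prod P) -
          ∑ z ∈ B, ∫ ω, ‖s i (z, ω)‖ ^ 2 ∂P) := by
      intro B
      have hsolc : SolvesLat P η A
          (fun i => (Prod.fst ⁻¹' (B : Set (Lattice d))ᶜ).indicator (s i))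
          (fun p => u p - ∑ z ∈ B, w z p) := by
        have h1 := hsol.add (hsolB B).neg
        have h2 : ∀ i p, s i p + -(Prod.fst ⁻¹' (B : Set (Lattice d))).indicator (s i) p =
            (Prod.fst ⁻¹' (B : Set (Lattice d))ᶜ).indicator (s i) p := by
          intro i p
          rw [Set.preimage_compl, Set.indicator_compl]
          simp [sub_eq_add_neg]
        simpa only [h2, ← sub_eq_add_neg] using h1
      have h3 := hsolc.sum_integral_latGrad_le hη hLam hρ hA hAm
        (fun i => memLp_restrict_sites (hs i) _) (hu.sub (hwsum B)) {x}
      rw [Finset.sum_singleton] at h3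
      have h4 : ‖∑ z ∈ B, K z x - (memLp_latGrad_slice hu x).toLp _‖ ^ 2 =
          ∫ ω, ‖latGrad (fun p => u p - ∑ z ∈ B, w z p) (x, ω)‖ ^ 2 ∂P := by
        rw [norm_sub_rev, hKsum, ← MemLp.toLp_sub, norm_toLp_sq]
        simp only [Pi.sub_apply, latGrad_sub]
      rw [h4]
      refine h3.trans_eq ?_
      congr 1
      refine Finset.sum_congr rfl fun i _ => ?_
      have h5 := (hasSum_slice (hs i)).sub (hasSum_indicator_finset B
        fun x => ∫ ω, ‖s i (x, ω)‖ ^ 2 ∂P)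
      refine (hasSum_restrict_sites (hs i) (B : Set (Lattice d))ᶜ).unique ?_
      rw [Set.indicator_compl]
      exact h5
    have h0 : Tendsto (fun B : Finset (Lattice d) => (ρ / Lam) ^ 2 *
        ∑ i, (∫ p, ‖s i p‖ ^ 2 ∂(Measure.count.prod P) -
          ∑ z ∈ B, ∫ ω, ‖s i (z, ω)‖ ^ 2 ∂P)) atTop (𝓝 0) := by
      have : (0 : ℝ) = (ρ / Lam) ^ 2 * ∑ i, (∫ p, ‖s i p‖ ^ 2 ∂(Measure.count.prod P) -
          ∫ p, ‖s i p‖ ^ 2 ∂(Measure.count.prod P)) := by simp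
      rw [this]
      exact (tendsto_finsetSum _ fun i _ => tendsto_const_nhds.sub (hasSum_slice (hs i))).const_mul _
    have h1 := squeeze_zero (fun _ => sq_nonneg _) hbd h0
    have h2 := h1.sqrt
    simpa using h2
  refine le_of_tendsto' ((tendsto_finsetSum Y fun x _ =>
    (hlim x).rpow_const (Or.inr hq0.le)).rpow_const (Or.inr (by positivity))) fun B => ?_
  refine (hB B).trans ?_
  rw [hc, ← mul_div_assoc]
  have hnn : ∀ z, 0 ≤ σ z ^ p₀ := fun z => Real.rpow_nonneg (hσ z) _
  have := Finset.sum_nonneg fun z (_ : z ∈ B) => hnn z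
  gcongr
  exact hsum.sum_le_tsum _ fun z _ => Real.rpow_nonneg (hσ z) _

end RandomEnv

namespace RandomEnv

/-! ### The derivative of the corrector as a lattice function -/

lemma MeasurePreserving.integral_comp_ae {X Y : Type*} [MeasurableSpace X] [MeasurableSpace Y]
    {μ : Measure X} {ν : Measure Y} {f : X → Y} (hf : MeasurePreserving f μ ν) {g : Y → ℝ}
    (hg : AEStronglyMeasurable g ν) : ∫ x, g (f x) ∂μ = ∫ y, g y ∂ν := by
  rw [← hf.map_eq] at hg ⊢
  rw [integral_map hf.aemeasurable hg]

section Lift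

variable {d n : ℕ}

/-- The phase `e^{-i x·ξ}` of a lattice site. -/
noncomputable def sitePhase (ξ : Fin d → ℝ) (x : Lattice d) : ℂ :=
  Complex.exp (-(Complex.I * ∑ i, (ξ i * x i : ℝ)))

lemma sitePhase_add (ξ : Fin d → ℝ) (x y : Lattice d) :
    sitePhase ξ (x + y) = sitePhase ξ x * sitePhase ξ y := by
  rw [sitePhase, sitePhase, sitePhase, ← Complex.exp_add]
  congr 1
  simp only [Pi.add_apply, Int.cast_add, mul_add, Finset.sum_add_distrib, Complex.ofReal_add]
  ring

lemma norm_sitePhase (ξ : Fin d → ℝ) (x : Lattice d) : ‖sitePhase ξ x‖ = 1 := by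
  have : -(Complex.I * ∑ i, (ξ i * x i : ℝ)) =
      ((-∑ i, (ξ i * x i : ℝ) : ℝ) : ℂ) * Complex.I := by push_cast; ring
  rw [sitePhase, this, Complex.norm_exp_ofReal_mul_I]

lemma sitePhase_unitVec (ξ : Fin d → ℝ) (i : Fin d) : sitePhase ξ (unitVec i) = phase ξ i := by
  rw [sitePhase, phase]
  congr 3
  rw [Finset.sum_eq_single i]
  · simp
  · intro j _ hj; simp [hj]
  · simp

lemma sitePhase_neg_unitVec (ξ : Fin d → ℝ) (i : Fin d) :
    sitePhase ξ (-unitVec i) = phaseInv ξ i := by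
  rw [sitePhase, phaseInv]
  congr 1
  rw [Finset.sum_eq_single i]
  · simp
  · intro j _ hj; simp [hj]
  · simp

/-- The function `(x, ω) ↦ e^{-i x·ξ} F(τ_x ω, τ_x θ)` of a site and a field. -/
noncomputable def lift (ξ : Fin d → ℝ) (θ : FieldSpace d n)
    (F : FieldSpace d n × FieldSpace d n → ℂ) (p : Lattice d × FieldSpace d n) : ℂ :=
  sitePhase ξ p.1 * F (shift p.1 p.2, shift p.1 θ)

/-- The coefficients `a(ω(x))`, as a complex matrix. -/
def latCoef (a : EuclideanSpace ℝ (Fin n) → Matrix (Fin d) (Fin d) ℝ)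
    (p : Lattice d × FieldSpace d n) : Matrix (Fin d) (Fin d) ℂ := (a (p.2 p.1)).map Complex.ofReal

variable (ξ : Fin d → ℝ) (θ : FieldSpace d n)

/-- The twisted differences in the field become plain lattice differences of the lift. -/
lemma twD_lift (i : Fin d) (F : FieldSpace d n × FieldSpace d n → ℂ) :
    twD latShift (fun _ => 1) i (lift ξ θ F) = lift ξ θ (twD unitShift₂ (phase ξ) i F) := by
  funext p
  obtain ⟨x, ω⟩ := p
  have h : ∀ ω : FieldSpace d n, shift (x + unitVec i) ω = shift (unitVec i) (shift x ω) := by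
    intro ω; rw [shift_shift, add_comm]
  simp only [twD, latShift_apply, lift, sitePhase_add, sitePhase_unitVec, h]
  change _ = sitePhase ξ x * (phase ξ i * F (shift (unitVec i) (shift x ω),
    shift (unitVec i) (shift x θ)) - _)
  ring

lemma twDstar_lift (i : Fin d) (F : FieldSpace d n × FieldSpace d n → ℂ) :
    twDstar latShift (fun _ => 1) i (lift ξ θ F) =
      lift ξ θ (twDstar unitShift₂ (phaseInv ξ) i F) := by
  funext p
  obtain ⟨x, ω⟩ := p
  have h : ∀ ω : FieldSpace d n, shift (x + -unitVec i) ω = shift (-unitVec i) (shift x ω) := by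
    intro ω; rw [shift_shift, add_comm]
  simp only [twDstar, latShift_symm_apply, lift, sitePhase_add, sitePhase_neg_unitVec, h]
  change _ = sitePhase ξ x * (phaseInv ξ i * F (shift (-unitVec i) (shift x ω),
    shift (-unitVec i) (shift x θ)) - _)
  ring

variable (a : EuclideanSpace ℝ (Fin n) → Matrix (Fin d) (Fin d) ℝ) (v : Fin d → ℂ) (η κ : ℝ)

/-- The lifted derivative of the gradient descent is itself a gradient descent, for a divergence
form equation on the lattice. -/
lemma lift_iterDeriv_succ (N : ℕ) (p : Lattice d × FieldSpace d n) :
    lift ξ θ (iterDeriv a ξ v η κ (N + 1)) p = lift ξ θ (iterDeriv a ξ v η κ N) p -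
      κ * (twOp latShift (fun _ => 1) (fun _ => 1) η (latCoef a)
        (lift ξ θ (iterDeriv a ξ v η κ N)) p +
      ∑ i, twDstar latShift (fun _ => 1) i
        (lift ξ θ (coefDeriv a ξ v (iter a ξ v η κ N) i)) p) := by
  set δ := iterDeriv a ξ v η κ N with hδ
  have h1 : ∀ i, (fun y => ∑ l, latCoef a y i l * twD latShift (fun _ => 1) l (lift ξ θ δ) y) =
      lift ξ θ (fun q => ∑ l, (a (q.1 0) i l : ℂ) * twD unitShift₂ (phase ξ) l δ q) := by
    intro i
    funext y
    simp only [twD_lift, lift, latCoef, Matrix.map_apply, Finset.mul_sum, shift, add_zero]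
    exact Finset.sum_congr rfl fun l _ => by ring
  simp only [twOp, h1, twDstar_lift]
  rw [add_assoc, ← Finset.sum_add_distrib]
  have h2 : ∀ i, lift ξ θ (twDstar unitShift₂ (phaseInv ξ) i
      (fun q => ∑ l, (a (q.1 0) i l : ℂ) * twD unitShift₂ (phase ξ) l δ q)) p +
      lift ξ θ (twDstar unitShift₂ (phaseInv ξ) i (coefDeriv a ξ v (iter a ξ v η κ N) i)) p =
      lift ξ θ (twDstar unitShift₂ (phaseInv ξ) i
        (fluxDeriv a ξ v (iter a ξ v η κ N) δ i)) p := by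
    intro i
    simp only [lift, twDstar, fluxDeriv]
    ring
  simp only [h2]
  simp only [lift, iterDeriv, ← hδ, ← Finset.mul_sum]
  ring

/-- The vector `∂_ξ φ + v`. -/
noncomputable def gradAdd (φ : FieldSpace d n → ℂ) (ω : FieldSpace d n) : EuclideanSpace ℂ (Fin d) :=
  WithLp.toLp 2 fun l => twD unitShift (phase ξ) l φ ω + v l

variable {a}

/-- The coefficient derivative is local in the variation: only its value at the origin enters. -/
lemma sum_norm_coefDeriv_sq_le (hD : BddAbove (Set.range fun s => ‖fderiv ℝ a s‖))
    (φ : FieldSpace d n → ℂ) (p : FieldSpace d n × FieldSpace d n) :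
    ∑ i, ‖coefDeriv a ξ v φ i p‖ ^ 2 ≤
      (derivSup a * ‖p.2 0‖) ^ 2 * ‖gradAdd ξ v φ p.1‖ ^ 2 := by
  refine (sum_norm_mulVec_sq_le (fderiv ℝ a (p.1 0) (p.2 0)) _).trans ?_
  rw [EuclideanSpace.norm_sq_eq (gradAdd ξ v φ p.1)]
  refine mul_le_mul_of_nonneg_right ?_ (Finset.sum_nonneg fun _ _ => sq_nonneg _)
  gcongr
  refine (ContinuousLinearMap.le_opNorm _ _).trans ?_
  gcongr
  exact le_ciSup hD (p.1 0)

section Measure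

variable {P : Measure (FieldSpace d n)} [IsProbabilityMeasure P]

lemma measurable_shift : Measurable fun p : Lattice d × FieldSpace d n => shift p.1 p.2 :=
  measurable_from_prod_countable_right fun x => (continuous_shift x).measurable

/-- Translating the field by the site preserves the product of counting measure and a translation
invariant law. -/
lemma measurePreserving_skew (hP : TranslationInvariant P) :
    MeasurePreserving (fun p : Lattice d × FieldSpace d n => (p.1, shift p.1 p.2))
      (Measure.count.prod P) (Measure.count.prod P) :=
  (MeasurePreserving.id Measure.count).skew_product measurable_shift
    (ae_of_all _ fun x => (hP x).map_eq)

lemma memLp_gradAdd (hP : TranslationInvariant P) {φ : FieldSpace d n → ℂ} (hφ : MemLp φ 2 P) :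
    MemLp (gradAdd ξ v φ) 2 P :=
  MemLp.of_eval_piLp fun i =>
    (memLp_twD (measurePreserving_unitShift hP) hφ i).add (memLp_const (v i))

lemma aestronglyMeasurable_shifted (hP : TranslationInvariant P) {ψ : FieldSpace d n → ℂ}
    (hψ : AEStronglyMeasurable ψ P) :
    AEStronglyMeasurable (fun p : Lattice d × FieldSpace d n => ψ (shift p.1 p.2))
      (Measure.count.prod P) := by
  have h2 : AEStronglyMeasurable (fun p : Lattice d × FieldSpace d n => ψ p.2)
    (Measure.count.prod P) := hψ.comp_snd
  exact h2.comp_measurePreserving (measurePreserving_skew hP)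

lemma integrable_shifted (hP : TranslationInvariant P) {r : Lattice d → ℝ} (hr : Summable r)
    {ψ : FieldSpace d n → ℝ} (hψ : Integrable ψ P) :
    Integrable (fun p : Lattice d × FieldSpace d n => r p.1 * ψ (shift p.1 p.2))
      (Measure.count.prod P) :=
  (measurePreserving_skew hP).integrable_comp_of_integrable
    (Integrable.mul_prod (integrable_count_iff.mpr hr.norm) hψ)

lemma integral_shifted (hP : TranslationInvariant P) {r : Lattice d → ℝ} (hr : Summable r)
    {ψ : FieldSpace d n → ℝ} (hψ : Integrable ψ P) :
    ∫ p : Lattice d × FieldSpace d n, r p.1 * ψ (shift p.1 p.2) ∂(Measure.count.prod P) =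
      (∑' x, r x) * ∫ ω, ψ ω ∂P := by
  have h1 : Integrable r Measure.count := integrable_count_iff.mpr hr.norm
  have h2 := MeasurePreserving.integral_comp_ae (measurePreserving_skew hP)
    (g := fun p : Lattice d × FieldSpace d n => r p.1 * ψ p.2) (h1.mul_prod hψ).1
  rw [h2, integral_prod_mul, integral_countable h1]
  simp

variable {ξ θ v}

/-- The source of the linearized equation is square integrable over sites and fields. -/
lemma memLp_lift_coefDeriv (ha : ContDiff ℝ 1 a)
    (hD : BddAbove (Set.range fun s => ‖fderiv ℝ a s‖)) (hP : TranslationInvariant P)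
    (hθ : Summable fun x => ‖θ x‖ ^ 2) {φ : FieldSpace d n → ℂ} (hφ : MemLp φ 2 P) (i : Fin d) :
    MemLp (lift ξ θ (coefDeriv a ξ v φ i)) 2 (Measure.count.prod P) := by
  have hmeas : AEStronglyMeasurable (lift ξ θ (coefDeriv a ξ v φ i)) (Measure.count.prod P) := by
    have e : lift ξ θ (coefDeriv a ξ v φ i) = fun p => sitePhase ξ p.1 *
        ∑ l, (fderiv ℝ a (p.2 (p.1 + 0)) (θ (p.1 + 0)) i l : ℂ) *
          (fun ω => twD unitShift (phase ξ) l φ ω + v l) (shift p.1 p.2) := rfl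
    rw [e]
    have m1 : Measurable fun p : Lattice d × FieldSpace d n => sitePhase ξ p.1 :=
      measurable_from_prod_countable_right fun x => measurable_const (a := sitePhase ξ x)
    refine m1.aestronglyMeasurable.mul (Finset.aestronglyMeasurable_fun_sum _ fun l _ => ?_)
    have m2 : Measurable fun p : Lattice d × FieldSpace d n =>
        (fderiv ℝ a (p.2 (p.1 + 0)) (θ (p.1 + 0)) i l : ℂ) := by
      refine measurable_from_prod_countable_right fun x => ?_
      have h1 : Continuous fun ω : FieldSpace d n => fderiv ℝ a (ω (x + 0)) (θ (x + 0)) :=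
        ((ha.continuous_fderiv one_ne_zero).comp (continuous_apply (x + 0))).clm_apply
          continuous_const
      exact ((entryCLM i l).continuous.comp h1).measurable
    exact m2.aestronglyMeasurable.mul (aestronglyMeasurable_shifted hP
      ((memLp_twD (measurePreserving_unitShift hP) hφ l).add (memLp_const (v l))).1)
  rw [memLp_two_iff_integrable_sq_norm hmeas]
  have hint := integrable_shifted hP (hθ.mul_left (derivSup a ^ 2))
    ((memLp_two_iff_integrable_sq_norm (memLp_gradAdd ξ v hP hφ).1).mp (memLp_gradAdd ξ v hP hφ))
  refine hint.mono' (hmeas.norm.pow 2) (ae_of_all _ fun p => ?_)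
  rw [Real.norm_of_nonneg (sq_nonneg _), lift, norm_mul, norm_sitePhase, one_mul, ← mul_pow]
  refine (Finset.single_le_sum (f := fun i => ‖coefDeriv a ξ v φ i (shift p.1 p.2, shift p.1 θ)‖ ^ 2)
    (fun _ _ => sq_nonneg _) (Finset.mem_univ i)).trans ?_
  refine (sum_norm_coefDeriv_sq_le ξ v hD φ _).trans_eq ?_
  simp [shift]

lemma sum_integral_lift_coefDeriv_le (ha : ContDiff ℝ 1 a)
    (hD : BddAbove (Set.range fun s => ‖fderiv ℝ a s‖)) (hP : TranslationInvariant P)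
    (hθ : Summable fun x => ‖θ x‖ ^ 2) {φ : FieldSpace d n → ℂ} (hφ : MemLp φ 2 P) :
    ∑ i, ∫ p, ‖lift ξ θ (coefDeriv a ξ v φ i) p‖ ^ 2 ∂(Measure.count.prod P) ≤
      (∑' x, derivSup a ^ 2 * ‖θ x‖ ^ 2) * ∫ ω, ‖gradAdd ξ v φ ω‖ ^ 2 ∂P := by
  have hG := (memLp_two_iff_integrable_sq_norm (memLp_gradAdd ξ v hP hφ).1).mp
    (memLp_gradAdd ξ v hP hφ)
  have hF := fun i => integrable_sq_of_memLp (memLp_lift_coefDeriv (ξ := ξ) (v := v) ha hD hP hθ hφ i)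
  rw [← integral_shifted hP (hθ.mul_left (derivSup a ^ 2)) hG,
    ← integral_finsetSum _ fun i _ => hF i]
  refine integral_mono (integrable_finsetSum _ fun i _ => hF i)
    (integrable_shifted hP (hθ.mul_left (derivSup a ^ 2)) hG) fun p => ?_
  simp only [lift, norm_mul, norm_sitePhase, one_mul]
  refine (sum_norm_coefDeriv_sq_le ξ v hD φ _).trans_eq ?_
  simp [shift, mul_pow]

/-- The source of the linearized equation at the site `x` is bounded by the size of the variation
there. -/
lemma sum_integral_slice_lift_coefDeriv_le (ha : ContDiff ℝ 1 a)
    (hD : BddAbove (Set.range fun s => ‖fderiv ℝ a s‖)) (hP : TranslationInvariant P)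
    (hθ : Summable fun x => ‖θ x‖ ^ 2) {φ : FieldSpace d n → ℂ} (hφ : MemLp φ 2 P) (x : Lattice d) :
    ∑ i, ∫ ω, ‖lift ξ θ (coefDeriv a ξ v φ i) (x, ω)‖ ^ 2 ∂P ≤
      (derivSup a * ‖θ x‖) ^ 2 * ∫ ω, ‖gradAdd ξ v φ ω‖ ^ 2 ∂P := by
  have hG := (memLp_two_iff_integrable_sq_norm (memLp_gradAdd ξ v hP hφ).1).mp
    (memLp_gradAdd ξ v hP hφ)
  have hF := fun i => integrable_sq_of_memLp (memLp_slice
    (memLp_lift_coefDeriv (ξ := ξ) (v := v) ha hD hP hθ hφ i) x)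
  rw [← MeasurePreserving.integral_comp_ae (hP x) hG.1, ← integral_finsetSum _ fun i _ => hF i,
    ← integral_const_mul]
  refine integral_mono (integrable_finsetSum _ fun i _ => hF i)
    (((hP x).integrable_comp_of_integrable hG).const_mul _) fun ω => ?_
  simp only [lift, norm_mul, norm_sitePhase, one_mul]
  refine (sum_norm_coefDeriv_sq_le ξ v hD φ _).trans_eq ?_
  simp [shift]

/-- The lift of the derivative of a smooth functional is square integrable, for square summable
variations. -/
lemma SmoothFunctional.memLp_lift {φ : FieldSpace d n → ℂ} {δ : FieldSpace d n × FieldSpace d n → ℂ}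
    (h : SmoothFunctional φ δ) (hθ : Summable fun x => ‖θ x‖ ^ 2) :
    MemLp (lift ξ θ δ) 2 (Measure.count.prod P) := by
  obtain ⟨B, C, hC, hB⟩ := h.deriv_bound
  have hm : Measurable (lift ξ θ δ) := by
    refine measurable_from_prod_countable_right fun x => ?_
    exact ((h.continuous_deriv.comp ((continuous_shift x).prodMk continuous_const)).const_mul
      (sitePhase ξ x) : Continuous fun ω : FieldSpace d n => sitePhase ξ x *
        δ (shift x ω, shift x θ)).measurable
  have hθ' : SqSummable θ := hθ
  have hs : SqSummable fun x => C * ∑ y ∈ B, ‖θ (x + y)‖ :=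
    (SqSummable.sum B fun y _ => (hθ'.comp_add y).norm).const_mul C
  rw [memLp_two_iff_integrable_sq_norm hm.aestronglyMeasurable]
  have hint : Integrable (fun p : Lattice d × FieldSpace d n => ‖C * ∑ y ∈ B, ‖θ (p.1 + y)‖‖ ^ 2)
      (Measure.count.prod P) :=
    Integrable.comp_fst (f := fun x => ‖C * ∑ y ∈ B, ‖θ (x + y)‖‖ ^ 2)
      (integrable_count_iff.mpr (Summable.norm hs)) P
  refine hint.mono' (hm.norm.pow_const 2).aestronglyMeasurable (ae_of_all _ fun p => ?_)
  rw [Real.norm_of_nonneg (sq_nonneg _)]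
  gcongr
  rw [lift, norm_mul, norm_sitePhase, one_mul, Real.norm_of_nonneg (by positivity)]
  exact hB _ _

lemma tendsto_eLpNorm_two_iff {X : Type*} [MeasurableSpace X] {ν : Measure X} {f : ℕ → X → ℂ}
    (hf : ∀ N, MemLp (f N) 2 ν) : Tendsto (fun N => eLpNorm (f N) 2 ν) atTop (𝓝 0) ↔
      Tendsto (fun N => ∫ x, ‖f N x‖ ^ 2 ∂ν) atTop (𝓝 0) := by
  have h0 : ∀ N, 0 ≤ ∫ x, ‖f N x‖ ^ 2 ∂ν := fun N => integral_nonneg fun _ => sq_nonneg _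
  simp only [fun N => eLpNorm_two_eq (hf N)]
  constructor
  · intro h
    have h1 := (ENNReal.tendsto_toReal ENNReal.zero_ne_top).comp h
    have h2 : Tendsto (fun N => √(∫ x, ‖f N x‖ ^ 2 ∂ν)) atTop (𝓝 0) := by
      simpa [Function.comp_def, ENNReal.toReal_ofReal (Real.sqrt_nonneg _)] using h1
    have h3 := h2.pow 2
    simpa [Real.sq_sqrt (h0 _)] using h3
  · intro h
    have := ENNReal.tendsto_ofReal h.sqrt
    simpa using this

lemma coefDeriv_sub (φ φ' : FieldSpace d n → ℂ) (i : Fin d) (p : FieldSpace d n × FieldSpace d n) :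
    coefDeriv a ξ 0 (fun ω => φ ω - φ' ω) i p = coefDeriv a ξ v φ i p - coefDeriv a ξ v φ' i p := by
  simp only [coefDeriv, ← Finset.sum_sub_distrib, twD, Pi.zero_apply]
  exact Finset.sum_congr rfl fun l _ => by ring

/-- The lifted derivatives of the gradient descent converge to the solution of the linearized
equation on the lattice. -/
lemma tendsto_lift_iterDeriv {Lam ρ : ℝ} (hη : 0 < η) (hLam : 0 < Lam) (hρ : 1 ≤ ρ)
    (ha : ContDiff ℝ 1 a) (hD : BddAbove (Set.range fun s => ‖fderiv ℝ a s‖))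
    (hP : TranslationInvariant P)
    (hA : NearScalar (latCoef a) Lam ρ) (hAm : ∀ i l, Measurable fun x => latCoef a x i l)
    (hκ : 0 < κ) (hκ' : κ * (η + 2 * Lam * (4 * d)) ^ 2 ≤ η)
    (hsm : ∀ N, SmoothFunctional (iter a ξ v η κ N) (iterDeriv a ξ v η κ N))
    (hθ : Summable fun x => ‖θ x‖ ^ 2) {φ : FieldSpace d n → ℂ} (hφ : MemLp φ 2 P)
    (hlim : Tendsto (fun N => eLpNorm (fun ω => iter a ξ v η κ N ω - φ ω) 2 P) atTop (𝓝 0))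
    {u : Lattice d × FieldSpace d n → ℂ} (hu : MemLp u 2 (Measure.count.prod P))
    (hsol : SolvesLat P η (latCoef a) (fun i p => -lift ξ θ (coefDeriv a ξ v φ i) p) u) :
    Tendsto (fun N => eLpNorm (fun p => lift ξ θ (iterDeriv a ξ v η κ N) p - u p) 2
      (Measure.count.prod P)) atTop (𝓝 0) := by
  have hit : ∀ N, MemLp (iter a ξ v η κ N) 2 P := fun N => (hsm N).memLp P 2
  have hdiff : ∀ N, MemLp (fun ω => iter a ξ v η κ N ω - φ ω) 2 P := fun N => (hit N).sub hφ
  set s : ℕ → Fin d → Lattice d × FieldSpace d n → ℂ := fun N i p =>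
    lift ξ θ (coefDeriv a ξ v (iter a ξ v η κ N) i) p - lift ξ θ (coefDeriv a ξ v φ i) p with hs
  have hseq : ∀ N i, s N i = lift ξ θ (coefDeriv a ξ 0 (fun ω => iter a ξ v η κ N ω - φ ω) i) := by
    intro N i; funext p
    simp only [hs, lift, coefDeriv_sub (v := v)]
    ring
  have hsmem : ∀ N i, MemLp (s N i) 2 (Measure.count.prod P) := fun N i => by
    rw [hseq]; exact memLp_lift_coefDeriv ha hD hP hθ (hdiff N) i
  have hs0 : ∀ i, Tendsto (fun N => eLpNorm (s N i) 2 (Measure.count.prod P)) atTop (𝓝 0) := by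
    intro i
    rw [tendsto_eLpNorm_two_iff fun N => hsmem N i]
    rw [tendsto_eLpNorm_two_iff hdiff] at hlim
    have h1 := hlim.const_mul ((∑' x, derivSup a ^ 2 * ‖θ x‖ ^ 2) * (4 * d))
    rw [mul_zero] at h1
    refine squeeze_zero (fun N => integral_nonneg fun _ => sq_nonneg _) (fun N => ?_) h1
    have h2 := sum_integral_lift_coefDeriv_le (ξ := ξ) (v := 0) ha hD hP hθ (hdiff N)
    simp only [← hseq] at h2
    refine (Finset.single_le_sum (f := fun i => ∫ p, ‖s N i p‖ ^ 2 ∂(Measure.count.prod P))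
      (fun i _ => integral_nonneg fun _ => sq_nonneg _) (Finset.mem_univ i)).trans (h2.trans ?_)
    rw [mul_assoc]
    refine mul_le_mul_of_nonneg_left ?_ (tsum_nonneg fun x => by positivity)
    have h3 := sum_integral_twD_sq_le (measurePreserving_unitShift hP) (norm_phase ξ) (hdiff N)
    refine le_trans (le_of_eq ?_) h3
    rw [← integral_finsetSum _ fun l _ => integrable_sq_of_memLp
      (memLp_twD (measurePreserving_unitShift hP) (hdiff N) l)]
    refine integral_congr_ae (ae_of_all _ fun ω => ?_)
    simp [gradAdd, EuclideanSpace.norm_sq_eq]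
  have hD' : ∀ N i, MemLp (twDstar latShift (fun _ => 1) i (s N i)) 2 (Measure.count.prod P) :=
    fun N i => memLp_twDstar measurePreserving_latShift (hsmem N i) i
  refine tendsto_eLpNorm_iteration (c := fun _ => 1) (c' := fun _ => 1) hη hLam hρ hA hAm
    measurePreserving_latShift (by simp) (by simp) hκ hκ'
    (w := fun N p => lift ξ θ (iterDeriv a ξ v η κ N) p - u p)
    (r := fun N p => -(κ : ℂ) * ∑ i, twDstar latShift (fun _ => 1) i (s N i) p)
    (fun N => ((hsm N).memLp_lift hθ).sub hu)
    (fun N => (memLp_finsetSum _ fun i _ => hD' N i).const_mul _) (fun N => ?_) ?_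
  · filter_upwards [hsol] with p hp
    rw [lift_iterDeriv_succ, twOp_sub, hp]
    simp only [hs, twDstar_sub, Finset.sum_sub_distrib]
    have h1 : ∀ i, twDstar latShift (fun _ => 1) i (fun p => -lift ξ θ (coefDeriv a ξ v φ i) p) p =
        -twDstar latShift (fun _ => 1) i (lift ξ θ (coefDeriv a ξ v φ i)) p := by
      intro i; simp only [twDstar]; ring
    simp only [h1, Finset.sum_neg_distrib]
    ring
  · have h1 : ∀ N, eLpNorm (fun p => -(κ : ℂ) * ∑ i, twDstar latShift (fun _ => 1) i (s N i) p) 2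
        (Measure.count.prod P) ≤ ‖(-(κ : ℂ))‖ₑ *
          ∑ i, 2 * eLpNorm (s N i) 2 (Measure.count.prod P) := by
      intro N
      refine (eLpNorm_const_smul_le (c := -(κ : ℂ))
        (f := fun p => ∑ i, twDstar latShift (fun _ => 1) i (s N i) p)).trans ?_
      gcongr
      have h2 := eLpNorm_sum_le (μ := Measure.count.prod P) (p := 2) (s := Finset.univ)
        (f := fun i => twDstar latShift (fun _ => 1) i (s N i)) (fun i _ => (hD' N i).1) one_le_two
      have h3 : (∑ i, twDstar latShift (fun _ => 1) i (s N i)) =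
          fun p => ∑ i, twDstar latShift (fun _ => 1) i (s N i) p := by
        funext p; simp
      rw [h3] at h2
      refine h2.trans (Finset.sum_le_sum fun i _ => ?_)
      have hmp := (measurePreserving_latShift (P := P) (Ω := FieldSpace d n) i).symm
      have h4 : twDstar latShift (fun _ => 1) i (s N i) =
          fun p => s N i ((latShift i).symm p) - s N i p := by
        funext p; simp [twDstar]
      rw [h4, two_mul]
      refine (eLpNorm_sub_le ((hsmem N i).comp_measurePreserving hmp).1 (hsmem N i).1
        one_le_two).trans ?_
      gcongr
      exact (eLpNorm_comp_measurePreserving (hsmem N i).1 hmp).le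
    refine tendsto_of_tendsto_of_tendsto_of_le_of_le tendsto_const_nhds ?_ (fun _ => zero_le) h1
    have h2 : Tendsto (fun N => ∑ i, 2 * eLpNorm (s N i) 2 (Measure.count.prod P)) atTop (𝓝 0) := by
      have := tendsto_finsetSum Finset.univ fun i _ =>
        ENNReal.Tendsto.const_mul (hs0 i) (Or.inr (ENNReal.ofNat_ne_top (n := 2)))
      simpa using this
    simpa using ENNReal.Tendsto.const_mul h2 (Or.inr enorm_ne_top)

end Measure

end Lift

end RandomEnv

namespace RandomEnv

/-! ### The Poincaré inequality for the convolution -/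

/-- Countably many sequences that converge in measure along the same countably generated filter
converge almost everywhere along a common sequence. -/
lemma exists_seq_tendsto_ae_forall {α ι κ E : Type*} [MeasurableSpace α] {μ : Measure α}
    [PseudoEMetricSpace E] [Countable κ] {u : Filter ι} [NeBot u] [IsCountablyGenerated u]
    {f : κ → ι → α → E} {g : κ → α → E} (h : ∀ x, TendstoInMeasure μ (f x) u (g x)) :
    ∃ ns : ℕ → ι, Tendsto ns atTop u ∧
      ∀ᵐ w ∂μ, ∀ x, Tendsto (fun N => f x (ns N) w) atTop (𝓝 (g x w)) := by
  classical
  obtain ⟨B, hB⟩ := exists_seq_tendsto (atTop : Filter (Finset κ))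
  obtain ⟨U, hU⟩ := u.exists_antitone_basis
  have hpos : ∀ N : ℕ, (0 : ENNReal) < 2⁻¹ ^ N := fun N => ENNReal.pow_pos (by simp) N
  have hex : ∀ N : ℕ, ∃ i, i ∈ U N ∧ ∀ x ∈ B N,
      μ {w | (2⁻¹ : ENNReal) ^ N ≤ edist (f x i w) (g x w)} ≤ 2⁻¹ ^ N := by
    intro N
    refine Eventually.exists (f := u) (Eventually.and (hU.1.mem_of_mem trivial) ?_)
    rw [Finset.eventually_all]
    intro x _
    exact ((h x _ (hpos N)).eventually_lt_const (hpos N)).mono fun i hi => hi.le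
  choose ns hns1 hns2 using hex
  refine ⟨ns, hU.tendsto hns1, ?_⟩
  rw [ae_all_iff]
  intro x
  have hx : ∀ᶠ N in atTop, x ∈ B N := by
    filter_upwards [hB.eventually_ge_atTop {x}] with N hN
    exact hN (Finset.mem_singleton_self x)
  have hsum : (∑' N, μ (if x ∈ B N then
      {w | (2⁻¹ : ENNReal) ^ N ≤ edist (f x (ns N) w) (g x w)} else ∅)) ≠ ⊤ := by
    refine ne_top_of_le_ne_top (b := ∑' N : ℕ, (2⁻¹ : ENNReal) ^ N) ?_ (ENNReal.tsum_le_tsum fun N => ?_)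
    · rw [ENNReal.tsum_geometric]
      simp
    · split_ifs with hxN
      · exact hns2 N x hxN
      · simp
  filter_upwards [ae_eventually_notMem hsum] with w hw
  rw [tendsto_iff_edist_tendsto_0]
  have hgeo : Tendsto (fun N : ℕ => (2⁻¹ : ENNReal) ^ N) atTop (𝓝 0) :=
    ENNReal.tendsto_pow_atTop_nhds_zero_of_lt_one (by simp)
  refine tendsto_of_tendsto_of_tendsto_of_le_of_le' tendsto_const_nhds hgeo
    (Eventually.of_forall fun _ => zero_le) ?_
  filter_upwards [hw, hx] with N h1 h2
  rw [if_pos h2] at h1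
  exact (not_le.mp h1).le

section Transfer

variable {d n k : ℕ} {Pt : Measure (FieldSpace d k)} {h : Lattice d → Matrix (Fin n) (Fin k) ℝ}
  {W : FieldSpace d k → FieldSpace d n}

/-- The partial sum `∑_{y ∈ F} h(x - y) w(y)` of the convolution. -/
noncomputable def partialConv (h : Lattice d → Matrix (Fin n) (Fin k) ℝ) (F : Finset (Lattice d))
    (w : FieldSpace d k) : FieldSpace d n :=
  fun x => ∑ y ∈ F, WithLp.toLp 2 (h (x - y) *ᵥ (w y).ofLp)

/-- The field `x ↦ h(x - y) e_j`, the response of the convolution to a variation at the site `y` in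
the direction of the `j`-th unit vector. -/
noncomputable def column (h : Lattice d → Matrix (Fin n) (Fin k) ℝ) (y : Lattice d) (j : Fin k) :
    FieldSpace d n :=
  fun x => WithLp.toLp 2 fun i => h (x - y) i j

lemma norm_column_le (h : Lattice d → Matrix (Fin n) (Fin k) ℝ) (y : Lattice d) (j : Fin k)
    (x : Lattice d) : ‖column h y j x‖ ≤ ‖h (x - y)‖ := by
  have h1 := Matrix.l2_opNorm_mulVec (h (x - y)) (EuclideanSpace.single j 1)
  have h2 : h (x - y) *ᵥ (EuclideanSpace.single j (1 : ℝ)).ofLp = fun i => h (x - y) i j := by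
    have : (EuclideanSpace.single j (1 : ℝ)).ofLp = Pi.single j 1 := rfl
    rw [this, Matrix.mulVec_single_one]; rfl
  rw [PiLp.norm_single, norm_one, mul_one] at h1
  refine le_trans (le_of_eq ?_) h1
  rw [column, ← h2]; rfl

lemma column_shift (h : Lattice d → Matrix (Fin n) (Fin k) ℝ) (y : Lattice d) (j : Fin k) :
    shift y (column h y j) = column h 0 j := by
  funext x; simp [shift, column]

/-- The law of the convolution is translation invariant, since `W (τ_x w)` and `τ_x (W w)` are
limits in probability of the same partial sums. -/
lemma translationInvariant_map [IsProbabilityMeasure Pt] (hPt : TranslationInvariant Pt)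
    (hW : IsConvolution Pt h W) : TranslationInvariant (Pt.map W) := by
  intro x
  have hcomm : (fun w => W (shift x w)) =ᵐ[Pt] fun w => shift x (W w) := by
    have h1 : ∀ᵐ w ∂Pt, ∀ z, W (shift x w) z = W w (x + z) := by
      rw [ae_all_iff]
      intro z
      have e : Tendsto (fun F : Finset (Lattice d) => F.map (addLeftEmbedding x)) atTop atTop := by
        refine tendsto_atTop_finset_of_monotone (fun F F' hF => Finset.map_subset_map.mpr hF) ?_
        intro y
        exact ⟨{y - x}, by simp⟩
      have h2 := (hW.2 (x + z)).comp e
      have h3 : TendstoInMeasure Pt (fun (F : Finset (Lattice d)) (w : FieldSpace d k) =>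
          ∑ y ∈ F, (WithLp.toLp 2 (h (z - y) *ᵥ (shift x w y).ofLp) : EuclideanSpace ℝ (Fin n)))
          atTop (fun w => W (shift x w) z) := by
        intro ε hε
        refine (hW.2 z ε hε).congr fun F => ?_
        have hmp : MeasurePreserving (shiftEquiv x : FieldSpace d k ≃ᵐ FieldSpace d k) Pt Pt := hPt x
        exact (hmp.measure_preimage_equiv _).symm
      refine tendstoInMeasure_ae_unique h3 (h2.congr_left fun F => ae_of_all _ fun w => ?_)
      simp only [Finset.sum_map, shift, Function.comp_apply, addLeftEmbedding_apply,
        add_sub_add_left_eq_sub]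
    filter_upwards [h1] with w hw
    funext z
    exact hw z
  have hm : Measurable (shift x : FieldSpace d n → FieldSpace d n) := (continuous_shift x).measurable
  have hm' : Measurable (shift x : FieldSpace d k → FieldSpace d k) := (continuous_shift x).measurable
  refine ⟨hm, ?_⟩
  have hW' : AEMeasurable W (Pt.map (shift x)) := by rw [(hPt x).map_eq]; exact hW.1
  calc (Pt.map W).map (shift x) = Pt.map (fun w => shift x (W w)) :=
        AEMeasurable.map_map_of_aemeasurable hm.aemeasurable hW.1
    _ = Pt.map (fun w => W (shift x w)) := Measure.map_congr hcomm.symm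
    _ = (Pt.map (shift x)).map W :=
        (AEMeasurable.map_map_of_aemeasurable hW' hm'.aemeasurable).symm
    _ = Pt.map W := by rw [(hPt x).map_eq]

lemma continuous_partialConv (F : Finset (Lattice d)) : Continuous (partialConv h F) := by
  refine continuous_pi fun x => continuous_finsetSum _ fun y _ => ?_
  have h1 : Continuous fun w : FieldSpace d k => (w y).ofLp :=
    (PiLp.continuous_ofLp 2 _).comp (continuous_apply y)
  exact (PiLp.continuous_toLp 2 _).comp (Continuous.matrix_mulVec continuous_const h1)

/-- The Poincaré inequality for a smooth functional of a partial sum of the convolution. -/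
lemma integral_partialConv_le [IsProbabilityMeasure Pt] {m : ℝ} (hm : 0 < m) (hPo : Poincare Pt m)
    {φ : FieldSpace d n → ℂ} {δ : FieldSpace d n × FieldSpace d n → ℂ} (hs : SmoothFunctional φ δ)
    (F : Finset (Lattice d)) :
    ∫ w, ‖φ (partialConv h F w) - ∫ w', φ (partialConv h F w') ∂Pt‖ ^ 2 ∂Pt ≤
      1 / m ^ 2 * ∑ y ∈ F, ∑ j, ∫ w, ‖δ (partialConv h F w, column h y j)‖ ^ 2 ∂Pt := by
  let T : (F → EuclideanSpace ℝ (Fin k)) → FieldSpace d n := fun w x =>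
    ∑ y : F, WithLp.toLp 2 (h (x - y) *ᵥ (w y).ofLp)
  have hT : ∀ w, T (F.restrict w) = partialConv h F w := by
    intro w; funext x
    exact Finset.sum_coe_sort F fun y => (WithLp.toLp 2 (h (x - y) *ᵥ (w y).ofLp) : EuclideanSpace ℝ (Fin n))
  have hTlin : ∀ w s (t : ℝ), T (w + t • s) = T w + t • T s := by
    intro w s t; funext x
    simp only [T, Pi.add_apply, Pi.smul_apply, Finset.smul_sum, ← Finset.sum_add_distrib]
    refine Finset.sum_congr rfl fun y _ => ?_
    rw [WithLp.ofLp_add, WithLp.ofLp_smul, Matrix.mulVec_add, Matrix.mulVec_smul, WithLp.toLp_add,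
      WithLp.toLp_smul]
  have hTcol : ∀ (y : F) (j : Fin k), T (Pi.single y (EuclideanSpace.single j 1)) = column h y j := by
    intro y j; funext x
    simp only [T]
    rw [Finset.sum_eq_single y]
    · have : (EuclideanSpace.single j (1 : ℝ)).ofLp = Pi.single j 1 := rfl
      rw [Pi.single_eq_same, this, Matrix.mulVec_single_one]; rfl
    · intro y' _ hy'
      rw [Pi.single_eq_of_ne hy']; simp
    · simp
  have hTsmooth : ∀ x, ContDiff ℝ 1 fun w => T w x := by
    intro x
    refine ContDiff.sum fun y _ => ?_
    let L : EuclideanSpace ℝ (Fin k) →L[ℝ] EuclideanSpace ℝ (Fin n) :=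
      LinearMap.toContinuousLinearMap (Matrix.toEuclideanLin (h (x - y)))
    exact L.contDiff.comp (contDiff_apply ℝ _ y)
  have hG : ContDiff ℝ 1 fun w => φ (T w) := hs.contDiff _ T hTsmooth
  have hcont : Continuous fun w => φ (partialConv h F w) :=
    hs.continuous.comp (continuous_partialConv F)
  obtain ⟨C, hC⟩ := hs.bounded
  have hmem : MemLp (fun w => φ (T (F.restrict w))) 2 Pt := by
    simp only [hT]
    exact MemLp.of_bound hcont.aestronglyMeasurable C (ae_of_all _ fun w => hC _)
  have hder : ∀ w (y : F) (j : Fin k), fderiv ℝ (fun w => φ (T w)) w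
      (Pi.single y (EuclideanSpace.single j 1)) = δ (T w, column h y j) := by
    intro w y j
    have h1 : HasDerivAt (fun t : ℝ => w + t • (Pi.single y (EuclideanSpace.single j 1) :
        F → EuclideanSpace ℝ (Fin k))) (Pi.single y (EuclideanSpace.single j 1)) 0 := by
      simpa using ((hasDerivAt_id (0 : ℝ)).smul_const (Pi.single y (EuclideanSpace.single j 1) :
        F → EuclideanSpace ℝ (Fin k))).const_add w
    have h2 : HasFDerivAt (fun w => φ (T w)) (fderiv ℝ (fun w => φ (T w)) w)
        (w + (0 : ℝ) • (Pi.single y (EuclideanSpace.single j 1) :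
        F → EuclideanSpace ℝ (Fin k))) := by
      simpa using (hG.differentiable one_ne_zero w).hasFDerivAt
    have h3 := h2.comp_hasDerivAt (0 : ℝ) h1
    have h4 := hs.hasDerivAt (T w) (column h y j)
    refine h3.unique (h4.congr_of_eventuallyEq (Eventually.of_forall fun t => ?_))
    simp only [Function.comp_apply, hTlin, hTcol]
  have hgrad : ∀ w, gradSq (fun w => φ (T w)) (F.restrict w) =
      ∑ y ∈ F, ∑ j, ‖δ (partialConv h F w, column h y j)‖ ^ 2 := by
    intro w
    simp only [gradSq, hder, hT]
    exact Finset.sum_coe_sort F fun y => ∑ j, ‖δ (partialConv h F w, column h y j)‖ ^ 2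
  have hp := hPo F (fun w => φ (T w)) hG hmem
  simp only [hT, hgrad] at hp
  obtain ⟨B, D, hD0, hD⟩ := hs.deriv_bound
  have hδc : ∀ y j, Continuous fun w => δ (partialConv h F w, column h y j) := fun y j =>
    hs.continuous_deriv.comp ((continuous_partialConv F).prodMk continuous_const)
  have hδ : ∀ y j, Integrable (fun w => ‖δ (partialConv h F w, column h y j)‖ ^ 2) Pt := by
    intro y j
    refine Integrable.of_bound ((hδc y j).norm.pow 2).aestronglyMeasurable
      ((D * ∑ x ∈ B, ‖column h y j x‖) ^ 2) (ae_of_all _ fun w => ?_)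
    rw [Real.norm_of_nonneg (sq_nonneg _)]
    gcongr
    exact hD _ _
  have hint : Integrable (fun w => ‖φ (partialConv h F w) - ∫ w', φ (partialConv h F w') ∂Pt‖ ^ 2)
      Pt := by
    have : MemLp (fun w => φ (partialConv h F w) - ∫ w', φ (partialConv h F w') ∂Pt) 2 Pt := by
      simp only [hT] at hmem
      exact hmem.sub (memLp_const _)
    exact integrable_sq_of_memLp this
  rw [← ofReal_integral_eq_lintegral_ofReal hint (ae_of_all _ fun _ => sq_nonneg _),
    ← ofReal_integral_eq_lintegral_ofReal
      (integrable_finsetSum _ fun y _ => integrable_finsetSum _ fun j _ => hδ y j)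
      (ae_of_all _ fun _ => Finset.sum_nonneg fun _ _ => Finset.sum_nonneg fun _ _ => sq_nonneg _),
    ← ENNReal.ofReal_mul (by positivity)] at hp
  have h0 : 0 ≤ 1 / m ^ 2 * ∫ w, ∑ y ∈ F, ∑ j, ‖δ (partialConv h F w, column h y j)‖ ^ 2 ∂Pt :=
    mul_nonneg (by positivity) (integral_nonneg fun _ =>
      Finset.sum_nonneg fun _ _ => Finset.sum_nonneg fun _ _ => sq_nonneg _)
  have := (ENNReal.ofReal_le_ofReal_iff h0).mp hp
  rwa [integral_finsetSum _ fun y _ => integrable_finsetSum _ fun j _ => hδ y j,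
    Finset.sum_congr rfl fun y _ => integral_finsetSum _ fun j _ => hδ y j] at this

/-- The dominating series for the gradients of a local functional of the convolution. -/
lemma summable_sum_norm_sq (hh : Summable fun y => ‖h y‖ ^ 2) (B : Finset (Lattice d)) (D : ℝ) :
    Summable fun y => ∑ _j : Fin k, (D * ∑ x ∈ B, ‖h (x - y)‖) ^ 2 := by
  refine summable_sum fun j _ => ?_
  have h1 : SqSummable h := hh
  have h2 : SqSummable fun y => h (-y) := (Equiv.neg (Lattice d)).summable_iff.mpr h1
  have h3 : ∀ x, SqSummable fun y => h (x - y) := by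
    intro x
    have := h2.comp_add (-x)
    simpa [neg_add_rev, sub_eq_add_neg] using this
  have h4 := (SqSummable.sum B fun x _ => (h3 x).norm).const_mul D
  have h5 : Summable fun y => ‖D * ∑ x ∈ B, ‖h (x - y)‖‖ ^ 2 := h4
  simpa only [Real.norm_eq_abs, sq_abs] using h5

/-- The Poincaré inequality for smooth functionals of the convolution `W = h * w`. -/
lemma variance_smoothFunctional_le [IsProbabilityMeasure Pt] {m : ℝ} (hm : 0 < m)
    (hPo : Poincare Pt m) (hh : Summable fun y => ‖h y‖ ^ 2) (hW : IsConvolution Pt h W)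
    {φ : FieldSpace d n → ℂ} {δ : FieldSpace d n × FieldSpace d n → ℂ} (hs : SmoothFunctional φ δ) :
    (Summable fun y => ∑ j, ∫ ω, ‖δ (ω, column h y j)‖ ^ 2 ∂(Pt.map W)) ∧
    ∫ ω, ‖φ ω - ∫ ω', φ ω' ∂(Pt.map W)‖ ^ 2 ∂(Pt.map W) ≤
      1 / m ^ 2 * ∑' y, ∑ j, ∫ ω, ‖δ (ω, column h y j)‖ ^ 2 ∂(Pt.map W) := by
  obtain ⟨C, hC⟩ := hs.bounded
  obtain ⟨B, D, hD0, hD⟩ := hs.deriv_bound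
  obtain ⟨F, hF, hFW⟩ := exists_seq_tendsto_ae_forall (μ := Pt) (u := atTop)
    (f := fun x (F : Finset (Lattice d)) w => partialConv h F w x) (g := fun x w => W w x) hW.2
  have hFW' : ∀ᵐ w ∂Pt, Tendsto (fun N => partialConv h (F N) w) atTop (𝓝 (W w)) := by
    filter_upwards [hFW] with w hw
    exact tendsto_pi_nhds.mpr hw
  have hφc := hs.continuous
  have hδc : ∀ y j, Continuous fun ω => δ (ω, column h y j) := fun y j =>
    hs.continuous_deriv.comp (continuous_id.prodMk continuous_const)
  have hδb : ∀ y j ω, ‖δ (ω, column h y j)‖ ^ 2 ≤ (D * ∑ x ∈ B, ‖h (x - y)‖) ^ 2 := by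
    intro y j ω
    gcongr
    refine (hD ω _).trans ?_
    gcongr
    exact norm_column_le _ _ _ _
  have e1 : ∫ ω, φ ω ∂(Pt.map W) = ∫ w, φ (W w) ∂Pt :=
    integral_map hW.1 hφc.aestronglyMeasurable
  have e2 : ∀ c : ℂ, ∫ ω, ‖φ ω - c‖ ^ 2 ∂(Pt.map W) = ∫ w, ‖φ (W w) - c‖ ^ 2 ∂Pt := fun c =>
    integral_map hW.1 ((hφc.sub continuous_const).norm.pow 2).aestronglyMeasurable
  have e3 : ∀ y j, ∫ ω, ‖δ (ω, column h y j)‖ ^ 2 ∂(Pt.map W) =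
      ∫ w, ‖δ (W w, column h y j)‖ ^ 2 ∂Pt := fun y j =>
    integral_map hW.1 ((hδc y j).norm.pow 2).aestronglyMeasurable
  simp only [e1, e2, e3]
  have hsum := summable_sum_norm_sq (k := k) hh B D
  have hbd : ∀ (V : FieldSpace d k → FieldSpace d n) y,
      ‖∑ j, ∫ w, ‖δ (V w, column h y j)‖ ^ 2 ∂Pt‖ ≤
        ∑ _j : Fin k, (D * ∑ x ∈ B, ‖h (x - y)‖) ^ 2 := by
    intro V y
    rw [Real.norm_of_nonneg (Finset.sum_nonneg fun j _ => integral_nonneg fun _ => sq_nonneg _)]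
    refine Finset.sum_le_sum fun j _ => ?_
    refine (integral_mono_of_nonneg (ae_of_all _ fun _ => sq_nonneg _)
      (integrable_const _) (ae_of_all _ fun w => hδb y j (V w))).trans ?_
    simp
  refine ⟨hsum.of_norm_bounded (hbd W), ?_⟩
  -- the limit of the means
  have hmean : Tendsto (fun N => ∫ w, φ (partialConv h (F N) w) ∂Pt) atTop
      (𝓝 (∫ w, φ (W w) ∂Pt)) := by
    refine tendsto_integral_of_dominated_convergence (fun _ => C)
      (fun N => (hφc.comp (continuous_partialConv _)).aestronglyMeasurable) (integrable_const _)
      (fun N => ae_of_all _ fun w => hC _) ?_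
    filter_upwards [hFW'] with w hw
    exact (hφc.tendsto _).comp hw
  -- the limit of the variances
  have hvar : Tendsto (fun N => ∫ w, ‖φ (partialConv h (F N) w) -
      ∫ w', φ (partialConv h (F N) w') ∂Pt‖ ^ 2 ∂Pt) atTop
      (𝓝 (∫ w, ‖φ (W w) - ∫ w', φ (W w') ∂Pt‖ ^ 2 ∂Pt)) := by
    refine tendsto_integral_of_dominated_convergence (fun _ => (C + C) ^ 2)
      (fun N => (((hφc.comp (continuous_partialConv _)).sub
        continuous_const).norm.pow 2).aestronglyMeasurable) (integrable_const _)
      (fun N => ae_of_all _ fun w => ?_) ?_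
    · rw [Real.norm_of_nonneg (sq_nonneg _)]
      gcongr
      refine (norm_sub_le _ _).trans (add_le_add (hC _) ?_)
      simpa using norm_integral_le_of_norm_le_const (μ := Pt)
        (ae_of_all _ fun w => hC (partialConv h (F N) w))
    · filter_upwards [hFW'] with w hw
      exact ((((hφc.tendsto _).comp hw).sub hmean).norm).pow 2
  -- the limit of the gradients
  have hgrad : Tendsto (fun N => ∑' y, ∑ j, ∫ w, ‖δ (partialConv h (F N) w, column h y j)‖ ^ 2 ∂Pt)
      atTop (𝓝 (∑' y, ∑ j, ∫ w, ‖δ (W w, column h y j)‖ ^ 2 ∂Pt)) := by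
    refine tendsto_tsum_of_dominated_convergence hsum (fun y => ?_)
      (Eventually.of_forall fun N y => hbd _ y)
    refine tendsto_finsetSum _ fun j _ => ?_
    refine tendsto_integral_of_dominated_convergence (fun _ => (D * ∑ x ∈ B, ‖h (x - y)‖) ^ 2)
      (fun N => (((hδc y j).comp (continuous_partialConv _)).norm.pow 2).aestronglyMeasurable)
      (integrable_const _) (fun N => ae_of_all _ fun w => ?_) ?_
    · rw [Real.norm_of_nonneg (sq_nonneg _)]
      exact hδb y j _
    · filter_upwards [hFW'] with w hw
      exact ((((hδc y j).tendsto _).comp hw).norm).pow 2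
  refine le_of_tendsto_of_tendsto' hvar (hgrad.const_mul _) fun N => ?_
  refine (integral_partialConv_le hm hPo hs (F N)).trans ?_
  gcongr
  exact (hsum.of_norm_bounded (hbd _)).sum_le_tsum _ fun y _ =>
    Finset.sum_nonneg fun j _ => integral_nonneg fun _ => sq_nonneg _

end Transfer

end RandomEnv

namespace RandomEnv

/-! ### Sequence norms and the energy estimate for the corrector -/

/-- The `ℓ^p` norms decrease in `p`. -/
lemma summable_rpow_and_ellNorm_le {ι E : Type*} [NormedAddCommGroup E] {f : ι → E} {p q : ℝ}
    (hp : 0 < p) (hpq : p ≤ q) (hf : Summable fun x => ‖f x‖ ^ p) :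
    (Summable fun x => ‖f x‖ ^ q) ∧ ellNorm q f ≤ ellNorm p f := by
  have hq : 0 < q := hp.trans_le hpq
  have hnn : ∀ x, 0 ≤ ‖f x‖ ^ p := fun x => Real.rpow_nonneg (norm_nonneg _) _
  have hS : 0 ≤ ∑' x, ‖f x‖ ^ p := tsum_nonneg hnn
  set M := ellNorm p f with hM
  have hM0 : 0 ≤ M := Real.rpow_nonneg hS _
  have hMp : M ^ p = ∑' x, ‖f x‖ ^ p := by
    rw [hM, ellNorm, ← Real.rpow_mul hS, one_div_mul_cancel hp.ne', Real.rpow_one]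
  have hle : ∀ x, ‖f x‖ ≤ M := by
    intro x
    refine (Real.rpow_le_rpow_iff (norm_nonneg _) hM0 hp).mp ?_
    rw [hMp]
    exact hf.le_tsum x fun y _ => hnn y
  have hbd : ∀ x, ‖f x‖ ^ q ≤ ‖f x‖ ^ p * M ^ (q - p) := by
    intro x
    calc ‖f x‖ ^ q = ‖f x‖ ^ p * ‖f x‖ ^ (q - p) := by
          rw [← Real.rpow_add_of_nonneg (norm_nonneg _) hp.le (by linarith)]; ring_nf
      _ ≤ _ := mul_le_mul_of_nonneg_left
          (Real.rpow_le_rpow (norm_nonneg _) (hle x) (by linarith)) (hnn x)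
  have hsum : Summable fun x => ‖f x‖ ^ q :=
    Summable.of_nonneg_of_le (fun x => Real.rpow_nonneg (norm_nonneg _) _) hbd (hf.mul_right _)
  refine ⟨hsum, ?_⟩
  have h1 : ∑' x, ‖f x‖ ^ q ≤ M ^ q := by
    refine (hsum.tsum_le_tsum hbd (hf.mul_right _)).trans_eq ?_
    rw [tsum_mul_right, ← hMp, ← Real.rpow_add_of_nonneg hM0 hp.le (by linarith)]
    ring_nf
  calc ellNorm q f ≤ (M ^ q) ^ (1 / q) :=
        Real.rpow_le_rpow (tsum_nonneg fun x => Real.rpow_nonneg (norm_nonneg _) _) h1 (by positivity)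
    _ = M := by rw [← Real.rpow_mul hM0, mul_one_div_cancel hq.ne', Real.rpow_one]

section Corrector

variable {d n k : ℕ} {a : EuclideanSpace ℝ (Fin n) → Matrix (Fin d) (Fin d) ℝ} {lam Lam : ℝ}

lemma Elliptic.nearScalar_fieldCoef (hLam : 0 < Lam) (hle : lam ≤ Lam) (ha : Elliptic a lam Lam) :
    NearScalar (fieldCoef a) Lam (Lam / lam) :=
  fun ω ζ => ha.contraction hLam hle (ω 0) ζ

lemma Elliptic.nearScalar_latCoef (hLam : 0 < Lam) (hle : lam ≤ Lam) (ha : Elliptic a lam Lam) :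
    NearScalar (latCoef a) Lam (Lam / lam) :=
  fun p ζ => ha.contraction hLam hle (p.2 p.1) ζ

lemma measurable_latCoef (ha : Continuous a) (i l : Fin d) :
    Measurable fun p : Lattice d × FieldSpace d n => latCoef a p i l :=
  measurable_from_prod_countable_right fun x =>
    ((entryCLM i l).continuous.comp (ha.comp (continuous_apply x))).measurable

variable {P : Measure (FieldSpace d n)} {ξ : Fin d → ℝ} {η : ℝ}
  {Φ : FieldSpace d n → EuclideanSpace ℂ (Fin d)}

/-- The component of the corrector in the direction `v`. -/
noncomputable def corrDir (Φ : FieldSpace d n → EuclideanSpace ℂ (Fin d)) (v : Fin d → ℂ)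
    (ω : FieldSpace d n) : ℂ := ∑ j, Φ ω j * v j

lemma IsCorrector.memLp_corrDir (h : IsCorrector P a ξ η Φ) (v : Fin d → ℂ) :
    MemLp (corrDir Φ v) 2 P :=
  memLp_finsetSum _ fun j _ => (h.memLp.eval_piLp j).mul_const (v j)

lemma gradXi_mulVec (v : Fin d → ℂ) (ω : FieldSpace d n) (l : Fin d) :
    (gradXi ξ Φ ω *ᵥ v) l = twD unitShift (phase ξ) l (corrDir Φ v) ω := by
  simp only [Matrix.mulVec, dotProduct, gradXi, Matrix.of_apply, twD, corrDir, Finset.mul_sum,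
    ← Finset.sum_sub_distrib]
  refine Finset.sum_congr rfl fun j _ => ?_
  change (phase ξ l * Φ (shift (unitVec l) ω) j - Φ ω j) * v j =
    phase ξ l * (Φ (shift (unitVec l) ω) j * v j) - Φ ω j * v j
  ring

/-- The scalar corrector equation for the direction `v`. -/
lemma IsCorrector.twOp_corrDir (h : IsCorrector P a ξ η Φ) (v : Fin d → ℂ) :
    twOp unitShift (phase ξ) (phaseInv ξ) η (fieldCoef a) (corrDir Φ v) =ᵐ[P] fun ω =>
      -∑ i, twDstar unitShift (phaseInv ξ) i (fun ω => ∑ l, (a (ω 0) i l : ℂ) * v l) ω := by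
  filter_upwards [h.eqn] with ω hω
  have hflux : ∀ i ω', ∑ l, fieldCoef a ω' i l * twD unitShift (phase ξ) l (corrDir Φ v) ω' =
      ∑ j, (∑ l, (a (ω' 0) i l : ℂ) * gradXi ξ Φ ω' l j) * v j := by
    intro i ω'
    simp only [← gradXi_mulVec, Matrix.mulVec, dotProduct, Finset.mul_sum, Finset.sum_mul]
    rw [Finset.sum_comm]
    exact Finset.sum_congr rfl fun j _ => Finset.sum_congr rfl fun l _ => by
      simp only [fieldCoef, Matrix.map_apply]; ring
  have hlin : ∀ i (f : Fin d → FieldSpace d n → ℂ),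
      twDstar unitShift (phaseInv ξ) i (fun ω => ∑ j, f j ω * v j) ω =
      ∑ j, dXiStar ξ i (f j) ω * v j := by
    intro i f
    simp only [twDstar, Finset.mul_sum, ← Finset.sum_sub_distrib]
    refine Finset.sum_congr rfl fun j _ => ?_
    change phaseInv ξ i * (f j (shift (-unitVec i) ω) * v j) - f j ω * v j =
      (phaseInv ξ i * f j (shift (-unitVec i) ω) - f j ω) * v j
    ring
  have h1 : ∑ j, ((η : ℂ) * Φ ω j
      + ∑ i, dXiStar ξ i (fun ω' => ∑ l, (a (ω' 0) i l : ℂ) * gradXi ξ Φ ω' l j) ω) * v j =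
      ∑ j, (-∑ i, dXiStar ξ i (fun ω' => (a (ω' 0) i j : ℂ)) ω) * v j :=
    Finset.sum_congr rfl fun j _ => by rw [hω j]
  simp only [twOp, hflux, hlin]
  rw [corrDir, Finset.mul_sum, Finset.sum_comm, ← Finset.sum_add_distrib, Finset.sum_comm,
    ← Finset.sum_neg_distrib]
  simp only [add_mul, neg_mul, Finset.sum_mul] at h1
  simpa only [mul_assoc] using h1

/-- The energy estimate for the corrector: `⟨|∂_ξ φ + v|²⟩ ≤ (8 ρ² + 2) |v|²`. -/
lemma IsCorrector.integral_gradAdd_sq_le [IsProbabilityMeasure P] (hP : TranslationInvariant P)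
    (hlam : 0 < lam) (hle : lam ≤ Lam) (hη : 0 < η) (ha : Continuous a) (hE : Elliptic a lam Lam)
    (h : IsCorrector P a ξ η Φ) (v : EuclideanSpace ℂ (Fin d)) :
    ∫ ω, ‖gradAdd ξ v.ofLp (corrDir Φ v.ofLp) ω‖ ^ 2 ∂P ≤
      (8 * (Lam / lam) ^ 2 + 2) * ‖v‖ ^ 2 := by
  have hLam : 0 < Lam := hlam.trans_le hle
  have hρ : 1 ≤ Lam / lam := (one_le_div hlam).mpr hle
  set φ := corrDir Φ v.ofLp with hφdef
  have hφ : MemLp φ 2 P := h.memLp_corrDir v.ofLp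
  have hA := hE.nearScalar_fieldCoef (d := d) hLam hle
  have hAm := measurable_fieldCoef (d := d) ha
  set s : Fin d → FieldSpace d n → ℂ := fun i ω => -∑ l, (a (ω 0) i l : ℂ) * v l with hs
  have hv : ∑ l, ‖v l‖ ^ 2 = ‖v‖ ^ 2 := (EuclideanSpace.norm_sq_eq v).symm
  have hsm : ∀ i, MemLp (s i) 2 P := fun i =>
    (memLp_finsetSum _ fun l _ => ((hA.memLp hLam hρ hAm i l).mono_exponent le_top).mul_const
      (v l)).neg
  have hsb : ∀ ω, ∑ i, ‖s i ω‖ ^ 2 ≤ 4 * Lam ^ 2 * ‖v‖ ^ 2 := by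
    intro ω
    have h1 := hA ω v.ofLp
    have hρ1 : (Lam / lam)⁻¹ ≤ 1 := inv_le_one_of_one_le₀ hρ
    have hρ2 : 0 ≤ (Lam / lam)⁻¹ := by positivity
    have h2 : ∀ i, ‖s i ω‖ ^ 2 ≤ Lam ^ 2 * (2 * ‖v i‖ ^ 2 +
        2 * ‖v i - (Lam : ℂ)⁻¹ * ∑ l, fieldCoef a ω i l * v l‖ ^ 2) := by
      intro i
      have h3 : s i ω = Lam * ((v i - (Lam : ℂ)⁻¹ * ∑ l, fieldCoef a ω i l * v l) - v i) := by
        have hLc : (Lam : ℂ) ≠ 0 := by exact_mod_cast hLam.ne'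
        simp only [hs, fieldCoef, Matrix.map_apply]
        field_simp
        ring
      rw [h3, norm_mul, mul_pow, Complex.norm_real, Real.norm_of_nonneg hLam.le]
      gcongr
      have h4 := norm_sub_le (v i - (Lam : ℂ)⁻¹ * ∑ l, fieldCoef a ω i l * v l) (v i)
      nlinarith [sq_nonneg (‖v i - (Lam : ℂ)⁻¹ * ∑ l, fieldCoef a ω i l * v l‖ - ‖v i‖),
        norm_nonneg (v i - (Lam : ℂ)⁻¹ * ∑ l, fieldCoef a ω i l * v l - v i),
        norm_nonneg (v i - (Lam : ℂ)⁻¹ * ∑ l, fieldCoef a ω i l * v l), norm_nonneg (v i)]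
    refine (Finset.sum_le_sum fun i _ => h2 i).trans ?_
    rw [← Finset.mul_sum, Finset.sum_add_distrib, ← Finset.mul_sum, ← Finset.mul_sum, hv]
    rw [hv] at h1
    have h5 : (1 - (Lam / lam)⁻¹) ^ 2 * ‖v‖ ^ 2 ≤ 1 * ‖v‖ ^ 2 := by
      gcongr
      exact pow_le_one₀ (by linarith) (by linarith)
    have h6 : Lam ^ 2 * (2 * ‖v‖ ^ 2 + 2 * ∑ i, ‖v i - (Lam : ℂ)⁻¹ *
        ∑ l, fieldCoef a ω i l * v l‖ ^ 2) ≤ Lam ^ 2 * (2 * ‖v‖ ^ 2 + 2 * (1 * ‖v‖ ^ 2)) := by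
      gcongr
      exact h1.trans h5
    linarith
  have heq : twOp unitShift (phase ξ) (phaseInv ξ) η (fieldCoef a) φ =ᵐ[P]
      fun ω => ∑ i, twDstar unitShift (phaseInv ξ) i (s i) ω := by
    filter_upwards [h.twOp_corrDir v.ofLp] with ω hω
    rw [hω, ← Finset.sum_neg_distrib]
    refine Finset.sum_congr rfl fun i _ => ?_
    simp only [twDstar, hs]; ring
  have hen := integral_twD_sq_le hη hLam hρ hA hAm (measurePreserving_unitShift hP) (norm_phase ξ)
    (phase_mul_phaseInv ξ) hsm hφ heq
  have hDi := fun i => integrable_sq_of_memLp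
    (memLp_twD (c := phase ξ) (measurePreserving_unitShift hP) hφ i)
  rw [← integral_finsetSum _ fun i _ => hDi i,
    ← integral_finsetSum _ fun i _ => integrable_sq_of_memLp (hsm i)] at hen
  have h7 : ∫ ω, ∑ i, ‖s i ω‖ ^ 2 ∂P ≤ 4 * Lam ^ 2 * ‖v‖ ^ 2 := by
    refine (integral_mono (integrable_finsetSum _ fun i _ => integrable_sq_of_memLp (hsm i))
      (integrable_const _) hsb).trans ?_
    simp
  have h8 : ∀ ω, ‖gradAdd ξ v.ofLp φ ω‖ ^ 2 ≤
      2 * ∑ i, ‖twD unitShift (phase ξ) i φ ω‖ ^ 2 + 2 * ‖v‖ ^ 2 := by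
    intro ω
    rw [EuclideanSpace.norm_sq_eq, ← hv, Finset.mul_sum, Finset.mul_sum, ← Finset.sum_add_distrib]
    refine Finset.sum_le_sum fun i _ => ?_
    have h9 := norm_add_le (twD unitShift (phase ξ) i φ ω) (v i)
    change ‖twD unitShift (phase ξ) i φ ω + v i‖ ^ 2 ≤ _
    nlinarith [sq_nonneg (‖twD unitShift (phase ξ) i φ ω‖ - ‖v i‖), norm_nonneg (v i),
      norm_nonneg (twD unitShift (phase ξ) i φ ω), norm_nonneg (twD unitShift (phase ξ) i φ ω + v i)]
  have hGi := (memLp_two_iff_integrable_sq_norm (memLp_gradAdd ξ v.ofLp hP hφ).1).mp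
    (memLp_gradAdd ξ v.ofLp hP hφ)
  refine (integral_mono hGi (((integrable_finsetSum _ fun i _ => hDi i).const_mul 2).add
    (integrable_const _)) h8).trans ?_
  rw [integral_add' ((integrable_finsetSum _ fun i _ => hDi i).const_mul 2) (integrable_const _),
    integral_const_mul]
  have h10 : (Lam / lam / Lam) ^ 2 * ∫ ω, ∑ i, ‖s i ω‖ ^ 2 ∂P ≤
      (Lam / lam / Lam) ^ 2 * (4 * Lam ^ 2 * ‖v‖ ^ 2) := by gcongr
  have h11 : (Lam / lam / Lam) ^ 2 * (4 * Lam ^ 2 * ‖v‖ ^ 2) = 4 * (Lam / lam) ^ 2 * ‖v‖ ^ 2 := by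
    field_simp
  simp only [integral_const, probReal_univ, one_smul]
  linarith

end Corrector

end RandomEnv

namespace RandomEnv

/-! ### The variance of combinations of translates -/

section Combination

variable {d n k : ℕ} {ξ : Fin d → ℝ} {g : Lattice d → Matrix (Fin d) (Fin d) ℂ}
  {G : Finset (Lattice d)}

/-- The combination `∑_{x ∈ G} g(x) ∂_ξ φ(τ_x ω)` of translates of a twisted gradient. -/
noncomputable def comb (ξ : Fin d → ℝ) (g : Lattice d → Matrix (Fin d) (Fin d) ℂ)
    (G : Finset (Lattice d)) (φ : FieldSpace d n → ℂ) (ω : FieldSpace d n) :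
    EuclideanSpace ℂ (Fin d) :=
  ∑ x ∈ G, WithLp.toLp 2 (g x *ᵥ fun l => twD unitShift (phase ξ) l φ (shift x ω))

/-- The components of the derivative of `comb`. -/
noncomputable def combDeriv (ξ : Fin d → ℝ) (g : Lattice d → Matrix (Fin d) (Fin d) ℂ)
    (G : Finset (Lattice d)) (δ : FieldSpace d n × FieldSpace d n → ℂ) (i : Fin d)
    (p : FieldSpace d n × FieldSpace d n) : ℂ :=
  ∑ x ∈ G, ∑ l, g x i l * twD unitShift₂ (phase ξ) l δ (shiftEquiv₂ x p)

lemma comb_apply (φ : FieldSpace d n → ℂ) (ω : FieldSpace d n) (i : Fin d) :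
    comb ξ g G φ ω i = ∑ x ∈ G, ∑ l, g x i l * twD unitShift (phase ξ) l φ (shift x ω) := by
  simp [comb, Matrix.mulVec, dotProduct]

lemma smoothFunctional_comb {φ : FieldSpace d n → ℂ} {δ : FieldSpace d n × FieldSpace d n → ℂ}
    (h : SmoothFunctional φ δ) (i : Fin d) :
    SmoothFunctional (fun ω => comb ξ g G φ ω i) (combDeriv ξ g G δ i) := by
  simp only [comb_apply]
  exact SmoothFunctional.sum G fun x _ => SmoothFunctional.sum Finset.univ fun l _ =>
    ((h.twD unitVec (phase ξ) l).comp_shift x).const_mul (g x i l)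

lemma norm_toLp_mulVec_le (M : Matrix (Fin d) (Fin d) ℂ) (w : EuclideanSpace ℂ (Fin d)) :
    ‖(WithLp.toLp 2 (M *ᵥ w.ofLp) : EuclideanSpace ℂ (Fin d))‖ ≤ ‖M‖ * ‖w‖ :=
  Matrix.l2_opNorm_mulVec M w

/-- Translation turns the derivative of `comb` into lattice gradients of the lifted derivative. -/
lemma combDeriv_shift (δ : FieldSpace d n × FieldSpace d n → ℂ) (θ : FieldSpace d n)
    (y : Lattice d) (ω : FieldSpace d n) (i : Fin d) :
    combDeriv ξ g G δ i (shift (-y) ω, shift (-y) θ) =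
      (∑ x ∈ G, sitePhase ξ (-(x - y)) • WithLp.toLp 2
        (g x *ᵥ (latGrad (lift ξ θ δ) (x - y, ω)).ofLp) : EuclideanSpace ℂ (Fin d)) i := by
  simp only [combDeriv, WithLp.ofLp_sum, Finset.sum_apply, PiLp.smul_apply, Matrix.mulVec,
    dotProduct, smul_eq_mul]
  refine Finset.sum_congr rfl fun x _ => ?_
  rw [Finset.mul_sum]
  refine Finset.sum_congr rfl fun l _ => ?_
  have h1 : (latGrad (lift ξ θ δ) (x - y, ω)).ofLp l =
      lift ξ θ (twD unitShift₂ (phase ξ) l δ) (x - y, ω) := by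
    rw [← twD_lift]; rfl
  have h2 : sitePhase ξ (-(x - y)) * sitePhase ξ (x - y) = 1 := by
    rw [← sitePhase_add, neg_add_cancel, sitePhase]; simp
  have h3 : shiftEquiv₂ x (shift (-y) ω, shift (-y) θ) = (shift (x - y) ω, shift (x - y) θ) := by
    change (shift x (shift (-y) ω), shift x (shift (-y) θ)) = _
    rw [shift_shift, shift_shift, sub_eq_add_neg]
  rw [h1, lift, h3]
  linear_combination (-g x i l * twD unitShift₂ (phase ξ) l δ (shift (x - y) ω, shift (x - y) θ)) * h2

lemma column_eq_shift (h : Lattice d → Matrix (Fin n) (Fin k) ℝ) (y : Lattice d) (j : Fin k) :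
    column h y j = shift (-y) (column h 0 j) := by
  rw [← column_shift h y j, shift_shift, neg_add_cancel, shift_zero]

lemma sqSummable_column {h : Lattice d → Matrix (Fin n) (Fin k) ℝ}
    (hh : Summable fun y => ‖h y‖ ^ 2) (j : Fin k) :
    Summable fun x => ‖column h 0 j x‖ ^ 2 := by
  refine Summable.of_nonneg_of_le (fun _ => sq_nonneg _) (fun x => ?_) hh
  gcongr
  simpa using norm_column_le h 0 j x

variable {P : Measure (FieldSpace d n)} [IsProbabilityMeasure P]

/-- The derivative of `comb` in a direction translated by `y`, by Minkowski's inequality in `L²`. -/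
lemma sum_integral_combDeriv_le (hP : TranslationInvariant P)
    {φ : FieldSpace d n → ℂ} {δ : FieldSpace d n × FieldSpace d n → ℂ} (hs : SmoothFunctional φ δ)
    {θ : FieldSpace d n} (hθ : Summable fun x => ‖θ x‖ ^ 2) (y : Lattice d) :
    ∑ i, ∫ ω, ‖combDeriv ξ g G δ i (ω, shift (-y) θ)‖ ^ 2 ∂P ≤
      (∑ x ∈ G, ‖g x‖ * ‖(memLp_latGrad_slice (hs.memLp_lift (ξ := ξ) (P := P) hθ)
        (x - y)).toLp _‖) ^ 2 := by
  have hu := hs.memLp_lift (ξ := ξ) (P := P) hθ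
  have hc : ∀ i, Continuous fun ω => combDeriv ξ g G δ i (ω, shift (-y) θ) := fun i =>
    (smoothFunctional_comb hs i).continuous_deriv.comp (continuous_id.prodMk continuous_const)
  have h1 : ∀ i, ∫ ω, ‖combDeriv ξ g G δ i (ω, shift (-y) θ)‖ ^ 2 ∂P =
      ∫ ω, ‖combDeriv ξ g G δ i (shift (-y) ω, shift (-y) θ)‖ ^ 2 ∂P := fun i =>
    (MeasurePreserving.integral_comp_ae (hP (-y))
      (g := fun ω => ‖combDeriv ξ g G δ i (ω, shift (-y) θ)‖ ^ 2)
      ((hc i).norm.pow 2).aestronglyMeasurable).symm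
  let f : Lattice d → FieldSpace d n → EuclideanSpace ℂ (Fin d) := fun x ω =>
    sitePhase ξ (-(x - y)) • WithLp.toLp 2 (g x *ᵥ (latGrad (lift ξ θ δ) (x - y, ω)).ofLp)
  have hfn : ∀ x ω, ‖f x ω‖ ≤ ‖g x‖ * ‖latGrad (lift ξ θ δ) (x - y, ω)‖ := by
    intro x ω
    rw [norm_smul, norm_sitePhase, one_mul]
    exact norm_toLp_mulVec_le _ _
  have hfm : ∀ x, MemLp (f x) 2 P := by
    intro x
    have hm := (memLp_latGrad_slice hu (x - y)).1
    have hc1 : Continuous fun w : EuclideanSpace ℂ (Fin d) =>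
        (WithLp.toLp 2 (g x *ᵥ w.ofLp) : EuclideanSpace ℂ (Fin d)) :=
      (PiLp.continuous_toLp 2 _).comp (Continuous.matrix_mulVec continuous_const
        (PiLp.continuous_ofLp 2 _))
    have hc : Continuous fun w : EuclideanSpace ℂ (Fin d) => sitePhase ξ (-(x - y)) •
        (WithLp.toLp 2 (g x *ᵥ w.ofLp) : EuclideanSpace ℂ (Fin d)) :=
      (continuous_const_smul (sitePhase ξ (-(x - y)))).comp hc1
    exact (memLp_latGrad_slice hu (x - y)).of_le_mul (hc.comp_aestronglyMeasurable hm)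
      (ae_of_all _ fun ω => hfn x ω)
  have hfL : ∀ x, ‖(hfm x).toLp _‖ ≤ ‖g x‖ * ‖(memLp_latGrad_slice hu (x - y)).toLp _‖ := by
    intro x
    refine Lp.norm_le_mul_norm_of_ae_le_mul ?_
    filter_upwards [(hfm x).coeFn_toLp, (memLp_latGrad_slice hu (x - y)).coeFn_toLp] with ω e1 e2
    rw [e1, e2]
    exact hfn x ω
  have hsumm : MemLp (fun ω => ∑ x ∈ G, f x ω) 2 P := memLp_finsetSum _ fun x _ => hfm x
  have hsumL : hsumm.toLp _ = ∑ x ∈ G, (hfm x).toLp _ := by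
    refine Lp.ext ?_
    have h2 : ∀ᵐ ω ∂P, ∀ x, (hfm x).toLp _ ω = f x ω := by
      rw [ae_all_iff]; exact fun x => (hfm x).coeFn_toLp
    filter_upwards [Lp.coeFn_finsetSum G fun x => (hfm x).toLp _, h2, hsumm.coeFn_toLp] with ω h3 h2 h4
    rw [h3, h4, Finset.sum_apply]
    exact Finset.sum_congr rfl fun x _ => (h2 x).symm
  have h5 : ∑ i, ∫ ω, ‖combDeriv ξ g G δ i (ω, shift (-y) θ)‖ ^ 2 ∂P = ‖hsumm.toLp _‖ ^ 2 := by
    rw [norm_toLp_sq]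
    simp only [h1, combDeriv_shift, EuclideanSpace.norm_sq_eq]
    rw [integral_finsetSum]
    intro i _
    exact integrable_sq_of_memLp (hsumm.eval_piLp i)
  rw [h5, hsumL]
  gcongr
  exact (norm_sum_le _ _).trans (Finset.sum_le_sum fun x _ => hfL x)

/-- The variance of a combination of translates of the gradient of a smooth functional is bounded by
a convolution of the norms of the coefficients and of the lifted derivative. -/
lemma variance_comb_le {Pt : Measure (FieldSpace d k)} [IsProbabilityMeasure Pt] {m : ℝ}
    (hm : 0 < m) (hPo : Poincare Pt m) {h : Lattice d → Matrix (Fin n) (Fin k) ℝ}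
    (hh : Summable fun y => ‖h y‖ ^ 2) {W : FieldSpace d k → FieldSpace d n}
    (hW : IsConvolution Pt h W) (hPW : P = Pt.map W) (hP : TranslationInvariant P)
    {φ : FieldSpace d n → ℂ} {δ : FieldSpace d n × FieldSpace d n → ℂ} (hs : SmoothFunctional φ δ)
    {M : Fin k → ℝ} (hM : ∀ j (Y : Finset (Lattice d)), ∑ y ∈ Y, (∑ x ∈ G, ‖g x‖ *
      ‖(memLp_latGrad_slice (hs.memLp_lift (ξ := ξ) (P := P) (sqSummable_column hh j))
        (x - y)).toLp _‖) ^ 2 ≤ M j) :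
    ∫ ω, ‖proj P (comb ξ g G φ) ω‖ ^ 2 ∂P ≤ 1 / m ^ 2 * ∑ j, M j := by
  have hsm := fun i => smoothFunctional_comb (ξ := ξ) (g := g) (G := G) hs i
  have hmem : MemLp (comb ξ g G φ) 2 P := MemLp.of_eval_piLp fun i => (hsm i).memLp P 2
  have hint : Integrable (comb ξ g G φ) P := hmem.integrable one_le_two
  have hproj : ∀ ω i, proj P (comb ξ g G φ) ω i =
      comb ξ g G φ ω i - ∫ ω', comb ξ g G φ ω' i ∂P := by
    intro ω i
    have := (EuclideanSpace.proj (𝕜 := ℂ) i).integral_comp_comm hint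
    simp only [proj, PiLp.sub_apply]
    congr 1
    exact this.symm
  have hvar := fun i => variance_smoothFunctional_le hm hPo hh hW (hsm i)
  rw [← hPW] at hvar
  have h1 : ∫ ω, ‖proj P (comb ξ g G φ) ω‖ ^ 2 ∂P =
      ∑ i, ∫ ω, ‖comb ξ g G φ ω i - ∫ ω', comb ξ g G φ ω' i ∂P‖ ^ 2 ∂P := by
    simp only [EuclideanSpace.norm_sq_eq, hproj]
    exact integral_finsetSum _ fun i _ =>
      integrable_sq_of_memLp (((hsm i).memLp P 2).sub (memLp_const _))
  rw [h1]
  refine (Finset.sum_le_sum fun i _ => (hvar i).2).trans ?_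
  rw [← Finset.mul_sum, ← Summable.tsum_finsetSum fun i _ => (hvar i).1]
  gcongr
  refine Real.tsum_le_of_sum_le (fun y => Finset.sum_nonneg fun i _ => Finset.sum_nonneg fun j _ =>
    integral_nonneg fun _ => sq_nonneg _) fun Y => ?_
  calc ∑ y ∈ Y, ∑ i, ∑ j, ∫ ω, ‖combDeriv ξ g G δ i (ω, column h y j)‖ ^ 2 ∂P
      = ∑ j, ∑ y ∈ Y, ∑ i, ∫ ω, ‖combDeriv ξ g G δ i (ω, column h y j)‖ ^ 2 ∂P := by
        rw [Finset.sum_comm' (s := Finset.univ) (t := fun _ => Y) (t' := Y)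
          (s' := fun _ => Finset.univ) (by simp)]
        exact Finset.sum_congr rfl fun y _ => Finset.sum_comm
    _ ≤ ∑ j, M j := by
        refine Finset.sum_le_sum fun j _ => le_trans (Finset.sum_le_sum fun y _ => ?_) (hM j Y)
        rw [column_eq_shift]
        exact sum_integral_combDeriv_le hP hs (sqSummable_column hh j) y

end Combination

end RandomEnv

namespace RandomEnv

/-! ### The bound for finite sums -/

section Convergence

variable {d n k : ℕ} {ξ : Fin d → ℝ} {g : Lattice d → Matrix (Fin d) (Fin d) ℂ}
  {G : Finset (Lattice d)} {P : Measure (FieldSpace d n)} [IsProbabilityMeasure P]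

lemma eLpNorm_proj_le {Ω E : Type*} [MeasurableSpace Ω] [NormedAddCommGroup E] [NormedSpace ℝ E]
    {P : Measure Ω} [IsProbabilityMeasure P] {X : Ω → E} (hX : MemLp X 2 P) :
    eLpNorm (proj P X) 2 P ≤ 2 * eLpNorm X 2 P := by
  refine (eLpNorm_sub_le hX.1 aestronglyMeasurable_const one_le_two).trans ?_
  rw [two_mul]
  gcongr
  rw [eLpNorm_const _ two_ne_zero (NeZero.ne P), measure_univ, ENNReal.one_rpow, mul_one]
  refine (enorm_integral_le_lintegral_enorm X).trans ?_
  rw [← eLpNorm_one_eq_lintegral_enorm]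
  exact eLpNorm_le_eLpNorm_of_exponent_le one_le_two hX.1

lemma norm_comb_le (φ : FieldSpace d n → ℂ) (ω : FieldSpace d n) :
    ‖comb ξ g G φ ω‖ ≤ ∑ x ∈ G, ‖g x‖ * ‖gradAdd ξ 0 φ (shift x ω)‖ := by
  refine (norm_sum_le _ _).trans (Finset.sum_le_sum fun x _ => ?_)
  have : (fun l => twD unitShift (phase ξ) l φ (shift x ω)) = (gradAdd ξ 0 φ (shift x ω)).ofLp := by
    funext l; simp [gradAdd]
  rw [this]
  exact norm_toLp_mulVec_le _ _

omit [IsProbabilityMeasure P] in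
lemma memLp_comb (hP : TranslationInvariant P) {φ : FieldSpace d n → ℂ} (hφ : MemLp φ 2 P) :
    MemLp (comb ξ g G φ) 2 P := by
  refine MemLp.of_eval_piLp fun i => ?_
  simp only [comb_apply]
  exact memLp_finsetSum _ fun x _ => memLp_finsetSum _ fun l _ =>
    ((memLp_twD (measurePreserving_unitShift hP) hφ l).comp_measurePreserving (hP x)).const_mul _

lemma eLpNorm_gradAdd_zero_le (hP : TranslationInvariant P) {φ : FieldSpace d n → ℂ}
    (hφ : MemLp φ 2 P) :
    eLpNorm (gradAdd ξ 0 φ) 2 P ≤ ENNReal.ofReal √(4 * d) * eLpNorm φ 2 P := by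
  rw [eLpNorm_two_eq (memLp_gradAdd ξ 0 hP hφ), eLpNorm_two_eq hφ,
    ← ENNReal.ofReal_mul (Real.sqrt_nonneg _), ← Real.sqrt_mul (by positivity)]
  refine ENNReal.ofReal_le_ofReal (Real.sqrt_le_sqrt ?_)
  refine le_trans (le_of_eq ?_) (sum_integral_twD_sq_le (measurePreserving_unitShift hP)
    (norm_phase ξ) hφ)
  rw [← integral_finsetSum _ fun l _ => integrable_sq_of_memLp
    (memLp_twD (measurePreserving_unitShift hP) hφ l)]
  refine integral_congr_ae (ae_of_all _ fun ω => ?_)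
  simp [gradAdd, EuclideanSpace.norm_sq_eq]

lemma eLpNorm_comb_le (hP : TranslationInvariant P) {φ : FieldSpace d n → ℂ} (hφ : MemLp φ 2 P) :
    eLpNorm (comb ξ g G φ) 2 P ≤
      ENNReal.ofReal ((∑ x ∈ G, ‖g x‖) * √(4 * d)) * eLpNorm φ 2 P := by
  have hG := memLp_gradAdd ξ 0 hP hφ
  have hGx : ∀ x, MemLp (fun ω => ‖g x‖ * ‖gradAdd ξ 0 φ (shift x ω)‖) 2 P := fun x =>
    (hG.norm.comp_measurePreserving (hP x)).const_mul _
  have h1 : eLpNorm (comb ξ g G φ) 2 P ≤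
      eLpNorm (∑ x ∈ G, fun ω => ‖g x‖ * ‖gradAdd ξ 0 φ (shift x ω)‖) 2 P := by
    refine eLpNorm_mono fun ω => (norm_comb_le φ ω).trans ?_
    rw [Finset.sum_apply]
    exact Real.le_norm_self _
  refine h1.trans ((eLpNorm_sum_le (fun x _ => (hGx x).1) one_le_two).trans ?_)
  have h2 : ∀ x, eLpNorm (fun ω => ‖g x‖ * ‖gradAdd ξ 0 φ (shift x ω)‖) 2 P ≤
      ENNReal.ofReal (‖g x‖ * √(4 * d)) * eLpNorm φ 2 P := by
    intro x
    have h3 : eLpNorm (fun ω => ‖gradAdd ξ 0 φ (shift x ω)‖) 2 P = eLpNorm (gradAdd ξ 0 φ) 2 P := by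
      rw [eLpNorm_norm (fun ω => gradAdd ξ 0 φ (shift x ω))]
      exact eLpNorm_comp_measurePreserving hG.1 (hP x)
    refine (eLpNorm_const_smul_le (c := ‖g x‖)
      (f := fun ω => ‖gradAdd ξ 0 φ (shift x ω)‖)).trans ?_
    rw [h3, enorm_norm, ENNReal.ofReal_mul (norm_nonneg _), ofReal_norm, mul_assoc]
    gcongr
    exact eLpNorm_gradAdd_zero_le hP hφ
  refine (Finset.sum_le_sum fun x _ => h2 x).trans_eq ?_
  rw [← Finset.sum_mul, ← ENNReal.ofReal_sum_of_nonneg fun x _ => by positivity, Finset.sum_mul]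

lemma comb_sub (φ φ' : FieldSpace d n → ℂ) (ω : FieldSpace d n) :
    comb ξ g G (fun ω => φ ω - φ' ω) ω = comb ξ g G φ ω - comb ξ g G φ' ω := by
  ext i
  rw [PiLp.sub_apply, comb_apply, comb_apply, comb_apply, ← Finset.sum_sub_distrib]
  refine Finset.sum_congr rfl fun x _ => ?_
  rw [← Finset.sum_sub_distrib]
  exact Finset.sum_congr rfl fun l _ => by simp only [twD]; ring

/-- Convolution with finitely supported coefficients, for a perturbed function: if `k' ≤ k + e` then
the square sum of `g * k'` is controlled by that of `g * k` and by the square sum of `e`. -/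
lemma sum_conv_sq_le {L : Type*} [AddCommGroup L] (G Y : Finset L) {γ k k' e : L → ℝ}
    (hγ : ∀ x, 0 ≤ γ x) (hk' : ∀ x, 0 ≤ k' x) (hle : ∀ x, k' x ≤ k x + e x) {M ε : ℝ}
    (hM : ∑ y ∈ Y, (∑ x ∈ G, γ x * k (x - y)) ^ 2 ≤ M)
    (hε : ∀ Z : Finset L, ∑ z ∈ Z, e z ^ 2 ≤ ε) :
    ∑ y ∈ Y, (∑ x ∈ G, γ x * k' (x - y)) ^ 2 ≤ 2 * M + 2 * ((∑ x ∈ G, γ x ^ 2) * (G.card * ε)) := by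
  classical
  have h1 : ∀ y, (∑ x ∈ G, γ x * k' (x - y)) ^ 2 ≤ 2 * (∑ x ∈ G, γ x * k (x - y)) ^ 2 +
      2 * ((∑ x ∈ G, γ x ^ 2) * ∑ x ∈ G, e (x - y) ^ 2) := by
    intro y
    have h2 : ∑ x ∈ G, γ x * k' (x - y) ≤
        ∑ x ∈ G, γ x * k (x - y) + ∑ x ∈ G, γ x * e (x - y) := by
      rw [← Finset.sum_add_distrib]
      refine Finset.sum_le_sum fun x _ => ?_
      rw [← mul_add]
      exact mul_le_mul_of_nonneg_left (hle _) (hγ x)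
    have h3 : 0 ≤ ∑ x ∈ G, γ x * k' (x - y) :=
      Finset.sum_nonneg fun x _ => mul_nonneg (hγ x) (hk' _)
    have h4 := Finset.sum_mul_sq_le_sq_mul_sq G γ fun x => e (x - y)
    have h5 := pow_le_pow_left₀ h3 h2 2
    nlinarith [sq_nonneg (∑ x ∈ G, γ x * k (x - y) - ∑ x ∈ G, γ x * e (x - y))]
  refine (Finset.sum_le_sum fun y _ => h1 y).trans ?_
  rw [Finset.sum_add_distrib, ← Finset.mul_sum, ← Finset.mul_sum, ← Finset.mul_sum, Finset.sum_comm]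
  have h6 : ∑ x ∈ G, ∑ y ∈ Y, e (x - y) ^ 2 ≤ G.card * ε := by
    rw [← nsmul_eq_mul]
    refine Finset.sum_le_card_nsmul _ _ _ fun x _ => ?_
    have := hε (Y.image fun y => x - y)
    rwa [Finset.sum_image fun a _ b _ hab => by simpa using hab] at this
  have h7 : 0 ≤ ∑ x ∈ G, γ x ^ 2 := Finset.sum_nonneg fun _ _ => sq_nonneg _
  have h8 := mul_le_mul_of_nonneg_left h6 h7
  linarith

end Convergence

set_option maxHeartbeats 1000000 in
/-- The bound for finite sums, uniform in the summation set `G`. The Poincaré inequality applies to the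
steps of the gradient descent only, the `ℓ^q` bound to the limit of their derivatives only. The
difference is small in `ℓ²`, and since `G` is finite this suffices to pass to the limit. -/
theorem exists_finite_bound (d : ℕ) (hd : 0 < d) {ρ p₀ : ℝ} (hρ : 1 ≤ ρ) (hp₀ : 1 ≤ p₀)
    (hp₀' : p₀ < 2) : ∃ p₁ C : ℝ, 1 < p₁ ∧ p₁ < 2 ∧ 0 ≤ C ∧
    ∀ (n k : ℕ) (lam Lam : ℝ), 0 < lam → 0 < Lam → Lam / lam = ρ →
      ∀ (a : EuclideanSpace ℝ (Fin n) → Matrix (Fin d) (Fin d) ℝ),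
        ContDiff ℝ 1 a → Elliptic a lam Lam →
        BddAbove (Set.range fun s => ‖fderiv ℝ a s‖) →
      ∀ (m : ℝ), 0 < m →
      ∀ (Pt : Measure (FieldSpace d k)) [IsProbabilityMeasure Pt], Poincare Pt m →
      ∀ (h : Lattice d → Matrix (Fin n) (Fin k) ℝ), Summable (fun y => ‖h y‖ ^ p₀) →
      ∀ (W : FieldSpace d k → FieldSpace d n), IsConvolution Pt h W →
      ∀ (P : Measure (FieldSpace d n)) [IsProbabilityMeasure P], P = Pt.map W →
        TranslationInvariant P →
      ∀ (ξ : Fin d → ℝ) (η : ℝ), 0 < η →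
      ∀ (Φ : FieldSpace d n → EuclideanSpace ℂ (Fin d)), IsCorrector P a ξ η Φ →
      ∀ (g : Lattice d → Matrix (Fin d) (Fin d) ℂ) (G : Finset (Lattice d))
        (v : EuclideanSpace ℂ (Fin d)),
        eLpNorm (proj P (comb ξ g G (corrDir Φ v.ofLp))) 2 P ≤
          ENNReal.ofReal (√(2 * k) * C * derivSup a * ‖v‖ / (m * Lam) * ellNorm p₀ h *
            (∑ x ∈ G, ‖g x‖ ^ p₁) ^ (1 / p₁)) := by
  obtain ⟨q, C, hq1, hq2, hC, hI⟩ := exists_lq_bound d hd hρ hp₀ hp₀'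
  have hp0 : 0 < p₀ := by linarith
  have hq0 : 0 < q := by linarith
  have hqa : 1 / 2 < 1 / q := one_div_lt_one_div_of_lt hq0 hq2
  have hqb : 1 / q < 1 := by rw [div_lt_one hq0]; exact hq1
  -- the exponent from Young's inequality
  set p₁ : ℝ := 1 / (3 / 2 - 1 / q) with hp₁
  have hp₁i : 1 / p₁ = 3 / 2 - 1 / q := by rw [hp₁, one_div_one_div]
  have hp₁1 : 1 < p₁ := by rw [hp₁, lt_div_iff₀ (by linarith)]; linarith
  have hp₁2 : p₁ < 2 := by rw [hp₁, div_lt_iff₀ (by linarith)]; linarith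
  refine ⟨p₁, C * √(8 * ρ ^ 2 + 2), hp₁1, hp₁2, by positivity, ?_⟩
  intro n k lam Lam hlam hLam hratio a ha hE hD m hm Pt _ hPo h hh W hW P _ hPW hP ξ η hη Φ hΦ g G v
  have hle : lam ≤ Lam := by rw [← one_le_div hlam, hratio]; exact hρ
  have hA := hE.nearScalar_fieldCoef (d := d) hLam hle
  have hA' := hE.nearScalar_latCoef (d := d) hLam hle
  rw [hratio] at hA hA'
  have hAm := measurable_latCoef (d := d) ha.continuous
  have hh2 : Summable fun y => ‖h y‖ ^ 2 := by
    simpa using (summable_rpow_and_ellNorm_le hp0 hp₀'.le hh).1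
  set D := derivSup a with hDdef
  have hD0 : 0 ≤ D := (norm_nonneg (fderiv ℝ a 0)).trans (le_ciSup hD 0)
  -- the step of the gradient descent
  set κ : ℝ := η / (η + 2 * Lam * (4 * d)) ^ 2 with hκ
  have hden : 0 < η + 2 * Lam * (4 * d) := by positivity
  have hκ0 : 0 < κ := by positivity
  have hκ1 : κ * (η + 2 * Lam * (4 * d)) ^ 2 ≤ η := by
    rw [hκ, div_mul_cancel₀ _ (by positivity)]
  have hent : ∀ s i l, |a s i l| ≤ 2 * Lam := by
    intro s i l
    have := hA.norm_entry_le hLam hρ (fun _ => s) i l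
    rwa [fieldCoef, Matrix.map_apply, Complex.norm_real] at this
  have hsm := smoothFunctional_iter ξ v.ofLp η κ ha hent hD
  set φ := corrDir Φ v.ofLp with hφdef
  have hφ : MemLp φ 2 P := hΦ.memLp_corrDir v.ofLp
  have hlim := tendsto_iter ξ v.ofLp η κ hP hη hLam hρ ha.continuous hA hκ0 hκ1
    (fun N => (hsm N).memLp P 2) hφ (hΦ.twOp_corrDir v.ofLp)
  have hθ := fun j : Fin k => sqSummable_column hh2 j
  have hsrc : ∀ j i, MemLp (fun p => -lift ξ (column h 0 j) (coefDeriv a ξ v.ofLp φ i) p) 2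
      (Measure.count.prod P) := fun j i => (memLp_lift_coefDeriv ha hD hP (hθ j) hφ i).neg
  have hex := fun j => exists_solvesLat hη hLam hρ hA' hAm (hsrc j)
  choose u hu husol using hex
  -- the bound in `ℓ^q` for the linearized equation
  set K := √(8 * ρ ^ 2 + 2) * ‖v‖ with hK
  have hK0 : 0 ≤ K := by positivity
  set R := C / Lam * (D * K * ellNorm p₀ h) with hR
  have hnh : 0 ≤ ellNorm p₀ h := Real.rpow_nonneg (tsum_nonneg fun _ =>
    Real.rpow_nonneg (norm_nonneg _) _) _
  have hR0 : 0 ≤ R := by positivity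
  have hkq : ∀ j (Z : Finset (Lattice d)),
      ∑ z ∈ Z, ‖(memLp_latGrad_slice (hu j) z).toLp _‖ ^ q ≤ R ^ q := by
    intro j Z
    have hpow : ∀ z, (D * K * ‖h z‖) ^ p₀ = (D * K) ^ p₀ * ‖h z‖ ^ p₀ := fun z =>
      Real.mul_rpow (by positivity) (norm_nonneg _)
    have h1 := hI _ P (latCoef a) η Lam _ (u j) (fun z => D * K * ‖h z‖) hη hLam hA' hAm (hsrc j)
      (hu j) (husol j) (fun z => by positivity) (fun z => ?_) (by
        simp only [hpow]; exact hh.mul_left _) Z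
    · have h2 : (∑' z, (D * K * ‖h z‖) ^ p₀) ^ (1 / p₀) = D * K * ellNorm p₀ h := by
        simp only [hpow]
        rw [tsum_mul_left, Real.mul_rpow (by positivity) (tsum_nonneg fun _ =>
          Real.rpow_nonneg (norm_nonneg _) _), ← Real.rpow_mul (by positivity),
          mul_one_div_cancel hp0.ne', Real.rpow_one]
        rfl
      rw [h2, ← hR] at h1
      have h3 : 0 ≤ ∑ z ∈ Z, ‖(memLp_latGrad_slice (hu j) z).toLp _‖ ^ q :=
        Finset.sum_nonneg fun _ _ => Real.rpow_nonneg (norm_nonneg _) _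
      have h4 := Real.rpow_le_rpow (Real.rpow_nonneg h3 _) h1 hq0.le
      rwa [← Real.rpow_mul h3, one_div_mul_cancel hq0.ne', Real.rpow_one] at h4
    · simp only [norm_neg]
      refine (sum_integral_slice_lift_coefDeriv_le ha hD hP (hθ j) hφ z).trans ?_
      have h2 := hΦ.integral_gradAdd_sq_le hP hlam hle hη ha.continuous hE v
      rw [hratio] at h2
      have h3 : ‖column h 0 j z‖ ≤ ‖h z‖ := by simpa using norm_column_le h 0 j z
      have h4 : K ^ 2 = (8 * ρ ^ 2 + 2) * ‖v‖ ^ 2 := by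
        rw [hK, mul_pow, Real.sq_sqrt (by positivity)]
      calc (derivSup a * ‖column h 0 j z‖) ^ 2 * ∫ ω, ‖gradAdd ξ v.ofLp φ ω‖ ^ 2 ∂P
          ≤ (D * ‖h z‖) ^ 2 * ((8 * ρ ^ 2 + 2) * ‖v‖ ^ 2) := by gcongr
        _ = (D * K * ‖h z‖) ^ 2 := by rw [← h4]; ring
  set T := (∑ x ∈ G, ‖g x‖ ^ p₁) ^ (1 / p₁) with hT
  have hT0 : 0 ≤ T := Real.rpow_nonneg (Finset.sum_nonneg fun _ _ =>
    Real.rpow_nonneg (norm_nonneg _) _) _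
  have hyoung : ∀ j (Y : Finset (Lattice d)), ∑ y ∈ Y, (∑ x ∈ G, ‖g x‖ *
      ‖(memLp_latGrad_slice (hu j) (x - y)).toLp _‖) ^ 2 ≤ (T * R) ^ 2 := by
    intro j Y
    have h1 := young_sq hp₁1 hp₁2 hq1 hq2 (by rw [hp₁i]; ring) (g := fun x => ‖g x‖)
      (k := fun z => ‖(memLp_latGrad_slice (hu j) z).toLp _‖) (fun _ => norm_nonneg _)
      (fun _ => norm_nonneg _) G le_rfl (hkq j) Y
    rwa [← Real.rpow_mul hR0, mul_one_div_cancel hq0.ne', Real.rpow_one] at h1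
  -- the bound along the gradient descent
  set w : ℕ → Fin k → Lattice d × FieldSpace d n → ℂ := fun N j =>
    lift ξ (column h 0 j) (iterDeriv a ξ v.ofLp η κ N) with hw
  have hwm : ∀ N j, MemLp (w N j) 2 (Measure.count.prod P) := fun N j => (hsm N).memLp_lift (hθ j)
  set ε : ℕ → Fin k → ℝ := fun N j =>
    4 * d * ∫ p, ‖w N j p - u j p‖ ^ 2 ∂(Measure.count.prod P) with hε
  have hε0 : ∀ j, Tendsto (fun N => ε N j) atTop (𝓝 0) := by
    intro j
    have h1 := tendsto_lift_iterDeriv η κ hη hLam hρ ha hD hP hA' hAm hκ0 hκ1 hsm (hθ j) hφ hlim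
      (hu j) (husol j)
    have h2 := ((tendsto_eLpNorm_two_iff fun N => (hwm N j).sub (hu j)).mp h1).const_mul (4 * (d : ℝ))
    simpa using h2
  have hεb : ∀ N j (Z : Finset (Lattice d)), ∑ z ∈ Z,
      ‖(memLp_latGrad_slice (hwm N j) z).toLp _ - (memLp_latGrad_slice (hu j) z).toLp _‖ ^ 2 ≤
        ε N j := by
    intro N j Z
    have hsub := (hwm N j).sub (hu j)
    have h1 : ∀ z, ‖(memLp_latGrad_slice (hwm N j) z).toLp _ -
        (memLp_latGrad_slice (hu j) z).toLp _‖ ^ 2 =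
        ∑ i, ∫ ω, ‖twD latShift (fun _ => 1) i (fun p => w N j p - u j p) (z, ω)‖ ^ 2 ∂P := by
      intro z
      rw [← MemLp.toLp_sub, norm_toLp_sq]
      have := integral_latGrad_sq hsub z
      simp only [Pi.sub_def, latGrad_sub] at this ⊢
      exact this
    simp only [h1]
    rw [Finset.sum_comm]
    refine le_trans (Finset.sum_le_sum fun i _ => ?_) (sum_integral_twD_sq_le
      (c := fun _ => 1) measurePreserving_latShift (by simp) hsub)
    exact sum_le_hasSum _ (fun z _ => integral_nonneg fun ω => sq_nonneg _)
      (hasSum_slice (memLp_twD measurePreserving_latShift hsub i))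
  have hVN : ∀ N, ∫ ω, ‖proj P (comb ξ g G (iter a ξ v.ofLp η κ N)) ω‖ ^ 2 ∂P ≤ 1 / m ^ 2 *
      ∑ j, (2 * (T * R) ^ 2 + 2 * ((∑ x ∈ G, ‖g x‖ ^ 2) * (G.card * ε N j))) := by
    intro N
    refine variance_comb_le hm hPo hh2 hW hPW hP (hsm N) fun j Y => ?_
    refine sum_conv_sq_le G Y (fun _ => norm_nonneg _) (fun _ => norm_nonneg _)
      (k := fun z => ‖(memLp_latGrad_slice (hu j) z).toLp _‖)
      (k' := fun z => ‖(memLp_latGrad_slice (hwm N j) z).toLp _‖)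
      (e := fun z => ‖(memLp_latGrad_slice (hwm N j) z).toLp _ -
        (memLp_latGrad_slice (hu j) z).toLp _‖) (fun z => ?_) (hyoung j Y) (hεb N j)
    have := norm_sub_norm_le ((memLp_latGrad_slice (hwm N j) z).toLp _)
      ((memLp_latGrad_slice (hu j) z).toLp _)
    linarith
  -- the limit of the gradient descent
  have hcm : ∀ N, MemLp (comb ξ g G (iter a ξ v.ofLp η κ N)) 2 P := fun N =>
    memLp_comb hP ((hsm N).memLp P 2)
  have hcφ : MemLp (comb ξ g G φ) 2 P := memLp_comb hP hφ
  have hpm : ∀ {X : FieldSpace d n → EuclideanSpace ℂ (Fin d)}, MemLp X 2 P →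
      MemLp (proj P X) 2 P := fun hX => hX.sub (memLp_const _)
  have hstep : ∀ N, eLpNorm (proj P (comb ξ g G φ)) 2 P ≤
      ENNReal.ofReal (√(1 / m ^ 2 *
        ∑ j, (2 * (T * R) ^ 2 + 2 * ((∑ x ∈ G, ‖g x‖ ^ 2) * (G.card * ε N j))))) +
      2 * (ENNReal.ofReal ((∑ x ∈ G, ‖g x‖) * √(4 * d)) *
        eLpNorm (fun ω => iter a ξ v.ofLp η κ N ω - φ ω) 2 P) := by
    intro N
    have hdm : MemLp (fun ω => iter a ξ v.ofLp η κ N ω - φ ω) 2 P := ((hsm N).memLp P 2).sub hφ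
    have h1 : proj P (comb ξ g G φ) = proj P (comb ξ g G (iter a ξ v.ofLp η κ N)) -
        proj P (comb ξ g G fun ω => iter a ξ v.ofLp η κ N ω - φ ω) := by
      funext ω
      simp only [proj, Pi.sub_apply, comb_sub]
      rw [integral_sub ((hcm N).integrable one_le_two) (hcφ.integrable one_le_two)]
      abel
    rw [h1]
    refine (eLpNorm_sub_le (hpm (hcm N)).1 (hpm (memLp_comb hP hdm)).1 one_le_two).trans ?_
    gcongr
    · rw [eLpNorm_two_eq (hpm (hcm N))]
      exact ENNReal.ofReal_le_ofReal (Real.sqrt_le_sqrt (hVN N))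
    · refine (eLpNorm_proj_le (memLp_comb hP hdm)).trans ?_
      gcongr
      exact eLpNorm_comb_le hP hdm
  have hlim2 : Tendsto (fun N => ENNReal.ofReal (√(1 / m ^ 2 *
        ∑ j, (2 * (T * R) ^ 2 + 2 * ((∑ x ∈ G, ‖g x‖ ^ 2) * (G.card * ε N j))))) +
      2 * (ENNReal.ofReal ((∑ x ∈ G, ‖g x‖) * √(4 * d)) *
        eLpNorm (fun ω => iter a ξ v.ofLp η κ N ω - φ ω) 2 P)) atTop
      (𝓝 (ENNReal.ofReal (√(1 / m ^ 2 * ∑ _j : Fin k, (2 * (T * R) ^ 2 +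
        2 * ((∑ x ∈ G, ‖g x‖ ^ 2) * (G.card * 0))))) +
      2 * (ENNReal.ofReal ((∑ x ∈ G, ‖g x‖) * √(4 * d)) * 0))) := by
    refine Tendsto.add (ENNReal.tendsto_ofReal (Tendsto.sqrt (Tendsto.const_mul _
      (tendsto_finsetSum _ fun j _ => Tendsto.const_add _ (Tendsto.const_mul _
        (Tendsto.const_mul _ (Tendsto.const_mul _ (hε0 j)))))))) ?_
    exact ENNReal.Tendsto.const_mul (ENNReal.Tendsto.const_mul hlim (Or.inr ENNReal.ofReal_ne_top))
      (Or.inr ENNReal.ofNat_ne_top)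
  refine (ge_of_tendsto' hlim2 hstep).trans (le_of_eq ?_)
  simp only [mul_zero, add_zero, Finset.sum_const, Finset.card_univ, Fintype.card_fin, nsmul_eq_mul]
  congr 1
  have h1 : 1 / m ^ 2 * (k * (2 * (T * R) ^ 2)) = (2 * k) * (T * R / m) ^ 2 := by ring
  rw [h1, Real.sqrt_mul (by positivity), Real.sqrt_sq (by positivity), hR, hK]
  field_simp

end RandomEnv

namespace RandomEnv

/-! ### Passage to the infinite series -/

section Summation

variable {d n : ℕ} {ξ : Fin d → ℝ} {g : Lattice d → Matrix (Fin d) (Fin d) ℂ}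
  {P : Measure (FieldSpace d n)} {Φ : FieldSpace d n → EuclideanSpace ℂ (Fin d)}
  {v : EuclideanSpace ℂ (Fin d)}

lemma summand_eq_comb (x : Lattice d) :
    summand ξ Φ g v x = comb ξ g {x} (corrDir Φ v.ofLp) := by
  funext ω
  have : gradXi ξ Φ (shift x ω) *ᵥ v.ofLp =
      fun l => twD unitShift (phase ξ) l (corrDir Φ v.ofLp) (shift x ω) :=
    funext fun l => gradXi_mulVec ..
  rw [summand, this, comb, Finset.sum_singleton]

lemma sum_proj_summand [IsProbabilityMeasure P] (hP : TranslationInvariant P)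
    (hφ : MemLp (corrDir Φ v.ofLp) 2 P) (F : Finset (Lattice d)) (ω : FieldSpace d n) :
    ∑ x ∈ F, proj P (summand ξ Φ g v x) ω = proj P (comb ξ g F (corrDir Φ v.ofLp)) ω := by
  have h1 : comb ξ g F (corrDir Φ v.ofLp) = fun ω => ∑ x ∈ F, summand ξ Φ g v x ω := by
    funext ω
    simp only [summand_eq_comb, comb, Finset.sum_singleton]
  simp only [proj, h1]
  rw [integral_finsetSum _ fun x _ => ?_, Finset.sum_sub_distrib]
  rw [summand_eq_comb]
  exact (memLp_comb hP hφ).integrable one_le_two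

/-- Unconditional convergence in `L²` from a bound on finite sums by an `ℓ^p` norm, with the
induced bound on the sum. -/
lemma exists_sum_of_finset_bound {Ω ι E : Type*} [MeasurableSpace Ω] [NormedAddCommGroup E]
    [CompleteSpace E] {P : Measure Ω} {f : ι → Ω → E} (hf : ∀ x, MemLp (f x) 2 P) {γ : ι → ℝ}
    (hγ0 : ∀ x, 0 ≤ γ x) {p R : ℝ} (hp : 0 < p) (hR : 0 ≤ R) (hγ : Summable fun x => γ x ^ p)
    (hb : ∀ F : Finset ι, eLpNorm (fun ω => ∑ x ∈ F, f x ω) 2 P ≤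
      ENNReal.ofReal (R * (∑ x ∈ F, γ x ^ p) ^ (1 / p))) :
    ∃ S : Ω → E, MemLp S 2 P ∧
      Tendsto (fun F : Finset ι => eLpNorm (fun ω => ∑ x ∈ F, f x ω - S ω) 2 P) atTop (𝓝 0) ∧
      eLpNorm S 2 P ≤ ENNReal.ofReal (R * (∑' x, γ x ^ p) ^ (1 / p)) := by
  classical
  set u : ι → Lp E 2 P := fun x => (hf x).toLp (f x) with hu
  have hsum : ∀ F : Finset ι, (∑ x ∈ F, u x : Lp E 2 P) =ᵐ[P] fun ω => ∑ x ∈ F, f x ω := by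
    intro F
    have h1 : ∀ᵐ ω ∂P, ∀ x ∈ F, u x ω = f x ω :=
      (ae_ball_iff F.countable_toSet).mpr fun x _ => (hf x).coeFn_toLp
    filter_upwards [Lp.coeFn_finsetSum F u, h1] with ω h2 h3
    rw [h2, Finset.sum_apply]
    exact Finset.sum_congr rfl h3
  have hpow0 : ∀ x, 0 ≤ γ x ^ p := fun x => Real.rpow_nonneg (hγ0 x) p
  have hnorm : ∀ F : Finset ι, ‖∑ x ∈ F, u x‖ ≤ R * (∑ x ∈ F, γ x ^ p) ^ (1 / p) := by
    intro F
    rw [Lp.norm_def, eLpNorm_congr_ae (hsum F)]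
    exact ENNReal.toReal_le_of_le_ofReal
      (mul_nonneg hR (Real.rpow_nonneg (Finset.sum_nonneg fun x _ => hpow0 x) _)) (hb F)
  have hsu : Summable u := by
    rw [summable_iff_vanishing_norm]
    intro ε hε
    have hlim : Tendsto (fun t : ℝ => R * t ^ (1 / p)) (𝓝 0) (𝓝 0) := by
      have := ((Real.continuousAt_rpow_const 0 (1 / p) (Or.inr (by positivity))).tendsto).const_mul R
      rwa [Real.zero_rpow (by positivity), mul_zero] at this
    obtain ⟨δ, hδ, hδε⟩ := Metric.eventually_nhds_iff.mp (hlim.eventually_lt_const hε)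
    obtain ⟨s, hs⟩ := summable_iff_vanishing_norm.mp hγ δ hδ
    exact ⟨s, fun t ht => (hnorm t).trans_lt (hδε (by simpa using hs t ht))⟩
  refine ⟨(∑' x, u x : Lp E 2 P), Lp.memLp _, ?_, ?_⟩
  · have h1 := tendsto_iff_norm_sub_tendsto_zero.mp hsu.hasSum
    have h2 := ENNReal.tendsto_ofReal h1
    rw [ENNReal.ofReal_zero] at h2
    refine h2.congr fun F => ?_
    rw [Lp.norm_def, ENNReal.ofReal_toReal (Lp.eLpNorm_ne_top _)]
    refine eLpNorm_congr_ae ?_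
    filter_upwards [Lp.coeFn_sub (∑ x ∈ F, u x) (∑' x, u x), hsum F] with ω h3 h4
    rw [h3, Pi.sub_apply, h4]
  · have h1 : ‖∑' x, u x‖ ≤ R * (∑' x, γ x ^ p) ^ (1 / p) := by
      refine le_of_tendsto' hsu.hasSum.norm fun F => (hnorm F).trans ?_
      gcongr
      · exact Finset.sum_nonneg fun x _ => hpow0 x
      · exact hγ.sum_le_tsum F fun x _ => hpow0 x
    rw [← ENNReal.ofReal_toReal (Lp.eLpNorm_ne_top (∑' x, u x))]
    exact ENNReal.ofReal_le_ofReal h1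

end Summation

end RandomEnv

open RandomEnv in
theorem proposition2p1 (d : ℕ) (ρ p₀ : ℝ) (hp₀ : 1 ≤ p₀) (hp₀' : p₀ < 2) :
    ∃ p₁ : ℝ, 1 < p₁ ∧ p₁ < 2 ∧ ∀ n k : ℕ, ∃ C : ℝ,
      ∀ (lam Lam : ℝ), 0 < lam → 0 < Lam → Lam / lam = ρ →
      ∀ (a : EuclideanSpace ℝ (Fin n) → Matrix (Fin d) (Fin d) ℝ),
        ContDiff ℝ 1 a → Elliptic a lam Lam →
        BddAbove (Set.range fun s => ‖fderiv ℝ a s‖) →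
      ∀ (m : ℝ), 0 < m →
      ∀ (Ptilde : Measure (FieldSpace d k)), IsProbabilityMeasure Ptilde →
        TranslationInvariant Ptilde → Poincare Ptilde m →
      ∀ (h : Lattice d → Matrix (Fin n) (Fin k) ℝ), Summable (fun y => ‖h y‖ ^ p₀) →
      ∀ (W : FieldSpace d k → FieldSpace d n), IsConvolution Ptilde h W →
      ∀ (P : Measure (FieldSpace d n)), P = Ptilde.map W →
      ∀ (ξ : Fin d → ℝ) (η : ℝ), 0 < η →
      ∀ (Φ : FieldSpace d n → EuclideanSpace ℂ (Fin d)), IsCorrector P a ξ η Φ →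
      ∀ (p : ℝ), 1 ≤ p → p ≤ p₁ →
      ∀ (g : Lattice d → Matrix (Fin d) (Fin d) ℂ), Summable (fun x => ‖g x‖ ^ p) →
      ∀ (v : EuclideanSpace ℂ (Fin d)),
      ∃ S : FieldSpace d n → EuclideanSpace ℂ (Fin d),
        MemLp S 2 P ∧
        Tendsto
          (fun F : Finset (Lattice d) =>
            eLpNorm (fun ω => ∑ x ∈ F, proj P (summand ξ Φ g v x) ω - S ω) 2 P)
          atTop (𝓝 0) ∧
        eLpNorm S 2 P ≤
          ENNReal.ofReal
            (C * derivSup a * ‖v‖ / (m * Lam) * ellNorm p₀ h * ellNorm p g) := by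

  rcases Nat.eq_zero_or_pos d with rfl | hd
  · -- there are no directions: all functions with values in `ℂ^0` vanish
    refine ⟨3 / 2, by norm_num, by norm_num, fun n k => ⟨0, ?_⟩⟩
    intro lam Lam _ _ _ a _ _ _ m _ Pt _ _ _ h _ W _ P _ ξ η _ Φ _ p _ _ g _ v
    refine ⟨fun _ => 0, MemLp.zero', ?_, ?_⟩
    · refine tendsto_const_nhds.congr fun F => ?_
      rw [eq_comm, Subsingleton.elim (fun ω => _) (0 : FieldSpace 0 n → EuclideanSpace ℂ (Fin 0)),
        eLpNorm_zero]
    · simp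
  -- there are elliptic coefficients for `ρ ≥ 1` only, but `p₁` has to be chosen for all `ρ`
  obtain ⟨p₁, C, h1, h2, hC, hB⟩ := exists_finite_bound d hd (le_max_right ρ 1) hp₀ hp₀'
  refine ⟨p₁, h1, h2, fun n k => ⟨√(2 * k) * C, ?_⟩⟩
  intro lam Lam hlam hLam hratio a ha hE hD m hm Pt hPt hPti hPo h hh W hW P hPW ξ η hη Φ hΦ p hp
    hp' g hg v
  have hρ : max ρ 1 = ρ := max_eq_left (hratio ▸ hE.one_le_ratio hd hlam)
  rw [hρ] at hB
  have hPp : IsProbabilityMeasure P := hPW ▸ Measure.isProbabilityMeasure_map hW.1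
  have hPinv : TranslationInvariant P := hPW ▸ translationInvariant_map hPti hW
  have hφ := hΦ.memLp_corrDir v.ofLp
  obtain ⟨hg1, hgle⟩ := summable_rpow_and_ellNorm_le (by linarith) hp' hg
  have hD0 : 0 ≤ derivSup a := (norm_nonneg (fderiv ℝ a 0)).trans (le_ciSup hD 0)
  have hnh : 0 ≤ ellNorm p₀ h := Real.rpow_nonneg (tsum_nonneg fun _ =>
    Real.rpow_nonneg (norm_nonneg _) _) _
  have hR : 0 ≤ √(2 * k) * C * derivSup a * ‖v‖ / (m * Lam) * ellNorm p₀ h := by positivity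
  obtain ⟨S, hS, hlim, hle⟩ := exists_sum_of_finset_bound
    (f := fun x => proj P (summand ξ Φ g v x)) (P := P) (fun x => by
      rw [summand_eq_comb]
      exact (memLp_comb hPinv hφ).sub (memLp_const _))
    (fun x => norm_nonneg (g x)) (by linarith) hR hg1 fun F => by
      simp only [sum_proj_summand hPinv hφ]
      exact hB n k lam Lam hlam hLam hratio a ha hE hD m hm Pt hPo h hh W hW P hPW hPinv ξ η hη Φ
        hΦ g F v
  refine ⟨S, hS, hlim, hle.trans (ENNReal.ofReal_le_ofReal ?_)⟩
  exact mul_le_mul_of_nonneg_left hgle hR
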